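/- **Theorem 3.2.** Let $M^3$ be a smooth (Hausdorff, second countable) $3$-manifold with a smooth Riemannian metric $g$ and a smooth lapse function $N:M^3\to(0,\infty)$. Let $\mathfrak L^4=\mathbb R\times M^3$, $\mathfrak g=-N^2dt^2+g$, $\xi=\partial/\partial t$, and let $F$ be a smooth $2$-form on $\mathfrak L^4$ such that $$\mathfrak R_{\mu\nu}=2\Bigl(F_{\mu\alpha}F_\nu{}^{\alpha}-\tfrac14\mathfrak g_{\mu\nu}F_{\alpha\beta}F^{\alpha\beta}\Bigr),\qquad d\star F=0,\qquad dF=0,\qquad \mathcal L_\xi F=0,\qquad \iota_\xi\star F=0 .$$ Assume asymptotic flatness with mass $M>0$ and charge $Q\neq 0$: there are a compact set $K\subset M^3$ and a diffeomorphism of $M^3\setminus K$ onto $\mathbb R^3\setminus\bar B$ ($\bar B$ the closed unit ball) in whose Cartesian coordinates, as $r=|x|\to\infty$, $$g=\delta+O(r^{-1}),\qquad N=1-\frac Mr+O(r^{-2}),\qquad F=-\frac{Q}{r^2}\,dt\wedge dr+O(r^{-3})$$ (componentwise). Let $(P^3,p)\hookrightarrow(\mathfrak L^4,\mathfrak g)$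 be a connected photon sphere, that is, a smoothly embedded timelike hypersurface with induced metric $p$ such that any null geodesic tangent to $P^3$ at one parameter value remains tangent to $P^3$ as long as it exists, $N$ is constant on $P^3$, and the one-form $\iota_\xi F$ is normal to $P^3$ (it vanishes on $TP^3$). Assume that $N$ regularly foliates the exterior of $P^3$: there is a connected open set $M^3_{\rm ext}\subset M^3$ such that * the boundary of $M^3_{\rm ext}$ is $\Sigma=\{x\in M^3:(0,x)\in P^3\}$; * for some $R>1$, $M^3_{\rm ext}$ contains $\{r>R\}$, and the closure of $M^3_{\rm ext}$ minus $\{r>R\}$ is compact; * $g({}^g\nabla N,{}^g\nabla N)\ne0$ on $M^3_{\rm ext}$. Then $P^3$ has constant scalar curvature ${}^pR$. Moreover $P^3$ admits a smooth unit normal field, and for every smooth unit normal field $\nu$ along $P^3$ the mean curvature $\mathfrak H=\operatorname{tr}_p\mathfrak h$, where $\mathfrak h(X,Y)=\mathfrak g({}^{\mathfrak g}\nabla_X\nu,Y)$, is constant, the normal component $E_\nu=E(\nu)$ of the electric field $E=-\iota_\xi F$ is constant on $P^3$, and $${}^pR=\frac23\,\mathfrak H^2+\frac{2E_\nu^2}{N^2}\qquad\text{on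 }P^3 .$$ -/

import Mathlib

set_option maxSynthPendingDepth 3

open Set Filter Topology Asymptotics Bornology
open scoped Manifold ContDiff

/-! ### Tensor calculus on open subsets of a finite-dimensional vector space

A field of bilinear forms on (an open subset of) `E` is a map `E → E →L[ℝ] E →L[ℝ] ℝ`. -/

section VectorSpace

variable {E : Type*} [NormedAddCommGroup E] [NormedSpace ℝ E]

/-- Exterior derivative of a field `α` of alternating bilinear forms:
`dα(u, v, w) = ∂ᵤ α(v, w) + ∂ᵥ α(w, u) + ∂_w α(u, v)`. -/
noncomputable def extDerivTwo (α : E → E → E → ℝ) (y u v w : E) : ℝ :=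
  fderiv ℝ (fun z => α z v w) y u + fderiv ℝ (fun z => α z w u) y v
    + fderiv ℝ (fun z => α z u v) y w

/-- Lie derivative of a field `T` of bilinear forms along a vector field `X`:
`(L_X T)(v, w) = (∂_X T)(v, w) + T(∂ᵥ X, w) + T(v, ∂_w X)`. -/
noncomputable def lieDerivTwo (X : E → E) (T : E → E →L[ℝ] E →L[ℝ] ℝ) (y v w : E) : ℝ :=
  fderiv ℝ T y (X y) v w + T y (fderiv ℝ X y v) w + T y v (fderiv ℝ X y w)

/-- The lowered Christoffel symbols `Γ(v, w; z) = ½ (∂ᵥ G(w, z) + ∂_w G(v, z) - ∂_z G(v, w))` of the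
metric `G`, as a bilinear map of `(v, w)` with values in covectors. -/
noncomputable def christoffelLower (G : E → E →L[ℝ] E →L[ℝ] ℝ) (y : E) :
    E →L[ℝ] E →L[ℝ] E →L[ℝ] ℝ :=
  let D : E →L[ℝ] E →L[ℝ] E →L[ℝ] ℝ := fderiv ℝ G y
  let flip₂ : (E →L[ℝ] E →L[ℝ] ℝ) →L[ℝ] E →L[ℝ] E →L[ℝ] ℝ :=
    (ContinuousLinearMap.flipₗᵢ ℝ E E ℝ).toContinuousLinearEquiv
  (1 / 2 : ℝ) • (D + D.flip - flip₂.comp D.flip)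

theorem christoffelLower_apply (G : E → E →L[ℝ] E →L[ℝ] ℝ) (y v w z : E) :
    christoffelLower G y v w z
      = 1 / 2 * (fderiv ℝ G y v w z + fderiv ℝ G y w v z - fderiv ℝ G y z v w) :=
  rfl

/-- The Christoffel symbols of the Levi-Civita connection of the metric `G`: the map `G y` from
vectors to covectors is inverted to raise the index of `christoffelLower`. -/
noncomputable def christoffel (G : E → E →L[ℝ] E →L[ℝ] ℝ) (y : E) : E →L[ℝ] E →L[ℝ] E :=
  (ContinuousLinearMap.compL ℝ E (E →L[ℝ] ℝ) E (G y).inverse).comp (christoffelLower G y)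

/-- The Riemann curvature `R(u, v) w = ∇ᵤ ∇ᵥ w - ∇ᵥ ∇ᵤ w - ∇_[u,v] w` of the metric `G`. -/
noncomputable def riemann (G : E → E →L[ℝ] E →L[ℝ] ℝ) (y u v w : E) : E :=
  fderiv ℝ (christoffel G) y u v w - fderiv ℝ (christoffel G) y v u w
    + christoffel G y u (christoffel G y v w) - christoffel G y v (christoffel G y u w)

variable [FiniteDimensional ℝ E]

/-- The coordinate covector `bⁱ` of a basis `b`. -/
noncomputable def coordCovector {ι : Type*} (b : Module.Basis ι ℝ E) (i : ι) : E →L[ℝ] ℝ :=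
  LinearMap.toContinuousLinearMap (b.coord i)

/-- The trace `Gⁱʲ Bᵢⱼ = ∑ᵢ B(bᵢ, ♯bⁱ)` of a bilinear form `B` with respect to a nondegenerate
symmetric bilinear form `G`; it does not depend on the basis. -/
noncomputable def metricTrace (G : E →L[ℝ] E →L[ℝ] ℝ) (B : E → E → ℝ) : ℝ :=
  ∑ i, B (Module.finBasis ℝ E i) (G.inverse (coordCovector (Module.finBasis ℝ E) i))

/-- The Ricci curvature `Ric(v, w) = tr (u ↦ R(u, v) w)`. -/
noncomputable def ricci (G : E → E →L[ℝ] E →L[ℝ] ℝ) (y v w : E) : ℝ :=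
  ∑ i, coordCovector (Module.finBasis ℝ E) i (riemann G y (Module.finBasis ℝ E i) v w)

/-- The scalar curvature, the metric trace of the Ricci curvature. -/
noncomputable def scalarCurv (G : E → E →L[ℝ] E →L[ℝ] ℝ) (y : E) : ℝ :=
  metricTrace (G y) (ricci G y)

/-- The symmetric tensor `F_{vα} F_w^α`. -/
noncomputable def formSquare (G F : E →L[ℝ] E →L[ℝ] ℝ) (v w : E) : ℝ :=
  metricTrace G (fun a b => F v a * F w b)

/-- Right-hand side of the Einstein-Maxwell equation,
`2 (F_{vα} F_w^α - ¼ G(v, w) F_{αβ} F^{αβ})`. -/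
noncomputable def maxwellSource (G F : E →L[ℝ] E →L[ℝ] ℝ) (v w : E) : ℝ :=
  2 * (formSquare G F v w - 1 / 4 * G v w * metricTrace G (formSquare G F))

/-- The volume form of `G` in the orientation of the basis `b`: `√|det G| · det_b`. -/
noncomputable def volumeFour (b : Module.Basis (Fin 4) ℝ E) (G : E →L[ℝ] E →L[ℝ] ℝ)
    (u : Fin 4 → E) : ℝ :=
  Real.sqrt |(Matrix.of fun i j => G (b i) (b j)).det| * b.det u

/-- The Hodge star of a two-form in dimension four, `(⋆F)_{vw} = ½ F^{αβ} ε_{αβvw}`, in the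
orientation of the basis `b` (reversing the orientation changes its sign). -/
noncomputable def hodgeStar (b : Module.Basis (Fin 4) ℝ E) (G F : E →L[ℝ] E →L[ℝ] ℝ)
    (v w : E) : ℝ :=
  1 / 2 * ∑ i, ∑ j, F (G.inverse (coordCovector b i)) (G.inverse (coordCovector b j))
    * volumeFour b G ![b i, b j, v, w]

end VectorSpace

/-! ### Tensor fields on manifolds

The tangent space `TangentSpace I x` is the model vector space `E`, through the preferred chart
at `x`. A curvature or a derivative of a tensor field at `x` is computed in the preferred chart at
`x`; all the quantities below are tensorial, so that the choice of the chart does not matter. -/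

section Manifold

variable {E : Type*} [NormedAddCommGroup E] [NormedSpace ℝ E]
  {H : Type*} [TopologicalSpace H] (I : ModelWithCorners ℝ E H)
  {L : Type*} [TopologicalSpace L] [ChartedSpace H L]

/-- Fields of bilinear forms on the tangent spaces of `L`. -/
abbrev BilinField (_I : ModelWithCorners ℝ E H) (L : Type*) [TopologicalSpace L]
    [ChartedSpace H L] := ∀ x : L, TangentSpace _I x →L[ℝ] TangentSpace _I x →L[ℝ] ℝ

/-- The coordinate expression of a field of bilinear forms in the preferred chart at `x`. -/
noncomputable def inChart (T : BilinField I L) (x : L) (y : E) : E →L[ℝ] E →L[ℝ] ℝ :=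
  ContinuousLinearMap.bilinearComp (E := E) (F := E)
    (T ((extChartAt I x).symm y))
    (mfderiv 𝓘(ℝ, E) I (extChartAt I x).symm y)
    (mfderiv 𝓘(ℝ, E) I (extChartAt I x).symm y)

/-- The coordinate expression of a vector field in the preferred chart at `x`. -/
noncomputable def vectorInChart (X : ∀ x : L, TangentSpace I x) (x : L) (y : E) : E :=
  mfderiv I 𝓘(ℝ, E) (extChartAt I x) ((extChartAt I x).symm y) (X ((extChartAt I x).symm y))

/-- Smoothness of a field of bilinear forms: its coordinate expressions are smooth. -/
def SmoothBilin (T : BilinField I L) : Prop :=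
  ∀ x : L, ContDiffOn ℝ ∞ (inChart I T x) (extChartAt I x).target

/-- The velocity `γ'(s)` of a curve. -/
noncomputable def velocity (γ : ℝ → L) (s : ℝ) : TangentSpace I (γ s) :=
  mfderiv 𝓘(ℝ, ℝ) I γ s (1 : ℝ)

/-- `γ` is a null geodesic of the metric `G` on the open interval `J`: it is smooth, its velocity is
null and nonzero, and `γ'' + Γ(γ', γ') = 0` (in the preferred chart at each of its points). -/
structure IsNullGeodesicOn (G : BilinField I L) (γ : ℝ → L) (J : Set ℝ) : Prop where
  isOpen : IsOpen J
  ordConnected : J.OrdConnected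
  smooth : ContMDiffOn 𝓘(ℝ, ℝ) I ∞ γ J
  ne_zero : ∀ s ∈ J, velocity I γ s ≠ 0
  null : ∀ s ∈ J, G (γ s) (velocity I γ s) (velocity I γ s) = 0
  geodesic : ∀ s ∈ J,
    deriv (deriv fun r => extChartAt I (γ s) (γ r)) s
      + christoffel (inChart I G (γ s)) (extChartAt I (γ s) (γ s))
          (deriv (fun r => extChartAt I (γ s) (γ r)) s)
          (deriv (fun r => extChartAt I (γ s) (γ r)) s) = 0

section Hypersurface

variable {E' : Type*} [NormedAddCommGroup E'] [NormedSpace ℝ E']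
  {H' : Type*} [TopologicalSpace H'] (I' : ModelWithCorners ℝ E' H')
  {P : Type*} [TopologicalSpace P] [ChartedSpace H' P]

/-- The metric on `P` induced by a map `f : P → L`. -/
noncomputable def inducedMetric (G : BilinField I L) (f : P → L) : BilinField I' P := fun q =>
  ContinuousLinearMap.bilinearComp (E := E) (F := E) (E' := E') (F' := E')
    (G (f q)) (mfderiv I' I f q) (mfderiv I' I f q)

/-- The curve `γ` is tangent to the image of `f : P → L` at the parameter `s`: `γ(s)` lies on it and
`γ'(s)` is tangent to it. -/
def TangentToAt [IsManifold I 1 L] (f : P → L) (γ : ℝ → L) (s : ℝ) : Prop :=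
  ∃ (q : P) (v : TangentSpace I' q),
    (⟨f q, mfderiv I' I f q v⟩ : TangentBundle I L) = ⟨γ s, velocity I γ s⟩

/-- A photon surface of the Lorentzian metric `G`: an embedded timelike hypersurface such that every
null geodesic which is tangent to it at one parameter is tangent to it as long as it exists. An
embedded hypersurface is timelike if each of its tangent spaces contains a timelike vector. -/
structure IsPhotonSurface [IsManifold I 1 L] (G : BilinField I L) (f : P → L) : Prop where
  embedding : Manifold.IsSmoothEmbedding I' I ∞ f
  timelike : ∀ q : P, ∃ v : TangentSpace I' q, inducedMetric I I' G f q v v < 0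
  null_geodesics : ∀ (γ : ℝ → L) (J : Set ℝ), IsNullGeodesicOn I G γ J →
    ∀ s₀ ∈ J, TangentToAt I I' f γ s₀ → ∀ s ∈ J, TangentToAt I I' f γ s

/-- `ν` is a smooth (spacelike) unit normal field along the hypersurface `f : P → L`. -/
structure IsUnitNormal [IsManifold I 1 L] (G : BilinField I L) (f : P → L) (ν : ∀ q : P, TangentSpace I (f q)) :
    Prop where
  smooth : ContMDiff I' I.tangent ∞ (fun q => (⟨f q, ν q⟩ : TangentBundle I L))
  unit : ∀ q, G (f q) (ν q) (ν q) = 1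
  normal : ∀ q (v : TangentSpace I' q), G (f q) (ν q) (mfderiv I' I f q v) = 0

/-- The coordinate expression near `q` of a vector field `ν` along `f : P → L`, in the preferred
charts at `q` and at `f q`. -/
noncomputable def alongInChart (f : P → L) (ν : ∀ q : P, TangentSpace I (f q)) (q : P) (y : E') :
    E :=
  mfderiv I 𝓘(ℝ, E) (extChartAt I (f q)) (f ((extChartAt I' q).symm y))
    (ν ((extChartAt I' q).symm y))

/-- The second fundamental form `II(v, w) = G(∇ᵥ ν, w)` of the hypersurface `f : P → L` with unit
normal `ν`, where `∇ᵥ ν = ∂ᵥ ν + Γ(df v, ν)` in coordinates. -/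
noncomputable def secondFundForm (G : BilinField I L) (f : P → L)
    (ν : ∀ q : P, TangentSpace I (f q)) (q : P) (v w : TangentSpace I' q) : ℝ :=
  G (f q)
    ((fderiv ℝ (alongInChart I I' f ν q) (extChartAt I' q q) v
      + christoffel (inChart I G (f q)) (extChartAt I (f q) (f q)) (mfderiv I' I f q v) (ν q) : E))
    (mfderiv I' I f q w)

/-- The mean curvature, the trace of the second fundamental form in the induced metric. -/
noncomputable def meanCurvature [FiniteDimensional ℝ E'] (G : BilinField I L) (f : P → L)
    (ν : ∀ q : P, TangentSpace I (f q)) (q : P) : ℝ :=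
  metricTrace (E := E') (inducedMetric I I' G f q) (secondFundForm I I' G f ν q)

end Hypersurface

/-- The Ricci curvature of a metric on a manifold. -/
noncomputable def ricciAt [FiniteDimensional ℝ E] (G : BilinField I L) (x : L)
    (v w : TangentSpace I x) : ℝ :=
  ricci (inChart I G x) (extChartAt I x x) v w

/-- The scalar curvature of a metric on a manifold. -/
noncomputable def scalarCurvAt [FiniteDimensional ℝ E] (G : BilinField I L) (x : L) : ℝ :=
  scalarCurv (inChart I G x) (extChartAt I x x)

end Manifold

/-! ### Static Einstein-Maxwell spacetimes -/

/-- The model vector space of the three-dimensional manifolds. -/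
abbrev E3 := EuclideanSpace ℝ (Fin 3)

/-- The model with corners of the spacetimes `ℝ × M`. -/
noncomputable abbrev I4 : ModelWithCorners ℝ (ℝ × E3) (ModelProd ℝ E3) := 𝓘(ℝ, ℝ).prod (𝓡 3)

/-- Smooth Riemannian metrics on a three-dimensional manifold. -/
abbrev RiemMetric3 (M : Type*) [TopologicalSpace M] [ChartedSpace E3 M] [IsManifold (𝓡 3) ∞ M] :=
  Bundle.ContMDiffRiemannianMetric (𝓡 3) ∞ E3 (fun x : M => TangentSpace (𝓡 3) x)

/-- The standard basis `∂_t, ∂₁, ∂₂, ∂₃` of `ℝ × ℝ³`. -/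
noncomputable def basis4 : Module.Basis (Fin 4) ℝ (ℝ × E3) :=
  ((Module.Basis.singleton (Fin 1) ℝ).prod (EuclideanSpace.basisFun (Fin 3) ℝ).toBasis).reindex
    finSumFinEquiv

section Spacetime

variable {M : Type*} [TopologicalSpace M] [ChartedSpace E3 M] [IsManifold (𝓡 3) ∞ M]

/-- The static spacetime metric `-N² dt² + g` on `ℝ × M`. -/
noncomputable def staticMetric (g : RiemMetric3 M) (N : M → ℝ) : BilinField I4 (ℝ × M) := fun z =>
  (-(N z.2) ^ 2) • ContinuousLinearMap.bilinearComp (ContinuousLinearMap.mul ℝ ℝ)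
      (ContinuousLinearMap.fst ℝ ℝ E3) (ContinuousLinearMap.fst ℝ ℝ E3)
    + ContinuousLinearMap.bilinearComp (E := E3) (F := E3) (g.inner z.2)
      (ContinuousLinearMap.snd ℝ ℝ E3) (ContinuousLinearMap.snd ℝ ℝ E3)

/-- The Killing field `ξ = ∂/∂t` on `ℝ × M`. -/
def timeField (z : ℝ × M) : TangentSpace I4 z := ((1, 0) : ℝ × E3)

/-- `(ℝ × M, -N² dt² + g, F)` is a static, purely electric solution of the Einstein-Maxwell
equations. -/
structure IsStaticElectrovac (g : RiemMetric3 M) (N : M → ℝ) (F : BilinField I4 (ℝ × M)) :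
    Prop where
  lapse_smooth : ContMDiff (𝓡 3) 𝓘(ℝ, ℝ) ∞ N
  lapse_pos : ∀ x, 0 < N x
  F_smooth : SmoothBilin I4 F
  F_alt : ∀ z (v : TangentSpace I4 z), F z v v = 0
  /-- `Ric = 2 (F_{μα} F_ν^α - ¼ 𝔤_{μν} F_{αβ} F^{αβ})` -/
  einstein : ∀ z (v w : TangentSpace I4 z),
    ricciAt I4 (staticMetric g N) z v w
      = maxwellSource (E := ℝ × E3) (staticMetric g N z) (F z) v w
  /-- `d ⋆F = 0` -/
  coclosed : ∀ (z : ℝ × M) (u v w : ℝ × E3),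
    extDerivTwo
      (fun y => hodgeStar basis4 (inChart I4 (staticMetric g N) z y) (inChart I4 F z y))
      (extChartAt I4 z z) u v w = 0
  /-- `dF = 0` -/
  closed : ∀ (z : ℝ × M) (u v w : ℝ × E3),
    extDerivTwo (fun y a b => inChart I4 F z y a b) (extChartAt I4 z z) u v w = 0
  /-- `L_ξ F = 0` -/
  stationary : ∀ (z : ℝ × M) (v w : ℝ × E3),
    lieDerivTwo (vectorInChart I4 timeField z) (inChart I4 F z) (extChartAt I4 z z) v w = 0
  /-- `ι_ξ ⋆F = 0` -/
  electric : ∀ z (w : TangentSpace I4 z),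
    hodgeStar (E := ℝ × E3) basis4 (staticMetric g N z) (F z) (timeField z) w = 0

/-- The coordinate vector `∂ᵢ` at the point with coordinates `x`, for asymptotic coordinates `φ`. -/
noncomputable def coordVec (φ : PartialDiffeomorph (𝓡 3) (𝓡 3) M E3 ∞) (x : E3) (i : Fin 3) : E3 :=
  mfderiv (𝓡 3) (𝓡 3) φ.symm x (EuclideanSpace.single i (1 : ℝ))

/-- Asymptotic flatness with mass `m` and charge `Q`, in the coordinates given by a diffeomorphism
`φ` of the complement of a compact set `K` onto the complement of the closed unit ball of `ℝ³`. -/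
structure IsAsymptoticallyFlat (g : RiemMetric3 M) (N : M → ℝ) (F : BilinField I4 (ℝ × M))
    (K : Set M) (φ : PartialDiffeomorph (𝓡 3) (𝓡 3) M E3 ∞) (m Q : ℝ) : Prop where
  compact : IsCompact K
  source : φ.source = Kᶜ
  target : φ.target = (Metric.closedBall (0 : E3) 1)ᶜ
  /-- `g = δ + O(r⁻¹)` -/
  metric : ∀ i j : Fin 3,
    (fun x : E3 => g.inner (φ.symm x) (coordVec φ x i) (coordVec φ x j) - if i = j then 1 else 0)
      =O[cobounded E3] fun x => ‖x‖⁻¹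
  /-- `N = 1 - m / r + O(r⁻²)` -/
  lapse : (fun x : E3 => N (φ.symm x) - (1 - m / ‖x‖)) =O[cobounded E3] fun x => (‖x‖ ^ 2)⁻¹
  /-- the `dt ∧ dxⁱ` components of `F = -(Q / r²) dt ∧ dr + O(r⁻³)` -/
  field_time : ∀ (t : ℝ) (i : Fin 3),
    (fun x : E3 => F (t, φ.symm x) ((1, 0) : ℝ × E3) ((0, coordVec φ x i) : ℝ × E3)
        - -(Q / ‖x‖ ^ 2) * (x i / ‖x‖))
      =O[cobounded E3] fun x => (‖x‖ ^ 3)⁻¹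
  /-- the `dxⁱ ∧ dxʲ` components of `F = -(Q / r²) dt ∧ dr + O(r⁻³)` -/
  field_space : ∀ (t : ℝ) (i j : Fin 3),
    (fun x : E3 => F (t, φ.symm x) ((0, coordVec φ x i) : ℝ × E3) ((0, coordVec φ x j) : ℝ × E3))
      =O[cobounded E3] fun x => (‖x‖ ^ 3)⁻¹

/-- The electric field one-form `E = -ι_ξ F`. -/
noncomputable def electricField (F : BilinField I4 (ℝ × M)) (z : ℝ × M) (v : TangentSpace I4 z) :
    ℝ :=
  -F z (timeField z) v

section PhotonSphere

variable {P : Type*} [TopologicalSpace P] [ChartedSpace E3 P]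

/-- A photon sphere: a photon surface on which the lapse function is constant and to which the
one-form `ι_ξ F` is normal. -/
structure IsPhotonSphere (g : RiemMetric3 M) (N : M → ℝ) (F : BilinField I4 (ℝ × M))
    (f : P → ℝ × M) : Prop where
  photonSurface : IsPhotonSurface I4 (𝓡 3) (staticMetric g N) f
  lapse_const : ∃ N₀ : ℝ, ∀ q, N (f q).2 = N₀
  normal_field : ∀ q (v : TangentSpace (𝓡 3) q),
    F (f q) (timeField (f q)) (mfderiv (𝓡 3) I4 f q v) = 0

/-- The gradient of `N` with respect to `g`. -/
noncomputable def gradient3 (g : RiemMetric3 M) (N : M → ℝ) (x : M) : TangentSpace (𝓡 3) x :=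
  ContinuousLinearMap.inverse (g.inner x) (mfderiv (𝓡 3) 𝓘(ℝ, ℝ) N x)

/-- `U ⊆ M` is the (spatial) exterior region of the hypersurface `f : P → ℝ × M`, and `N` foliates
it regularly: `U` is open and connected, its boundary is the intersection `Σ` of the hypersurface
with the time slice `{0} × M`, it consists, up to a set with compact closure, of the asymptotic end
of `M`, and `g(∇N, ∇N) ≠ 0` on `U`. -/
structure IsRegularExterior (g : RiemMetric3 M) (N : M → ℝ)
    (φ : PartialDiffeomorph (𝓡 3) (𝓡 3) M E3 ∞) (f : P → ℝ × M) (U : Set M) : Prop where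
  isOpen : IsOpen U
  isConnected : IsConnected U
  frontier_eq : frontier U = {x : M | ((0 : ℝ), x) ∈ range f}
  ends : ∃ R : ℝ, 1 < R ∧ φ.symm '' {x : E3 | R < ‖x‖} ⊆ U ∧
    IsCompact (closure U \ φ.symm '' {x : E3 | R < ‖x‖})
  regular : ∀ x ∈ U, g.inner x (gradient3 g N x) (gradient3 g N x) ≠ 0

end PhotonSphere

end Spacetime

/-! ### Levi-Civita calculus in a vector space -/

theorem two_le_infty : (2 : WithTop ℕ∞) ≤ ∞ := by
  norm_cast

theorem infty_ne_zero : (∞ : WithTop ℕ∞) ≠ 0 := by simp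

theorem minSmoothness_two_le : minSmoothness ℝ 2 ≤ ∞ := by
  simp only [minSmoothness_of_isRCLikeNormedField]
  exact two_le_infty

section LeviCivita

variable {E : Type*} [NormedAddCommGroup E] [NormedSpace ℝ E]

/-- A smooth nondegenerate symmetric metric on an open subset of a vector space. -/
structure IsMetricOn (G : E → E →L[ℝ] E →L[ℝ] ℝ) (Ω : Set E) : Prop where
  isOpen : IsOpen Ω
  smooth : ContDiffOn ℝ ∞ G Ω
  symm : ∀ y ∈ Ω, ∀ v w, G y v w = G y w v
  nondeg : ∀ y ∈ Ω, ∀ v, (∀ w, G y v w = 0) → v = 0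

/-- The covariant Hessian of a function. -/
noncomputable def covHess (G : E → E →L[ℝ] E →L[ℝ] ℝ) (f : E → ℝ) (y : E) :
    E →L[ℝ] E →L[ℝ] ℝ :=
  fderiv ℝ (fderiv ℝ f) y -
    (ContinuousLinearMap.compL ℝ E E ℝ (fderiv ℝ f y)).comp (christoffel G y)

theorem covHess_apply (G : E → E →L[ℝ] E →L[ℝ] ℝ) (f : E → ℝ) (y v w : E) :
    covHess G f y v w = fderiv ℝ (fderiv ℝ f) y v w - fderiv ℝ f y (christoffel G y v w) := rfl

/-- The covariant Laplacian of a function. -/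
noncomputable def covLap [FiniteDimensional ℝ E] (G : E → E →L[ℝ] E →L[ℝ] ℝ) (f : E → ℝ)
    (y : E) : ℝ :=
  metricTrace (G y) (fun v w => covHess G f y v w)

theorem isInvertible_of_nondeg [FiniteDimensional ℝ E] {B : E →L[ℝ] E →L[ℝ] ℝ}
    (h : ∀ v, (∀ w, B v w = 0) → v = 0) : B.IsInvertible := by
  have hinj : Function.Injective B := by
    intro v w hvw
    have : v - w = 0 := h _ fun z => by rw [map_sub, hvw, sub_self]; rfl
    exact sub_eq_zero.1 this
  have hdim : Module.finrank ℝ E = Module.finrank ℝ (E →L[ℝ] ℝ) := by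
    have e : (E →ₗ[ℝ] ℝ) ≃ₗ[ℝ] (E →L[ℝ] ℝ) := LinearMap.toContinuousLinearMap
    rw [← e.finrank_eq]
    exact (Subspace.dual_finrank_eq (K := ℝ) (V := E)).symm
  have : FiniteDimensional ℝ (E →L[ℝ] ℝ) :=
    (LinearMap.toContinuousLinearMap : (E →ₗ[ℝ] ℝ) ≃ₗ[ℝ] (E →L[ℝ] ℝ)).finiteDimensional
  let e := LinearEquiv.ofInjectiveOfFinrankEq B.toLinearMap hinj hdim
  refine ⟨e.toContinuousLinearEquiv, ?_⟩
  ext v w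
  rfl

theorem apply_inverse_of_nondeg [FiniteDimensional ℝ E] {B : E →L[ℝ] E →L[ℝ] ℝ}
    (h : ∀ v, (∀ w, B v w = 0) → v = 0) (l : E →L[ℝ] ℝ) : B (B.inverse l) = l :=
  (((isInvertible_of_nondeg h).inverse_apply_eq).1 rfl).symm

theorem inverse_apply_of_nondeg [FiniteDimensional ℝ E] {B : E →L[ℝ] E →L[ℝ] ℝ}
    (h : ∀ v, (∀ w, B v w = 0) → v = 0) (v : E) : B.inverse (B v) = v :=
  ((isInvertible_of_nondeg h).inverse_apply_eq).2 rfl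

namespace IsMetricOn

variable {G : E → E →L[ℝ] E →L[ℝ] ℝ} {Ω : Set E} (hG : IsMetricOn G Ω) {y : E} (hy : y ∈ Ω)

include hG hy in
theorem mem_nhds : Ω ∈ 𝓝 y := hG.isOpen.mem_nhds hy

include hG hy in
theorem contDiffAt : ContDiffAt ℝ ∞ G y := hG.smooth.contDiffAt (hG.mem_nhds hy)

include hG hy in
theorem differentiableAt : DifferentiableAt ℝ G y :=
  (hG.contDiffAt hy).differentiableAt (by simp)

include hG hy in
theorem eq_of_forall {v v' : E} (h : ∀ w, G y v w = G y v' w) : v = v' := by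
  refine sub_eq_zero.1 (hG.nondeg y hy _ fun w => ?_)
  rw [map_sub, sub_apply, h, sub_self]

end IsMetricOn

theorem fderiv_apply₂ {X F₁ F₂ : Type*} [NormedAddCommGroup X] [NormedSpace ℝ X]
    [NormedAddCommGroup F₁] [NormedSpace ℝ F₁] [NormedAddCommGroup F₂] [NormedSpace ℝ F₂]
    {B : X → F₁ →L[ℝ] F₂ →L[ℝ] ℝ} {a : X → F₁} {b : X → F₂} {x : X}
    (hB : DifferentiableAt ℝ B x) (ha : DifferentiableAt ℝ a x) (hb : DifferentiableAt ℝ b x)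
    (u : X) :
    fderiv ℝ (fun y => B y (a y) (b y)) x u
      = fderiv ℝ B x u (a x) (b x) + B x (fderiv ℝ a x u) (b x) + B x (a x) (fderiv ℝ b x u) := by
  rw [((hB.hasFDerivAt.clm_apply ha.hasFDerivAt).clm_apply hb.hasFDerivAt).fderiv]
  simp
  ring

theorem differentiableAt_apply₂ {X F₁ F₂ : Type*} [NormedAddCommGroup X] [NormedSpace ℝ X]
    [NormedAddCommGroup F₁] [NormedSpace ℝ F₁] [NormedAddCommGroup F₂] [NormedSpace ℝ F₂]
    {B : X → F₁ →L[ℝ] F₂ →L[ℝ] ℝ} {a : X → F₁} {b : X → F₂} {x : X}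
    (hB : DifferentiableAt ℝ B x) (ha : DifferentiableAt ℝ a x) (hb : DifferentiableAt ℝ b x) :
    DifferentiableAt ℝ (fun y => B y (a y) (b y)) x :=
  (hB.clm_apply ha).clm_apply hb

theorem fderiv_fixed₂ {X F₁ F₂ F₃ : Type*} [NormedAddCommGroup X] [NormedSpace ℝ X]
    [NormedAddCommGroup F₁] [NormedSpace ℝ F₁] [NormedAddCommGroup F₂] [NormedSpace ℝ F₂]
    [NormedAddCommGroup F₃] [NormedSpace ℝ F₃]
    {B : X → F₁ →L[ℝ] F₂ →L[ℝ] F₃} {x : X} (hB : DifferentiableAt ℝ B x) (u : X) (a : F₁)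
    (b : F₂) : fderiv ℝ (fun y => B y a b) x u = fderiv ℝ B x u a b := by
  rw [((hB.hasFDerivAt.clm_apply (hasFDerivAt_const a x)).clm_apply (hasFDerivAt_const b x)).fderiv]
  simp

namespace IsMetricOn

variable {G : E → E →L[ℝ] E →L[ℝ] ℝ} {Ω : Set E} (hG : IsMetricOn G Ω) {y : E} (hy : y ∈ Ω)

include hG hy in
theorem fderiv_symm (u v w : E) : fderiv ℝ G y u v w = fderiv ℝ G y u w v := by
  rw [← fderiv_fixed₂ (hG.differentiableAt hy), ← fderiv_fixed₂ (hG.differentiableAt hy)]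
  refine congrArg (fun L : E →L[ℝ] ℝ => L u) (Filter.EventuallyEq.fderiv_eq ?_)
  filter_upwards [hG.mem_nhds hy] with x hx
  exact hG.symm x hx v w

variable [FiniteDimensional ℝ E]

include hG hy in
theorem christoffel_spec (v w z : E) :
    G y (christoffel G y v w) z = christoffelLower G y v w z := by
  have := apply_inverse_of_nondeg (hG.nondeg y hy) (christoffelLower G y v w)
  exact congrArg (fun L : E →L[ℝ] ℝ => L z) this

omit [FiniteDimensional ℝ E] in
include hG hy in
theorem christoffelLower_symm (v w z : E) :
    christoffelLower G y v w z = christoffelLower G y w v z := by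
  rw [christoffelLower_apply, christoffelLower_apply, hG.fderiv_symm hy z v w]
  ring

include hG hy in
theorem christoffel_symm (v w : E) : christoffel G y v w = christoffel G y w v := by
  refine hG.eq_of_forall hy fun z => ?_
  rw [hG.christoffel_spec hy, hG.christoffel_spec hy, hG.christoffelLower_symm hy]

include hG hy in
/-- Metric compatibility. -/
theorem fderiv_eq (u v w : E) :
    fderiv ℝ G y u v w = G y (christoffel G y u v) w + G y (christoffel G y u w) v := by
  rw [hG.christoffel_spec hy, hG.christoffel_spec hy, christoffelLower_apply,
    christoffelLower_apply, hG.fderiv_symm hy u w v, hG.fderiv_symm hy v u w,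
    hG.fderiv_symm hy w u v]
  ring

include hG hy in
theorem contDiffAt_inverse : ContDiffAt ℝ ∞ (fun x => (G x).inverse) y := by
  have : CompleteSpace E := FiniteDimensional.complete ℝ E
  obtain ⟨e, he⟩ := isInvertible_of_nondeg (hG.nondeg y hy)
  have h := contDiffAt_map_inverse (n := ∞) (𝕜 := ℝ) e
  rw [he] at h
  exact h.comp y (hG.contDiffAt hy)

include hG hy in
theorem contDiffAt_christoffelLower : ContDiffAt ℝ ∞ (christoffelLower G) y := by
  have h : ContDiffAt ℝ ∞ (fderiv ℝ G) y := (hG.contDiffAt hy).fderiv_right (by simp)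
  let fl : (E →L[ℝ] E →L[ℝ] E →L[ℝ] ℝ) →L[ℝ] (E →L[ℝ] E →L[ℝ] E →L[ℝ] ℝ) :=
    (ContinuousLinearMap.flipₗᵢ ℝ E E (E →L[ℝ] ℝ)).toContinuousLinearEquiv
  have hf : ContDiffAt ℝ ∞ (fun x => (fderiv ℝ G x).flip) y :=
    fl.contDiff.contDiffAt.comp y h
  let fl₂ : (E →L[ℝ] E →L[ℝ] ℝ) →L[ℝ] E →L[ℝ] E →L[ℝ] ℝ :=
    (ContinuousLinearMap.flipₗᵢ ℝ E E ℝ).toContinuousLinearEquiv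
  have hc : ContDiffAt ℝ ∞ (fun x => fl₂.comp (fderiv ℝ G x).flip) y :=
    contDiffAt_const.clm_comp hf
  exact ((h.add hf).sub hc).const_smul (1 / 2 : ℝ)

include hG hy in
theorem contDiffAt_christoffel : ContDiffAt ℝ ∞ (christoffel G) y := by
  have h1 : ContDiffAt ℝ ∞ (fun x => ContinuousLinearMap.compL ℝ E (E →L[ℝ] ℝ) E (G x).inverse) y :=
    (ContinuousLinearMap.compL ℝ E (E →L[ℝ] ℝ) E).contDiff.contDiffAt.comp y
      (hG.contDiffAt_inverse hy)
  exact h1.clm_comp (hG.contDiffAt_christoffelLower hy)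

include hG hy in
theorem differentiableAt_christoffel : DifferentiableAt ℝ (christoffel G) y :=
  (hG.contDiffAt_christoffel hy).differentiableAt (by simp)

include hG hy in
theorem differentiableAt_christoffelLower : DifferentiableAt ℝ (christoffelLower G) y :=
  (hG.contDiffAt_christoffelLower hy).differentiableAt (by simp)

include hG hy in
/-- The lowered curvature in terms of the lowered Christoffel symbols. -/
theorem riemann_lower (u v w z : E) :
    G y (riemann G y u v w) z
      = fderiv ℝ (fun x => christoffelLower G x v w z) y u
        - fderiv ℝ (fun x => christoffelLower G x u w z) y v
        - G y (christoffel G y v w) (christoffel G y u z)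
        + G y (christoffel G y u w) (christoffel G y v z) := by
  have hΓ := hG.differentiableAt_christoffel hy
  have key : ∀ a b c : E, fderiv ℝ (fun x => christoffelLower G x b c z) y a
      = G y (christoffel G y a (christoffel G y b c)) z
        + G y (christoffel G y a z) (christoffel G y b c)
        + G y (fderiv ℝ (christoffel G) y a b c) z := by
    intro a b c
    have : (fun x => christoffelLower G x b c z) =ᶠ[𝓝 y] fun x => G x (christoffel G x b c) z := by
      filter_upwards [hG.mem_nhds hy] with x hx
      rw [hG.christoffel_spec hx]
    rw [this.fderiv_eq, fderiv_apply₂ (hG.differentiableAt hy)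
      ((hΓ.clm_apply (differentiableAt_const b)).clm_apply (differentiableAt_const c))
      (differentiableAt_const z), hG.fderiv_eq hy, fderiv_fixed₂ hΓ]
    simp
  rw [key, key, riemann]
  simp only [map_sub, map_add, add_apply, sub_apply]
  rw [hG.symm y hy (christoffel G y v z), hG.symm y hy (christoffel G y u z)]
  ring

include hG hy in
theorem fderiv_christoffelLower (u v w z : E) :
    fderiv ℝ (fun x => christoffelLower G x v w z) y u
      = 1 / 2 * (fderiv ℝ (fderiv ℝ G) y u v w z + fderiv ℝ (fderiv ℝ G) y u w v z
        - fderiv ℝ (fderiv ℝ G) y u z v w) := by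
  have hD : DifferentiableAt ℝ (fderiv ℝ G) y :=
    ((hG.contDiffAt hy).fderiv_right (m := 1) (by norm_cast)).differentiableAt (by simp)
  have h3 : ∀ a b c : E, HasFDerivAt (fun x => fderiv ℝ G x a b c)
      ((((fderiv ℝ (fderiv ℝ G) y).flip a).flip b).flip c) y := by
    intro a b c
    have := ((hD.hasFDerivAt.clm_apply (hasFDerivAt_const a y)).clm_apply
      (hasFDerivAt_const b y)).clm_apply (hasFDerivAt_const c y)
    refine this.congr_fderiv ?_
    ext x
    simp
  simp only [christoffelLower_apply]
  have h4 : HasFDerivAt (fun x => 1 / 2 * (fderiv ℝ G x v w z + fderiv ℝ G x w v z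
      - fderiv ℝ G x z v w)) _ y :=
    (((h3 v w z).add (h3 w v z)).sub (h3 z v w)).const_mul (1 / 2)
  rw [h4.fderiv]
  simp

include hG hy in
/-- The curvature is skew-symmetric in the last two arguments. -/
theorem riemann_skew (u v w z : E) :
    G y (riemann G y u v w) z = -G y (riemann G y u v z) w := by
  have hs : IsSymmSndFDerivAt ℝ G y := (hG.contDiffAt hy).isSymmSndFDerivAt minSmoothness_two_le
  have hs' : ∀ a b c d : E, fderiv ℝ (fderiv ℝ G) y a b c d = fderiv ℝ (fderiv ℝ G) y b a c d :=
    fun a b c d => by rw [hs.eq]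
  have hD : DifferentiableAt ℝ (fderiv ℝ G) y :=
    ((hG.contDiffAt hy).fderiv_right (m := 1) (by norm_cast)).differentiableAt (by simp)
  have hsym : ∀ a b c d : E, fderiv ℝ (fderiv ℝ G) y a b c d
      = fderiv ℝ (fderiv ℝ G) y a b d c := by
    intro a b c d
    have h : ∀ c d : E, HasFDerivAt (fun x => fderiv ℝ G x b c d)
        ((((fderiv ℝ (fderiv ℝ G) y).flip b).flip c).flip d) y := by
      intro c d
      have := ((hD.hasFDerivAt.clm_apply (hasFDerivAt_const b y)).clm_apply
        (hasFDerivAt_const c y)).clm_apply (hasFDerivAt_const d y)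
      refine this.congr_fderiv ?_
      ext x
      simp
    have e : (fun x => fderiv ℝ G x b c d) =ᶠ[𝓝 y] fun x => fderiv ℝ G x b d c := by
      filter_upwards [hG.mem_nhds hy] with x hx
      exact hG.fderiv_symm hx b c d
    have := e.fderiv_eq (𝕜 := ℝ)
    rw [(h c d).fderiv, (h d c).fderiv] at this
    simpa using DFunLike.congr_fun this a
  rw [hG.riemann_lower hy, hG.riemann_lower hy]
  simp only [hG.fderiv_christoffelLower hy]
  rw [hG.symm y hy (christoffel G y v z), hG.symm y hy (christoffel G y u z),
    hs' v u w z, hs' v u z w, hsym u v w z, hsym u w v z, hsym u z v w,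
    hsym v w u z, hsym v z u w]
  ring

include hG hy in
/-- The Ricci identity for the Hessian of a function. -/
theorem ricci_identity {f : E → ℝ} (hf : ContDiffAt ℝ ∞ f y) (u v w : E) :
    (fderiv ℝ (covHess G f) y u v w - covHess G f y (christoffel G y u v) w
        - covHess G f y v (christoffel G y u w))
      - (fderiv ℝ (covHess G f) y v u w - covHess G f y (christoffel G y v u) w
        - covHess G f y u (christoffel G y v w))
      = -fderiv ℝ f y (riemann G y u v w) := by
  have hΓ := hG.differentiableAt_christoffel hy
  have h1 : ContDiffAt ℝ ∞ (fderiv ℝ f) y := hf.fderiv_right (by simp)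
  have h2 : ContDiffAt ℝ ∞ (fderiv ℝ (fderiv ℝ f)) y := h1.fderiv_right (by simp)
  have hd1 := (h1.differentiableAt (by simp)).hasFDerivAt
  have hd2 := (h2.differentiableAt (by simp)).hasFDerivAt
  have hT : HasFDerivAt (covHess G f) _ y := hd2.sub
    (((ContinuousLinearMap.compL ℝ E E ℝ).hasFDerivAt.comp y hd1).clm_comp hΓ.hasFDerivAt)
  have key : ∀ a b c : E, fderiv ℝ (covHess G f) y a b c
      = fderiv ℝ (fderiv ℝ (fderiv ℝ f)) y a b c
        - fderiv ℝ (fderiv ℝ f) y a (christoffel G y b c)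
        - fderiv ℝ f y (fderiv ℝ (christoffel G) y a b c) := by
    intro a b c
    rw [hT.fderiv]
    simp
    ring
  have hs2 : ∀ a b c : E, fderiv ℝ (fderiv ℝ (fderiv ℝ f)) y a b c
      = fderiv ℝ (fderiv ℝ (fderiv ℝ f)) y b a c :=
    fun a b c => by rw [(h1.isSymmSndFDerivAt minSmoothness_two_le).eq a b]
  rw [key, key, hs2 v u w, riemann, hG.christoffel_symm hy v u]
  simp only [covHess_apply, map_sub, map_add]
  ring

include hG hy in
theorem covHess_symm {f : E → ℝ} (hf : ContDiffAt ℝ ∞ f y) (v w : E) :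
    covHess G f y v w = covHess G f y w v := by
  rw [covHess_apply, covHess_apply, hG.christoffel_symm hy v w,
    (hf.isSymmSndFDerivAt minSmoothness_two_le).eq v w]

include hG hy in
theorem contDiffAt_covHess {f : E → ℝ} (hf : ContDiffAt ℝ ∞ f y) :
    ContDiffAt ℝ ∞ (covHess G f) y := by
  have h1 : ContDiffAt ℝ ∞ (fderiv ℝ f) y := hf.fderiv_right (by simp)
  have h2 : ContDiffAt ℝ ∞ (fderiv ℝ (fderiv ℝ f)) y := h1.fderiv_right (by simp)
  exact h2.sub (((ContinuousLinearMap.compL ℝ E E ℝ).contDiff.contDiffAt.comp y h1).clm_comp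
    (hG.contDiffAt_christoffel hy))

end IsMetricOn

/-! ### Curvature along a map -/

section Along

variable [FiniteDimensional ℝ E] {E' : Type*} [NormedAddCommGroup E'] [NormedSpace ℝ E']
  [FiniteDimensional ℝ E']

/-- The covariant derivative `∇ᵥ dF(w)` along a map `F`. -/
noncomputable def covAlong (G : E → E →L[ℝ] E →L[ℝ] ℝ) (F : E' → E) (y v w : E') : E :=
  fderiv ℝ (fderiv ℝ F) y v w + christoffel G (F y) (fderiv ℝ F y v) (fderiv ℝ F y w)

variable {G : E → E →L[ℝ] E →L[ℝ] ℝ} {Ω : Set E} (hG : IsMetricOn G Ω)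
  {p : E' → E' →L[ℝ] E' →L[ℝ] ℝ} {Ω' : Set E'} (hp : IsMetricOn p Ω')
  {F : E' → E} (hF : ContDiffOn ℝ ∞ F Ω') (hmaps : MapsTo F Ω' Ω)
  (hpull : ∀ y ∈ Ω', ∀ v w, p y v w = G (F y) (fderiv ℝ F y v) (fderiv ℝ F y w))

include hG hp hF hmaps hpull in
theorem christoffelLower_along {y : E'} (hy : y ∈ Ω') (v w z : E') :
    christoffelLower p y v w z = G (F y) (covAlong G F y v w) (fderiv ℝ F y z) := by
  have hFy : ContDiffAt ℝ ∞ F y := hF.contDiffAt (hp.mem_nhds hy)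
  have h1 : ContDiffAt ℝ ∞ (fderiv ℝ F) y := hFy.fderiv_right (by simp)
  have hd1 : DifferentiableAt ℝ (fderiv ℝ F) y := h1.differentiableAt (by simp)
  have hdF : DifferentiableAt ℝ F y := hFy.differentiableAt (by simp)
  have hGF := hG.differentiableAt (hmaps hy)
  have key : ∀ a b c : E', fderiv ℝ p y a b c
      = fderiv ℝ G (F y) (fderiv ℝ F y a) (fderiv ℝ F y b) (fderiv ℝ F y c)
        + G (F y) (fderiv ℝ (fderiv ℝ F) y a b) (fderiv ℝ F y c)
        + G (F y) (fderiv ℝ F y b) (fderiv ℝ (fderiv ℝ F) y a c) := by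
    intro a b c
    rw [← fderiv_fixed₂ (hp.differentiableAt hy)]
    have : (fun x => p x b c) =ᶠ[𝓝 y] fun x => G (F x) (fderiv ℝ F x b) (fderiv ℝ F x c) := by
      filter_upwards [hp.mem_nhds hy] with x hx
      exact hpull x hx b c
    rw [this.fderiv_eq, fderiv_apply₂ (B := fun x => G (F x)) (hGF.comp y hdF)
      (hd1.clm_apply (differentiableAt_const b)) (hd1.clm_apply (differentiableAt_const c)),
      fderiv_fun_comp y hGF hdF, fderiv_clm_apply hd1 (differentiableAt_const b),
      fderiv_clm_apply hd1 (differentiableAt_const c)]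
    simp
  have hs : ∀ a b : E', fderiv ℝ (fderiv ℝ F) y a b = fderiv ℝ (fderiv ℝ F) y b a :=
    fun a b => (hFy.isSymmSndFDerivAt minSmoothness_two_le).eq a b
  have hsy := hG.symm _ (hmaps hy)
  rw [christoffelLower_apply, key, key, key, covAlong, map_add, add_apply,
    hG.christoffel_spec (hmaps hy), christoffelLower_apply, hs w v, hs z v, hs z w,
    hsy (fderiv ℝ F y w) (fderiv ℝ (fderiv ℝ F) y v z),
    hsy (fderiv ℝ F y v) (fderiv ℝ (fderiv ℝ F) y w z)]
  ring

include hG hp hF hmaps hpull in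
/-- The Gauss equation along a map which is not necessarily of full rank. -/
theorem gauss_along {y : E'} (hy : y ∈ Ω') (u v w z : E') :
    p y (riemann p y u v w) z
      = G (F y) (riemann G (F y) (fderiv ℝ F y u) (fderiv ℝ F y v) (fderiv ℝ F y w))
          (fderiv ℝ F y z)
        + G (F y) (covAlong G F y v w) (covAlong G F y u z)
        - G (F y) (covAlong G F y u w) (covAlong G F y v z)
        - p y (christoffel p y v w) (christoffel p y u z)
        + p y (christoffel p y u w) (christoffel p y v z) := by
  have hFy : ContDiffAt ℝ ∞ F y := hF.contDiffAt (hp.mem_nhds hy)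
  have h1 : ContDiffAt ℝ ∞ (fderiv ℝ F) y := hFy.fderiv_right (by simp)
  have h2 : ContDiffAt ℝ ∞ (fderiv ℝ (fderiv ℝ F)) y := h1.fderiv_right (by simp)
  have hd1 : DifferentiableAt ℝ (fderiv ℝ F) y := h1.differentiableAt (by simp)
  have hd2 : DifferentiableAt ℝ (fderiv ℝ (fderiv ℝ F)) y := h2.differentiableAt (by simp)
  have hdF : DifferentiableAt ℝ F y := hFy.differentiableAt (by simp)
  have hFm := hmaps hy
  have hGF := hG.differentiableAt hFm
  have hΓ := hG.differentiableAt_christoffel hFm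
  have hC : ∀ b c : E', HasFDerivAt (fun x => covAlong G F x b c) _ y := fun b c =>
    ((hd2.hasFDerivAt.clm_apply (hasFDerivAt_const b y)).clm_apply (hasFDerivAt_const c y)).add
      (((hΓ.hasFDerivAt.comp y hdF.hasFDerivAt).clm_apply
        (hd1.hasFDerivAt.clm_apply (hasFDerivAt_const b y))).clm_apply
        (hd1.hasFDerivAt.clm_apply (hasFDerivAt_const c y)))
  have hCd : ∀ a b c : E', fderiv ℝ (fun x => covAlong G F x b c) y a
      = fderiv ℝ (fderiv ℝ (fderiv ℝ F)) y a b c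
        + fderiv ℝ (christoffel G) (F y) (fderiv ℝ F y a) (fderiv ℝ F y b) (fderiv ℝ F y c)
        + christoffel G (F y) (fderiv ℝ (fderiv ℝ F) y a b) (fderiv ℝ F y c)
        + christoffel G (F y) (fderiv ℝ F y b) (fderiv ℝ (fderiv ℝ F) y a c) := by
    intro a b c
    rw [(hC b c).fderiv]
    simp
    abel
  have key : ∀ a b c : E', fderiv ℝ (fun x => christoffelLower p x b c z) y a
      = G (F y) (christoffel G (F y) (fderiv ℝ F y a) (covAlong G F y b c)
          + fderiv ℝ (fun x => covAlong G F x b c) y a) (fderiv ℝ F y z)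
        + G (F y) (covAlong G F y b c) (covAlong G F y a z) := by
    intro a b c
    have : (fun x => christoffelLower p x b c z) =ᶠ[𝓝 y]
        fun x => G (F x) (covAlong G F x b c) (fderiv ℝ F x z) := by
      filter_upwards [hp.mem_nhds hy] with x hx
      exact christoffelLower_along hG hp hF hmaps hpull hx b c z
    rw [this.fderiv_eq, fderiv_apply₂ (B := fun x => G (F x)) (hGF.comp y hdF)
      (hC b c).differentiableAt (hd1.clm_apply (differentiableAt_const z)),
      fderiv_fun_comp y hGF hdF, fderiv_clm_apply hd1 (differentiableAt_const z)]
    simp only [ContinuousLinearMap.comp_apply, map_add, add_apply]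
    rw [hG.fderiv_eq hFm]
    conv_rhs => rw [covAlong.eq_def G F y a z]
    simp only [map_add, add_apply]
    rw [hG.symm _ hFm (christoffel G (F y) (fderiv ℝ F y a) (fderiv ℝ F y z))]
    simp
    ring
  have hs : ∀ a b : E', fderiv ℝ (fderiv ℝ F) y a b = fderiv ℝ (fderiv ℝ F) y b a :=
    fun a b => (hFy.isSymmSndFDerivAt minSmoothness_two_le).eq a b
  have hs2 : ∀ a b c : E', fderiv ℝ (fderiv ℝ (fderiv ℝ F)) y a b c
      = fderiv ℝ (fderiv ℝ (fderiv ℝ F)) y b a c :=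
    fun a b c => by rw [(h1.isSymmSndFDerivAt minSmoothness_two_le).eq a b]
  have hR : riemann G (F y) (fderiv ℝ F y u) (fderiv ℝ F y v) (fderiv ℝ F y w)
      = (christoffel G (F y) (fderiv ℝ F y u) (covAlong G F y v w)
          + fderiv ℝ (fun x => covAlong G F x v w) y u)
        - (christoffel G (F y) (fderiv ℝ F y v) (covAlong G F y u w)
          + fderiv ℝ (fun x => covAlong G F x u w) y v) := by
    rw [hCd, hCd, hs2 v u w, hs v u, covAlong, covAlong, riemann]
    simp only [map_add]
    abel
  rw [hp.riemann_lower hy, key, key, hR]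
  simp only [map_sub, sub_apply]
  ring

include hG hp hF hmaps hpull in
/-- Transformation law of the Christoffel symbols under a change of coordinates. -/
theorem covAlong_eq_of_surjective {y : E'} (hy : y ∈ Ω')
    (hsurj : Function.Surjective (fderiv ℝ F y)) (v w : E') :
    covAlong G F y v w = fderiv ℝ F y (christoffel p y v w) := by
  refine hG.eq_of_forall (hmaps hy) fun z' => ?_
  obtain ⟨z, rfl⟩ := hsurj z'
  rw [← christoffelLower_along hG hp hF hmaps hpull hy, ← hpull y hy, hp.christoffel_spec hy]

include hG hp hF hmaps hpull in
/-- Transformation law of the Hessian under a change of coordinates. -/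
theorem covHess_comp_of_surjective {y : E'} (hy : y ∈ Ω')
    (hsurj : Function.Surjective (fderiv ℝ F y)) {f : E → ℝ} (hf : ContDiffAt ℝ ∞ f (F y))
    (v w : E') :
    covHess p (fun x => f (F x)) y v w
      = covHess G f (F y) (fderiv ℝ F y v) (fderiv ℝ F y w) := by
  have hFy : ContDiffAt ℝ ∞ F y := hF.contDiffAt (hp.mem_nhds hy)
  have h1 : ContDiffAt ℝ ∞ (fderiv ℝ F) y := hFy.fderiv_right (by simp)
  have hd1 : DifferentiableAt ℝ (fderiv ℝ F) y := h1.differentiableAt (by simp)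
  have hdF : DifferentiableAt ℝ F y := hFy.differentiableAt (by simp)
  have hf1 : DifferentiableAt ℝ (fderiv ℝ f) (F y) :=
    (hf.fderiv_right (m := 1) (by norm_cast)).differentiableAt (by simp)
  have e : fderiv ℝ (fun x => f (F x)) =ᶠ[𝓝 y] fun x => (fderiv ℝ f (F x)).comp (fderiv ℝ F x) := by
    have hf2 : ContDiffAt ℝ 2 f (F y) := hf.of_le two_le_infty
    have hev := hFy.continuousAt.eventually (hf2.eventually (by simp))
    have hF2 : ContDiffAt ℝ 2 F y := hFy.of_le two_le_infty
    filter_upwards [hev, hF2.eventually (by simp)] with x hx hx'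
    exact fderiv_fun_comp x (hx.differentiableAt (by simp)) (hx'.differentiableAt (by simp))
  have e2 := covAlong_eq_of_surjective hG hp hF hmaps hpull hy hsurj v w
  have h5 : HasFDerivAt (fun x => (fderiv ℝ f (F x)).comp (fderiv ℝ F x)) _ y :=
    (hf1.hasFDerivAt.comp y hdF.hasFDerivAt).clm_comp hd1.hasFDerivAt
  rw [covHess_apply, e.fderiv_eq, e.eq_of_nhds, covHess_apply, h5.fderiv]
  simp only [ContinuousLinearMap.comp_apply]
  rw [← e2, covAlong]
  simp

end Along

end LeviCivita

/-! ### Traces -/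

section Traces

variable {E : Type*} [NormedAddCommGroup E] [NormedSpace ℝ E] [FiniteDimensional ℝ E]
  {ι : Type*} [Fintype ι] {B : E →L[ℝ] E →L[ℝ] ℝ} {b : Module.Basis ι ℝ E}

theorem apply_self_ne_zero_of_orthogonal (hnd : ∀ v, (∀ w, B v w = 0) → v = 0)
    (hb : ∀ i j, i ≠ j → B (b i) (b j) = 0) (i : ι) : B (b i) (b i) ≠ 0 := by
  intro h
  refine b.ne_zero i (hnd _ fun w => ?_)
  have : (B (b i) : E →ₗ[ℝ] ℝ) = 0 := b.ext fun j => by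
    by_cases hij : i = j
    · subst hij; simpa using h
    · simpa using hb i j hij
  exact DFunLike.congr_fun this w

theorem coord_of_orthogonal (hnd : ∀ v, (∀ w, B v w = 0) → v = 0)
    (hb : ∀ i j, i ≠ j → B (b i) (b j) = 0) (i : ι) (v : E) :
    b.repr v i = B (b i) v / B (b i) (b i) := by
  classical
  rw [eq_div_iff (apply_self_ne_zero_of_orthogonal hnd hb i)]
  conv_rhs => rw [← b.sum_repr v]
  rw [map_sum, Finset.sum_eq_single i]
  · simp
  · intro j _ hj
    simp [hb i j hj.symm]
  · simp

theorem trace_of_orthogonal (hnd : ∀ v, (∀ w, B v w = 0) → v = 0)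
    (hb : ∀ i j, i ≠ j → B (b i) (b j) = 0) (A : E →ₗ[ℝ] E) :
    LinearMap.trace ℝ E A = ∑ i, B (b i) (A (b i)) / B (b i) (b i) := by
  classical
  rw [LinearMap.trace_eq_matrix_trace ℝ b, Matrix.trace]
  refine Finset.sum_congr rfl fun i _ => ?_
  rw [Matrix.diag_apply, LinearMap.toMatrix_apply, coord_of_orthogonal hnd hb]

/-- Raising an index of a bilinear form. -/
noncomputable def raiseIndex (B : E →L[ℝ] E →L[ℝ] ℝ) (T : E →ₗ[ℝ] E →ₗ[ℝ] ℝ) : E →ₗ[ℝ] E :=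
  (B.inverse : (E →L[ℝ] ℝ) →ₗ[ℝ] E) ∘ₗ
    (LinearMap.toContinuousLinearMap : (E →ₗ[ℝ] ℝ) ≃ₗ[ℝ] (E →L[ℝ] ℝ)).toLinearMap ∘ₗ T

theorem apply_raiseIndex (hnd : ∀ v, (∀ w, B v w = 0) → v = 0) (T : E →ₗ[ℝ] E →ₗ[ℝ] ℝ) (v w : E) :
    B (raiseIndex B T v) w = T v w := by
  simp [raiseIndex, apply_inverse_of_nondeg hnd]

theorem sum_apply_inverse_coordCovector (hnd : ∀ v, (∀ w, B v w = 0) → v = 0)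
    (hs : ∀ v w, B v w = B w v) (b : Module.Basis ι ℝ E) (T : E →ₗ[ℝ] E →ₗ[ℝ] ℝ) :
    ∑ i, T (b i) (B.inverse (coordCovector b i)) = LinearMap.trace ℝ E (raiseIndex B T) := by
  classical
  rw [LinearMap.trace_eq_matrix_trace ℝ b, Matrix.trace]
  refine Finset.sum_congr rfl fun i _ => ?_
  rw [Matrix.diag_apply, LinearMap.toMatrix_apply, ← apply_raiseIndex hnd, hs,
    apply_inverse_of_nondeg hnd]
  simp [coordCovector]

theorem metricTrace_eq_sum (hnd : ∀ v, (∀ w, B v w = 0) → v = 0) (hs : ∀ v w, B v w = B w v)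
    (b : Module.Basis ι ℝ E) (T : E →ₗ[ℝ] E →ₗ[ℝ] ℝ) :
    metricTrace B (fun v w => T v w) = ∑ i, T (b i) (B.inverse (coordCovector b i)) := by
  rw [metricTrace, sum_apply_inverse_coordCovector hnd hs,
    sum_apply_inverse_coordCovector hnd hs]

theorem metricTrace_of_orthogonal (hnd : ∀ v, (∀ w, B v w = 0) → v = 0)
    (hs : ∀ v w, B v w = B w v) (hb : ∀ i j, i ≠ j → B (b i) (b j) = 0) {T : E → E → ℝ}
    (T' : E →ₗ[ℝ] E →ₗ[ℝ] ℝ) (hT : ∀ v w, T v w = T' v w) :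
    metricTrace B T = ∑ i, T (b i) (b i) / B (b i) (b i) := by
  have : T = fun v w => T' v w := by ext; apply hT
  rw [this, metricTrace_eq_sum hnd hs b]
  refine Finset.sum_congr rfl fun i _ => ?_
  have : B.inverse (coordCovector b i) = (B (b i) (b i))⁻¹ • b i := by
    rw [← inverse_apply_of_nondeg hnd ((B (b i) (b i))⁻¹ • b i)]
    congr 1
    ext v
    simp only [coordCovector, LinearMap.coe_toContinuousLinearMap', Module.Basis.coord_apply,
      coord_of_orthogonal hnd hb, map_smul, smul_apply, smul_eq_mul]
    field_simp
  rw [this, map_smul, smul_eq_mul]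
  field_simp

/-- A continuous bilinear form as a bilinear form. -/
noncomputable def bilinToLin (T : E →L[ℝ] E →L[ℝ] ℝ) : E →ₗ[ℝ] E →ₗ[ℝ] ℝ :=
  LinearMap.mk₂ ℝ (fun v w => T v w) (by simp) (by simp) (by simp) (by simp)

/-- The Ricci curvature as a bilinear form. -/
noncomputable def ricciLin (G : E → E →L[ℝ] E →L[ℝ] ℝ) (y : E) : E →ₗ[ℝ] E →ₗ[ℝ] ℝ :=
  LinearMap.mk₂ ℝ (ricci G y)
    (by intros; simp only [ricci, riemann, map_add, add_apply, map_sub,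
          ← Finset.sum_add_distrib]; refine Finset.sum_congr rfl fun i _ => ?_; ring)
    (by intros; simp only [ricci, riemann, map_add, map_smul, map_sub, smul_eq_mul, Finset.mul_sum,
          smul_apply]; refine Finset.sum_congr rfl fun i _ => ?_; ring)
    (by intros; simp only [ricci, riemann, map_add, map_sub,
          ← Finset.sum_add_distrib]; refine Finset.sum_congr rfl fun i _ => ?_; ring)
    (by intros; simp only [ricci, riemann, map_add, map_smul, map_sub, smul_eq_mul, Finset.mul_sum];
        refine Finset.sum_congr rfl fun i _ => ?_; ring)

/-- The curvature `u ↦ R(u, v) w` as a linear map. -/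
noncomputable def riemannLin (G : E → E →L[ℝ] E →L[ℝ] ℝ) (y v w : E) : E →ₗ[ℝ] E where
  toFun u := riemann G y u v w
  map_add' a c := by simp only [riemann, map_add, add_apply]; abel
  map_smul' a c := by
    simp only [riemann, map_smul, smul_apply, RingHom.id_apply, smul_add,
      smul_sub]

theorem ricci_of_orthogonal {G : E → E →L[ℝ] E →L[ℝ] ℝ} {Ω : Set E} (hG : IsMetricOn G Ω) {y : E}
    (hy : y ∈ Ω) (hb : ∀ i j, i ≠ j → G y (b i) (b j) = 0) (v w : E) :
    ricci G y v w = ∑ i, G y (riemann G y (b i) v w) (b i) / G y (b i) (b i) := by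
  classical
  have h1 : ricci G y v w = LinearMap.trace ℝ E (riemannLin G y v w) := by
    rw [LinearMap.trace_eq_matrix_trace ℝ (Module.finBasis ℝ E), Matrix.trace, ricci]
    refine Finset.sum_congr rfl fun i _ => ?_
    rw [Matrix.diag_apply, LinearMap.toMatrix_apply]
    simp [coordCovector, riemannLin]
  rw [h1, trace_of_orthogonal (hG.nondeg y hy) hb]
  refine Finset.sum_congr rfl fun i _ => ?_
  rw [hG.symm y hy (b i)]
  rfl

theorem sum_repr_of_orthonormal (hnd : ∀ v, (∀ w, B v w = 0) → v = 0) [DecidableEq ι]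
    (hb : ∀ i j, B (b i) (b j) = if i = j then 1 else 0) (v : E) :
    ∑ i, B (b i) v • b i = v := by
  conv_rhs => rw [← b.sum_repr v]
  refine Finset.sum_congr rfl fun i _ => ?_
  rw [coord_of_orthogonal hnd (fun i j hij => by rw [hb, if_neg hij]), hb, if_pos rfl, div_one]

theorem metricTrace_of_orthonormal (hnd : ∀ v, (∀ w, B v w = 0) → v = 0)
    (hs : ∀ v w, B v w = B w v) [DecidableEq ι]
    (hb : ∀ i j, B (b i) (b j) = if i = j then 1 else 0) {T : E → E → ℝ}
    (T' : E →ₗ[ℝ] E →ₗ[ℝ] ℝ) (hT : ∀ v w, T v w = T' v w) :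
    metricTrace B T = ∑ i, T (b i) (b i) := by
  rw [metricTrace_of_orthogonal hnd hs (fun i j hij => by rw [hb, if_neg hij]) T' hT]
  simp [hb]

/-- A family of nonzero orthogonal vectors of the right cardinality is a basis. -/
theorem exists_basis_of_orthogonal (hcard : Fintype.card ι = Module.finrank ℝ E) {v : ι → E}
    (hv : ∀ i j, i ≠ j → B (v i) (v j) = 0) (hv0 : ∀ i, B (v i) (v i) ≠ 0) :
    ∃ b : Module.Basis ι ℝ E, ∀ i, b i = v i := by
  have hli : LinearIndependent ℝ v := by
    rw [Fintype.linearIndependent_iff]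
    intro c hc i
    have := congrArg (fun x => B (v i) x) hc
    simp only [map_sum, map_smul, map_zero, smul_eq_mul] at this
    rw [Finset.sum_eq_single i (fun j _ hj => by rw [hv i j hj.symm, mul_zero]) (by simp)] at this
    exact (mul_eq_zero.1 this).resolve_right (hv0 i)
  rcases isEmpty_or_nonempty ι with h | h
  · have : Module.finrank ℝ E = 0 := by rw [← hcard]; simp
    have : Subsingleton E := Module.finrank_zero_iff.1 this
    exact ⟨Module.Basis.empty E, fun i => h.elim i⟩
  · exact ⟨basisOfLinearIndependentOfCardEqFinrank hli hcard, fun i => by simp⟩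

/-- In dimension three there is an orthonormal basis whose first vector has a given direction. -/
theorem exists_orthonormal_basis (hdim : Module.finrank ℝ E = 3) (hs : ∀ v w, B v w = B w v)
    (hpos : ∀ v, v ≠ 0 → 0 < B v v) (V : E) :
    ∃ b : Module.Basis (Fin 3) ℝ E, (∀ i j, B (b i) (b j) = if i = j then 1 else 0) ∧
      ∃ c : ℝ, 0 ≤ c ∧ V = c • b 0 := by
  have hnt : Nontrivial E := Module.nontrivial_of_finrank_pos (R := ℝ) (by omega)
  have norm : ∀ v : E, v ≠ 0 → ∃ c : ℝ, 0 < c ∧ B (c⁻¹ • v) (c⁻¹ • v) = 1 := by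
    intro v hv
    refine ⟨Real.sqrt (B v v), Real.sqrt_pos.2 (hpos v hv), ?_⟩
    simp only [map_smul, smul_apply, smul_eq_mul]
    have h := hpos v hv
    have h2 := Real.mul_self_sqrt h.le
    field_simp
    nlinarith
  obtain ⟨e0, he0, c, hc, hV⟩ : ∃ e : E, B e e = 1 ∧ ∃ c : ℝ, 0 ≤ c ∧ V = c • e := by
    by_cases hV : V = 0
    · obtain ⟨v, hv⟩ := exists_ne (0 : E)
      obtain ⟨c, -, h1⟩ := norm v hv
      exact ⟨_, h1, 0, le_rfl, by simp [hV]⟩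
    · obtain ⟨c, hc, h1⟩ := norm V hV
      exact ⟨_, h1, c, hc.le, by rw [smul_inv_smul₀ hc.ne']⟩
  have perp : ∀ a d : E, ∃ w : E, B a w = 0 ∧ B d w = 0 ∧ B w w = 1 := by
    intro a d
    let Lm : E →ₗ[ℝ] ℝ × ℝ := ((B a : E →ₗ[ℝ] ℝ)).prod (B d : E →ₗ[ℝ] ℝ)
    have hk : LinearMap.ker Lm ≠ ⊥ := LinearMap.ker_ne_bot_of_finrank_lt (by simp [hdim])
    obtain ⟨w, hw, hw0⟩ := Submodule.exists_mem_ne_zero_of_ne_bot hk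
    have hw' : B a w = 0 ∧ B d w = 0 := by simpa [Lm] using hw
    obtain ⟨c, -, h1⟩ := norm w hw0
    exact ⟨c⁻¹ • w, by simp [hw'.1], by simp [hw'.2], h1⟩
  obtain ⟨e1, h01, -, h11⟩ := perp e0 e0
  obtain ⟨e2, h02, h12, h22⟩ := perp e0 e1
  have hv : ∀ i j, B ((![e0, e1, e2] : Fin 3 → E) i) ((![e0, e1, e2] : Fin 3 → E) j)
      = if i = j then 1 else 0 := by
    intro i j
    fin_cases i <;> fin_cases j <;>
      simp [h01, h02, h12, h11, h22, he0, hs e1 e0, hs e2 e0, hs e2 e1]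
  obtain ⟨b, hb⟩ := exists_basis_of_orthogonal (B := B) (by simp [hdim])
    (v := (![e0, e1, e2] : Fin 3 → E)) (fun i j hij => by rw [hv, if_neg hij])
    (fun i => by rw [hv]; simp)
  exact ⟨b, fun i j => by rw [hb, hb, hv], c, hc, by rw [hb]; exact hV⟩

end Traces

/-! ### Gradients and the Bochner formula -/

section Bochner

variable {E : Type*} [NormedAddCommGroup E] [NormedSpace ℝ E] [FiniteDimensional ℝ E]

/-- The gradient of a function. -/
noncomputable def covGrad (G : E → E →L[ℝ] E →L[ℝ] ℝ) (f : E → ℝ) (y : E) : E :=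
  (G y).inverse (fderiv ℝ f y)

variable {G : E → E →L[ℝ] E →L[ℝ] ℝ} {Ω : Set E} (hG : IsMetricOn G Ω) {y : E} (hy : y ∈ Ω)
  {f : E → ℝ} (hf : ContDiffOn ℝ ∞ f Ω)

namespace IsMetricOn

include hG hy in
theorem apply_covGrad (f : E → ℝ) (w : E) : G y (covGrad G f y) w = fderiv ℝ f y w := by
  rw [covGrad, apply_inverse_of_nondeg (hG.nondeg y hy)]

include hG hy in
theorem differentiableAt_inverse_apply {l : E → E →L[ℝ] ℝ} (hl : DifferentiableAt ℝ l y) :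
    DifferentiableAt ℝ (fun x => (G x).inverse (l x)) y :=
  ((hG.contDiffAt_inverse hy).differentiableAt (by simp)).clm_apply hl

include hG hy in
/-- Derivative of a vector field obtained by raising an index. -/
theorem apply_fderiv_inverse {l : E → E →L[ℝ] ℝ} (hl : DifferentiableAt ℝ l y) (v w : E) :
    G y (fderiv ℝ (fun x => (G x).inverse (l x)) y v
        + christoffel G y v ((G y).inverse (l y))) w
      = fderiv ℝ l y v w - l y (christoffel G y v w) := by
  have h1 : (fun x => G x ((G x).inverse (l x)) w) =ᶠ[𝓝 y] fun x => l x w := by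
    filter_upwards [hG.mem_nhds hy] with x hx
    rw [apply_inverse_of_nondeg (hG.nondeg x hx)]
  have h2 := DFunLike.congr_fun (h1.fderiv_eq (𝕜 := ℝ)) v
  rw [fderiv_apply₂ (hG.differentiableAt hy) (hG.differentiableAt_inverse_apply hy hl)
    (differentiableAt_const w), hG.fderiv_eq hy, hG.symm y hy (christoffel G y v w),
    apply_inverse_of_nondeg (hG.nondeg y hy), fderiv_clm_apply hl (differentiableAt_const w)] at h2
  simp only [map_add, add_apply]
  simp at h2
  linarith

include hG hf in
theorem contDiffAt_of_mem (hy : y ∈ Ω) : ContDiffAt ℝ ∞ f y := hf.contDiffAt (hG.mem_nhds hy)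

include hG hy hf in
theorem differentiableAt_fderiv : DifferentiableAt ℝ (fderiv ℝ f) y :=
  ((hG.contDiffAt_of_mem hf hy).fderiv_right (m := 1) (by norm_cast)).differentiableAt (by simp)

include hG hy hf in
theorem apply_fderiv_covGrad (v w : E) :
    G y (fderiv ℝ (covGrad G f) y v + christoffel G y v (covGrad G f y)) w
      = covHess G f y v w :=
  hG.apply_fderiv_inverse hy (hG.differentiableAt_fderiv hy hf) v w

include hG hy hf in
theorem fderiv_apply_covGrad (v : E) :
    fderiv ℝ (fun x => fderiv ℝ f x (covGrad G f x)) y v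
      = 2 * covHess G f y v (covGrad G f y) := by
  have hd := hG.differentiableAt_fderiv hy hf
  have h1 := hG.apply_fderiv_covGrad hy hf v (covGrad G f y)
  have hV : DifferentiableAt ℝ (covGrad G f) y := hG.differentiableAt_inverse_apply hy hd
  rw [fderiv_clm_apply hd hV]
  rw [hG.symm y hy, map_add, hG.apply_covGrad hy, hG.apply_covGrad hy] at h1
  have h2 := covHess_apply G f y v (covGrad G f y)
  simp
  linarith

include hG hf in
theorem contDiffOn_covGrad : ContDiffOn ℝ ∞ (covGrad G f) Ω := fun x hx =>
  ((hG.contDiffAt_inverse hx).clm_apply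
    ((hG.contDiffAt_of_mem hf hx).fderiv_right (by simp))).contDiffWithinAt

include hG hf in
theorem contDiffOn_apply_covGrad :
    ContDiffOn ℝ ∞ (fun x => fderiv ℝ f x (covGrad G f x)) Ω := fun x hx =>
  (((hG.contDiffAt_of_mem hf hx).fderiv_right (by simp)).clm_apply
    ((hG.contDiffOn_covGrad hf).contDiffAt (hG.mem_nhds hx))).contDiffWithinAt

include hG hy hf in
theorem covHess_apply_covGrad (u v : E) :
    covHess G (fun x => fderiv ℝ f x (covGrad G f x)) y u v
      = 2 * (fderiv ℝ (covHess G f) y u v (covGrad G f y)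
          - covHess G f y (christoffel G y u v) (covGrad G f y)
          - covHess G f y v (christoffel G y u (covGrad G f y)))
        + 2 * covHess G f y v
          (fderiv ℝ (covGrad G f) y u + christoffel G y u (covGrad G f y)) := by
  have hT := (hG.contDiffAt_covHess hy (hG.contDiffAt_of_mem hf hy)).differentiableAt (by simp)
  have hV : DifferentiableAt ℝ (covGrad G f) y :=
    ((hG.contDiffOn_covGrad hf).contDiffAt (hG.mem_nhds hy)).differentiableAt (by simp)
  have hq : DifferentiableAt ℝ (fderiv ℝ (fun x => fderiv ℝ f x (covGrad G f x))) y :=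
    hG.differentiableAt_fderiv hy (hG.contDiffOn_apply_covGrad hf)
  have e : (fun x => fderiv ℝ (fun x => fderiv ℝ f x (covGrad G f x)) x v)
      =ᶠ[𝓝 y] fun x => 2 * covHess G f x v (covGrad G f x) := by
    filter_upwards [hG.mem_nhds hy] with x hx
    exact hG.fderiv_apply_covGrad hx hf v
  have h1 := DFunLike.congr_fun (e.fderiv_eq (𝕜 := ℝ)) u
  rw [fderiv_clm_apply hq (differentiableAt_const v), fderiv_const_mul
    (differentiableAt_apply₂ hT (differentiableAt_const v) hV),
    smul_apply, fderiv_apply₂ hT (differentiableAt_const v) hV] at h1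
  simp at h1
  rw [covHess_apply, h1, hG.fderiv_apply_covGrad hy hf]
  simp only [map_add]
  ring

variable {ι : Type*} [Fintype ι] [DecidableEq ι] {b : Module.Basis ι ℝ E}
  (hb : ∀ i j, G y (b i) (b j) = if i = j then 1 else 0)

include hG hy hb in
theorem covLap_eq_sum (f : E → ℝ) : covLap G f y = ∑ i, covHess G f y (b i) (b i) :=
  metricTrace_of_orthonormal (hG.nondeg y hy) (hG.symm y hy) hb (bilinToLin (covHess G f y))
    (fun _ _ => rfl)

include hG hy hb in
theorem sum_apply_smul (v : E) : ∑ i, G y (b i) v • b i = v :=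
  sum_repr_of_orthonormal (hG.nondeg y hy) hb v

include hG hy hb in
/-- The trace commutes with covariant differentiation. -/
theorem fderiv_metricTrace {T : E → E →L[ℝ] E →L[ℝ] ℝ} (hT : DifferentiableAt ℝ T y)
    (hTs : ∀ v w, T y v w = T y w v) (v : E) :
    fderiv ℝ (fun x => metricTrace (G x) (fun a c => T x a c)) y v
      = ∑ i, (fderiv ℝ T y v (b i) (b i) - 2 * T y (b i) (christoffel G y v (b i))) := by
  have e : (fun x => metricTrace (G x) (fun a c => T x a c)) =ᶠ[𝓝 y]
      fun x => ∑ i, T x (b i) ((G x).inverse (coordCovector b i)) := by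
    filter_upwards [hG.mem_nhds hy] with x hx
    exact metricTrace_eq_sum (hG.nondeg x hx) (hG.symm x hx) b (bilinToLin (T x))
  have hd : ∀ i, DifferentiableAt ℝ (fun x => (G x).inverse (coordCovector b i)) y := fun i =>
    hG.differentiableAt_inverse_apply hy (differentiableAt_const _)
  have hbi : ∀ i, (G y).inverse (coordCovector b i) = b i := by
    intro i
    rw [← inverse_apply_of_nondeg (hG.nondeg y hy) (b i)]
    congr 1
    ext w
    simp only [coordCovector, LinearMap.coe_toContinuousLinearMap', Module.Basis.coord_apply]
    rw [coord_of_orthogonal (hG.nondeg y hy) (fun i j hij => by rw [hb, if_neg hij]), hb,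
      if_pos rfl, div_one]
  have hder : ∀ i, T y (b i) (fderiv ℝ (fun x => (G x).inverse (coordCovector b i)) y v)
      = -(∑ k, G y (b i) (christoffel G y v (b k)) * T y (b i) (b k))
        - T y (b i) (christoffel G y v (b i)) := by
    intro i
    have h1 := hG.apply_fderiv_inverse hy (differentiableAt_const (coordCovector b i)) v
    rw [hbi i] at h1
    have h2 : ∀ w, coordCovector b i w = G y (b i) w := by
      intro w
      have h := apply_inverse_of_nondeg (hG.nondeg y hy) (coordCovector b i)
      rw [hbi i] at h
      rw [h]
    have h3 := hG.sum_apply_smul hy hb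
      (fderiv ℝ (fun x => (G x).inverse (coordCovector b i)) y v + christoffel G y v (b i))
    have h4 := congrArg (T y (b i)) h3
    rw [map_add, map_sum] at h4
    rw [eq_sub_iff_add_eq, ← h4, ← Finset.sum_neg_distrib]
    refine Finset.sum_congr rfl fun k _ => ?_
    rw [hG.symm y hy (b k), h1, h2, map_smul, smul_eq_mul]
    simp
  have hder2 : ∑ i, ∑ k, G y (b i) (christoffel G y v (b k)) * T y (b i) (b k)
      = ∑ k, T y (b k) (christoffel G y v (b k)) := by
    rw [Finset.sum_comm]
    refine Finset.sum_congr rfl fun k _ => ?_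
    conv_rhs => rw [← hG.sum_apply_smul hy hb (christoffel G y v (b k)), map_sum]
    refine Finset.sum_congr rfl fun i _ => ?_
    rw [map_smul, smul_eq_mul, hTs]
  have hTd : ∀ i, DifferentiableAt ℝ
      (fun x => T x (b i) ((G x).inverse (coordCovector b i))) y := fun i =>
    differentiableAt_apply₂ hT (differentiableAt_const _) (hd i)
  rw [e.fderiv_eq, fderiv_fun_sum (fun i _ => hTd i), ContinuousLinearMap.sum_apply]
  have h5 : ∀ i, fderiv ℝ (fun x => T x (b i) ((G x).inverse (coordCovector b i))) y v
      = fderiv ℝ T y v (b i) (b i)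
        - ∑ k, G y (b i) (christoffel G y v (b k)) * T y (b i) (b k)
        - T y (b i) (christoffel G y v (b i)) := by
    intro i
    rw [fderiv_apply₂ hT (differentiableAt_const _) (hd i), hbi, hder]
    simp
    ring
  simp only [h5, Finset.sum_sub_distrib, hder2, ← Finset.mul_sum]
  ring

include hG hy hf hb in
/-- The Bochner formula. -/
theorem bochner :
    covLap G (fun x => fderiv ℝ f x (covGrad G f x)) y
      = 2 * ∑ i, ∑ j, covHess G f y (b i) (b j) ^ 2
        + 2 * fderiv ℝ (covLap G f) y (covGrad G f y)
        + 2 * ricci G y (covGrad G f y) (covGrad G f y) := by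
  have hfy := hG.contDiffAt_of_mem hf hy
  have hT := (hG.contDiffAt_covHess hy hfy).differentiableAt (by simp)
  have hsym := hG.covHess_symm hy hfy
  set V := covGrad G f y with hV
  have h1 : fderiv ℝ (covLap G f) y V = _ := hG.fderiv_metricTrace hy hb hT hsym V
  have hTsym : ∀ u v w, fderiv ℝ (covHess G f) y u v w = fderiv ℝ (covHess G f) y u w v := by
    intro u v w
    rw [← fderiv_fixed₂ hT, ← fderiv_fixed₂ hT]
    refine congrArg (fun L : E →L[ℝ] ℝ => L u) (Filter.EventuallyEq.fderiv_eq ?_)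
    filter_upwards [hG.mem_nhds hy] with x hx
    exact hG.covHess_symm hx (hG.contDiffAt_of_mem hf hx) v w
  have hR : ricci G y V V = ∑ i, fderiv ℝ f y (riemann G y V (b i) (b i)) := by
    rw [ricci_of_orthogonal hG hy (fun i j hij => by rw [hb, if_neg hij])]
    refine Finset.sum_congr rfl fun i _ => ?_
    rw [hb, if_pos rfl, div_one, hG.riemann_skew hy, ← hG.apply_covGrad hy, ← hV,
      hG.symm y hy V]
    simp only [riemann, ← neg_sub (fderiv ℝ (christoffel G) y (b i) V (b i))]
    rw [← ContinuousLinearMap.neg_apply, ← map_neg]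
    congr 2
    abel
  rw [hG.covLap_eq_sum hy hb, h1, hR, Finset.mul_sum, Finset.mul_sum, Finset.mul_sum,
    ← Finset.sum_add_distrib, ← Finset.sum_add_distrib]
  refine Finset.sum_congr rfl fun i _ => ?_
  rw [hG.covHess_apply_covGrad hy hf, ← hV]
  have h2 : covHess G f y (b i) (fderiv ℝ (covGrad G f) y (b i) + christoffel G y (b i) V)
      = ∑ j, covHess G f y (b i) (b j) ^ 2 := by
    rw [← hG.sum_apply_smul hy hb (fderiv ℝ (covGrad G f) y (b i) + christoffel G y (b i) V),
      map_sum]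
    refine Finset.sum_congr rfl fun j _ => ?_
    rw [hG.symm y hy (b j), hG.apply_fderiv_covGrad hy hf, map_smul, smul_eq_mul, sq]
  have h3 := hG.ricci_identity hy hfy (b i) V (b i)
  have h4 : riemann G y V (b i) (b i) = - riemann G y (b i) V (b i) := by
    simp only [riemann]; abel
  rw [h2, h4, map_neg, ← h3, hTsym (b i) (b i) V, hG.christoffel_symm hy V (b i),
    hsym (christoffel G y (b i) V) (b i), hsym _ V,
    hsym (b i) (christoffel G y (b i) V)]
  ring

end IsMetricOn

end Bochner

/-! ### Static metrics in coordinates -/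

section StaticCoordinates

variable {X : Type*} [NormedAddCommGroup X] [NormedSpace ℝ X]

/-- The metric `-N² dt² + g` on `ℝ × X`. -/
noncomputable def staticCoord (g : X → X →L[ℝ] X →L[ℝ] ℝ) (N : X → ℝ) (z : ℝ × X) :
    (ℝ × X) →L[ℝ] (ℝ × X) →L[ℝ] ℝ :=
  (-(N z.2) ^ 2) • ContinuousLinearMap.bilinearComp (ContinuousLinearMap.mul ℝ ℝ)
      (ContinuousLinearMap.fst ℝ ℝ X) (ContinuousLinearMap.fst ℝ ℝ X)
    + ContinuousLinearMap.bilinearComp (g z.2)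
      (ContinuousLinearMap.snd ℝ ℝ X) (ContinuousLinearMap.snd ℝ ℝ X)

theorem staticCoord_apply (g : X → X →L[ℝ] X →L[ℝ] ℝ) (N : X → ℝ) (z v w : ℝ × X) :
    staticCoord g N z v w = -(N z.2) ^ 2 * (v.1 * w.1) + g z.2 v.2 w.2 := by
  simp [staticCoord, ContinuousLinearMap.bilinearComp_apply]

variable {g : X → X →L[ℝ] X →L[ℝ] ℝ} {N : X → ℝ} {Ω : Set X}

/-- Coordinate data of a static metric: a Riemannian metric and a positive lapse function. -/
structure IsStaticOn (g : X → X →L[ℝ] X →L[ℝ] ℝ) (N : X → ℝ) (Ω : Set X) : Prop where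
  metric : IsMetricOn g Ω
  pos : ∀ y ∈ Ω, ∀ v, v ≠ 0 → 0 < g y v v
  lapse_smooth : ContDiffOn ℝ ∞ N Ω
  lapse_pos : ∀ y ∈ Ω, 0 < N y

/-- Bilinear pull-back under the projection to the second factor, as a continuous linear map. -/
noncomputable def pullSnd (X : Type*) [NormedAddCommGroup X] [NormedSpace ℝ X] :
    (X →L[ℝ] X →L[ℝ] ℝ) →L[ℝ] (ℝ × X) →L[ℝ] (ℝ × X) →L[ℝ] ℝ :=
  ((ContinuousLinearMap.compL ℝ (ℝ × X) X ((ℝ × X) →L[ℝ] ℝ)).flip (ContinuousLinearMap.snd ℝ ℝ X)).comp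
    (ContinuousLinearMap.compL ℝ X (X →L[ℝ] ℝ) ((ℝ × X) →L[ℝ] ℝ)
      ((ContinuousLinearMap.compL ℝ (ℝ × X) X ℝ).flip (ContinuousLinearMap.snd ℝ ℝ X)))

namespace IsStaticOn

variable (h : IsStaticOn g N Ω)

include h in
theorem metric4 : IsMetricOn (staticCoord g N) (univ ×ˢ Ω) where
  isOpen := isOpen_univ.prod h.metric.isOpen
  smooth := by
    have h1 : ContDiffOn ℝ ∞ (fun z : ℝ × X => -(N z.2) ^ 2) (univ ×ˢ Ω) :=
      ((h.lapse_smooth.comp contDiffOn_snd fun z hz => hz.2).pow 2).neg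
    have h2 : ContDiffOn ℝ ∞ (fun z : ℝ × X => pullSnd X (g z.2)) (univ ×ˢ Ω) :=
      (pullSnd X).contDiff.comp_contDiffOn (h.metric.smooth.comp contDiffOn_snd fun z hz => hz.2)
    exact (h1.smul contDiffOn_const).add h2
  symm z hz v w := by
    rw [staticCoord_apply, staticCoord_apply, h.metric.symm z.2 hz.2, mul_comm v.1]
  nondeg z hz v hv := by
    have hN := (h.lapse_pos z.2 hz.2).ne'
    have h0 := hv (v.1, 0)
    have h1 := hv (0, v.2)
    simp only [staticCoord_apply, map_zero, add_zero, mul_zero, zero_add] at h0 h1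
    have hv1 : v.1 = 0 := by
      have : (N z.2) ^ 2 * (v.1 * v.1) = 0 := by linarith
      simpa [hN] using this
    have hv2 : v.2 = 0 := by
      by_contra hne
      exact (h.pos z.2 hz.2 v.2 hne).ne' h1
    exact Prod.ext hv1 hv2

include h in
theorem hasFDerivAt_lapse {z : ℝ × X} (hz : z.2 ∈ Ω) : DifferentiableAt ℝ N z.2 :=
  (h.lapse_smooth.contDiffAt (h.metric.mem_nhds hz)).differentiableAt (by simp)

include h in
theorem fderiv_staticCoord {z : ℝ × X} (hz : z.2 ∈ Ω) (u v w : ℝ × X) :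
    fderiv ℝ (staticCoord g N) z u v w
      = -2 * N z.2 * fderiv ℝ N z.2 u.2 * (v.1 * w.1) + fderiv ℝ g z.2 u.2 v.2 w.2 := by
  have hN := (h.hasFDerivAt_lapse hz).hasFDerivAt
  have hg := (h.metric.differentiableAt hz).hasFDerivAt
  have h1 : HasFDerivAt (fun x : ℝ × X => -(N x.2) ^ 2 * (v.1 * w.1) + g x.2 v.2 w.2) _ z :=
    (((hN.comp z hasFDerivAt_snd).pow 2).neg.mul_const (v.1 * w.1)).add
      (((hg.comp z hasFDerivAt_snd).clm_apply (hasFDerivAt_const v.2 z)).clm_apply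
        (hasFDerivAt_const w.2 z))
  rw [← fderiv_fixed₂ (h.metric4.differentiableAt ⟨mem_univ _, hz⟩)]
  simp only [staticCoord_apply]
  rw [h1.fderiv]
  simp
  ring

include h in
theorem christoffelLower_staticCoord {z : ℝ × X} (hz : z.2 ∈ Ω) (u v w : ℝ × X) :
    christoffelLower (staticCoord g N) z u v w
      = -N z.2 * (fderiv ℝ N z.2 u.2 * (v.1 * w.1) + fderiv ℝ N z.2 v.2 * (u.1 * w.1)
          - fderiv ℝ N z.2 w.2 * (u.1 * v.1)) + christoffelLower g z.2 u.2 v.2 w.2 := by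
  rw [christoffelLower_apply, christoffelLower_apply, h.fderiv_staticCoord hz,
    h.fderiv_staticCoord hz, h.fderiv_staticCoord hz]
  ring

variable [FiniteDimensional ℝ X]

include h in
theorem christoffel_staticCoord {z : ℝ × X} (hz : z.2 ∈ Ω) (u v : ℝ × X) :
    christoffel (staticCoord g N) z u v
      = ((fderiv ℝ N z.2 u.2 * v.1 + fderiv ℝ N z.2 v.2 * u.1) / N z.2,
          christoffel g z.2 u.2 v.2 + (u.1 * v.1 * N z.2) • covGrad g N z.2) := by
  have hz' : z ∈ (univ : Set ℝ) ×ˢ Ω := ⟨mem_univ _, hz⟩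
  refine h.metric4.eq_of_forall hz' fun w => ?_
  rw [h.metric4.christoffel_spec hz', h.christoffelLower_staticCoord hz, staticCoord_apply,
    map_add, add_apply, h.metric.christoffel_spec hz, map_smul, smul_apply,
    h.metric.apply_covGrad hz, smul_eq_mul]
  field_simp
  ring

include h in
theorem fderiv_christoffelLower_staticCoord {z : ℝ × X} (hz : z.2 ∈ Ω) (u v w a : ℝ × X) :
    fderiv ℝ (fun x => christoffelLower (staticCoord g N) x v w a) z u
      = -fderiv ℝ N z.2 u.2 * (fderiv ℝ N z.2 v.2 * (w.1 * a.1) + fderiv ℝ N z.2 w.2 * (v.1 * a.1)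
          - fderiv ℝ N z.2 a.2 * (v.1 * w.1))
        - N z.2 * (fderiv ℝ (fderiv ℝ N) z.2 u.2 v.2 * (w.1 * a.1)
          + fderiv ℝ (fderiv ℝ N) z.2 u.2 w.2 * (v.1 * a.1)
          - fderiv ℝ (fderiv ℝ N) z.2 u.2 a.2 * (v.1 * w.1))
        + fderiv ℝ (fun y => christoffelLower g y v.2 w.2 a.2) z.2 u.2 := by
  have hz' : z ∈ (univ : Set ℝ) ×ˢ Ω := ⟨mem_univ _, hz⟩
  have e : (fun x => christoffelLower (staticCoord g N) x v w a) =ᶠ[𝓝 z] fun x =>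
      -N x.2 * (fderiv ℝ N x.2 v.2 * (w.1 * a.1) + fderiv ℝ N x.2 w.2 * (v.1 * a.1)
          - fderiv ℝ N x.2 a.2 * (v.1 * w.1)) + christoffelLower g x.2 v.2 w.2 a.2 := by
    filter_upwards [h.metric4.mem_nhds hz'] with x hx
    exact h.christoffelLower_staticCoord hx.2 v w a
  have hN := (h.hasFDerivAt_lapse hz).hasFDerivAt.comp z hasFDerivAt_snd
  have hdN : ∀ c : X, HasFDerivAt (fun x : ℝ × X => fderiv ℝ N x.2 c) _ z := fun c =>
    ((h.metric.differentiableAt_fderiv hz h.lapse_smooth).hasFDerivAt.comp z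
      hasFDerivAt_snd).clm_apply (hasFDerivAt_const c z)
  have hΓ : HasFDerivAt (fun x : ℝ × X => christoffelLower g x.2 v.2 w.2 a.2) _ z :=
    ((((h.metric.differentiableAt_christoffelLower hz).hasFDerivAt.comp z
      hasFDerivAt_snd).clm_apply (hasFDerivAt_const v.2 z)).clm_apply
        (hasFDerivAt_const w.2 z)).clm_apply (hasFDerivAt_const a.2 z)
  have hΓ' : HasFDerivAt (fun y : X => christoffelLower g y v.2 w.2 a.2) _ z.2 :=
    (((h.metric.differentiableAt_christoffelLower hz).hasFDerivAt.clm_apply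
      (hasFDerivAt_const v.2 z.2)).clm_apply
        (hasFDerivAt_const w.2 z.2)).clm_apply (hasFDerivAt_const a.2 z.2)
  have h1 : HasFDerivAt (fun x : ℝ × X =>
      -N x.2 * (fderiv ℝ N x.2 v.2 * (w.1 * a.1) + fderiv ℝ N x.2 w.2 * (v.1 * a.1)
          - fderiv ℝ N x.2 a.2 * (v.1 * w.1)) + christoffelLower g x.2 v.2 w.2 a.2) _ z :=
    (hN.neg.mul ((((hdN v.2).mul_const (w.1 * a.1)).add ((hdN w.2).mul_const (v.1 * a.1))).sub
      ((hdN a.2).mul_const (v.1 * w.1)))).add hΓ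
  rw [e.fderiv_eq, h1.fderiv, hΓ'.fderiv]
  simp
  ring

/-- The vectors `∂_t` and `(0, bᵢ)`. -/
noncomputable def staticBasis {ι : Type*} (b : Module.Basis ι ℝ X) :
    Module.Basis (Unit ⊕ ι) ℝ (ℝ × X) :=
  (Module.Basis.singleton Unit ℝ).prod b

omit [FiniteDimensional ℝ X] in
theorem staticBasis_inl {ι : Type*} (b : Module.Basis ι ℝ X) (u : Unit) :
    staticBasis b (Sum.inl u) = (1, 0) := by simp [staticBasis]

omit [FiniteDimensional ℝ X] in
theorem staticBasis_inr {ι : Type*} (b : Module.Basis ι ℝ X) (i : ι) :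
    staticBasis b (Sum.inr i) = (0, b i) := by simp [staticBasis]

section Frame

variable {ι : Type*} [Fintype ι] [DecidableEq ι] {b : Module.Basis ι ℝ X} {t : ℝ} {y : X}
  (hy : y ∈ Ω) (hb : ∀ i j, g y (b i) (b j) = if i = j then 1 else 0)

omit [FiniteDimensional ℝ X] [Fintype ι] in
include hb in
theorem staticBasis_orthogonal (i j : Unit ⊕ ι) (hij : i ≠ j) :
    staticCoord g N (t, y) (staticBasis b i) (staticBasis b j) = 0 := by
  rcases i with i | i <;> rcases j with j | j
  · exact absurd rfl hij
  · simp [staticBasis_inl, staticBasis_inr, staticCoord_apply]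
  · simp [staticBasis_inl, staticBasis_inr, staticCoord_apply]
  · have : i ≠ j := fun e => hij (by rw [e])
    simp [staticBasis_inr, staticCoord_apply, hb, this]

include h hy hb in
theorem metricTrace_staticCoord {T : ℝ × X → ℝ × X → ℝ}
    (T' : (ℝ × X) →ₗ[ℝ] (ℝ × X) →ₗ[ℝ] ℝ) (hT : ∀ v w, T v w = T' v w) :
    metricTrace (staticCoord g N (t, y)) T
      = -(T (1, 0) (1, 0) / N y ^ 2) + ∑ i, T (0, b i) (0, b i) := by
  have hz' : ((t, y) : ℝ × X) ∈ (univ : Set ℝ) ×ˢ Ω := ⟨mem_univ _, hy⟩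
  rw [metricTrace_of_orthogonal (h.metric4.nondeg _ hz') (h.metric4.symm _ hz')
    (staticBasis_orthogonal hb) T' hT]
  simp [staticBasis_inl, staticBasis_inr, staticCoord_apply, hb, div_neg]

include h hy hb in
theorem ricci_staticCoord_frame (v w : ℝ × X) :
    ricci (staticCoord g N) (t, y) v w
      = -(staticCoord g N (t, y) (riemann (staticCoord g N) (t, y) (1, 0) v w) (1, 0) / N y ^ 2)
        + ∑ i, staticCoord g N (t, y) (riemann (staticCoord g N) (t, y) (0, b i) v w) (0, b i) := by
  have hz' : ((t, y) : ℝ × X) ∈ (univ : Set ℝ) ×ˢ Ω := ⟨mem_univ _, hy⟩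
  rw [ricci_of_orthogonal h.metric4 hz' (staticBasis_orthogonal hb)]
  simp [staticBasis_inl, staticBasis_inr, staticCoord_apply, hb, div_neg]

include h hy hb in
theorem ricci_staticCoord_time :
    ricci (staticCoord g N) (t, y) (1, 0) (1, 0) = N y * covLap g N y := by
  have hz' : ((t, y) : ℝ × X) ∈ (univ : Set ℝ) ×ˢ Ω := ⟨mem_univ _, hy⟩
  have hN := (h.lapse_pos y hy).ne'
  rw [h.ricci_staticCoord_frame hy hb, h.metric.covLap_eq_sum hy hb, Finset.mul_sum]
  have h0 : staticCoord g N (t, y) (riemann (staticCoord g N) (t, y) (1, 0) (1, 0) (1, 0)) (1, 0)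
      = 0 := by
    have := h.metric4.riemann_skew hz' (1, 0) (1, 0) (1, 0) (1, 0)
    linarith
  rw [h0, zero_div, neg_zero, zero_add]
  refine Finset.sum_congr rfl fun i _ => ?_
  rw [h.metric4.riemann_lower hz', h.fderiv_christoffelLower_staticCoord hy,
    h.fderiv_christoffelLower_staticCoord hy, h.christoffel_staticCoord hy,
    h.christoffel_staticCoord hy, h.christoffel_staticCoord hy, h.christoffel_staticCoord hy,
    covHess_apply]
  have h1 : g y (covGrad g N y) (christoffel g y (b i) (b i))
      = fderiv ℝ N y (christoffel g y (b i) (b i)) := h.metric.apply_covGrad hy N _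
  simp [staticCoord_apply, h1]
  field_simp
  ring

include h hy in
theorem riemann_staticCoord_space (u v w a : X) :
    staticCoord g N (t, y) (riemann (staticCoord g N) (t, y) (0, u) (0, v) (0, w)) (0, a)
      = g y (riemann g y u v w) a := by
  have hz' : ((t, y) : ℝ × X) ∈ (univ : Set ℝ) ×ˢ Ω := ⟨mem_univ _, hy⟩
  rw [h.metric4.riemann_lower hz', h.metric.riemann_lower hy,
    h.fderiv_christoffelLower_staticCoord hy,
    h.fderiv_christoffelLower_staticCoord hy, h.christoffel_staticCoord hy,
    h.christoffel_staticCoord hy, h.christoffel_staticCoord hy, h.christoffel_staticCoord hy]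
  simp [staticCoord_apply]

include h hy hb in
theorem ricci_staticCoord_space (v w : X) :
    ricci (staticCoord g N) (t, y) (0, v) (0, w) = ricci g y v w - covHess g N y v w / N y := by
  have hz' : ((t, y) : ℝ × X) ∈ (univ : Set ℝ) ×ˢ Ω := ⟨mem_univ _, hy⟩
  have hN := (h.lapse_pos y hy).ne'
  rw [h.ricci_staticCoord_frame hy hb,
    ricci_of_orthogonal h.metric hy (fun i j hij => by rw [hb, if_neg hij])]
  have h0 : staticCoord g N (t, y) (riemann (staticCoord g N) (t, y) (1, 0) (0, v) (0, w)) (1, 0)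
      = N y * covHess g N y v w := by
    rw [h.metric4.riemann_lower hz', h.fderiv_christoffelLower_staticCoord hy,
      h.fderiv_christoffelLower_staticCoord hy, h.christoffel_staticCoord hy,
      h.christoffel_staticCoord hy, h.christoffel_staticCoord hy, h.christoffel_staticCoord hy,
      covHess_apply]
    have h1 : g y (christoffel g y v w) (covGrad g N y)
        = fderiv ℝ N y (christoffel g y v w) := by
      rw [h.metric.symm y hy]
      exact h.metric.apply_covGrad hy N _
    simp [staticCoord_apply, h1]
    field_simp
    ring
  rw [h0]
  simp only [h.riemann_staticCoord_space hy, hb, if_true, div_one]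
  field_simp
  ring

end Frame

end IsStaticOn

end StaticCoordinates

/-! ### Purely electric Maxwell fields on static metrics in coordinates -/

section ElectricField

variable {X : Type*} [NormedAddCommGroup X] [NormedSpace ℝ X] [FiniteDimensional ℝ X]
  {g : X → X →L[ℝ] X →L[ℝ] ℝ} {N : X → ℝ} {Ω : Set X}

theorem alternating_skew {V : Type*} [NormedAddCommGroup V] [NormedSpace ℝ V]
    {F : V →L[ℝ] V →L[ℝ] ℝ} (hF : ∀ v, F v v = 0) (v w : V) : F v w = -F w v := by
  have h := hF (v + w)
  simp only [map_add, add_apply, hF] at h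
  linarith

/-- A two-form without magnetic part is determined by its electric field `e = -F(∂_t, ·)`. -/
theorem electric_form_eq {F : (ℝ × X) →L[ℝ] (ℝ × X) →L[ℝ] ℝ} (hF : ∀ v, F v v = 0)
    (hS : ∀ a c : X, F (0, a) (0, c) = 0) (v w : ℝ × X) :
    F v w = w.1 * -F (1, 0) (0, v.2) - v.1 * -F (1, 0) (0, w.2) := by
  have hv : ∀ v : ℝ × X, v = v.1 • ((1, 0) : ℝ × X) + (0, v.2) := fun v => by ext <;> simp
  conv_lhs => rw [hv v, hv w]
  simp only [map_add, add_apply, map_smul, smul_apply, hF, hS, smul_eq_mul]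
  rw [alternating_skew hF (0, v.2) (1, 0)]
  ring

namespace IsStaticOn

variable (h : IsStaticOn g N Ω)

/-- The trace of `(a, c) ↦ F(v, a) F(w, c)` is bilinear. -/
noncomputable def mulLin {V : Type*} [AddCommGroup V] [Module ℝ V] (a c : V →ₗ[ℝ] ℝ) :
    V →ₗ[ℝ] V →ₗ[ℝ] ℝ :=
  (LinearMap.mul ℝ ℝ).compl₁₂ a c

variable {ι : Type*} [Fintype ι] [DecidableEq ι] {b : Module.Basis ι ℝ X} {t : ℝ} {y : X}
  (hy : y ∈ Ω) (hb : ∀ i j, g y (b i) (b j) = if i = j then 1 else 0)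
  {F : (ℝ × X) →L[ℝ] (ℝ × X) →L[ℝ] ℝ} {e : X →L[ℝ] ℝ}
  (hF : ∀ v w, F v w = w.1 * e v.2 - v.1 * e w.2)

include h hy hb hF in
theorem formSquare_electric (v w : ℝ × X) :
    formSquare (staticCoord g N (t, y)) F v w
      = -(e v.2 * e w.2 / N y ^ 2) + v.1 * w.1 * ∑ i, e (b i) ^ 2 := by
  rw [formSquare, h.metricTrace_staticCoord (t := t) (T := fun a b => F v a * F w b) hy hb
    (mulLin (F v : (ℝ × X) →ₗ[ℝ] ℝ) (F w)) (fun _ _ => rfl)]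
  simp only [hF, map_zero, mul_zero, sub_zero, one_mul, zero_mul, zero_sub, neg_mul_neg,
    Finset.mul_sum]
  congr 1
  refine Finset.sum_congr rfl fun i _ => ?_
  ring

include h hy hb hF in
theorem trace_formSquare_electric :
    metricTrace (staticCoord g N (t, y)) (formSquare (staticCoord g N (t, y)) F)
      = -(2 * (∑ i, e (b i) ^ 2) / N y ^ 2) := by
  let e' : (ℝ × X) →ₗ[ℝ] ℝ := (e : X →ₗ[ℝ] ℝ) ∘ₗ LinearMap.snd ℝ ℝ X
  rw [h.metricTrace_staticCoord hy hb
    (-((N y ^ 2)⁻¹ • mulLin e' e')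
      + (∑ i, e (b i) ^ 2) • mulLin (LinearMap.fst ℝ ℝ X) (LinearMap.fst ℝ ℝ X))]
  · simp only [h.formSquare_electric hy hb hF]
    simp only [map_zero, mul_zero, zero_div, neg_zero, zero_add, mul_one, one_mul, zero_mul,
      add_zero, Finset.sum_neg_distrib, ← Finset.sum_div]
    simp only [← sq]
    ring
  · intro v w
    rw [h.formSquare_electric hy hb hF]
    simp [mulLin, e']
    ring

include h hy hb hF in
theorem maxwellSource_electric (v w : ℝ × X) :
    maxwellSource (staticCoord g N (t, y)) F v w
      = 2 * (-(e v.2 * e w.2 / N y ^ 2) + v.1 * w.1 * ∑ i, e (b i) ^ 2)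
        + staticCoord g N (t, y) v w * ((∑ i, e (b i) ^ 2) / N y ^ 2) := by
  rw [maxwellSource, h.formSquare_electric hy hb hF, h.trace_formSquare_electric hy hb hF]
  ring

variable (hEin : ∀ v w, ricci (staticCoord g N) (t, y) v w
    = maxwellSource (staticCoord g N (t, y)) F v w)

include h hy hb hF hEin in
theorem lapse_equation : N y * covLap g N y = ∑ i, e (b i) ^ 2 := by
  have hN := (h.lapse_pos y hy).ne'
  rw [← h.ricci_staticCoord_time (t := t) hy hb, hEin, h.maxwellSource_electric hy hb hF,
    staticCoord_apply]
  simp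
  field_simp
  ring

include h hy hb hF hEin in
theorem ricci_equation (v w : X) :
    ricci g y v w = covHess g N y v w / N y - 2 * (e v * e w) / N y ^ 2
      + (∑ i, e (b i) ^ 2) / N y ^ 2 * g y v w := by
  have h1 := h.ricci_staticCoord_space (t := t) hy hb v w
  rw [hEin, h.maxwellSource_electric hy hb hF, staticCoord_apply] at h1
  simp at h1
  linear_combination -h1

end IsStaticOn

end ElectricField

section Hodge

theorem basis4_zero : basis4 0 = (1, 0) := by
  rw [basis4, Module.Basis.reindex_apply]
  have : (finSumFinEquiv (m := 1) (n := 3)).symm 0 = Sum.inl (0 : Fin 1) := rfl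
  rw [this]
  simp

theorem basis4_succ (i : Fin 3) : basis4 i.succ = (0, EuclideanSpace.single i 1) := by
  rw [basis4, Module.Basis.reindex_apply]
  have : (finSumFinEquiv (m := 1) (n := 3)).symm i.succ = Sum.inr i := by
    fin_cases i <;> rfl
  rw [this]
  simp

theorem coordCovector_basis4_zero (v : ℝ × E3) : coordCovector basis4 0 v = v.1 := by
  have : (finSumFinEquiv (m := 1) (n := 3)).symm 0 = Sum.inl (0 : Fin 1) := rfl
  simp [coordCovector, basis4, this]

theorem coordCovector_basis4_succ (i : Fin 3) (v : ℝ × E3) :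
    coordCovector basis4 i.succ v = v.2 i := by
  have : (finSumFinEquiv (m := 1) (n := 3)).symm i.succ = Sum.inr i := by
    fin_cases i <;> rfl
  simp [coordCovector, basis4, this]

/-- The `i`-th Cartesian coordinate as a covector. -/
noncomputable def coordE3 (i : Fin 3) : E3 →L[ℝ] ℝ := EuclideanSpace.proj i

variable {g : E3 → E3 →L[ℝ] E3 →L[ℝ] ℝ} {N : E3 → ℝ} {Ω : Set E3} (h : IsStaticOn g N Ω)
  {z : ℝ × E3} (hz : z.2 ∈ Ω)

include h hz in
theorem sharp_basis4_zero :
    (staticCoord g N z).inverse (coordCovector basis4 0) = (-(N z.2 ^ 2)⁻¹, 0) := by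
  have hz' : z ∈ (univ : Set ℝ) ×ˢ Ω := ⟨mem_univ _, hz⟩
  have hN := (h.lapse_pos z.2 hz).ne'
  rw [← inverse_apply_of_nondeg (h.metric4.nondeg _ hz') (-(N z.2 ^ 2)⁻¹, 0)]
  congr 1
  ext v
  · simp [coordCovector_basis4_zero, staticCoord_apply]
    field_simp
  · simp [coordCovector_basis4_zero, staticCoord_apply]

include h hz in
theorem sharp_basis4_succ (i : Fin 3) :
    (staticCoord g N z).inverse (coordCovector basis4 i.succ)
      = (0, (g z.2).inverse (coordE3 i)) := by
  have hz' : z ∈ (univ : Set ℝ) ×ˢ Ω := ⟨mem_univ _, hz⟩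
  rw [← inverse_apply_of_nondeg (h.metric4.nondeg _ hz') (0, (g z.2).inverse (coordE3 i))]
  congr 1
  refine ContinuousLinearMap.ext fun v => ?_
  rw [coordCovector_basis4_succ, staticCoord_apply, apply_inverse_of_nondeg (h.metric.nondeg _ hz)]
  simp [coordE3]

/-- The Gram determinant of the Cartesian frame. -/
noncomputable def gramDet (g : E3 → E3 →L[ℝ] E3 →L[ℝ] ℝ) (y : E3) : ℝ :=
  (Matrix.of fun i j : Fin 3 =>
    g y (EuclideanSpace.single i (1 : ℝ)) (EuclideanSpace.single j (1 : ℝ))).det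

theorem gramDet_static :
    (Matrix.of fun i j => staticCoord g N z (basis4 i) (basis4 j)).det
      = -(N z.2) ^ 2 * gramDet g z.2 := by
  rw [Matrix.det_succ_row_zero, Fin.sum_univ_succ]
  have h0 : ∀ j : Fin 3, staticCoord g N z (basis4 0) (basis4 j.succ) = 0 := by
    intro j
    simp [basis4_zero, basis4_succ, staticCoord_apply]
  have h1 : (Matrix.of fun i j => staticCoord g N z (basis4 i) (basis4 j)).submatrix Fin.succ
      (Fin.succAbove 0) = Matrix.of fun i j : Fin 3 =>
    g z.2 (EuclideanSpace.single i (1 : ℝ)) (EuclideanSpace.single j (1 : ℝ)) := by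
    ext i j
    simp [basis4_succ, staticCoord_apply]
  rw [h1]
  simp only [Matrix.of_apply, h0]
  simp [basis4_zero, staticCoord_apply, gramDet]

theorem det_basis4 (i j k l : Fin 4) :
    basis4.det ![basis4 i, basis4 j, basis4 k, basis4 l]
      = (Matrix.of fun r c : Fin 4 => if r = ![i, j, k, l] c then (1 : ℝ) else 0).det := by
  rw [Module.Basis.det_apply]
  congr 1
  ext r c
  rw [Module.Basis.toMatrix_apply, Matrix.of_apply]
  fin_cases c <;> simp [Finsupp.single_apply, eq_comm]

include h hz in
/-- A purely electric field has no spatial components. -/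
theorem spatial_eq_zero_of_electric {F : (ℝ × E3) →L[ℝ] (ℝ × E3) →L[ℝ] ℝ} (hF : ∀ v, F v v = 0)
    (hdet : gramDet g z.2 ≠ 0)
    (hel : ∀ w, hodgeStar basis4 (staticCoord g N z) F (1, 0) w = 0) (a c : E3) :
    F (0, a) (0, c) = 0 := by
  have hN := (h.lapse_pos z.2 hz).ne'
  set s : Fin 3 → E3 := fun i => (g z.2).inverse (coordE3 i) with hs
  have hD : Real.sqrt |(Matrix.of fun i j => staticCoord g N z (basis4 i) (basis4 j)).det| ≠ 0 := by
    rw [gramDet_static]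
    refine (Real.sqrt_pos.2 (abs_pos.2 ?_)).ne'
    exact mul_ne_zero (neg_ne_zero.2 (pow_ne_zero 2 hN)) hdet
  have key : ∀ i j : Fin 3, F (0, s i) (0, s j) = 0 := by
    have hsk : ∀ i j : Fin 3, F (0, s i) (0, s j) = -F (0, s j) (0, s i) :=
      fun i j => alternating_skew hF _ _
    have hw : ∀ k : Fin 3, ∑ i : Fin 3, ∑ j : Fin 3, F (0, s i) (0, s j) *
        (Matrix.of fun r c : Fin 4 => if r = ![i.succ, j.succ, 0, k.succ] c then (1 : ℝ)
          else 0).det = 0 := by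
      intro k
      have := hel (basis4 k.succ)
      rw [hodgeStar, ← basis4_zero] at this
      simp only [volumeFour, det_basis4] at this
      have hz0 : ∀ j, (Matrix.of fun r c : Fin 4 => if r = ![0, j, 0, k.succ] c then (1 : ℝ)
          else 0).det = 0 := fun j => Matrix.det_zero_of_column_eq (i := 0) (j := 2) (by decide)
            (fun r => rfl)
      have hz1 : ∀ j, (Matrix.of fun r c : Fin 4 => if r = ![j, 0, 0, k.succ] c then (1 : ℝ)
          else 0).det = 0 := fun j => Matrix.det_zero_of_column_eq (i := 1) (j := 2) (by decide)
            (fun r => rfl)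
      simp only [Fin.sum_univ_succ (n := 3), hz0, hz1, sharp_basis4_succ h hz, mul_zero, zero_add,
        add_zero, Finset.sum_const_zero] at this
      have h2 : ∑ i : Fin 3, ∑ j : Fin 3, F (0, s i) (0, s j) *
        (Matrix.of fun r c : Fin 4 => if r = ![i.succ, j.succ, 0, k.succ] c then (1 : ℝ)
          else 0).det * Real.sqrt |(Matrix.of fun i j =>
            staticCoord g N z (basis4 i) (basis4 j)).det| = 0 := by
        refine (mul_eq_zero.1 this).resolve_left (by norm_num) |>.symm.trans ?_ |>.symm
        refine Finset.sum_congr rfl fun i _ => Finset.sum_congr rfl fun j _ => ?_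
        ring
      simp only [← Finset.sum_mul] at h2
      exact (mul_eq_zero.1 h2).resolve_right hD
    have h22 : Fin.succAbove (2 : Fin (2 + 1 + 1)) (2 : Fin 3) = 3 := rfl
    have h0 := hw 0
    have h1 := hw 1
    have h2 := hw 2
    simp [Fin.sum_univ_succ, Matrix.det_succ_row_zero, hF, h22] at h0 h1 h2
    have e01 := hsk 0 1
    have e02 := hsk 0 2
    have e12 := hsk 1 2
    have k01 : F (0, s 0) (0, s 1) = 0 := by linarith
    have k02 : F (0, s 0) (0, s 2) = 0 := by linarith
    have k12 : F (0, s 1) (0, s 2) = 0 := by linarith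
    intro i j
    fin_cases i <;> fin_cases j <;> simp [hF, k01, k02, k12, hsk 1 0, hsk 2 0, hsk 2 1]
  have hexp : ∀ a : E3, ((0, a) : ℝ × E3)
      = ∑ i : Fin 3, g z.2 a (EuclideanSpace.single i 1) • ((0, s i) : ℝ × E3) := by
    intro a
    have h1 : g z.2 a = ∑ i : Fin 3, g z.2 a (EuclideanSpace.single i 1) • coordE3 i := by
      ext v
      conv_lhs => rw [← (EuclideanSpace.basisFun (Fin 3) ℝ).sum_repr v]
      simp [coordE3, mul_comm]
    have h2 : a = ∑ i : Fin 3, g z.2 a (EuclideanSpace.single i 1) • s i := by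
      conv_lhs => rw [← inverse_apply_of_nondeg (h.metric.nondeg _ hz) a, h1, map_sum]
      simp [hs]
    have h3 : ((0, a) : ℝ × E3) = ContinuousLinearMap.inr ℝ ℝ E3 a := rfl
    rw [h3, h2, map_sum, ← h2]
    simp
  rw [hexp a, hexp c]
  simp only [map_sum, map_smul, ContinuousLinearMap.sum_apply, smul_apply, key,
    smul_zero, Finset.sum_const_zero]

theorem coord_sharp (hg : IsMetricOn g Ω) {y : E3} (hy : y ∈ Ω) (f : E3 → ℝ) (i : Fin 3) :
    fderiv ℝ f y ((g y).inverse (coordE3 i)) = covGrad g f y i := by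
  rw [← hg.apply_covGrad hy, hg.symm y hy, apply_inverse_of_nondeg (hg.nondeg y hy)]
  rfl

include h hz in
/-- The Hodge dual of a purely electric field. -/
theorem hodgeStar_electric {F : (ℝ × E3) →L[ℝ] (ℝ × E3) →L[ℝ] ℝ} {f : E3 → ℝ}
    (hF : ∀ v w, F v w = w.1 * fderiv ℝ f z.2 v.2 - v.1 * fderiv ℝ f z.2 w.2)
    {i j k : Fin 3} (hijk : (i = 0 ∧ j = 1 ∧ k = 2) ∨ (i = 1 ∧ j = 2 ∧ k = 0) ∨
      (i = 2 ∧ j = 0 ∧ k = 1)) :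
    hodgeStar basis4 (staticCoord g N z) F (basis4 j.succ) (basis4 k.succ)
      = Real.sqrt |gramDet g z.2| / N z.2 * covGrad g f z.2 i := by
  have hN := h.lapse_pos z.2 hz
  have hsq : Real.sqrt |(Matrix.of fun i j => staticCoord g N z (basis4 i) (basis4 j)).det|
      = N z.2 * Real.sqrt |gramDet g z.2| := by
    rw [gramDet_static, abs_mul, abs_neg, abs_of_pos (pow_pos hN 2), Real.sqrt_mul (by positivity),
      Real.sqrt_sq hN.le]
  have h22 : Fin.succAbove (2 : Fin (2 + 1 + 1)) (2 : Fin 3) = 3 := rfl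
  have h12 : Fin.succAbove (1 : Fin (2 + 1 + 1)) (2 : Fin 3) = 3 := rfl
  have h00 : F (-(N z.2 ^ 2)⁻¹, 0) (-(N z.2 ^ 2)⁻¹, 0) = 0 := by rw [hF]; ring
  have h0 : ∀ i, F (-(N z.2 ^ 2)⁻¹, 0) (0, (g z.2).inverse (coordE3 i))
      = (N z.2 ^ 2)⁻¹ * covGrad g f z.2 i := by
    intro i
    rw [hF, coord_sharp h.metric hz]
    simp
  have h1 : ∀ i, F (0, (g z.2).inverse (coordE3 i)) (-(N z.2 ^ 2)⁻¹, 0)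
      = -((N z.2 ^ 2)⁻¹ * covGrad g f z.2 i) := by
    intro i
    rw [hF, coord_sharp h.metric hz]
    simp
  have h2 : ∀ i j, F (0, (g z.2).inverse (coordE3 i)) (0, (g z.2).inverse (coordE3 j)) = 0 := by
    intro i j
    rw [hF]
    simp
  rw [hodgeStar]
  simp only [volumeFour, det_basis4, hsq, Fin.sum_univ_succ (n := 3), sharp_basis4_succ h hz,
    sharp_basis4_zero h hz, h0, h1, h2, h00]
  rcases hijk with ⟨rfl, rfl, rfl⟩ | ⟨rfl, rfl, rfl⟩ | ⟨rfl, rfl, rfl⟩ <;>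
  · simp [Fin.sum_univ_succ, Matrix.det_succ_row_zero, h22, h12]
    field_simp
    ring

theorem det_lie_identity (M P : Matrix (Fin 3) (Fin 3) ℝ) (hM : ∀ i j, M i j = M j i) :
    let D := fun i j => ∑ k, (P i k * M k j + P j k * M k i)
    D 0 0 * (M 1 1 * M 2 2 - M 1 2 * M 2 1) - D 0 1 * (M 1 0 * M 2 2 - M 1 2 * M 2 0)
      + D 0 2 * (M 1 0 * M 2 1 - M 1 1 * M 2 0)
      - D 1 0 * (M 0 1 * M 2 2 - M 0 2 * M 2 1) + D 1 1 * (M 0 0 * M 2 2 - M 0 2 * M 2 0)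
      - D 1 2 * (M 0 0 * M 2 1 - M 0 1 * M 2 0)
      + D 2 0 * (M 0 1 * M 1 2 - M 0 2 * M 1 1) - D 2 1 * (M 0 0 * M 1 2 - M 0 2 * M 1 0)
      + D 2 2 * (M 0 0 * M 1 1 - M 0 1 * M 1 0)
      = 2 * (∑ i, P i i) * M.det := by
  intro D
  simp only [D, Fin.sum_univ_three, Matrix.det_fin_three, hM 1 0, hM 2 0, hM 2 1]
  ring

/-- Derivative of the Gram determinant. -/
theorem fderiv_gramDet (hg : IsMetricOn g Ω) {y : E3} (hy : y ∈ Ω) (v : E3) :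
    DifferentiableAt ℝ (gramDet g) y ∧ fderiv ℝ (gramDet g) y v
      = 2 * (∑ i : Fin 3, christoffel g y v (EuclideanSpace.single i 1) i) * gramDet g y := by
  let m : Fin 3 → Fin 3 → E3 → ℝ := fun i j y =>
    g y (EuclideanSpace.single i (1 : ℝ)) (EuclideanSpace.single j (1 : ℝ))
  have hm : ∀ i j, HasFDerivAt (m i j) (((fderiv ℝ g y).flip
      (EuclideanSpace.single i (1 : ℝ))).flip (EuclideanSpace.single j (1 : ℝ))) y := by
    intro i j
    have := ((hg.differentiableAt hy).hasFDerivAt.clm_apply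
      (hasFDerivAt_const (EuclideanSpace.single i (1 : ℝ)) y)).clm_apply
      (hasFDerivAt_const (EuclideanSpace.single j (1 : ℝ)) y)
    refine this.congr_fderiv ?_
    ext x
    simp
  have hdet : gramDet g = fun y => m 0 0 y * m 1 1 y * m 2 2 y - m 0 0 y * m 1 2 y * m 2 1 y
      - m 0 1 y * m 1 0 y * m 2 2 y + m 0 1 y * m 1 2 y * m 2 0 y
      + m 0 2 y * m 1 0 y * m 2 1 y - m 0 2 y * m 1 1 y * m 2 0 y := by
    ext y
    rw [gramDet, Matrix.det_fin_three]
    rfl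
  have hd := ((((((hm 0 0).mul (hm 1 1)).mul (hm 2 2)).sub (((hm 0 0).mul (hm 1 2)).mul
    (hm 2 1))).sub (((hm 0 1).mul (hm 1 0)).mul (hm 2 2))).add
    (((hm 0 1).mul (hm 1 2)).mul (hm 2 0))).add
    (((hm 0 2).mul (hm 1 0)).mul (hm 2 1)) |>.sub (((hm 0 2).mul (hm 1 1)).mul (hm 2 0))
  refine ⟨by rw [hdet]; exact hd.differentiableAt, ?_⟩
  have hexp : ∀ a w : E3, g y a w = ∑ k : Fin 3, a k * g y (EuclideanSpace.single k 1) w := by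
    intro a w
    conv_lhs => rw [← (EuclideanSpace.basisFun (Fin 3) ℝ).sum_repr a]
    simp
  have hder : ∀ i j, fderiv ℝ g y v (EuclideanSpace.single i (1 : ℝ)) (EuclideanSpace.single j 1)
      = ∑ k, (christoffel g y v (EuclideanSpace.single i 1) k * m k j y
        + christoffel g y v (EuclideanSpace.single j 1) k * m k i y) := by
    intro i j
    rw [hg.fderiv_eq hy, hexp, hexp, Finset.sum_add_distrib]
  have key := det_lie_identity (Matrix.of fun i j => m i j y)
    (Matrix.of fun i k => christoffel g y v (EuclideanSpace.single i 1) k)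
    (fun i j => hg.symm y hy _ _)
  simp only [Matrix.of_apply, ← hder] at key
  have hd' := hd.fderiv
  simp only [Pi.mul_def, Pi.sub_def, Pi.add_def] at hd'
  rw [gramDet, ← key, hdet, hd']
  simp
  ring

theorem trace_eq_sum_coord (A : E3 →ₗ[ℝ] E3) :
    LinearMap.trace ℝ E3 A = ∑ i : Fin 3, A (EuclideanSpace.single i 1) i := by
  rw [LinearMap.trace_eq_matrix_trace ℝ (EuclideanSpace.basisFun (Fin 3) ℝ).toBasis, Matrix.trace]
  refine Finset.sum_congr rfl fun i _ => ?_
  rw [Matrix.diag_apply, LinearMap.toMatrix_apply]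
  simp

include h hz in
/-- The Maxwell equation `d ⋆F = 0` for the potential of a purely electric field. -/
theorem potential_equation {F : ℝ × E3 → (ℝ × E3) →L[ℝ] (ℝ × E3) →L[ℝ] ℝ} {f : E3 → ℝ}
    {G : ℝ × E3 → (ℝ × E3) →L[ℝ] (ℝ × E3) →L[ℝ] ℝ}
    (hf : ContDiffOn ℝ ∞ f Ω) (hdet : gramDet g z.2 ≠ 0)
    (hG : ∀ x ∈ (univ : Set ℝ) ×ˢ Ω, G x = staticCoord g N x)
    (hF : ∀ x ∈ (univ : Set ℝ) ×ˢ Ω, ∀ v w,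
      F x v w = w.1 * fderiv ℝ f x.2 v.2 - v.1 * fderiv ℝ f x.2 w.2)
    (hcl : ∀ u v w, extDerivTwo (fun y => hodgeStar basis4 (G y) (F y)) z u v w = 0) :
    covLap g f z.2 = fderiv ℝ f z.2 (covGrad g N z.2) / N z.2 := by
  have hz' : z ∈ (univ : Set ℝ) ×ˢ Ω := ⟨mem_univ _, hz⟩
  have hN := (h.lapse_pos z.2 hz).ne'
  set ρ : E3 → ℝ := fun y => Real.sqrt |gramDet g y| / N y with hρ
  have hV : DifferentiableAt ℝ (covGrad g f) z.2 :=
    ((h.metric.contDiffOn_covGrad hf).contDiffAt (h.metric.mem_nhds hz)).differentiableAt (by simp)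
  obtain ⟨hgd, hgd'⟩ := fderiv_gramDet h.metric hz (covGrad g f z.2)
  set τ := ∑ i : Fin 3, christoffel g z.2 (covGrad g f z.2) (EuclideanSpace.single i 1) i with hτ
  have habs : ∃ L : E3 →L[ℝ] ℝ, HasFDerivAt (fun y => Real.sqrt |gramDet g y|) L z.2 ∧
      L (covGrad g f z.2) = Real.sqrt |gramDet g z.2| * τ := by
    have hpos : 0 < |gramDet g z.2| := abs_pos.2 hdet
    have h1 : HasDerivAt (fun x : ℝ => Real.sqrt |x|) _ (gramDet g z.2) :=
      (hasDerivAt_abs hdet).sqrt hpos.ne'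
    refine ⟨_, h1.comp_hasFDerivAt z.2 hgd.hasFDerivAt, ?_⟩
    simp only [smul_apply, smul_eq_mul, hgd']
    have h2 : (SignType.sign (gramDet g z.2) : ℝ) * gramDet g z.2 = |gramDet g z.2| :=
      sign_mul_self _
    have h3 := Real.mul_self_sqrt hpos.le
    field_simp
    linear_combination (τ) * h2 - τ * h3
  obtain ⟨L, hL, hLV⟩ := habs
  have hNd := (h.hasFDerivAt_lapse hz).hasFDerivAt
  have hρd : HasFDerivAt ρ (Real.sqrt |gramDet g z.2| • -(N z.2 ^ 2)⁻¹ • fderiv ℝ N z.2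
      + (N z.2)⁻¹ • L) z.2 :=
    (hL.mul ((hasDerivAt_inv hN).comp_hasFDerivAt z.2 hNd)).congr_of_eventuallyEq
      (Eventually.of_forall fun x => div_eq_mul_inv _ _)
  have hρV : fderiv ℝ ρ z.2 (covGrad g f z.2)
      = ρ z.2 * (τ - fderiv ℝ N z.2 (covGrad g f z.2) / N z.2) := by
    rw [hρd.fderiv]
    simp [hLV, hρ]
    field_simp
    ring
  have hVi : ∀ i : Fin 3, DifferentiableAt ℝ (fun y => covGrad g f y i) z.2 := fun i =>
    (coordE3 i).differentiableAt.comp z.2 hV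
  have hVi' : ∀ (i : Fin 3) u, fderiv ℝ (fun y => covGrad g f y i) z.2 u
      = fderiv ℝ (covGrad g f) z.2 u i := by
    intro i u
    have : HasFDerivAt (fun y => covGrad g f y i) _ z.2 :=
      (coordE3 i).hasFDerivAt.comp z.2 hV.hasFDerivAt
    rw [this.fderiv]
    rfl
  have key : ∀ i j k : Fin 3, ((i = 0 ∧ j = 1 ∧ k = 2) ∨ (i = 1 ∧ j = 2 ∧ k = 0) ∨
      (i = 2 ∧ j = 0 ∧ k = 1)) →
      fderiv ℝ (fun x => hodgeStar basis4 (G x) (F x) (basis4 j.succ) (basis4 k.succ)) z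
        (basis4 i.succ)
      = fderiv ℝ ρ z.2 (EuclideanSpace.single i 1) * covGrad g f z.2 i
        + ρ z.2 * fderiv ℝ (covGrad g f) z.2 (EuclideanSpace.single i 1) i := by
    intro i j k hijk
    have e : (fun x => hodgeStar basis4 (G x) (F x) (basis4 j.succ) (basis4 k.succ)) =ᶠ[𝓝 z]
        fun x => ρ x.2 * covGrad g f x.2 i := by
      filter_upwards [h.metric4.mem_nhds hz'] with x hx
      rw [hG x hx]
      exact hodgeStar_electric h hx.2 (hF x hx) hijk
    have h1 : HasFDerivAt (fun x : ℝ × E3 => ρ x.2 * covGrad g f x.2 i) _ z :=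
      (hρd.differentiableAt.hasFDerivAt.comp z hasFDerivAt_snd).mul
        ((hVi i).hasFDerivAt.comp z hasFDerivAt_snd)
    rw [e.fderiv_eq, h1.fderiv, basis4_succ]
    simp [hVi']
    ring
  have h1 := hcl (basis4 (0 : Fin 3).succ) (basis4 (1 : Fin 3).succ) (basis4 (2 : Fin 3).succ)
  rw [extDerivTwo, key 0 1 2 (by simp), key 1 2 0 (by simp), key 2 0 1 (by simp)] at h1
  have hρV2 : fderiv ℝ ρ z.2 (covGrad g f z.2)
      = ∑ i : Fin 3, fderiv ℝ ρ z.2 (EuclideanSpace.single i 1) * covGrad g f z.2 i := by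
    conv_lhs => rw [← (EuclideanSpace.basisFun (Fin 3) ℝ).sum_repr (covGrad g f z.2)]
    simp [mul_comm]
  obtain ⟨b, hb, -⟩ := exists_orthonormal_basis (B := g z.2) (by simp) (h.metric.symm _ hz)
    (h.pos _ hz) 0
  let A : E3 →ₗ[ℝ] E3 := (fderiv ℝ (covGrad g f) z.2 + (christoffel g z.2) (covGrad g f z.2) :
    E3 →L[ℝ] E3)
  have hA : covLap g f z.2 = LinearMap.trace ℝ E3 A := by
    rw [h.metric.covLap_eq_sum hz hb,
      trace_of_orthogonal (h.metric.nondeg _ hz) (fun i j hij => by rw [hb, if_neg hij])]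
    refine Finset.sum_congr rfl fun i _ => ?_
    rw [hb, if_pos rfl, div_one, h.metric.symm _ hz, ← h.metric.apply_fderiv_covGrad hz hf,
      h.metric.christoffel_symm hz]
    rfl
  have hA2 : LinearMap.trace ℝ E3 A
      = ∑ i : Fin 3, fderiv ℝ (covGrad g f) z.2 (EuclideanSpace.single i 1) i + τ := by
    rw [trace_eq_sum_coord, hτ, ← Finset.sum_add_distrib]
    rfl
  have hρ0 : ρ z.2 ≠ 0 := div_ne_zero (Real.sqrt_pos.2 (abs_pos.2 hdet)).ne' hN
  have hsw : fderiv ℝ N z.2 (covGrad g f z.2) = fderiv ℝ f z.2 (covGrad g N z.2) := by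
    rw [← h.metric.apply_covGrad hz, ← h.metric.apply_covGrad hz, h.metric.symm _ hz]
  rw [hρV2] at hρV
  rw [Fin.sum_univ_three] at hρV hA2
  rw [hA, hA2, ← hsw]
  refine mul_left_cancel₀ hρ0 ?_
  linear_combination h1 - hρV

end Hodge

/-! ### Charts -/

section Charts

variable {E : Type*} [NormedAddCommGroup E] [NormedSpace ℝ E]
  {H : Type*} [TopologicalSpace H] {I : ModelWithCorners ℝ E H} [I.Boundaryless]
  {L : Type*} [TopologicalSpace L] [ChartedSpace H L]

/-- The derivative of the inverse of the preferred chart at `x`, in the model space. -/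
noncomputable def chartInv (I : ModelWithCorners ℝ E H) {L : Type*} [TopologicalSpace L]
    [ChartedSpace H L] (x : L) (y : E) : E →L[ℝ] E :=
  mfderiv 𝓘(ℝ, E) I (extChartAt I x).symm y

/-- The change between the preferred charts at `x₀` and at `x₁`. -/
noncomputable def chartChange (I : ModelWithCorners ℝ E H) {L : Type*} [TopologicalSpace L]
    [ChartedSpace H L] (x₀ x₁ : L) (y : E) : E :=
  extChartAt I x₁ ((extChartAt I x₀).symm y)

theorem inChart_apply (T : BilinField I L) (x : L) (y v w : E) :
    inChart I T x y v w
      = T ((extChartAt I x).symm y) (chartInv I x y v) (chartInv I x y w) := rfl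

theorem bilinField_congr (T : BilinField I L) {x x' : L} (h : x = x') (v w : E) :
    (T x : E →L[ℝ] E →L[ℝ] ℝ) v w = (T x' : E →L[ℝ] E →L[ℝ] ℝ) v w := by
  subst h
  rfl

theorem eventually_mem_target {x : L} {y : E} (hy : y ∈ (extChartAt I x).target) :
    (extChartAt I x).target ∈ 𝓝 y :=
  (isOpen_extChartAt_target x).mem_nhds hy

section

variable [IsManifold I 1 L]

theorem mdifferentiableAt_extChartAt_symm {x : L} {y : E} (hy : y ∈ (extChartAt I x).target) :
    MDifferentiableAt 𝓘(ℝ, E) I (extChartAt I x).symm y := by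
  have := mdifferentiableWithinAt_extChartAt_symm (I := I) hy
  rwa [I.range_eq_univ, mdifferentiableWithinAt_univ] at this

theorem chartInv_self (x : L) : chartInv I x (extChartAt I x x) = ContinuousLinearMap.id ℝ E := by
  have := mfderivWithin_range_extChartAt_symm (I := I) (x := x)
  rw [I.range_eq_univ, mfderivWithin_univ] at this
  exact this

theorem inChart_self (T : BilinField I L) (x : L) (v w : E) :
    inChart I T x (extChartAt I x x) v w = (T x : E →L[ℝ] E →L[ℝ] ℝ) v w := by
  rw [inChart_apply, chartInv_self]
  exact bilinField_congr T (extChartAt_to_inv x) v w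

theorem chartInv_bijective {x : L} {y : E} (hy : y ∈ (extChartAt I x).target) :
    Function.Bijective (chartInv I x y) := by
  have h := isInvertible_mfderivWithin_extChartAt_symm (I := I) hy
  rw [I.range_eq_univ, mfderivWithin_univ] at h
  obtain ⟨e, he⟩ := h
  have : (chartInv I x y : E → E) = e := by
    rw [chartInv, ← he]
    rfl
  rw [this]
  exact e.bijective

/-- The points at which a change of charts is defined. -/
theorem isOpen_chartChange_source (x₀ x₁ : L) :
    IsOpen ((extChartAt I x₀).target ∩ (extChartAt I x₀).symm ⁻¹' (extChartAt I x₁).source) :=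
  (continuousOn_extChartAt_symm x₀).isOpen_inter_preimage (isOpen_extChartAt_target x₀)
    (isOpen_extChartAt_source x₁)

theorem chartChange_mem_target {x₀ x₁ : L} {y : E}
    (h1 : (extChartAt I x₀).symm y ∈ (extChartAt I x₁).source) :
    chartChange I x₀ x₁ y ∈ (extChartAt I x₁).target :=
  (extChartAt I x₁).map_source h1

theorem symm_chartChange {x₀ x₁ : L} {y : E}
    (h1 : (extChartAt I x₀).symm y ∈ (extChartAt I x₁).source) :
    (extChartAt I x₁).symm (chartChange I x₀ x₁ y) = (extChartAt I x₀).symm y :=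
  (extChartAt I x₁).left_inv h1

theorem differentiableAt_chartChange {x₀ x₁ : L} {y : E} (hy : y ∈ (extChartAt I x₀).target)
    (h1 : (extChartAt I x₀).symm y ∈ (extChartAt I x₁).source) :
    DifferentiableAt ℝ (chartChange I x₀ x₁) y := by
  rw [← mdifferentiableAt_iff_differentiableAt]
  refine MDifferentiableAt.comp y (mdifferentiableAt_extChartAt ?_)
    (mdifferentiableAt_extChartAt_symm hy)
  rwa [← extChartAt_source I]

theorem chartInv_chartChange {x₀ x₁ : L} {y : E} (hy : y ∈ (extChartAt I x₀).target)
    (h1 : (extChartAt I x₀).symm y ∈ (extChartAt I x₁).source) (v : E) :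
    chartInv I x₁ (chartChange I x₀ x₁ y) (fderiv ℝ (chartChange I x₀ x₁) y v)
      = chartInv I x₀ y v := by
  have e : (extChartAt I x₀).symm =ᶠ[𝓝 y]
      (extChartAt I x₁).symm ∘ chartChange I x₀ x₁ := by
    filter_upwards [(isOpen_chartChange_source x₀ x₁).mem_nhds ⟨hy, h1⟩] with z hz
    exact (symm_chartChange hz.2).symm
  have hd := (differentiableAt_chartChange hy h1).hasFDerivAt.hasMFDerivAt
  have hs := (mdifferentiableAt_extChartAt_symm (chartChange_mem_target h1)).hasMFDerivAt
  have hc := HasMFDerivAt.comp y hs hd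
  have h2 := (hc.congr_of_eventuallyEq e).mfderiv
  have h3 : chartInv I x₀ y = (chartInv I x₁ (chartChange I x₀ x₁ y)).comp
      (fderiv ℝ (chartChange I x₀ x₁) y) := h2
  rw [h3]
  rfl

theorem inChart_chartChange (T : BilinField I L) {x₀ x₁ : L} {y : E}
    (hy : y ∈ (extChartAt I x₀).target)
    (h1 : (extChartAt I x₀).symm y ∈ (extChartAt I x₁).source) (v w : E) :
    inChart I T x₀ y v w = inChart I T x₁ (chartChange I x₀ x₁ y)
      (fderiv ℝ (chartChange I x₀ x₁) y v) (fderiv ℝ (chartChange I x₀ x₁) y w) := by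
  rw [inChart_apply, inChart_apply, chartInv_chartChange hy h1, chartInv_chartChange hy h1]
  exact bilinField_congr T (symm_chartChange h1).symm _ _

theorem fderiv_chartChange_self {x₀ : L} {y : E} (hy : y ∈ (extChartAt I x₀).target) (v : E) :
    fderiv ℝ (chartChange I x₀ ((extChartAt I x₀).symm y)) y v = chartInv I x₀ y v := by
  rw [← chartInv_chartChange hy (mem_extChartAt_source _), chartChange, chartInv_self]
  rfl

theorem fderiv_chartChange_bijective {x₀ x₁ : L} {y : E} (hy : y ∈ (extChartAt I x₀).target)
    (h1 : (extChartAt I x₀).symm y ∈ (extChartAt I x₁).source) :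
    Function.Bijective (fderiv ℝ (chartChange I x₀ x₁) y) := by
  have h := chartInv_bijective (I := I) hy
  have h' := chartInv_bijective (I := I) (chartChange_mem_target h1)
  have e : (chartInv I x₁ (chartChange I x₀ x₁ y)) ∘ (fderiv ℝ (chartChange I x₀ x₁) y)
      = chartInv I x₀ y := funext fun v => chartInv_chartChange hy h1 v
  rw [← e] at h
  exact ⟨h.1.of_comp, fun w => by
    obtain ⟨v, hv⟩ := h.2 (chartInv I x₁ (chartChange I x₀ x₁ y) w)
    exact ⟨v, h'.1 hv⟩⟩

/-- The differential of a map in the preferred chart. -/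
theorem fderiv_comp_symm {V : Type*} [NormedAddCommGroup V] [NormedSpace ℝ V] {u : L → V} {x : L}
    {y : E} (hy : y ∈ (extChartAt I x).target)
    {A : E →L[ℝ] V} (hu : HasMFDerivAt I 𝓘(ℝ, V) u ((extChartAt I x).symm y) A) :
    HasFDerivAt (u ∘ (extChartAt I x).symm) (A.comp (chartInv I x y)) y := by
  exact (HasMFDerivAt.comp y hu (mdifferentiableAt_extChartAt_symm hy).hasMFDerivAt).hasFDerivAt

end

section Smooth

variable [IsManifold I ∞ L]

theorem contDiffOn_chartChange (x₀ x₁ : L) :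
    ContDiffOn ℝ ∞ (chartChange I x₀ x₁)
      ((extChartAt I x₀).target ∩ (extChartAt I x₀).symm ⁻¹' (extChartAt I x₁).source) := by
  rw [← contMDiffOn_iff_contDiffOn]
  refine (contMDiffOn_extChartAt (x := x₁)).comp
    ((contMDiffOn_extChartAt_symm x₀).mono inter_subset_left) ?_
  intro y hy
  rw [← extChartAt_source I]
  exact hy.2

variable [FiniteDimensional ℝ E] {G : BilinField I L} (hG : SmoothBilin I G)
  (hs : ∀ x (v w : TangentSpace I x), G x v w = G x w v)
  (hnd : ∀ x (v : TangentSpace I x), (∀ w, G x v w = 0) → v = 0)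

include hG hs hnd in
/-- A metric in the preferred chart. -/
theorem isMetricOn_inChart (x : L) : IsMetricOn (inChart I G x) (extChartAt I x).target where
  isOpen := isOpen_extChartAt_target x
  smooth := hG x
  symm y _ v w := by
    rw [inChart_apply, inChart_apply]
    exact hs ((extChartAt I x).symm y) _ _
  nondeg y hy v hv := by
    have : IsManifold I 1 L := IsManifold.of_le (n := ∞) (by norm_cast)
    obtain ⟨hi, hsur⟩ := chartInv_bijective (I := I) hy
    have h0 : chartInv I x y v = 0 := by
      refine hnd ((extChartAt I x).symm y) (chartInv I x y v) fun w => ?_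
      obtain ⟨w', hw'⟩ := hsur w
      have := hv w'
      rw [inChart_apply, hw'] at this
      exact this
    exact hi (h0.trans (map_zero _).symm)

include hG hs hnd in
theorem isMetricOn_inChart_inter (x₀ x₁ : L) : IsMetricOn (inChart I G x₀)
    ((extChartAt I x₀).target ∩ (extChartAt I x₀).symm ⁻¹' (extChartAt I x₁).source) :=
  have : IsManifold I 1 L := IsManifold.of_le (n := ∞) (by norm_cast)
  have h := isMetricOn_inChart hG hs hnd x₀
  { isOpen := isOpen_chartChange_source x₀ x₁
    smooth := h.smooth.mono inter_subset_left
    symm := fun y hy => h.symm y hy.1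
    nondeg := fun y hy => h.nondeg y hy.1 }

include hG hs hnd in
/-- The covariant Hessian is a tensor. -/
theorem covHess_chartChange {x₀ x₁ : L} {y : E} (hy : y ∈ (extChartAt I x₀).target)
    (h1 : (extChartAt I x₀).symm y ∈ (extChartAt I x₁).source) {u : L → ℝ}
    (hu : ContDiffAt ℝ ∞ (u ∘ (extChartAt I x₁).symm) (chartChange I x₀ x₁ y)) (v w : E) :
    covHess (inChart I G x₀) (u ∘ (extChartAt I x₀).symm) y v w
      = covHess (inChart I G x₁) (u ∘ (extChartAt I x₁).symm) (chartChange I x₀ x₁ y)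
        (fderiv ℝ (chartChange I x₀ x₁) y v) (fderiv ℝ (chartChange I x₀ x₁) y w) := by
  have : IsManifold I 1 L := IsManifold.of_le (n := ∞) (by norm_cast)
  rw [← covHess_comp_of_surjective (isMetricOn_inChart hG hs hnd x₁)
    (isMetricOn_inChart_inter hG hs hnd x₀ x₁) (contDiffOn_chartChange x₀ x₁)
    (fun z hz => chartChange_mem_target hz.2)
    (fun z hz v w => inChart_chartChange G hz.1 hz.2 v w) ⟨hy, h1⟩
    (fderiv_chartChange_bijective hy h1).2 hu]
  have e : (u ∘ (extChartAt I x₀).symm) =ᶠ[𝓝 y]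
      fun x => (u ∘ (extChartAt I x₁).symm) (chartChange I x₀ x₁ x) := by
    filter_upwards [(isOpen_chartChange_source x₀ x₁).mem_nhds ⟨hy, h1⟩] with z hz
    exact congrArg u (symm_chartChange hz.2).symm
  rw [covHess_apply, covHess_apply, e.fderiv_eq, (e.fderiv (𝕜 := ℝ)).fderiv_eq]

include hG hs hnd in
/-- Christoffel symbols under a change of charts. -/
theorem christoffel_chartChange {x₀ x₁ : L} {y : E} (hy : y ∈ (extChartAt I x₀).target)
    (h1 : (extChartAt I x₀).symm y ∈ (extChartAt I x₁).source) (v w : E) :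
    fderiv ℝ (fderiv ℝ (chartChange I x₀ x₁)) y v w
      + christoffel (inChart I G x₁) (chartChange I x₀ x₁ y)
        (fderiv ℝ (chartChange I x₀ x₁) y v) (fderiv ℝ (chartChange I x₀ x₁) y w)
      = fderiv ℝ (chartChange I x₀ x₁) y (christoffel (inChart I G x₀) y v w) := by
  have : IsManifold I 1 L := IsManifold.of_le (n := ∞) (by norm_cast)
  exact covAlong_eq_of_surjective (isMetricOn_inChart hG hs hnd x₁)
    (isMetricOn_inChart_inter hG hs hnd x₀ x₁) (contDiffOn_chartChange x₀ x₁)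
    (fun z hz => chartChange_mem_target hz.2)
    (fun z hz v w => inChart_chartChange G hz.1 hz.2 v w) ⟨hy, h1⟩
    (fderiv_chartChange_bijective hy h1).2 v w

end Smooth

end Charts

section SmoothMetric

variable {E : Type*} [NormedAddCommGroup E] [NormedSpace ℝ E]
  {H : Type*} [TopologicalSpace H] {I : ModelWithCorners ℝ E H} [I.Boundaryless]
  {L : Type*} [TopologicalSpace L] [ChartedSpace H L] [IsManifold I ∞ L]

/-- Coordinate vector fields are smooth. -/
theorem contMDiffOn_chartInv (x : L) (v : E) :
    ContMDiffOn 𝓘(ℝ, E) I.tangent ∞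
      (fun y => (⟨(extChartAt I x).symm y, chartInv I x y v⟩ : TangentBundle I L))
      (extChartAt I x).target := by
  have : IsManifold I 1 L := IsManifold.of_le (n := ∞) (by norm_cast)
  have h := (Bundle.Trivialization.contMDiffOn_symm (IB := I) (n := ∞)
    (trivializationAt E (TangentSpace I) x)).comp
    (((contMDiffOn_extChartAt_symm (I := I) (n := ∞) x)).prodMk
      (contMDiffOn_const (c := v) (I' := 𝓘(ℝ, E)))) (t := (trivializationAt E (TangentSpace I) x).target)
    (by
      intro y hy
      have := (extChartAt I x).map_target hy
      rw [extChartAt_source] at this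
      simpa using this)
  refine h.congr fun y hy => ?_
  have hy' := (extChartAt I x).map_target hy
  rw [extChartAt_source] at hy'
  have hb : (extChartAt I x).symm y ∈ (trivializationAt E (TangentSpace I) x).baseSet := by
    simpa using hy'
  have h2 := TangentBundle.symmL_trivializationAt (I := I) (𝕜 := ℝ) hy'
  rw [(extChartAt I x).right_inv hy, I.range_eq_univ, mfderivWithin_univ] at h2
  rw [Function.comp_apply, ← Bundle.Trivialization.mk_symm _ hb]
  have h3 := congrArg (fun A : E →L[ℝ] E => A v) h2
  have h4 : chartInv I x y v
      = (trivializationAt E (TangentSpace I) x).symm ((extChartAt I x).symm y) v := by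
    rw [← Bundle.Trivialization.symmL_apply (R := ℝ) _ hb]
    exact h3.symm
  rw [h4]

theorem smoothBilin_inner [FiniteDimensional ℝ E]
    (g : Bundle.ContMDiffRiemannianMetric I ∞ E (fun x : L => TangentSpace I x)) :
    SmoothBilin I (L := L) g.inner := by
  intro x
  have : IsManifold I 1 L := IsManifold.of_le (n := ∞) (by norm_cast)
  rw [contDiffOn_clm_apply]
  intro v
  rw [contDiffOn_clm_apply]
  intro w
  rw [← contMDiffOn_iff_contDiffOn]
  have h : ∀ y ∈ (extChartAt I x).target, ContMDiffWithinAt 𝓘(ℝ, E) (I.prod 𝓘(ℝ, ℝ)) ∞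
      (fun y => Bundle.TotalSpace.mk' ℝ (E := Bundle.Trivial L ℝ) ((extChartAt I x).symm y)
        (g.inner ((extChartAt I x).symm y) (chartInv I x y v) (chartInv I x y w)))
      (extChartAt I x).target y := by
    intro y hy
    apply ContMDiffWithinAt.clm_bundle_apply₂ (F₁ := E) (F₂ := E)
    · exact (g.contMDiff.contMDiffAt).comp_contMDiffWithinAt y
        ((contMDiffOn_extChartAt_symm (I := I) (n := ∞) x) y hy)
    · exact contMDiffOn_chartInv x v y hy
    · exact contMDiffOn_chartInv x w y hy
  intro y hy
  have := h y hy
  rw [Bundle.contMDiffWithinAt_totalSpace] at this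
  exact this.2

end SmoothMetric

section StaticCharts

variable {M : Type*} [TopologicalSpace M] [ChartedSpace E3 M]

theorem extChartAt_I4_apply (z p : ℝ × M) :
    extChartAt I4 z p = (p.1, extChartAt (𝓡 3) z.2 p.2) := by
  rw [extChartAt_prod]
  rfl

theorem extChartAt_I4_symm_apply (z : ℝ × M) (y : ℝ × E3) :
    (extChartAt I4 z).symm y = (y.1, (extChartAt (𝓡 3) z.2).symm y.2) := by
  rw [extChartAt_prod]
  rfl

theorem extChartAt_I4_target (z : ℝ × M) :
    (extChartAt I4 z).target = univ ×ˢ (extChartAt (𝓡 3) z.2).target := by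
  rw [extChartAt_prod, PartialEquiv.prod_target, extChartAt_model_space_eq_id]
  rfl

theorem extChartAt_I4_source (z : ℝ × M) :
    (extChartAt I4 z).source = univ ×ˢ (extChartAt (𝓡 3) z.2).source := by
  rw [extChartAt_prod, PartialEquiv.prod_source, extChartAt_model_space_eq_id]
  rfl

variable [IsManifold (𝓡 3) ∞ M]

theorem isManifold_one : IsManifold (𝓡 3) 1 M := IsManifold.of_le (n := ∞) (by norm_cast)

theorem chartInv_I4 {z : ℝ × M} {y : ℝ × E3} (hy : y.2 ∈ (extChartAt (𝓡 3) z.2).target)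
    (v : ℝ × E3) : chartInv I4 z y v = (v.1, chartInv (𝓡 3) z.2 y.2 v.2) := by
  have : IsManifold (𝓡 3) 1 M := isManifold_one
  have h1 : HasMFDerivAt 𝓘(ℝ, ℝ × E3) 𝓘(ℝ, ℝ) (fun y : ℝ × E3 => y.1) y
      (ContinuousLinearMap.fst ℝ ℝ E3) := hasFDerivAt_fst.hasMFDerivAt
  have h2 : HasMFDerivAt 𝓘(ℝ, ℝ × E3) 𝓘(ℝ, E3) (fun y : ℝ × E3 => y.2) y
      (ContinuousLinearMap.snd ℝ ℝ E3) := hasFDerivAt_snd.hasMFDerivAt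
  have h3 := HasMFDerivAt.comp y (mdifferentiableAt_extChartAt_symm hy).hasMFDerivAt h2
  have h4 := h1.prodMk h3
  have e : ((extChartAt I4 z).symm : ℝ × E3 → ℝ × M)
      = fun y => (y.1, ((extChartAt (𝓡 3) z.2).symm ∘ fun y : ℝ × E3 => y.2) y) :=
    funext fun y => extChartAt_I4_symm_apply z y
  have h5 : chartInv I4 z y = (ContinuousLinearMap.fst ℝ ℝ E3).prod
      ((chartInv (𝓡 3) z.2 y.2).comp (ContinuousLinearMap.snd ℝ ℝ E3)) := by
    rw [chartInv, e]
    exact h4.mfderiv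
  rw [h5]
  rfl

variable (g : RiemMetric3 M) (N : M → ℝ)

/-- The coordinate expression of the Riemannian metric in the preferred chart at `x`. -/
noncomputable abbrev chartMetric (x : M) : E3 → E3 →L[ℝ] E3 →L[ℝ] ℝ :=
  inChart (𝓡 3) (L := M) g.inner x

/-- The coordinate expression of a function in the preferred chart at `x`. -/
noncomputable abbrev chartFun (u : M → ℝ) (x : M) : E3 → ℝ := u ∘ (extChartAt (𝓡 3) x).symm

theorem staticMetric_apply (z : ℝ × M) (v w : ℝ × E3) :
    (staticMetric g N z : (ℝ × E3) →L[ℝ] (ℝ × E3) →L[ℝ] ℝ) v w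
      = -(N z.2) ^ 2 * (v.1 * w.1)
        + (g.inner z.2 : E3 →L[ℝ] E3 →L[ℝ] ℝ) v.2 w.2 := rfl

theorem inChart_staticMetric {z : ℝ × M} {y : ℝ × E3}
    (hy : y.2 ∈ (extChartAt (𝓡 3) z.2).target) :
    inChart I4 (staticMetric g N) z y
      = staticCoord (chartMetric g z.2) (chartFun N z.2) y := by
  refine ContinuousLinearMap.ext fun v => ContinuousLinearMap.ext fun w => ?_
  rw [inChart_apply, bilinField_congr (I := I4) _ (extChartAt_I4_symm_apply z y), chartInv_I4 hy,
    chartInv_I4 hy, staticCoord_apply, inChart_apply]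
  exact staticMetric_apply g N _ _ _

theorem chartMetric_self (x : M) (v w : E3) :
    chartMetric g x (extChartAt (𝓡 3) x x) v w = (g.inner x : E3 →L[ℝ] E3 →L[ℝ] ℝ) v w :=
  have : IsManifold (𝓡 3) 1 M := isManifold_one
  inChart_self _ _ _ _

theorem inner_nondeg (x : M) (v : TangentSpace (𝓡 3) x) (h : ∀ w, g.inner x v w = 0) : v = 0 := by
  by_contra hv
  exact (g.pos x v hv).ne' (h v)

theorem isMetricOn_chartMetric (x : M) :
    IsMetricOn (chartMetric g x) (extChartAt (𝓡 3) x).target :=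
  isMetricOn_inChart (smoothBilin_inner g) g.symm (inner_nondeg g) x

variable {N} (hN : ContMDiff (𝓡 3) 𝓘(ℝ, ℝ) ∞ N) (hpos : ∀ x, 0 < N x)

theorem contDiffOn_chartFun {u : M → ℝ} (hu : ContMDiff (𝓡 3) 𝓘(ℝ, ℝ) ∞ u) (x : M) :
    ContDiffOn ℝ ∞ (chartFun u x) (extChartAt (𝓡 3) x).target := by
  rw [← contMDiffOn_iff_contDiffOn]
  exact hu.comp_contMDiffOn (contMDiffOn_extChartAt_symm x)

include hN hpos in
theorem isStaticOn_chart (x : M) :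
    IsStaticOn (chartMetric g x) (chartFun N x) (extChartAt (𝓡 3) x).target where
  metric := isMetricOn_chartMetric g x
  pos y hy v hv := by
    have : IsManifold (𝓡 3) 1 M := isManifold_one
    rw [inChart_apply]
    refine g.pos ((extChartAt (𝓡 3) x).symm y) (chartInv (𝓡 3) x y v) fun h => hv ?_
    exact (chartInv_bijective hy).1 (h.trans (map_zero _).symm)
  lapse_smooth := contDiffOn_chartFun hN x
  lapse_pos y _ := hpos _

include hN hpos in
theorem staticMetric_symm (z : ℝ × M) (v w : TangentSpace I4 z) :
    staticMetric g N z v w = staticMetric g N z w v := by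
  have h1 := staticMetric_apply g N z v w
  have h2 := staticMetric_apply g N z w v
  have h3 : (g.inner z.2 : E3 →L[ℝ] E3 →L[ℝ] ℝ) (v : ℝ × E3).2 (w : ℝ × E3).2
    = (g.inner z.2 : E3 →L[ℝ] E3 →L[ℝ] ℝ) (w : ℝ × E3).2 (v : ℝ × E3).2 := g.symm z.2 _ _
  refine h1.trans (Eq.trans ?_ h2.symm)
  rw [h3]
  ring

include hN hpos in
theorem staticMetric_nondeg (z : ℝ × M) (v : TangentSpace I4 z)
    (h : ∀ w, staticMetric g N z v w = 0) : v = 0 := by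
  have key : ∀ v : ℝ × E3, (∀ w : ℝ × E3,
      (staticMetric g N z : (ℝ × E3) →L[ℝ] (ℝ × E3) →L[ℝ] ℝ) v w = 0) → v = 0 := by
    intro v h
    refine ((isStaticOn_chart g hN hpos z.2).metric4).nondeg (z.1, extChartAt (𝓡 3) z.2 z.2)
      ⟨mem_univ _, mem_extChartAt_target _⟩ v fun w => ?_
    rw [staticCoord_apply, chartMetric_self]
    simp only [Function.comp_apply, extChartAt_to_inv]
    exact (staticMetric_apply g N z v w).symm.trans (h w)
  exact key v h

include hN in
theorem smoothBilin_staticMetric (hpos : ∀ x, 0 < N x) : SmoothBilin I4 (staticMetric g N) := by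
  intro z
  rw [extChartAt_I4_target]
  refine ((isStaticOn_chart g hN hpos z.2).metric4).smooth.congr fun y hy => ?_
  exact inChart_staticMetric g N hy.2

end StaticCharts

/-! ### The static electric field -/

section Congr

variable {E : Type*} [NormedAddCommGroup E] [NormedSpace ℝ E]

theorem christoffel_congr {G G' : E → E →L[ℝ] E →L[ℝ] ℝ} {y : E} (h : G =ᶠ[𝓝 y] G') :
    christoffel G =ᶠ[𝓝 y] christoffel G' := by
  filter_upwards [h.eventually_nhds] with x hx
  have h1 : christoffelLower G x = christoffelLower G' x := by
    simp only [christoffelLower, Filter.EventuallyEq.fderiv_eq (𝕜 := ℝ) hx]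
  rw [christoffel, christoffel, h1, Filter.EventuallyEq.eq_of_nhds hx]

theorem riemann_congr {G G' : E → E →L[ℝ] E →L[ℝ] ℝ} {y : E} (h : G =ᶠ[𝓝 y] G') :
    riemann G y = riemann G' y := by
  have h1 := christoffel_congr h
  ext u v w
  rw [riemann, riemann, h1.fderiv_eq, h1.eq_of_nhds]

theorem ricci_congr [FiniteDimensional ℝ E] {G G' : E → E →L[ℝ] E →L[ℝ] ℝ} {y : E}
    (h : G =ᶠ[𝓝 y] G') : ricci G y = ricci G' y := by
  ext v w
  rw [ricci, ricci, riemann_congr h]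

theorem covHess_congr {G : E → E →L[ℝ] E →L[ℝ] ℝ} {f f' : E → ℝ} {y : E}
    (h : f =ᶠ[𝓝 y] f') : covHess G f y = covHess G f' y := by
  rw [covHess, covHess, h.fderiv_eq, (h.fderiv (𝕜 := ℝ)).fderiv_eq]

end Congr

theorem gramDet_ne_zero {g : E3 → E3 →L[ℝ] E3 →L[ℝ] ℝ} {y : E3}
    (hpos : ∀ v, v ≠ 0 → 0 < g y v v) : gramDet g y ≠ 0 := by
  intro h
  obtain ⟨v, hv, hv2⟩ := Matrix.exists_mulVec_eq_zero_iff.2 h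
  have h2 : ∀ i : Fin 3, g y (EuclideanSpace.single i 1) (WithLp.toLp 2 v) = 0 := by
    intro i
    have h3 := congrFun hv2 i
    have h4 : (WithLp.toLp 2 v : E3) = ∑ j, v j • EuclideanSpace.single j (1 : ℝ) := by
      conv_lhs => rw [← (EuclideanSpace.basisFun (Fin 3) ℝ).sum_repr (WithLp.toLp 2 v : E3)]
      simp
    rw [h4, map_sum]
    simpa [Matrix.mulVec, dotProduct, mul_comm] using h3
  refine (hpos (WithLp.toLp 2 v) (fun h0 => hv ?_)).ne' ?_
  · exact congrArg WithLp.ofLp h0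
  · have h4 : (WithLp.toLp 2 v : E3) = ∑ j, v j • EuclideanSpace.single j (1 : ℝ) := by
      conv_lhs => rw [← (EuclideanSpace.basisFun (Fin 3) ℝ).sum_repr (WithLp.toLp 2 v : E3)]
      simp
    have h5 := congrArg (fun u => g y u (WithLp.toLp 2 v)) h4
    simp only [map_sum, map_smul, ContinuousLinearMap.sum_apply, smul_apply,
      h2] at h5
    simpa using h5

theorem IsStaticOn.mono {X : Type*} [NormedAddCommGroup X] [NormedSpace ℝ X]
    {g : X → X →L[ℝ] X →L[ℝ] ℝ} {N : X → ℝ} {Ω Ω' : Set X} (h : IsStaticOn g N Ω)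
    (ho : IsOpen Ω') (hs : Ω' ⊆ Ω) : IsStaticOn g N Ω' where
  metric := ⟨ho, h.metric.smooth.mono hs, fun y hy => h.metric.symm y (hs hy),
    fun y hy => h.metric.nondeg y (hs hy)⟩
  pos y hy := h.pos y (hs hy)
  lapse_smooth := h.lapse_smooth.mono hs
  lapse_pos y hy := h.lapse_pos y (hs hy)

section Forms

variable {M : Type*} [TopologicalSpace M] [ChartedSpace E3 M] [IsManifold (𝓡 3) ∞ M]

/-- The coordinate expression of a one-form in the preferred chart at `x`. -/
noncomputable def chartForm (α : M → E3 →L[ℝ] ℝ) (x : M) (y : E3) : E3 →L[ℝ] ℝ :=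
  (α ((extChartAt (𝓡 3) x).symm y)).comp (chartInv (𝓡 3) x y)

/-- Smooth closed one-forms. -/
structure IsClosedForm (α : M → E3 →L[ℝ] ℝ) : Prop where
  smooth : ∀ x, ContDiffOn ℝ ∞ (chartForm α x) (extChartAt (𝓡 3) x).target
  closed : ∀ x, ∀ y ∈ (extChartAt (𝓡 3) x).target, ∀ v w,
    fderiv ℝ (chartForm α x) y v w = fderiv ℝ (chartForm α x) y w v

theorem isClosedForm_zero : IsClosedForm (0 : M → E3 →L[ℝ] ℝ) := by
  have h : ∀ x : M, chartForm (0 : M → E3 →L[ℝ] ℝ) x = fun _ => 0 := fun x => by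
    ext y v
    rfl
  refine ⟨fun x => ?_, fun x y _ v w => ?_⟩
  · rw [h]
    exact contDiffOn_const
  · rw [h]
    simp

/-- `ψ` is a potential of the one-form `α` near `x`. -/
def IsPotentialAt (α : M → E3 →L[ℝ] ℝ) (ψ : M → ℝ) (x : M) : Prop :=
  ∀ᶠ y in 𝓝 x, HasMFDerivAt (𝓡 3) 𝓘(ℝ, ℝ) ψ y (α y)

variable {α : M → E3 →L[ℝ] ℝ} {ψ p : M → ℝ} {x : M}

theorem IsPotentialAt.eventually (h : IsPotentialAt α ψ x) :
    ∀ᶠ y in 𝓝 x, IsPotentialAt α ψ y := Filter.Eventually.eventually_nhds h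

theorem IsPotentialAt.congr (h : IsPotentialAt α ψ x) (hp : p =ᶠ[𝓝 x] ψ) :
    IsPotentialAt α p x := by
  filter_upwards [h, hp.eventually_nhds] with y hy hy'
  exact hy.congr_of_eventuallyEq hy'

theorem IsPotentialAt.add_const (h : IsPotentialAt α ψ x) (c : ℝ) :
    IsPotentialAt α (fun y => ψ y + c) x := by
  filter_upwards [h] with y hy
  have := hy.add (hasMFDerivAt_const c y)
  have h0 : α y + (0 : E3 →L[ℝ] ℝ) = α y := add_zero _
  rw [← h0]
  exact this

theorem tendsto_extChartAt_symm {x : M} {y : E3} (hy : y ∈ (extChartAt (𝓡 3) x).target) :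
    Tendsto (extChartAt (𝓡 3) x).symm (𝓝 y) (𝓝 ((extChartAt (𝓡 3) x).symm y)) :=
  continuousAt_extChartAt_symm'' hy

theorem IsPotentialAt.chart {x₀ : M} {y : E3} (hy : y ∈ (extChartAt (𝓡 3) x₀).target)
    (h : IsPotentialAt α ψ ((extChartAt (𝓡 3) x₀).symm y)) :
    ∀ᶠ z in 𝓝 y, HasFDerivAt (chartFun ψ x₀) (chartForm α x₀ z) z := by
  have : IsManifold (𝓡 3) 1 M := isManifold_one
  filter_upwards [(tendsto_extChartAt_symm hy).eventually h, eventually_mem_target hy] with z hz hz'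
  exact fderiv_comp_symm hz' hz

theorem IsPotentialAt.contDiffAt_chart (hα : IsClosedForm α) {x₀ : M} {y : E3}
    (hy : y ∈ (extChartAt (𝓡 3) x₀).target)
    (h : IsPotentialAt α ψ ((extChartAt (𝓡 3) x₀).symm y)) :
    ContDiffAt ℝ ∞ (chartFun ψ x₀) y := by
  have h1 := (h.chart hy).and (eventually_mem_target hy)
  obtain ⟨V, hV, hVo, hyV⟩ := eventually_nhds_iff.1 h1
  have h2 : ContDiffOn ℝ ∞ (chartFun ψ x₀) V := by
    rw [contDiffOn_infty_iff_fderiv_of_isOpen hVo]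
    refine ⟨fun z hz => (hV z hz).1.differentiableAt.differentiableWithinAt, ?_⟩
    exact ((hα.smooth x₀).mono fun z hz => (hV z hz).2).congr fun z hz => (hV z hz).1.fderiv
  exact h2.contDiffAt (hVo.mem_nhds hyV)

/-- The Poincaré lemma. -/
theorem IsClosedForm.exists_potential (hα : IsClosedForm α) (x : M) :
    ∃ p, IsPotentialAt α p x := by
  have : IsManifold (𝓡 3) 1 M := isManifold_one
  obtain ⟨r, hr, hball⟩ := Metric.isOpen_iff.1 (isOpen_extChartAt_target (I := 𝓡 3) x) _
    (mem_extChartAt_target x)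
  obtain ⟨p, hp⟩ := (convex_ball (extChartAt (𝓡 3) x x) r).exists_forall_hasFDerivAt_of_fderiv_symmetric
    Metric.isOpen_ball (((hα.smooth x).mono hball).differentiableOn (by simp))
    (fun y hy v w => hα.closed x y (hball hy) v w)
  refine ⟨p ∘ extChartAt (𝓡 3) x, ?_⟩
  have h1 : ∀ᶠ x' in 𝓝 x, extChartAt (𝓡 3) x x' ∈ Metric.ball (extChartAt (𝓡 3) x x) r :=
    (continuousAt_extChartAt x).eventually (Metric.ball_mem_nhds _ hr)
  filter_upwards [h1, extChartAt_source_mem_nhds (I := 𝓡 3) x] with x' h1 h2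
  have h3 := hp _ h1
  have h4 : x' ∈ (chartAt E3 x).source := by rwa [extChartAt_source] at h2
  have h5 := HasMFDerivAt.comp x' h3.hasMFDerivAt
    (mdifferentiableAt_extChartAt (I := 𝓡 3) h4).hasMFDerivAt
  have h6 := mfderivWithin_extChartAt_symm_comp_mfderiv_extChartAt' (I := 𝓡 3) h2
  rw [(𝓡 3).range_eq_univ, mfderivWithin_univ] at h6
  have h7 : (chartForm α x (extChartAt (𝓡 3) x x')).comp
      (mfderiv (𝓡 3) 𝓘(ℝ, E3) (extChartAt (𝓡 3) x) x' : E3 →L[ℝ] E3) = α x' := by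
    refine ContinuousLinearMap.ext fun v => ?_
    have h8 := congrArg (fun A : E3 →L[ℝ] E3 => A v) h6
    have h9 : chartInv (𝓡 3) x (extChartAt (𝓡 3) x x')
      ((mfderiv (𝓡 3) 𝓘(ℝ, E3) (extChartAt (𝓡 3) x) x' : E3 →L[ℝ] E3) v) = v := h8
    change α ((extChartAt (𝓡 3) x).symm (extChartAt (𝓡 3) x x')) (chartInv (𝓡 3) x
      (extChartAt (𝓡 3) x x')
      ((mfderiv (𝓡 3) 𝓘(ℝ, E3) (extChartAt (𝓡 3) x) x' : E3 →L[ℝ] E3) v)) = α x' v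
    rw [h9, (extChartAt (𝓡 3) x).left_inv h2]
  rw [← h7]
  exact h5

theorem IsPotentialAt.eventually_eq_add_const (h : IsPotentialAt α ψ x)
    (hp : IsPotentialAt α p x) : ∃ c, ∀ᶠ y in 𝓝 x, ψ y = p y + c := by
  have h1 : IsPotentialAt α ψ ((extChartAt (𝓡 3) x).symm (extChartAt (𝓡 3) x x)) := by
    rwa [extChartAt_to_inv]
  have h2 : IsPotentialAt α p ((extChartAt (𝓡 3) x).symm (extChartAt (𝓡 3) x x)) := by
    rwa [extChartAt_to_inv]
  have h3 := (h1.chart (mem_extChartAt_target x)).and (h2.chart (mem_extChartAt_target x))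
  obtain ⟨r, hr, hball⟩ := Metric.eventually_nhds_iff_ball.1 h3
  have h4 : ∀ y ∈ Metric.ball (extChartAt (𝓡 3) x x) r,
      chartFun ψ x y - chartFun p x y
        = chartFun ψ x (extChartAt (𝓡 3) x x) - chartFun p x (extChartAt (𝓡 3) x x) := by
    intro y hy
    refine (convex_ball _ r).is_const_of_fderivWithin_eq_zero (𝕜 := ℝ)
      (f := fun y => chartFun ψ x y - chartFun p x y)
      (fun z hz => ((hball z hz).1.sub (hball z hz).2).differentiableAt.differentiableWithinAt)
      (fun z hz => ?_) hy (Metric.mem_ball_self hr)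
    rw [fderivWithin_of_isOpen Metric.isOpen_ball hz]
    have := ((hball z hz).1.sub (hball z hz).2).fderiv
    rw [sub_self] at this
    exact this
  refine ⟨chartFun ψ x (extChartAt (𝓡 3) x x) - chartFun p x (extChartAt (𝓡 3) x x), ?_⟩
  have h5 : ∀ᶠ x' in 𝓝 x, extChartAt (𝓡 3) x x' ∈ Metric.ball (extChartAt (𝓡 3) x x) r :=
    (continuousAt_extChartAt x).eventually (Metric.ball_mem_nhds _ hr)
  filter_upwards [h5, extChartAt_source_mem_nhds (I := 𝓡 3) x] with x' h6 h7
  have h8 := h4 _ h6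
  simp only [Function.comp_apply, (extChartAt (𝓡 3) x).left_inv h7] at h8 ⊢
  linarith

/-- Two potentials on a preconnected open set differ by a constant. -/
theorem exists_eq_add_const_of_isPreconnected {V : Set M} (hVo : IsOpen V) (hV : IsPreconnected V)
    (hψ : ∀ x ∈ V, IsPotentialAt α ψ x) (hp : ∀ x ∈ V, IsPotentialAt α p x) :
    ∃ c, ∀ x ∈ V, ψ x = p x + c := by
  rcases V.eq_empty_or_nonempty with rfl | ⟨x₀, hx₀⟩
  · exact ⟨0, by simp⟩
  refine ⟨ψ x₀ - p x₀, fun x hx => ?_⟩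
  have key : ∀ x ∈ V, ∀ᶠ y in 𝓝 x, ψ y - p y = ψ x - p x := by
    intro x hx
    obtain ⟨c, hc⟩ := (hψ x hx).eventually_eq_add_const (hp x hx)
    filter_upwards [hc] with y hy
    rw [hy, hc.self_of_nhds]
    ring
  have := hV.induction₂ (fun a b => ψ a - p a = ψ b - p b)
    (fun x hx => eventually_nhdsWithin_of_eventually_nhds ((key x hx).mono fun y hy => hy.symm))
    (fun a b c _ _ _ h1 h2 => h1.trans h2) (fun a b _ _ h => h.symm) hx hx₀
  linarith

end Forms

section ElectricForm

variable {M : Type*} [TopologicalSpace M] [ChartedSpace E3 M] [IsManifold (𝓡 3) ∞ M]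
  {g : RiemMetric3 M} {N : M → ℝ} {F : BilinField I4 (ℝ × M)}

/-- The electric one-form on the slice `t = 0`. -/
noncomputable def elecForm (F : BilinField I4 (ℝ × M)) (x : M) : E3 →L[ℝ] ℝ :=
  -((F (0, x) : (ℝ × E3) →L[ℝ] (ℝ × E3) →L[ℝ] ℝ) (1, 0)).comp (ContinuousLinearMap.inr ℝ ℝ E3)

theorem extChartAt_I4_congr (t t' : ℝ) (x : M) : extChartAt I4 (t, x) = extChartAt I4 (t', x) := by
  rw [extChartAt_prod, extChartAt_prod, extChartAt_model_space_eq_id, extChartAt_model_space_eq_id]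

theorem inChart_I4_congr (F : BilinField I4 (ℝ × M)) (t t' : ℝ) (x : M) :
    inChart I4 F (t, x) = inChart I4 F (t', x) := by
  have h1 : ∀ y, chartInv I4 (t, x) y = chartInv I4 (t', x) y := by
    intro y
    let D (e : PartialEquiv (ℝ × M) (ℝ × E3)) : (ℝ × E3) →L[ℝ] ℝ × E3 :=
      mfderiv 𝓘(ℝ, ℝ × E3) I4 e.symm y
    have h2 : D (extChartAt I4 (t, x)) = D (extChartAt I4 (t', x)) :=
      congrArg D (extChartAt_I4_congr t t' x)
    exact h2
  ext1 y
  refine ContinuousLinearMap.ext fun v => ContinuousLinearMap.ext fun w => ?_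
  rw [inChart_apply, inChart_apply, h1]
  exact bilinField_congr F (by rw [extChartAt_I4_congr t t' x]) _ _

theorem vectorInChart_timeField {z : ℝ × M} {y : ℝ × E3} (hy : y ∈ (extChartAt I4 z).target) :
    vectorInChart I4 timeField z y = (1, 0) := by
  have : IsManifold (𝓡 3) 1 M := isManifold_one
  have h6 := mfderiv_extChartAt_comp_mfderivWithin_extChartAt_symm (I := I4) hy
  rw [ModelWithCorners.range_eq_univ, mfderivWithin_univ] at h6
  have h8 : (mfderiv I4 𝓘(ℝ, ℝ × E3) (extChartAt I4 z) ((extChartAt I4 z).symm y) :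
      ℝ × E3 →L[ℝ] ℝ × E3) (chartInv I4 z y (1, 0)) = (1, 0) :=
    congrArg (fun A : ℝ × E3 →L[ℝ] ℝ × E3 => A (1, 0)) h6
  rw [extChartAt_I4_target] at hy
  rw [chartInv_I4 hy.2, map_zero] at h8
  exact h8

theorem extChartAt_I4_self (t : ℝ) (x : M) :
    extChartAt I4 (t, x) (t, x) = (t, extChartAt (𝓡 3) x x) := extChartAt_I4_apply _ _

theorem inChart_I4_self (F : BilinField I4 (ℝ × M)) (t : ℝ) (x : M) (v w : ℝ × E3) :
    inChart I4 F (0, x) (t, extChartAt (𝓡 3) x x) v w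
      = (F (t, x) : (ℝ × E3) →L[ℝ] (ℝ × E3) →L[ℝ] ℝ) v w := by
  have : IsManifold (𝓡 3) 1 M := isManifold_one
  rw [← inChart_self F (t, x), inChart_I4_congr F t 0, extChartAt_I4_self]

variable (h : IsStaticElectrovac g N F)

namespace IsStaticElectrovac

include h

theorem fderiv_inChart_time (t : ℝ) (x : M) (v w : ℝ × E3) :
    fderiv ℝ (inChart I4 F (0, x)) (t, extChartAt (𝓡 3) x x) (1, 0) v w = 0 := by
  have : IsManifold (𝓡 3) 1 M := isManifold_one
  have h1 := h.stationary (t, x) v w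
  have h2 : vectorInChart I4 timeField (t, x) =ᶠ[𝓝 (extChartAt I4 (t, x) (t, x))]
      fun _ => (1, 0) := by
    filter_upwards [eventually_mem_target (I := I4) (mem_extChartAt_target (t, x))] with y hy
    exact vectorInChart_timeField hy
  rw [lieDerivTwo, h2.fderiv_eq, h2.eq_of_nhds, inChart_I4_congr F t 0, extChartAt_I4_self] at h1
  simpa using h1

theorem mem_target_I4 (t : ℝ) (x : M) {y : E3} (hy : y ∈ (extChartAt (𝓡 3) x).target) :
    ((t, y) : ℝ × E3) ∈ (extChartAt I4 ((0, x) : ℝ × M)).target := by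
  rw [extChartAt_I4_target]
  exact ⟨mem_univ _, hy⟩

theorem contDiffAt_inChart (t : ℝ) (x : M) {y : E3} (hy : y ∈ (extChartAt (𝓡 3) x).target) :
    ContDiffAt ℝ ∞ (inChart I4 F (0, x)) (t, y) :=
  (h.F_smooth (0, x)).contDiffAt (eventually_mem_target (h.mem_target_I4 t x hy))

theorem field_stationary (t : ℝ) (x : M) (v w : ℝ × E3) :
    (F (t, x) : (ℝ × E3) →L[ℝ] (ℝ × E3) →L[ℝ] ℝ) v w
      = (F (0, x) : (ℝ × E3) →L[ℝ] (ℝ × E3) →L[ℝ] ℝ) v w := by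
  rw [← inChart_I4_self, ← inChart_I4_self F 0]
  have hd : ∀ s : ℝ, HasDerivAt
      (fun s => inChart I4 F (0, x) (s, extChartAt (𝓡 3) x x) v w) 0 s := by
    intro s
    have h1 := (h.contDiffAt_inChart s x (mem_extChartAt_target x)).differentiableAt
      infty_ne_zero
    have h2 : HasDerivAt (fun s : ℝ => ((s, extChartAt (𝓡 3) x x) : ℝ × E3)) (1, 0) s :=
      (hasDerivAt_id s).prodMk (hasDerivAt_const s _)
    have h3 := (differentiableAt_apply₂ h1 (differentiableAt_const v)
      (differentiableAt_const w)).hasFDerivAt.comp_hasDerivAt s h2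
    rw [fderiv_fixed₂ h1, h.fderiv_inChart_time] at h3
    exact h3
  exact is_const_of_deriv_eq_zero (fun s => (hd s).differentiableAt) (fun s => (hd s).deriv) t 0

theorem staticMetric_eq_staticCoord (t : ℝ) (x : M) :
    (staticMetric g N (t, x) : (ℝ × E3) →L[ℝ] (ℝ × E3) →L[ℝ] ℝ)
      = staticCoord (chartMetric g x) (chartFun N x) (t, extChartAt (𝓡 3) x x) := by
  refine ContinuousLinearMap.ext fun v => ContinuousLinearMap.ext fun w => ?_
  refine (staticMetric_apply g N _ v w).trans ?_
  refine Eq.trans ?_ (staticCoord_apply _ _ _ _ _).symm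
  rw [chartMetric_self]
  simp only [Function.comp_apply, extChartAt_to_inv]

end IsStaticElectrovac

end ElectricForm

section FieldEquations

variable {M : Type*} [TopologicalSpace M] [ChartedSpace E3 M] [IsManifold (𝓡 3) ∞ M]
  {g : RiemMetric3 M} {N : M → ℝ} {F : BilinField I4 (ℝ × M)}

omit [IsManifold (𝓡 3) ∞ M] in
theorem chartFun_self (u : M → ℝ) (x : M) : chartFun u x (extChartAt (𝓡 3) x x) = u x :=
  congrArg u (extChartAt_to_inv x)

theorem chartForm_self (α : M → E3 →L[ℝ] ℝ) (x : M) :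
    chartForm α x (extChartAt (𝓡 3) x x) = α x := by
  have : IsManifold (𝓡 3) 1 M := isManifold_one
  rw [chartForm, chartInv_self, extChartAt_to_inv]
  rfl

namespace IsStaticElectrovac

variable (h : IsStaticElectrovac g N F)

include h

theorem isStaticOn (x : M) :
    IsStaticOn (chartMetric g x) (chartFun N x) (extChartAt (𝓡 3) x).target :=
  isStaticOn_chart g h.lapse_smooth h.lapse_pos x

/-- The electromagnetic field is determined by the electric one-form. -/
theorem field_eq (t : ℝ) (x : M) (v w : ℝ × E3) :
    (F (t, x) : (ℝ × E3) →L[ℝ] (ℝ × E3) →L[ℝ] ℝ) v w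
      = w.1 * elecForm F x v.2 - v.1 * elecForm F x w.2 := by
  have hx := mem_extChartAt_target (I := 𝓡 3) x
  have hF : ∀ v : ℝ × E3, (F (0, x) : (ℝ × E3) →L[ℝ] (ℝ × E3) →L[ℝ] ℝ) v v = 0 :=
    fun v => h.F_alt (0, x) v
  have hel : ∀ w : ℝ × E3, hodgeStar basis4 (staticCoord (chartMetric g x) (chartFun N x)
      (0, extChartAt (𝓡 3) x x)) (F (0, x) : (ℝ × E3) →L[ℝ] (ℝ × E3) →L[ℝ] ℝ) (1, 0) w = 0 := by
    intro w
    rw [← h.staticMetric_eq_staticCoord]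
    exact h.electric (0, x) w
  rw [h.field_stationary]
  exact electric_form_eq hF (fun a c => spatial_eq_zero_of_electric (h.isStaticOn x)
    (z := (0, extChartAt (𝓡 3) x x)) hx hF (gramDet_ne_zero ((h.isStaticOn x).pos _ hx)) hel a c) v w

theorem inChart_field_eq (x : M) (t : ℝ) {y : E3} (hy : y ∈ (extChartAt (𝓡 3) x).target)
    (v w : ℝ × E3) :
    inChart I4 F (0, x) (t, y) v w
      = w.1 * chartForm (elecForm F) x y v.2 - v.1 * chartForm (elecForm F) x y w.2 := by
  have h1 := bilinField_congr F (extChartAt_I4_symm_apply ((0, x) : ℝ × M) (t, y))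
    (chartInv I4 ((0, x) : ℝ × M) (t, y) v) (chartInv I4 ((0, x) : ℝ × M) (t, y) w)
  rw [chartInv_I4 (z := ((0, x) : ℝ × M)) (y := (t, y)) hy v,
    chartInv_I4 (z := ((0, x) : ℝ × M)) (y := (t, y)) hy w] at h1
  have h2 := h.field_eq t ((extChartAt (𝓡 3) x).symm y) (v.1, chartInv (𝓡 3) x y v.2)
    (w.1, chartInv (𝓡 3) x y w.2)
  rw [inChart_apply, chartInv_I4 (z := ((0, x) : ℝ × M)) (y := (t, y)) hy v,
    chartInv_I4 (z := ((0, x) : ℝ × M)) (y := (t, y)) hy w]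
  exact h1.trans h2

theorem contDiffOn_chartForm (x : M) :
    ContDiffOn ℝ ∞ (chartForm (elecForm F) x) (extChartAt (𝓡 3) x).target := by
  rw [contDiffOn_clm_apply]
  intro v
  have h1 : ContDiffOn ℝ ∞ (fun y : E3 => inChart I4 F (0, x) (0, y) (0, v) (1, 0))
      (extChartAt (𝓡 3) x).target := by
    intro y hy
    have h2 := h.contDiffAt_inChart 0 x hy
    have h3 : ContDiffAt ℝ ∞ (fun y : E3 => ((0, y) : ℝ × E3)) y :=
      contDiffAt_const.prodMk contDiffAt_id
    exact (((h2.comp y h3).clm_apply contDiffAt_const).clm_apply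
      contDiffAt_const).contDiffWithinAt
  refine h1.congr fun y hy => ?_
  rw [h.inChart_field_eq x 0 hy]
  simp

theorem fderiv_chartForm_symm_self (x : M) (v w : E3) :
    fderiv ℝ (chartForm (elecForm F) x) (extChartAt (𝓡 3) x x) v w
      = fderiv ℝ (chartForm (elecForm F) x) (extChartAt (𝓡 3) x x) w v := by
  set y₀ := extChartAt (𝓡 3) x x with hy₀
  have hx := mem_extChartAt_target (I := 𝓡 3) x
  have hd : DifferentiableAt ℝ (chartForm (elecForm F) x) y₀ :=
    ((h.contDiffOn_chartForm x).contDiffAt (eventually_mem_target hx)).differentiableAt (by simp)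
  have key : ∀ a c : ℝ × E3, HasFDerivAt (fun y : ℝ × E3 => inChart I4 F (0, x) y a c)
      (c.1 • ((fderiv ℝ (chartForm (elecForm F) x) y₀).flip a.2).comp
        (ContinuousLinearMap.snd ℝ ℝ E3)
        - a.1 • ((fderiv ℝ (chartForm (elecForm F) x) y₀).flip c.2).comp
        (ContinuousLinearMap.snd ℝ ℝ E3)) ((0, y₀) : ℝ × E3) := by
    intro a c
    have e : (fun y : ℝ × E3 => inChart I4 F (0, x) y a c) =ᶠ[𝓝 ((0, y₀) : ℝ × E3)]
        fun y => c.1 * chartForm (elecForm F) x y.2 a.2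
          - a.1 * chartForm (elecForm F) x y.2 c.2 := by
      filter_upwards [continuousAt_snd.eventually (eventually_mem_target hx)] with y hy
      exact h.inChart_field_eq x y.1 hy a c
    refine HasFDerivAt.congr_of_eventuallyEq ?_ e
    have h1 : ∀ v : E3, HasFDerivAt (fun y : ℝ × E3 => chartForm (elecForm F) x y.2 v)
        (((fderiv ℝ (chartForm (elecForm F) x) y₀).flip v).comp
        (ContinuousLinearMap.snd ℝ ℝ E3)) ((0, y₀) : ℝ × E3) := by
      intro v
      have h2 : HasFDerivAt (fun y : E3 => chartForm (elecForm F) x y v)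
          ((fderiv ℝ (chartForm (elecForm F) x) y₀).flip v) y₀ := by
        refine (hd.hasFDerivAt.clm_apply (hasFDerivAt_const v y₀)).congr_fderiv ?_
        ext; simp
      have h3 : HasFDerivAt (Prod.snd : ℝ × E3 → E3) (ContinuousLinearMap.snd ℝ ℝ E3)
        ((0, y₀) : ℝ × E3) := hasFDerivAt_snd
      exact HasFDerivAt.comp (f := Prod.snd) ((0, y₀) : ℝ × E3) h2 h3
    exact ((h1 a.2).const_mul c.1).sub ((h1 c.2).const_mul a.1)
  have h1 := h.closed (0, x) (1, 0) (0, v) (0, w)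
  rw [extDerivTwo, extChartAt_I4_self, ← hy₀, (key _ _).fderiv, (key _ _).fderiv,
    (key _ _).fderiv] at h1
  simp at h1
  linarith

theorem isClosedForm_elecForm : IsClosedForm (elecForm F) where
  smooth := h.contDiffOn_chartForm
  closed x y hy v w := by
    have : IsManifold (𝓡 3) 1 M := isManifold_one
    set x₁ := (extChartAt (𝓡 3) x).symm y
    have h1 : (extChartAt (𝓡 3) x).symm y ∈ (extChartAt (𝓡 3) x₁).source :=
      mem_extChartAt_source x₁
    have hmem := (isOpen_chartChange_source (I := 𝓡 3) x x₁).mem_nhds ⟨hy, h1⟩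
    have hF : ContDiffAt ℝ ∞ (chartChange (𝓡 3) x x₁) y :=
      (contDiffOn_chartChange x x₁).contDiffAt hmem
    have hF1 : DifferentiableAt ℝ (fderiv ℝ (chartChange (𝓡 3) x x₁)) y :=
      (hF.fderiv_right (m := 1) (by norm_cast)).differentiableAt (by simp)
    have hc : chartChange (𝓡 3) x x₁ y = extChartAt (𝓡 3) x₁ x₁ := rfl
    have hd : DifferentiableAt ℝ (chartForm (elecForm F) x₁) (chartChange (𝓡 3) x x₁ y) :=
      ((h.contDiffOn_chartForm x₁).contDiffAt (eventually_mem_target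
        (chartChange_mem_target h1))).differentiableAt (by simp)
    have e : ∀ w, (fun z => chartForm (elecForm F) x z w) =ᶠ[𝓝 y]
        fun z => chartForm (elecForm F) x₁ (chartChange (𝓡 3) x x₁ z)
          (fderiv ℝ (chartChange (𝓡 3) x x₁) z w) := by
      intro w
      filter_upwards [hmem] with z hz
      rw [chartForm, ContinuousLinearMap.comp_apply, ← chartInv_chartChange hz.1 hz.2,
        ← symm_chartChange hz.2]
      rfl
    have hdx : DifferentiableAt ℝ (chartForm (elecForm F) x) y :=
      ((h.contDiffOn_chartForm x).contDiffAt (eventually_mem_target hy)).differentiableAt (by simp)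
    have key : ∀ v w, fderiv ℝ (chartForm (elecForm F) x) y v w
        = fderiv ℝ (chartForm (elecForm F) x₁) (chartChange (𝓡 3) x x₁ y)
            (fderiv ℝ (chartChange (𝓡 3) x x₁) y v) (fderiv ℝ (chartChange (𝓡 3) x x₁) y w)
          + chartForm (elecForm F) x₁ (chartChange (𝓡 3) x x₁ y)
            (fderiv ℝ (fderiv ℝ (chartChange (𝓡 3) x x₁)) y v w) := by
      intro v w
      have h2 : HasFDerivAt (fun z => chartForm (elecForm F) x z w)
          ((fderiv ℝ (chartForm (elecForm F) x) y).flip w) y := by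
        refine (hdx.hasFDerivAt.clm_apply (hasFDerivAt_const w y)).congr_fderiv ?_
        ext; simp
      have h3 := (hd.hasFDerivAt.comp y (hF.differentiableAt (by simp)).hasFDerivAt).clm_apply
        (hF1.hasFDerivAt.clm_apply (hasFDerivAt_const w y))
      have h4 := (e w).fderiv_eq (𝕜 := ℝ)
      have h5 := congrArg (fun A : E3 →L[ℝ] ℝ => A v) (h2.fderiv.symm.trans (h4.trans h3.fderiv))
      simp at h5
      rw [h5]
      ring
    rw [key, key, hc, h.fderiv_chartForm_symm_self x₁,
      (hF.isSymmSndFDerivAt minSmoothness_two_le).eq v w]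

variable {x : M} {ι : Type*} [Fintype ι] [DecidableEq ι] {b : Module.Basis ι ℝ E3}

theorem einstein_chart (v w : ℝ × E3) :
    ricci (staticCoord (chartMetric g x) (chartFun N x)) (0, extChartAt (𝓡 3) x x) v w
      = maxwellSource (staticCoord (chartMetric g x) (chartFun N x) (0, extChartAt (𝓡 3) x x))
        (F (0, x) : (ℝ × E3) →L[ℝ] (ℝ × E3) →L[ℝ] ℝ) v w := by
  have h1 := h.einstein (0, x) v w
  have e : inChart I4 (staticMetric g N) (0, x) =ᶠ[𝓝 ((0, extChartAt (𝓡 3) x x) : ℝ × E3)]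
      staticCoord (chartMetric g x) (chartFun N x) := by
    filter_upwards [continuousAt_snd.eventually (eventually_mem_target
      (mem_extChartAt_target (I := 𝓡 3) x))] with y hy
    exact inChart_staticMetric g N (z := (0, x)) hy
  rw [← h.staticMetric_eq_staticCoord, ← ricci_congr e, ← extChartAt_I4_self]
  exact h1

theorem lapse_equation_self
    (hb : ∀ i j, chartMetric g x (extChartAt (𝓡 3) x x) (b i) (b j) = if i = j then 1 else 0) :
    N x * covLap (chartMetric g x) (chartFun N x) (extChartAt (𝓡 3) x x)
      = ∑ i, elecForm F x (b i) ^ 2 := by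
  have h1 := (h.isStaticOn x).lapse_equation (t := 0) (mem_extChartAt_target x) hb
    (h.field_eq 0 x) h.einstein_chart
  rwa [chartFun_self] at h1

theorem ricci_equation_self
    (hb : ∀ i j, chartMetric g x (extChartAt (𝓡 3) x x) (b i) (b j) = if i = j then 1 else 0)
    (v w : E3) :
    ricci (chartMetric g x) (extChartAt (𝓡 3) x x) v w
      = covHess (chartMetric g x) (chartFun N x) (extChartAt (𝓡 3) x x) v w / N x
        - 2 * (elecForm F x v * elecForm F x w) / N x ^ 2
        + (∑ i, elecForm F x (b i) ^ 2) / N x ^ 2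
          * chartMetric g x (extChartAt (𝓡 3) x x) v w := by
  have h1 := (h.isStaticOn x).ricci_equation (t := 0) (mem_extChartAt_target x) hb
    (h.field_eq 0 x) h.einstein_chart v w
  rwa [chartFun_self] at h1

theorem potential_equation_self {ψ : M → ℝ} (hψ : IsPotentialAt (elecForm F) ψ x) :
    covLap (chartMetric g x) (chartFun ψ x) (extChartAt (𝓡 3) x x)
      = fderiv ℝ (chartFun ψ x) (extChartAt (𝓡 3) x x)
          (covGrad (chartMetric g x) (chartFun N x) (extChartAt (𝓡 3) x x)) / N x := by
  have hx := mem_extChartAt_target (I := 𝓡 3) x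
  have hψ' : IsPotentialAt (elecForm F) ψ ((extChartAt (𝓡 3) x).symm (extChartAt (𝓡 3) x x)) := by
    rwa [extChartAt_to_inv]
  obtain ⟨Ω, hΩ, hΩo, hxΩ⟩ := eventually_nhds_iff.1 ((hψ'.chart hx).and (eventually_mem_target hx))
  have hst := (h.isStaticOn x).mono hΩo fun y hy => (hΩ y hy).2
  have hsm : ContDiffOn ℝ ∞ (chartFun ψ x) Ω := by
    rw [contDiffOn_infty_iff_fderiv_of_isOpen hΩo]
    refine ⟨fun z hz => (hΩ z hz).1.differentiableAt.differentiableWithinAt, ?_⟩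
    exact ((h.contDiffOn_chartForm x).mono fun z hz => (hΩ z hz).2).congr
      fun z hz => (hΩ z hz).1.fderiv
  have h1 := potential_equation hst (z := (0, extChartAt (𝓡 3) x x)) hxΩ
    (F := inChart I4 F (0, x)) (G := inChart I4 (staticMetric g N) (0, x)) hsm
    (gramDet_ne_zero ((h.isStaticOn x).pos _ hx))
    (fun y hy => inChart_staticMetric g N (z := (0, x)) (hΩ y.2 hy.2).2)
    (fun y hy v w => by
      rw [(hΩ y.2 hy.2).1.fderiv]
      exact h.inChart_field_eq x y.1 (hΩ y.2 hy.2).2 v w)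
    (fun u v w => by
      have := h.coclosed (0, x) u v w
      rwa [extChartAt_I4_self] at this)
  rwa [chartFun_self] at h1

end IsStaticElectrovac

end FieldEquations

section PointwiseEquations

variable {X : Type*} [NormedAddCommGroup X] [NormedSpace ℝ X] [FiniteDimensional ℝ X]

/-- Raising an index commutes with pull-back by an isomorphism. -/
theorem apply_inverse_of_comp {B₀ B₁ : X →L[ℝ] X →L[ℝ] ℝ}
    (h₀ : ∀ v, (∀ w, B₀ v w = 0) → v = 0) (h₁ : ∀ v, (∀ w, B₁ v w = 0) → v = 0) {D : X →L[ℝ] X}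
    (hD : Function.Surjective D) (hB : ∀ v w, B₀ v w = B₁ (D v) (D w)) (l : X →L[ℝ] ℝ) :
    D (B₀.inverse (l.comp D)) = B₁.inverse l := by
  refine sub_eq_zero.1 (h₁ _ fun w => ?_)
  obtain ⟨w, rfl⟩ := hD w
  rw [map_sub, sub_apply, ← hB, apply_inverse_of_nondeg h₀, apply_inverse_of_nondeg h₁]
  simp

/-- The data of a purely electric static solution with potential `ψ` in coordinates; the Ricci
curvature is only needed at one point. -/
structure ElectrovacOn (g : E3 → E3 →L[ℝ] E3 →L[ℝ] ℝ) (N ψ : E3 → ℝ) (Ω : Set E3) (y₀ : E3) :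
    Prop where
  static : IsStaticOn g N Ω
  mem : y₀ ∈ Ω
  potential_smooth : ContDiffOn ℝ ∞ ψ Ω
  potential_eq : ∀ y ∈ Ω, covLap g ψ y = fderiv ℝ ψ y (covGrad g N y) / N y
  lapse_eq : ∀ y ∈ Ω, N y * covLap g N y = fderiv ℝ ψ y (covGrad g ψ y)
  ricci_eq : ∀ v w, ricci g y₀ v w = covHess g N y₀ v w / N y₀
    - 2 * (fderiv ℝ ψ y₀ v * fderiv ℝ ψ y₀ w) / N y₀ ^ 2
    + fderiv ℝ ψ y₀ (covGrad g ψ y₀) / N y₀ ^ 2 * g y₀ v w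

theorem sum_sq_eq_apply_inverse {ι : Type*} [Fintype ι] [DecidableEq ι] {b : Module.Basis ι ℝ X}
    {B : X →L[ℝ] X →L[ℝ] ℝ} (hnd : ∀ v, (∀ w, B v w = 0) → v = 0)
    (hs : ∀ v w, B v w = B w v)
    (hb : ∀ i j, B (b i) (b j) = if i = j then 1 else 0) (l : X →L[ℝ] ℝ) :
    ∑ i, l (b i) ^ 2 = l (B.inverse l) := by
  conv_rhs => rw [← sum_repr_of_orthonormal hnd hb (B.inverse l)]
  rw [map_sum]
  refine Finset.sum_congr rfl fun i _ => ?_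
  rw [map_smul, hs, apply_inverse_of_nondeg hnd, smul_eq_mul, sq]

section Transfer

variable {M : Type*} [TopologicalSpace M] [ChartedSpace E3 M] [IsManifold (𝓡 3) ∞ M]
  (g : RiemMetric3 M)

/-- The inner product of two one-forms. -/
noncomputable def formInner (α β : M → E3 →L[ℝ] ℝ) (x : M) : ℝ :=
  α x (ContinuousLinearMap.inverse (g.inner x : E3 →L[ℝ] E3 →L[ℝ] ℝ) (β x))

theorem formInner_chart (α β : M → E3 →L[ℝ] ℝ) {x : M} {y : E3}
    (hy : y ∈ (extChartAt (𝓡 3) x).target) :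
    formInner g α β ((extChartAt (𝓡 3) x).symm y)
      = chartForm α x y ((chartMetric g x y).inverse (chartForm β x y)) := by
  have : IsManifold (𝓡 3) 1 M := isManifold_one
  have h1 := apply_inverse_of_comp ((isMetricOn_chartMetric g x).nondeg y hy)
    (inner_nondeg g ((extChartAt (𝓡 3) x).symm y)) (chartInv_bijective hy).2
    (fun v w => rfl) (β ((extChartAt (𝓡 3) x).symm y))
  have h2 : formInner g α β ((extChartAt (𝓡 3) x).symm y)
    = α ((extChartAt (𝓡 3) x).symm y) (ContinuousLinearMap.inverse
      (g.inner ((extChartAt (𝓡 3) x).symm y) : E3 →L[ℝ] E3 →L[ℝ] ℝ)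
      (β ((extChartAt (𝓡 3) x).symm y))) := rfl
  rw [h2]
  exact congrArg (α ((extChartAt (𝓡 3) x).symm y)) h1.symm

theorem formInner_self_eq (α β : M → E3 →L[ℝ] ℝ) (x : M) :
    formInner g α β x
      = α x ((chartMetric g x (extChartAt (𝓡 3) x x)).inverse (β x)) := by
  have h1 := formInner_chart g α β (mem_extChartAt_target (I := 𝓡 3) x)
  rwa [extChartAt_to_inv, chartForm_self, chartForm_self]
    at h1

/-- The Laplacian of a function on the manifold. -/
noncomputable def lapAt (u : M → ℝ) (x : M) : ℝ :=
  covLap (chartMetric g x) (chartFun u x) (extChartAt (𝓡 3) x x)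

theorem covLap_chart {x : M} {y : E3} (hy : y ∈ (extChartAt (𝓡 3) x).target)
    (hpos : ∀ v, v ≠ 0 → 0 < chartMetric g x y v v) {u : M → ℝ}
    (hu : ContDiffAt ℝ ∞ (chartFun u ((extChartAt (𝓡 3) x).symm y))
      (chartChange (𝓡 3) x ((extChartAt (𝓡 3) x).symm y) y)) :
    covLap (chartMetric g x) (chartFun u x) y = lapAt g u ((extChartAt (𝓡 3) x).symm y) := by
  have : IsManifold (𝓡 3) 1 M := isManifold_one
  set x₁ := (extChartAt (𝓡 3) x).symm y
  have hm := isMetricOn_chartMetric g x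
  have hm₁ := isMetricOn_chartMetric g x₁
  have h1 : (extChartAt (𝓡 3) x).symm y ∈ (extChartAt (𝓡 3) x₁).source := mem_extChartAt_source x₁
  obtain ⟨b, hb, -⟩ := exists_orthonormal_basis (B := chartMetric g x y) (by simp) (hm.symm _ hy)
    hpos 0
  have hbij := fderiv_chartChange_bijective hy h1
  let D := LinearEquiv.ofBijective (fderiv ℝ (chartChange (𝓡 3) x x₁) y : E3 →ₗ[ℝ] E3) hbij
  have hD : ∀ i, b.map D i = fderiv ℝ (chartChange (𝓡 3) x x₁) y (b i) := fun i => rfl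
  have hb' : ∀ i j, chartMetric g x₁ (chartChange (𝓡 3) x x₁ y) (b.map D i) (b.map D j)
      = if i = j then 1 else 0 := by
    intro i j
    rw [hD, hD, ← inChart_chartChange _ hy h1]
    exact hb i j
  rw [hm.covLap_eq_sum hy hb, lapAt]
  have h2 := hm₁.covLap_eq_sum (chartChange_mem_target h1) hb' (chartFun u x₁)
  refine Eq.trans ?_ h2.symm
  refine Finset.sum_congr rfl fun i _ => ?_
  rw [hD]
  exact covHess_chartChange (smoothBilin_inner g) g.symm (inner_nondeg g) hy h1 hu _ _

end Transfer

namespace IsStaticElectrovac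

variable {M : Type*} [TopologicalSpace M] [ChartedSpace E3 M] [IsManifold (𝓡 3) ∞ M]
  {g : RiemMetric3 M} {N : M → ℝ} {F : BilinField I4 (ℝ × M)}

theorem exists_electrovacOn (h : IsStaticElectrovac g N F) {x : M} {ψ : M → ℝ}
    (hψ : IsPotentialAt (elecForm F) ψ x) :
    ∃ Ω ⊆ (extChartAt (𝓡 3) x).target,
      ElectrovacOn (chartMetric g x) (chartFun N x) (chartFun ψ x) Ω (extChartAt (𝓡 3) x x) ∧
      ∀ y ∈ Ω, HasFDerivAt (chartFun ψ x) (chartForm (elecForm F) x y) y := by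
  have : IsManifold (𝓡 3) 1 M := isManifold_one
  have hx := mem_extChartAt_target (I := 𝓡 3) x
  have hψ' : IsPotentialAt (elecForm F) ψ ((extChartAt (𝓡 3) x).symm (extChartAt (𝓡 3) x x)) := by
    rwa [extChartAt_to_inv]
  obtain ⟨Ω, hΩ, hΩo, hxΩ⟩ := eventually_nhds_iff.1 (((hψ'.chart hx).and
    (eventually_mem_target hx)).and ((tendsto_extChartAt_symm hx).eventually hψ'.eventually))
  have hst := (h.isStaticOn x).mono hΩo fun y hy => (hΩ y hy).1.2
  have hsm : ContDiffOn ℝ ∞ (chartFun ψ x) Ω := by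
    rw [contDiffOn_infty_iff_fderiv_of_isOpen hΩo]
    refine ⟨fun z hz => (hΩ z hz).1.1.differentiableAt.differentiableWithinAt, ?_⟩
    exact ((h.contDiffOn_chartForm x).mono fun z hz => (hΩ z hz).1.2).congr
      fun z hz => (hΩ z hz).1.1.fderiv
  have hd : ∀ z, IsPotentialAt (elecForm F) ψ z →
      fderiv ℝ (chartFun ψ z) (extChartAt (𝓡 3) z z) = elecForm F z := by
    intro z hz
    have h1 : IsPotentialAt (elecForm F) ψ ((extChartAt (𝓡 3) z).symm (extChartAt (𝓡 3) z z)) := by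
      rwa [extChartAt_to_inv]
    rw [(h1.chart (mem_extChartAt_target z)).self_of_nhds.fderiv, chartForm_self]
  let dN : M → E3 →L[ℝ] ℝ := fun z => (mfderiv (𝓡 3) 𝓘(ℝ, ℝ) N z : E3 →L[ℝ] ℝ)
  have hdN : ∀ z, ∀ y ∈ (extChartAt (𝓡 3) z).target,
      fderiv ℝ (chartFun N z) y = chartForm dN z y := fun z y hy =>
    (fderiv_comp_symm hy (h.lapse_smooth.mdifferentiableAt (by simp)).hasMFDerivAt).fderiv
  have hcov : ∀ y ∈ Ω, lapAt g ψ ((extChartAt (𝓡 3) x).symm y)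
      = formInner g (elecForm F) dN ((extChartAt (𝓡 3) x).symm y)
        / N ((extChartAt (𝓡 3) x).symm y) := by
    intro y hy
    rw [lapAt, h.potential_equation_self (hΩ y hy).2, hd _ (hΩ y hy).2, formInner_self_eq, covGrad,
      hdN _ _ (mem_extChartAt_target _), chartForm_self]
  have hlap : ∀ z, N z * lapAt g N z = formInner g (elecForm F) (elecForm F) z := by
    intro z
    have hm := h.isStaticOn z
    have hz := mem_extChartAt_target (I := 𝓡 3) z
    obtain ⟨b, hb, -⟩ := exists_orthonormal_basis
      (B := chartMetric g z (extChartAt (𝓡 3) z z)) (by simp) (hm.metric.symm _ hz)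
      (hm.pos _ hz) 0
    rw [lapAt, h.lapse_equation_self hb, formInner_self_eq,
      sum_sq_eq_apply_inverse (hm.metric.nondeg _ hz) (hm.metric.symm _ hz) hb]
  refine ⟨Ω, fun y hy => (hΩ y hy).1.2, ⟨hst, hxΩ, hsm, ?_, ?_, ?_⟩, fun y hy => (hΩ y hy).1.1⟩
  · intro y hy
    rw [covLap_chart g (hΩ y hy).1.2 (hst.pos y hy), hcov y hy,
      formInner_chart g _ _ (hΩ y hy).1.2, (hΩ y hy).1.1.fderiv, covGrad, hdN _ _ (hΩ y hy).1.2]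
    · rfl
    · exact IsPotentialAt.contDiffAt_chart h.isClosedForm_elecForm
        (chartChange_mem_target (mem_extChartAt_source _))
        (by rw [symm_chartChange (mem_extChartAt_source _)]; exact (hΩ y hy).2)
  · intro y hy
    rw [covLap_chart g (hΩ y hy).1.2 (hst.pos y hy), (hΩ y hy).1.1.fderiv, covGrad,
      (hΩ y hy).1.1.fderiv, ← formInner_chart g _ _ (hΩ y hy).1.2, ← hlap]
    · rfl
    · exact (contDiffOn_chartFun h.lapse_smooth _).contDiffAt
        (eventually_mem_target (mem_extChartAt_target _))
  · intro v w
    have hm := h.isStaticOn x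
    obtain ⟨b, hb, -⟩ := exists_orthonormal_basis
      (B := chartMetric g x (extChartAt (𝓡 3) x x)) (by simp) (hm.metric.symm _ hx)
      (hm.pos _ hx) 0
    rw [h.ricci_equation_self hb, covGrad, hd x hψ, chartFun_self,
      sum_sq_eq_apply_inverse (hm.metric.nondeg _ hx) (hm.metric.symm _ hx) hb]

end IsStaticElectrovac

end PointwiseEquations

/-! ### The drift Laplacian -/

section DriftLaplacian

variable {X : Type*} [NormedAddCommGroup X] [NormedSpace ℝ X] [FiniteDimensional ℝ X]
  {g : X → X →L[ℝ] X →L[ℝ] ℝ} {N : X → ℝ} {Ω : Set X} {y : X}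

/-- The operator `Δu - ⟨∇N, ∇u⟩ / N`. -/
noncomputable def driftLap (g : X → X →L[ℝ] X →L[ℝ] ℝ) (N u : X → ℝ) (y : X) : ℝ :=
  covLap g u y - fderiv ℝ u y (covGrad g N y) / N y

theorem covHess_mul {u v : X → ℝ} (hu : ContDiffAt ℝ ∞ u y) (hv : ContDiffAt ℝ ∞ v y) (a c : X) :
    covHess g (fun x => u x * v x) y a c
      = u y * covHess g v y a c + v y * covHess g u y a c
        + fderiv ℝ u y a * fderiv ℝ v y c + fderiv ℝ v y a * fderiv ℝ u y c := by
  have hud := hu.differentiableAt infty_ne_zero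
  have hvd := hv.differentiableAt infty_ne_zero
  have hu1 : DifferentiableAt ℝ (fderiv ℝ u) y :=
    (hu.fderiv_right (m := 1) (by norm_cast)).differentiableAt (by simp)
  have hv1 : DifferentiableAt ℝ (fderiv ℝ v) y :=
    (hv.fderiv_right (m := 1) (by norm_cast)).differentiableAt (by simp)
  have e : fderiv ℝ (fun x => u x * v x) =ᶠ[𝓝 y]
      fun x => u x • fderiv ℝ v x + v x • fderiv ℝ u x := by
    have h1 := (hu.of_le two_le_infty).eventually (by simp)
    have h2 := (hv.of_le two_le_infty).eventually (by simp)
    filter_upwards [h1, h2] with x hx1 hx2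
    exact fderiv_fun_mul (hx1.differentiableAt (by simp)) (hx2.differentiableAt (by simp))
  have h3 : HasFDerivAt (fun x => u x • fderiv ℝ v x + v x • fderiv ℝ u x) _ y :=
    (hud.hasFDerivAt.smul hv1.hasFDerivAt).add (hvd.hasFDerivAt.smul hu1.hasFDerivAt)
  rw [covHess_apply, covHess_apply, covHess_apply, e.fderiv_eq, e.eq_of_nhds, h3.fderiv]
  simp only [add_apply, smul_apply, smul_eq_mul,
    ContinuousLinearMap.smulRight_apply]
  ring

theorem covHess_add {u v : X → ℝ} (hu : ContDiffAt ℝ ∞ u y) (hv : ContDiffAt ℝ ∞ v y) (a c : X) :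
    covHess g (fun x => u x + v x) y a c = covHess g u y a c + covHess g v y a c := by
  have hu1 : DifferentiableAt ℝ (fderiv ℝ u) y :=
    (hu.fderiv_right (m := 1) (by norm_cast)).differentiableAt (by simp)
  have hv1 : DifferentiableAt ℝ (fderiv ℝ v) y :=
    (hv.fderiv_right (m := 1) (by norm_cast)).differentiableAt (by simp)
  have e : fderiv ℝ (fun x => u x + v x) =ᶠ[𝓝 y] fun x => fderiv ℝ u x + fderiv ℝ v x := by
    have h1 := (hu.of_le two_le_infty).eventually (by simp)
    have h2 := (hv.of_le two_le_infty).eventually (by simp)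
    filter_upwards [h1, h2] with x hx1 hx2
    exact fderiv_fun_add (hx1.differentiableAt (by simp)) (hx2.differentiableAt (by simp))
  have h3 : HasFDerivAt (fun x => fderiv ℝ u x + fderiv ℝ v x) _ y :=
    hu1.hasFDerivAt.add hv1.hasFDerivAt
  rw [covHess_apply, covHess_apply, covHess_apply, e.fderiv_eq, e.eq_of_nhds, h3.fderiv]
  simp only [add_apply]
  ring

theorem covHess_const (c : ℝ) (a b : X) : covHess g (fun _ => c) y a b = 0 := by
  rw [covHess_apply]
  simp

section

variable (hg : IsMetricOn g Ω) (hy : y ∈ Ω) {ι : Type*} [Fintype ι] [DecidableEq ι]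
  {b : Module.Basis ι ℝ X} (hb : ∀ i j, g y (b i) (b j) = if i = j then 1 else 0)

include hg hy in
theorem fderiv_covGrad_comm (u v : X → ℝ) :
    fderiv ℝ u y (covGrad g v y) = fderiv ℝ v y (covGrad g u y) := by
  rw [← hg.apply_covGrad hy, ← hg.apply_covGrad hy, hg.symm y hy]

include hg hy hb in
theorem sum_fderiv_mul (u v : X → ℝ) :
    ∑ i, fderiv ℝ u y (b i) * fderiv ℝ v y (b i) = fderiv ℝ u y (covGrad g v y) := by
  conv_rhs => rw [← hg.sum_apply_smul hy hb (covGrad g v y)]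
  rw [map_sum]
  refine Finset.sum_congr rfl fun i _ => ?_
  rw [map_smul, hg.symm y hy, hg.apply_covGrad hy, smul_eq_mul, mul_comm]

include hg hy hb in
theorem driftLap_mul {u v : X → ℝ} (hu : ContDiffAt ℝ ∞ u y) (hv : ContDiffAt ℝ ∞ v y) :
    driftLap g N (fun x => u x * v x) y
      = u y * driftLap g N v y + v y * driftLap g N u y
        + 2 * fderiv ℝ u y (covGrad g v y) := by
  have hud := hu.differentiableAt infty_ne_zero
  have hvd := hv.differentiableAt infty_ne_zero
  simp only [driftLap, hg.covLap_eq_sum hy hb, covHess_mul hu hv, Finset.sum_add_distrib,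
    ← Finset.mul_sum, sum_fderiv_mul hg hy hb]
  rw [fderiv_fun_mul hud hvd, fderiv_covGrad_comm hg hy v u]
  simp only [add_apply, smul_apply, smul_eq_mul]
  ring

include hg hy hb in
theorem driftLap_add {u v : X → ℝ} (hu : ContDiffAt ℝ ∞ u y) (hv : ContDiffAt ℝ ∞ v y) :
    driftLap g N (fun x => u x + v x) y = driftLap g N u y + driftLap g N v y := by
  have hud := hu.differentiableAt infty_ne_zero
  have hvd := hv.differentiableAt infty_ne_zero
  simp only [driftLap, hg.covLap_eq_sum hy hb, covHess_add hu hv, Finset.sum_add_distrib]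
  rw [fderiv_fun_add hud hvd]
  simp only [add_apply]
  ring

include hg hy hb in
theorem driftLap_const_mul (c : ℝ) {u : X → ℝ} (hu : ContDiffAt ℝ ∞ u y) :
    driftLap g N (fun x => c * u x) y = c * driftLap g N u y := by
  rw [driftLap_mul hg hy hb contDiffAt_const hu]
  simp only [driftLap, hg.covLap_eq_sum hy hb, covHess_const]
  simp

end

theorem fderiv_fderiv_nonpos_of_isLocalMax {u : X → ℝ} (hu : ContDiffAt ℝ ∞ u y)
    (hmax : IsLocalMax u y) (v : X) : fderiv ℝ (fderiv ℝ u) y v v ≤ 0 := by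
  by_contra hlt
  push Not at hlt
  have hu1 : DifferentiableAt ℝ (fderiv ℝ u) y :=
    (hu.fderiv_right (m := 1) (by norm_cast)).differentiableAt (by simp)
  have hl : ∀ t : ℝ, HasDerivAt (fun t : ℝ => y + t • v) v t := fun t => by
    simpa using ((hasDerivAt_id t).smul_const v).const_add y
  have hl0 : Tendsto (fun t : ℝ => y + t • v) (𝓝 0) (𝓝 y) := by
    have := (hl 0).continuousAt.tendsto
    simpa using this
  have hev : ∀ᶠ t : ℝ in 𝓝 0, HasDerivAt (fun t : ℝ => u (y + t • v)) (fderiv ℝ u (y + t • v) v) t := by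
    have h1 := hl0.eventually ((hu.of_le two_le_infty).eventually (by simp))
    filter_upwards [h1] with t ht
    exact (ht.differentiableAt (by simp)).hasFDerivAt.comp_hasDerivAt t (hl t)
  have hd1 : deriv (fun t : ℝ => u (y + t • v)) =ᶠ[𝓝 0] fun t => fderiv ℝ u (y + t • v) v :=
    hev.mono fun t ht => ht.deriv
  have hd2 : HasDerivAt (fun t : ℝ => fderiv ℝ u (y + t • v) v) (fderiv ℝ (fderiv ℝ u) y v v) 0 := by
    have h1 : HasFDerivAt (fderiv ℝ u) (fderiv ℝ (fderiv ℝ u) y) (y + (0 : ℝ) • v) := by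
      simpa using hu1.hasFDerivAt
    exact (ContinuousLinearMap.apply ℝ ℝ v).hasFDerivAt.comp_hasDerivAt (0 : ℝ)
      (h1.comp_hasDerivAt (0 : ℝ) (hl 0))
  have hmax' : IsLocalMax (fun t : ℝ => u (y + t • v)) 0 := by
    have := hl0.eventually hmax
    filter_upwards [this] with t ht
    simpa using ht
  have hmin : IsLocalMin (fun t : ℝ => u (y + t • v)) 0 := by
    refine isLocalMin_of_deriv_deriv_pos ?_ ?_ hev.self_of_nhds.continuousAt
    · rw [hd1.deriv_eq, hd2.deriv]
      exact hlt
    · exact hmax'.deriv_eq_zero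
  have hconst : (fun t : ℝ => u (y + t • v)) =ᶠ[𝓝 0] fun _ => u (y + (0 : ℝ) • v) := by
    filter_upwards [hmax', hmin] with t h1 h2
    exact le_antisymm h1 h2
  have h3 : deriv (deriv fun t : ℝ => u (y + t • v)) 0 = 0 := by
    rw [(hconst.deriv).deriv_eq]
    simp
  rw [hd1.deriv_eq, hd2.deriv] at h3
  exact hlt.ne' h3

theorem driftLap_nonpos_of_isLocalMax (hg : IsMetricOn g Ω) (hy : y ∈ Ω) {ι : Type*} [Fintype ι]
    [DecidableEq ι] {b : Module.Basis ι ℝ X}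
    (hb : ∀ i j, g y (b i) (b j) = if i = j then 1 else 0) {u : X → ℝ} (hu : ContDiffAt ℝ ∞ u y)
    (hmax : IsLocalMax u y) : driftLap g N u y ≤ 0 := by
  rw [driftLap, hg.covLap_eq_sum hy hb, hmax.fderiv_eq_zero]
  simp only [zero_apply, zero_div, sub_zero]
  refine Finset.sum_nonpos fun i _ => ?_
  rw [covHess_apply, hmax.fderiv_eq_zero]
  simpa using fderiv_fderiv_nonpos_of_isLocalMax hu hmax (b i)

end DriftLaplacian

section ElectrovacLocal

variable {g : E3 → E3 →L[ℝ] E3 →L[ℝ] ℝ} {N ψ : E3 → ℝ} {Ω : Set E3} {y₀ : E3}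

namespace ElectrovacOn

variable (h : ElectrovacOn g N ψ Ω y₀)

include h

theorem exists_basis (V : E3) : ∃ b : Module.Basis (Fin 3) ℝ E3,
    (∀ i j, g y₀ (b i) (b j) = if i = j then 1 else 0) ∧ ∃ c : ℝ, 0 ≤ c ∧ V = c • b 0 :=
  exists_orthonormal_basis (by simp) (h.static.metric.symm _ h.mem) (h.static.pos _ h.mem) V

theorem contDiffAt_lapse : ContDiffAt ℝ ∞ N y₀ :=
  h.static.metric.contDiffAt_of_mem h.static.lapse_smooth h.mem

theorem contDiffAt_potential : ContDiffAt ℝ ∞ ψ y₀ :=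
  h.static.metric.contDiffAt_of_mem h.potential_smooth h.mem

theorem driftLap_potential : driftLap g N ψ y₀ = 0 := by
  rw [driftLap, h.potential_eq y₀ h.mem, sub_self]

theorem driftLap_lapse :
    N y₀ * driftLap g N N y₀
      = fderiv ℝ ψ y₀ (covGrad g ψ y₀) - fderiv ℝ N y₀ (covGrad g N y₀) := by
  have hN := (h.static.lapse_pos _ h.mem).ne'
  rw [driftLap, mul_sub, h.lapse_eq y₀ h.mem]
  field_simp

theorem driftLap_lapse_sq :
    driftLap g N (fun y => N y * N y) y₀ = 2 * fderiv ℝ ψ y₀ (covGrad g ψ y₀) := by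
  obtain ⟨b, hb, -⟩ := h.exists_basis 0
  rw [driftLap_mul h.static.metric h.mem hb h.contDiffAt_lapse h.contDiffAt_lapse, h.driftLap_lapse]
  ring

theorem driftLap_potential_sq :
    driftLap g N (fun y => ψ y * ψ y) y₀ = 2 * fderiv ℝ ψ y₀ (covGrad g ψ y₀) := by
  obtain ⟨b, hb, -⟩ := h.exists_basis 0
  rw [driftLap_mul h.static.metric h.mem hb h.contDiffAt_potential h.contDiffAt_potential,
    h.driftLap_potential]
  ring

theorem gradSq_nonneg (f : E3 → ℝ) : 0 ≤ fderiv ℝ f y₀ (covGrad g f y₀) := by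
  rw [← h.static.metric.apply_covGrad h.mem]
  rcases eq_or_ne (covGrad g f y₀) 0 with h0 | h0
  · rw [h0]
    simp
  · exact (h.static.pos _ h.mem _ h0).le

theorem gradSq_pos {f : E3 → ℝ} (hf : fderiv ℝ f y₀ ≠ 0) :
    0 < fderiv ℝ f y₀ (covGrad g f y₀) := by
  rw [← h.static.metric.apply_covGrad h.mem]
  refine h.static.pos _ h.mem _ fun h0 => hf ?_
  ext w
  rw [← h.static.metric.apply_covGrad h.mem, h0]
  simp

theorem driftLap_lapse_cube :
    3 * N y₀ * fderiv ℝ N y₀ (covGrad g N y₀) ≤ driftLap g N (fun y => N y * (N y * N y)) y₀ := by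
  obtain ⟨b, hb, -⟩ := h.exists_basis 0
  have hN := h.contDiffAt_lapse
  have hNd := hN.differentiableAt infty_ne_zero
  have h1 := h.driftLap_lapse
  have h2 : fderiv ℝ N y₀ (covGrad g (fun y => N y * N y) y₀)
      = 2 * N y₀ * fderiv ℝ N y₀ (covGrad g N y₀) := by
    rw [fderiv_covGrad_comm h.static.metric h.mem, fderiv_fun_mul hNd hNd]
    simp only [add_apply, smul_apply, smul_eq_mul]
    ring
  rw [driftLap_mul h.static.metric h.mem hb hN (hN.mul hN), h.driftLap_lapse_sq, h2]
  have h3 := mul_nonneg (h.static.lapse_pos _ h.mem).le (h.gradSq_nonneg ψ)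
  linarith [congrArg (fun r => N y₀ * r) h1, mul_assoc (N y₀) (N y₀) (driftLap g N N y₀)]

variable {c : ℝ} (hc : ∀ y ∈ Ω, N y • fderiv ℝ N y = (ψ y - c) • fderiv ℝ ψ y)

include hc in
/-- If `N² = ψ² - 2cψ + const`, then `|∇ψ|² / N²` is a subsolution. -/
theorem driftLap_gradSq_nonneg {Y : E3 → ℝ}
    (hY : ∀ y ∈ Ω, Y y * (N y * N y) = fderiv ℝ ψ y (covGrad g ψ y)) :
    0 ≤ driftLap g N Y y₀ := by
  obtain ⟨b, hb, k, hk, hV⟩ := h.exists_basis (covGrad g ψ y₀)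
  have hm := h.static.metric
  have hmem := h.static.metric.mem_nhds h.mem
  have hN := h.static.lapse_pos _ h.mem
  have hNs := h.contDiffAt_lapse
  have hψs := h.contDiffAt_potential
  have hNd := hNs.differentiableAt infty_ne_zero
  have hψd := hψs.differentiableAt infty_ne_zero
  have hN1 : DifferentiableAt ℝ (fderiv ℝ N) y₀ :=
    (hNs.fderiv_right (m := 1) (by norm_cast)).differentiableAt (by simp)
  have hψ1 : DifferentiableAt ℝ (fderiv ℝ ψ) y₀ :=
    (hψs.fderiv_right (m := 1) (by norm_cast)).differentiableAt (by simp)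
  have he2 : ContDiffAt ℝ ∞ (fun y => fderiv ℝ ψ y (covGrad g ψ y)) y₀ :=
    (hm.contDiffOn_apply_covGrad h.potential_smooth).contDiffAt hmem
  have hYs : ContDiffAt ℝ ∞ Y y₀ := by
    have h1 : ContDiffAt ℝ ∞ (fun y => fderiv ℝ ψ y (covGrad g ψ y) / (N y * N y)) y₀ :=
      he2.div (hNs.mul hNs) (mul_pos hN hN).ne'
    refine h1.congr_of_eventuallyEq ?_
    filter_upwards [hmem] with y hy
    have := (h.static.lapse_pos _ hy).ne'
    rw [← hY y hy]
    field_simp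
  have hYe : (fun y => fderiv ℝ ψ y (covGrad g ψ y)) =ᶠ[𝓝 y₀] fun y => Y y * (N y * N y) := by
    filter_upwards [hmem] with y hy using (hY y hy).symm
  set α := (ψ y₀ - c) / N y₀ with hα
  have hdN : ∀ v, fderiv ℝ N y₀ v = α * fderiv ℝ ψ y₀ v := by
    intro v
    have := congrArg (fun A : E3 →L[ℝ] ℝ => A v) (hc y₀ h.mem)
    simp only [smul_apply, smul_eq_mul] at this
    rw [hα]
    field_simp
    linarith
  set H : E3 → E3 → ℝ := fun v w => covHess g ψ y₀ v w with hH
  set e2 := fderiv ℝ ψ y₀ (covGrad g ψ y₀) with hhe2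
  have hHN : ∀ v w, N y₀ * covHess g N y₀ v w
      = (ψ y₀ - c) * H v w + (1 - α ^ 2) * (fderiv ℝ ψ y₀ v * fderiv ℝ ψ y₀ w) := by
    intro v w
    have e : (fun y => N y • fderiv ℝ N y) =ᶠ[𝓝 y₀] fun y => (ψ y - c) • fderiv ℝ ψ y := by
      filter_upwards [hmem] with y hy using hc y hy
    have h1 : HasFDerivAt (fun y => N y • fderiv ℝ N y) _ y₀ :=
      hNd.hasFDerivAt.smul hN1.hasFDerivAt
    have h2 : HasFDerivAt (fun y => (ψ y - c) • fderiv ℝ ψ y) _ y₀ :=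
      (hψd.hasFDerivAt.sub_const c).smul hψ1.hasFDerivAt
    have h3 := congrArg (fun A : E3 →L[ℝ] E3 →L[ℝ] ℝ => A v w)
      (h1.fderiv.symm.trans (e.fderiv_eq.trans h2.fderiv))
    simp only [add_apply, smul_apply, smul_eq_mul,
      ContinuousLinearMap.smulRight_apply] at h3
    have h4 := congrArg (fun A : E3 →L[ℝ] ℝ => A (christoffel g y₀ v w)) (hc y₀ h.mem)
    simp only [smul_apply, smul_eq_mul] at h4
    simp only [hH, covHess_apply]
    rw [hdN v, hdN w] at h3
    linear_combination h3 - h4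
  have hα' : ψ y₀ - c = α * N y₀ := by
    rw [hα]
    field_simp
  have hHN' : ∀ v w, covHess g N y₀ v w
      = α * H v w + (1 - α ^ 2) / N y₀ * (fderiv ℝ ψ y₀ v * fderiv ℝ ψ y₀ w) := by
    intro v w
    have h1 := hHN v w
    rw [hα'] at h1
    field_simp
    linarith
  have hdψ : ∀ v, fderiv ℝ ψ y₀ v = k * g y₀ (b 0) v := by
    intro v
    rw [← hm.apply_covGrad h.mem, hV]
    simp
  have he2k : e2 = k ^ 2 := by
    rw [hhe2, hV, map_smul, hdψ, hb]
    simp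
    ring
  have hgN : covGrad g N y₀ = α • covGrad g ψ y₀ := by
    refine hm.eq_of_forall h.mem fun w => ?_
    rw [hm.apply_covGrad h.mem, hdN, map_smul, smul_apply,
      hm.apply_covGrad h.mem, smul_eq_mul]
  -- the Laplacian of `ψ` near the point
  have hlapd : fderiv ℝ (covLap g ψ) y₀ (covGrad g ψ y₀)
      = (covHess g N y₀ (covGrad g ψ y₀) (covGrad g ψ y₀)
          + H (covGrad g ψ y₀) (covGrad g N y₀)) / N y₀ - α ^ 2 * e2 ^ 2 / N y₀ ^ 2 := by
    have e : covLap g ψ =ᶠ[𝓝 y₀] fun y => g y (covGrad g ψ y) (covGrad g N y) * (N y)⁻¹ := by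
      filter_upwards [hmem] with y hy
      rw [h.potential_eq y hy, hm.apply_covGrad hy, div_eq_mul_inv]
    have hgd : DifferentiableAt ℝ (covGrad g ψ) y₀ :=
      ((hm.contDiffOn_covGrad h.potential_smooth).contDiffAt hmem).differentiableAt (by simp)
    have hgd' : DifferentiableAt ℝ (covGrad g N) y₀ :=
      ((hm.contDiffOn_covGrad h.static.lapse_smooth).contDiffAt hmem).differentiableAt (by simp)
    have h1 := differentiableAt_apply₂ (hm.differentiableAt h.mem) hgd hgd'
    have h2 : HasFDerivAt (fun y => g y (covGrad g ψ y) (covGrad g N y) * (N y)⁻¹) _ y₀ :=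
      h1.hasFDerivAt.mul ((hasDerivAt_inv hN.ne').comp_hasFDerivAt y₀ hNd.hasFDerivAt)
    rw [e.fderiv_eq, h2.fderiv]
    simp only [add_apply, smul_apply, smul_eq_mul]
    rw [fderiv_apply₂ (hm.differentiableAt h.mem) hgd hgd', hm.fderiv_eq h.mem]
    have h3 := hm.apply_fderiv_covGrad h.mem h.potential_smooth (covGrad g ψ y₀) (covGrad g N y₀)
    have h4 := hm.apply_fderiv_covGrad h.mem h.static.lapse_smooth (covGrad g ψ y₀) (covGrad g ψ y₀)
    simp only [map_add, add_apply] at h3 h4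
    have h5 : g y₀ (covGrad g ψ y₀) (covGrad g N y₀) = α * e2 := by
      rw [hm.apply_covGrad h.mem, hgN, map_smul, smul_eq_mul]
    have h6 := hm.symm y₀ h.mem (covGrad g ψ y₀) (fderiv ℝ (covGrad g N) y₀ (covGrad g ψ y₀))
    have h7 := hdN (covGrad g ψ y₀)
    rw [← hhe2] at h7
    simp only [hH, Function.comp_apply]
    rw [h5, h7, h6, ← h3, ← h4]
    field_simp
    ring
  have hboch := hm.bochner h.mem h.potential_smooth hb
  rw [hlapd, h.ricci_eq, ← hhe2] at hboch
  rw [hHN', hgN] at hboch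
  have hq := hm.fderiv_apply_covGrad h.mem h.potential_smooth
  have hHV : H (covGrad g ψ y₀) (covGrad g ψ y₀) = k ^ 2 * H (b 0) (b 0) := by
    simp only [hH]
    rw [hV]
    simp
    ring
  have hHs : H (b 0) (b 0) ^ 2 ≤ ∑ i, ∑ j, covHess g ψ y₀ (b i) (b j) ^ 2 := by
    refine le_trans ?_ (Finset.single_le_sum (f := fun i => ∑ j, covHess g ψ y₀ (b i) (b j) ^ 2)
      (fun i _ => Finset.sum_nonneg fun j _ => sq_nonneg _) (Finset.mem_univ 0))
    exact Finset.single_le_sum (f := fun j => covHess g ψ y₀ (b 0) (b j) ^ 2)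
      (fun j _ => sq_nonneg _) (Finset.mem_univ 0)
  have hHαV : H (covGrad g ψ y₀) (α • covGrad g ψ y₀) = α * (k ^ 2 * H (b 0) (b 0)) := by
    rw [← hHV]
    simp [hH]
  rw [hHαV] at hboch
  have hHV' : covHess g ψ y₀ (covGrad g ψ y₀) (covGrad g ψ y₀) = k ^ 2 * H (b 0) (b 0) := hHV
  rw [hHV, hm.apply_covGrad h.mem, ← hhe2, he2k] at hboch
  -- drift Laplacian of `|∇ψ|²` computed in two ways
  have hL1 : driftLap g N (fun y => fderiv ℝ ψ y (covGrad g ψ y)) y₀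
      = covLap g (fun y => fderiv ℝ ψ y (covGrad g ψ y)) y₀
        - 2 * α * (k ^ 2 * H (b 0) (b 0)) / N y₀ := by
    rw [driftLap, hq, hgN, map_smul, smul_apply, smul_eq_mul, hHV']
    ring
  have hYd := hYs.differentiableAt infty_ne_zero
  have hL2 : driftLap g N (fun y => fderiv ℝ ψ y (covGrad g ψ y)) y₀
      = Y y₀ * (2 * k ^ 2) + N y₀ * N y₀ * driftLap g N Y y₀
        + 4 * N y₀ * α * fderiv ℝ Y y₀ (covGrad g ψ y₀) := by
    have h1 : driftLap g N (fun y => fderiv ℝ ψ y (covGrad g ψ y)) y₀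
        = driftLap g N (fun y => Y y * (N y * N y)) y₀ := by
      simp only [driftLap, covLap, hYe.fderiv_eq, covHess_congr hYe]
    rw [h1, driftLap_mul hm h.mem hb hYs (hNs.mul hNs), h.driftLap_lapse_sq, ← hhe2, he2k,
      fderiv_covGrad_comm hm h.mem, fderiv_fun_mul hNd hNd,
      fderiv_covGrad_comm hm h.mem Y ψ]
    simp only [add_apply, smul_apply, smul_eq_mul, hdN]
    ring
  have hdY : 2 * (k ^ 2 * H (b 0) (b 0)) = N y₀ * N y₀ * fderiv ℝ Y y₀ (covGrad g ψ y₀)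
      + 2 * Y y₀ * N y₀ * (α * k ^ 2) := by
    rw [← hHV', ← hq, hYe.fderiv_eq, fderiv_fun_mul hYd (hNd.fun_mul hNd)]
    have h1 : fderiv ℝ (fun y => N y * N y) y₀ (covGrad g ψ y₀) = 2 * N y₀ * (α * e2) := by
      rw [fderiv_fun_mul hNd hNd]
      simp only [add_apply, smul_apply, smul_eq_mul, hdN]
      ring
    simp only [add_apply, smul_apply, smul_eq_mul]
    rw [h1, he2k]
    ring
  have hY0 : Y y₀ * (N y₀ * N y₀) = k ^ 2 := by
    rw [hY y₀ h.mem, ← hhe2, he2k]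
  rw [hL1, hboch] at hL2
  have key : N y₀ ^ 2 * driftLap g N Y y₀
      = 2 * (∑ i, ∑ j, covHess g ψ y₀ (b i) (b j) ^ 2 - H (b 0) (b 0) ^ 2)
        + 2 * (H (b 0) (b 0) - α * k ^ 2 / N y₀) ^ 2 := by
    have hY1 : Y y₀ = k ^ 2 / N y₀ ^ 2 := by
      field_simp
      linarith
    have hdY1 : fderiv ℝ Y y₀ (covGrad g ψ y₀)
        = (2 * (k ^ 2 * H (b 0) (b 0)) - 2 * (k ^ 2 / N y₀ ^ 2) * N y₀ * (α * k ^ 2))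
          / N y₀ ^ 2 := by
      rw [hY1] at hdY
      field_simp at hdY ⊢
      linarith
    rw [hY1, hdY1] at hL2
    field_simp at hL2 ⊢
    linear_combination -hL2
  have h0 : 0 ≤ N y₀ ^ 2 * driftLap g N Y y₀ := by
    rw [key]
    have := sq_nonneg (H (b 0) (b 0) - α * k ^ 2 / N y₀)
    linarith
  exact nonneg_of_mul_nonneg_right h0 (by positivity)

end ElectrovacOn

end ElectrovacLocal

/-! ### Geodesics -/

section Geodesics

/-- Integral curves of smooth vector fields are smooth. -/
theorem contDiffOn_of_hasDerivAt {W : Type*} [NormedAddCommGroup W] [NormedSpace ℝ W]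
    {V : W → W} {O : Set W} (hV : ContDiffOn ℝ ∞ V O) {J : Set ℝ} (hJ : IsOpen J) {γ : ℝ → W}
    (hγ : ∀ s ∈ J, HasDerivAt γ (V (γ s)) s) (hm : MapsTo γ J O) : ContDiffOn ℝ ∞ γ J := by
  rw [contDiffOn_infty]
  intro n
  induction n with
  | zero =>
    exact contDiffOn_zero.2 fun s hs => (hγ s hs).continuousAt.continuousWithinAt
  | succ n ih =>
    push_cast
    rw [contDiffOn_succ_iff_deriv_of_isOpen hJ]
    refine ⟨fun s hs => (hγ s hs).differentiableAt.differentiableWithinAt, fun h => ?_, ?_⟩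
    · simp at h
    · refine ContDiffOn.congr ((hV.of_le ?_).comp ih hm) fun s hs => (hγ s hs).deriv
      exact_mod_cast le_top

variable {E : Type*} [NormedAddCommGroup E] [NormedSpace ℝ E] [FiniteDimensional ℝ E]

/-- Local existence of geodesics in coordinates. -/
theorem IsMetricOn.exists_geodesic {G : E → E →L[ℝ] E →L[ℝ] ℝ} {Ω : Set E} (hG : IsMetricOn G Ω)
    {y₀ : E} (hy₀ : y₀ ∈ Ω) {v : E} (hv : v ≠ 0) :
    ∃ ε > (0 : ℝ), ∃ y w : ℝ → E, y 0 = y₀ ∧ w 0 = v ∧ ContDiffOn ℝ ∞ y (Ioo (-ε) ε) ∧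
      ∀ s ∈ Ioo (-ε) ε, y s ∈ Ω ∧ w s ≠ 0 ∧ HasDerivAt y (w s) s ∧
        HasDerivAt w (-christoffel G (y s) (w s) (w s)) s := by
  have : CompleteSpace E := FiniteDimensional.complete ℝ E
  let V : E × E → E × E := fun p => (p.2, -christoffel G p.1 p.2 p.2)
  have hV : ContDiffOn ℝ ∞ V (Ω ×ˢ univ) := by
    intro p hp
    have h1 : ContDiffAt ℝ ∞ (fun p : E × E => christoffel G p.1) p :=
      (hG.contDiffAt_christoffel hp.1).comp p contDiffAt_fst
    exact (contDiffAt_snd.prodMk ((h1.clm_apply contDiffAt_snd).clm_apply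
      contDiffAt_snd).neg).contDiffWithinAt
  have hO : IsOpen (Ω ×ˢ (univ : Set E)) := hG.isOpen.prod isOpen_univ
  have hVa : ContDiffAt ℝ 1 V (y₀, v) :=
    (hV.contDiffAt (hO.mem_nhds ⟨hy₀, mem_univ _⟩)).of_le (by norm_cast)
  obtain ⟨γ, hγ0, ε, hε, hγ⟩ :=
    hVa.exists_forall_mem_closedBall_exists_eq_forall_mem_Ioo_hasDerivAt₀ 0
  simp only [zero_sub, zero_add] at hγ
  have hcont : ContinuousAt γ 0 := (hγ 0 ⟨by linarith, hε⟩).continuousAt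
  have hev : ∀ᶠ s in 𝓝 (0 : ℝ), (γ s).1 ∈ Ω ∧ (γ s).2 ≠ 0 := by
    have h1 : ∀ᶠ p in 𝓝 (γ 0), p.1 ∈ Ω ∧ p.2 ≠ 0 := by
      rw [hγ0]
      exact (continuousAt_fst.eventually (hG.mem_nhds hy₀)).and
        (continuousAt_snd.eventually_ne hv)
    exact hcont.eventually h1
  obtain ⟨δ, hδ, hδ'⟩ := Metric.eventually_nhds_iff_ball.1 hev
  refine ⟨min ε δ, lt_min hε hδ, fun s => (γ s).1, fun s => (γ s).2, by simp [hγ0], by simp [hγ0],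
    ?_, ?_⟩
  · refine contDiff_fst.comp_contDiffOn (contDiffOn_of_hasDerivAt hV isOpen_Ioo
      (fun s hs => hγ s ⟨?_, ?_⟩) fun s hs => ⟨(hδ' s ?_).1, mem_univ _⟩)
    · linarith [hs.1, min_le_left ε δ]
    · linarith [hs.2, min_le_left ε δ]
    · rw [mem_ball_zero_iff, Real.norm_eq_abs, abs_lt]
      exact ⟨by linarith [hs.1, min_le_right ε δ], by linarith [hs.2, min_le_right ε δ]⟩
  · intro s hs
    have h1 := hγ s ⟨by linarith [hs.1, min_le_left ε δ], by linarith [hs.2, min_le_left ε δ]⟩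
    have h2 := hδ' s (by
      rw [mem_ball_zero_iff, Real.norm_eq_abs, abs_lt]
      exact ⟨by linarith [hs.1, min_le_right ε δ], by linarith [hs.2, min_le_right ε δ]⟩)
    exact ⟨h2.1, h2.2, h1.fst, h1.snd⟩

/-- The length of the velocity of a geodesic is constant. -/
theorem IsMetricOn.geodesic_speed {G : E → E →L[ℝ] E →L[ℝ] ℝ} {Ω : Set E} (hG : IsMetricOn G Ω)
    {ε : ℝ} {y w : ℝ → E} (h : ∀ s ∈ Ioo (-ε) ε, y s ∈ Ω ∧ HasDerivAt y (w s) s ∧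
        HasDerivAt w (-christoffel G (y s) (w s) (w s)) s) {s : ℝ} (hs : s ∈ Ioo (-ε) ε) :
    G (y s) (w s) (w s) = G (y 0) (w 0) (w 0) := by
  have h0 : (0 : ℝ) ∈ Ioo (-ε) ε := ⟨by linarith [hs.1, hs.2], by linarith [hs.1, hs.2]⟩
  have key : ∀ s ∈ Ioo (-ε) ε, HasDerivAt (fun s => G (y s) (w s) (w s)) 0 s := by
    intro s hs
    obtain ⟨h1, h2, h3⟩ := h s hs
    have h4 := (hG.differentiableAt h1).hasFDerivAt.comp_hasDerivAt s h2
    have h5 := (h4.clm_apply h3).clm_apply h3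
    refine h5.congr_deriv ?_
    have h6 := hG.fderiv_eq h1 (w s) (w s) (w s)
    have h7 := hG.symm _ h1 (w s) (christoffel G (y s) (w s) (w s))
    simp only [add_apply, map_neg, neg_apply, Function.comp_apply]
    linarith
  exact isOpen_Ioo.is_const_of_deriv_eq_zero isPreconnected_Ioo
    (fun s hs => (key s hs).differentiableAt.differentiableWithinAt)
    (fun s hs => (key s hs).deriv) hs h0

variable {H : Type*} [TopologicalSpace H] {I : ModelWithCorners ℝ E H} [I.Boundaryless]
  {L : Type*} [TopologicalSpace L] [ChartedSpace H L] [IsManifold I ∞ L] {G : BilinField I L}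
  (hG : SmoothBilin I G) (hs : ∀ x (v w : TangentSpace I x), G x v w = G x w v)
  (hnd : ∀ x (v : TangentSpace I x), (∀ w, G x v w = 0) → v = 0)

include hG hs hnd in
/-- Local existence of null geodesics. -/
theorem exists_isNullGeodesicOn (z : L) {v : E} (hv : v ≠ 0)
    (hnull : (G z : E →L[ℝ] E →L[ℝ] ℝ) v v = 0) :
    ∃ ε > (0 : ℝ), ∃ (γ : ℝ → L) (y w : ℝ → E), IsNullGeodesicOn I G γ (Ioo (-ε) ε) ∧
      γ 0 = z ∧ (velocity I γ 0 : E) = v ∧ y 0 = extChartAt I z z ∧ w 0 = v ∧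
      ∀ s ∈ Ioo (-ε) ε, γ s = (extChartAt I z).symm (y s) ∧ HasDerivAt y (w s) s ∧
        HasDerivAt w (-christoffel (inChart I G z) (y s) (w s) (w s)) s := by
  have : IsManifold I 1 L := IsManifold.of_le (n := ∞) (by norm_cast)
  have hm := isMetricOn_inChart hG hs hnd z
  obtain ⟨ε, hε, y, w, hy0, hw0, hsm, hode⟩ := hm.exists_geodesic (mem_extChartAt_target z) hv
  have h0 : (0 : ℝ) ∈ Ioo (-ε) ε := ⟨by linarith, hε⟩
  have hvel : ∀ s ∈ Ioo (-ε) ε, (velocity I ((extChartAt I z).symm ∘ y) s : E)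
      = chartInv I z (y s) (w s) := by
    intro s hs'
    obtain ⟨h1, -, h3, -⟩ := hode s hs'
    have h4 := HasMFDerivAt.comp s (mdifferentiableAt_extChartAt_symm h1).hasMFDerivAt
      h3.hasFDerivAt.hasMFDerivAt
    have h5 := congrArg (fun A : ℝ →L[ℝ] E => A 1) h4.mfderiv
    refine Eq.trans h5 ?_
    change chartInv I z (y s) (ContinuousLinearMap.toSpanSingleton ℝ (w s) 1) = _
    simp
  refine ⟨ε, hε, (extChartAt I z).symm ∘ y, y, w, ?_, ?_, ?_, hy0, hw0, fun s hs' =>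
    ⟨rfl, (hode s hs').2.2⟩⟩
  · refine ⟨isOpen_Ioo, ordConnected_Ioo, ?_, ?_, ?_, ?_⟩
    · exact (contMDiffOn_extChartAt_symm z).comp hsm.contMDiffOn fun s hs' => (hode s hs').1
    · intro s hs' h1
      have h2 := (hvel s hs').symm.trans h1
      exact (hode s hs').2.1 ((chartInv_bijective (hode s hs').1).1 (h2.trans (map_zero _).symm))
    · intro s hs'
      have h1 : inChart I G z (y s) (w s) (w s) = 0 := by
        rw [hm.geodesic_speed (fun s hs' => ⟨(hode s hs').1, (hode s hs').2.2⟩) hs', hy0, hw0,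
          inChart_self]
        exact hnull
      rw [inChart_apply] at h1
      have h2 := hvel s hs'
      have h3 : (G (((extChartAt I z).symm ∘ y) s) : E →L[ℝ] E →L[ℝ] ℝ)
          (velocity I ((extChartAt I z).symm ∘ y) s)
          (velocity I ((extChartAt I z).symm ∘ y) s) = 0 := by
        rw [h2]
        exact h1
      exact h3
    · intro s hs'
      obtain ⟨h1, -, h3, h4⟩ := hode s hs'
      set x₁ := (extChartAt I z).symm (y s)
      have hsrc : (extChartAt I z).symm (y s) ∈ (extChartAt I x₁).source := mem_extChartAt_source x₁
      have hmem := (isOpen_chartChange_source (I := I) z x₁).mem_nhds ⟨h1, hsrc⟩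
      have hF : ContDiffAt ℝ ∞ (chartChange I z x₁) (y s) :=
        (contDiffOn_chartChange z x₁).contDiffAt hmem
      have hF1 : DifferentiableAt ℝ (fderiv ℝ (chartChange I z x₁)) (y s) :=
        (hF.fderiv_right (m := 1) (by norm_cast)).differentiableAt (by simp)
      have e1 : deriv (fun r => chartChange I z x₁ (y r)) =ᶠ[𝓝 s]
          fun r => fderiv ℝ (chartChange I z x₁) (y r) (w r) := by
        filter_upwards [isOpen_Ioo.mem_nhds hs', h3.continuousAt.eventually hmem] with r hr hr'
        have hFr : DifferentiableAt ℝ (chartChange I z x₁) (y r) :=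
          differentiableAt_chartChange hr'.1 hr'.2
        exact (hFr.hasFDerivAt.comp_hasDerivAt r (hode r hr).2.2.1).deriv
      have h5 : HasDerivAt (fun r => fderiv ℝ (chartChange I z x₁) (y r) (w r))
          (fderiv ℝ (fderiv ℝ (chartChange I z x₁)) (y s) (w s) (w s)
            + fderiv ℝ (chartChange I z x₁) (y s)
              (-christoffel (inChart I G z) (y s) (w s) (w s))) s :=
        (hF1.hasFDerivAt.comp_hasDerivAt s h3).clm_apply h4
      have h6 := christoffel_chartChange hG hs hnd h1 hsrc (w s) (w s)
      change deriv (deriv fun r => chartChange I z x₁ (y r)) s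
        + christoffel (inChart I G x₁) (chartChange I z x₁ (y s))
          (deriv (fun r => chartChange I z x₁ (y r)) s)
          (deriv (fun r => chartChange I z x₁ (y r)) s) = 0
      rw [e1.deriv_eq, h5.deriv, e1.eq_of_nhds, map_neg, ← h6]
      abel
  · rw [Function.comp_apply, hy0, extChartAt_to_inv]
  · refine (hvel 0 h0).trans ?_
    rw [hy0, hw0, chartInv_self]
    rfl

end Geodesics

/-! ### Photon surfaces are umbilic -/

section Immersion

open Manifold

variable {E : Type*} [NormedAddCommGroup E] [NormedSpace ℝ E]
  {H : Type*} [TopologicalSpace H] {I : ModelWithCorners ℝ E H} [I.Boundaryless]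
  {L : Type*} [TopologicalSpace L] [ChartedSpace H L]
  {E' : Type*} [NormedAddCommGroup E'] [NormedSpace ℝ E']
  {H' : Type*} [TopologicalSpace H'] {I' : ModelWithCorners ℝ E' H'} [I'.Boundaryless]
  {P : Type*} [TopologicalSpace P] [ChartedSpace H' P] {f : P → L} {q : P}

/-- An immersion has local smooth left inverses. -/
theorem exists_leftInverse_of_isImmersionAt (hf : IsImmersionAt I' I ∞ f q) :
    ∃ ρ : L → P, ContMDiffAt I I' ∞ ρ (f q) ∧ ∀ᶠ q' in 𝓝 q, ρ (f q') = q' := by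
  let k := hf.domChart
  let c := hf.codChart
  let e := hf.equiv
  have hq : q ∈ k.source := hf.mem_domChart_source
  have hfq : f q ∈ c.source := hf.mem_codChart_source
  have key : ∀ q' ∈ k.source, (k.extend I').symm (e.symm (c.extend I (f q'))).1 = q' := by
    intro q' hq'
    have h1 : k.extend I' q' ∈ (k.extend I').target :=
      (k.extend I').map_source (by rwa [k.extend_source])
    have h2 := hf.writtenInCharts h1
    have h3 : (k.extend I').symm (k.extend I' q') = q' := k.extend_left_inv hq'
    have h4 : c.extend I (f q') = e (k.extend I' q', 0) := by
      have h5 : c.extend I (f ((k.extend I').symm (k.extend I' q'))) = e (k.extend I' q', 0) := h2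
      rwa [h3] at h5
    rw [h4, e.symm_apply_apply, h3]
  refine ⟨fun z => (k.extend I').symm (e.symm (c.extend I z)).1, ?_, ?_⟩
  · have h1 : ContMDiffAt I 𝓘(ℝ, E) ∞ (c.extend I) (f q) :=
      c.contMDiffAt_extend hf.codChart_mem_maximalAtlas hfq
    have h2 : ContDiff ℝ ∞ fun y : E => (e.symm y).1 := by fun_prop
    have h3 : ContMDiffAt 𝓘(ℝ, E') I' ∞ (k.extend I').symm (e.symm (c.extend I (f q))).1 := by
      have h4 : (e.symm (c.extend I (f q))).1 = k.extend I' q := by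
        have h5 : c.extend I (f ((k.extend I').symm (k.extend I' q))) = e (k.extend I' q, 0) :=
          hf.writtenInCharts ((k.extend I').map_source (by rwa [k.extend_source]))
        rw [show (k.extend I').symm (k.extend I' q) = q from k.extend_left_inv hq] at h5
        rw [h5, e.symm_apply_apply]
      rw [h4]
      refine (contMDiffOn_extend_symm hf.domChart_mem_maximalAtlas).contMDiffAt ?_
      have h5 : IsOpen (Set.image I' k.target) := I'.toHomeomorph.isOpenMap _ k.open_target
      exact h5.mem_nhds ⟨k q, k.map_source hq, rfl⟩
    exact h3.comp (f q) (h2.contMDiff.contMDiffAt.comp (f q) h1)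
  · filter_upwards [k.open_source.mem_nhds hq] with q' hq' using key q' hq'

theorem mfderiv_injective_of_isImmersionAt (hf : IsImmersionAt I' I ∞ f q) :
    Function.Injective (mfderiv I' I f q) := by
  obtain ⟨ρ, hρ, h⟩ := exists_leftInverse_of_isImmersionAt hf
  have h1 : mfderiv I' I' (ρ ∘ f) q = (mfderiv I I' ρ (f q)).comp (mfderiv I' I f q) :=
    mfderiv_comp q (hρ.mdifferentiableAt (by simp)) (hf.contMDiffAt.mdifferentiableAt (by simp))
  have h2 : mfderiv I' I' (ρ ∘ f) q = mfderiv I' I' id q := by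
    refine Filter.EventuallyEq.mfderiv_eq ?_
    filter_upwards [h] with q' hq' using hq'
  rw [h2, mfderiv_id] at h1
  intro v w hvw
  have h3 := congrArg (fun A => A v) h1
  have h4 := congrArg (fun A => A w) h1
  have h5 : v = mfderiv I I' ρ (f q) (mfderiv I' I f q v) := h3
  have h6 : w = mfderiv I I' ρ (f q) (mfderiv I' I f q w) := h4
  rw [h5, h6, hvw]

end Immersion

section PhotonSurface

variable {E : Type*} [NormedAddCommGroup E] [NormedSpace ℝ E] [FiniteDimensional ℝ E]
  {H : Type*} [TopologicalSpace H] {I : ModelWithCorners ℝ E H} [I.Boundaryless]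
  {L : Type*} [TopologicalSpace L] [ChartedSpace H L] [IsManifold I ∞ L] [IsManifold I 1 L]
  {E' : Type*} [NormedAddCommGroup E'] [NormedSpace ℝ E']
  {H' : Type*} [TopologicalSpace H'] {I' : ModelWithCorners ℝ E' H'} [I'.Boundaryless]
  {P : Type*} [TopologicalSpace P] [ChartedSpace H' P] {f : P → L} {q : P}
  {G : BilinField I L}

/-- The Hessian of a function which is constant on a photon surface vanishes on the null vectors
tangent to the photon surface. -/
theorem IsPhotonSurface.covHess_eq_zero (hP : IsPhotonSurface I I' G f) (hG : SmoothBilin I G)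
    (hs : ∀ z v w, G z v w = G z w v) (hnd : ∀ z v, (∀ w, G z v w = 0) → v = 0) {u : L → ℝ}
    (hu : ContDiffAt ℝ ∞ (u ∘ (extChartAt I (f q)).symm) (extChartAt I (f q) (f q)))
    (hc : ∀ᶠ q' in 𝓝 q, u (f q') = u (f q)) {v : TangentSpace I' q} {w₀ : E}
    (hw₀ : (mfderiv I' I f q v : E) = w₀) (hne : w₀ ≠ 0)
    (hnull : (G (f q) : E →L[ℝ] E →L[ℝ] ℝ) w₀ w₀ = 0) :
    covHess (inChart I G (f q)) (u ∘ (extChartAt I (f q)).symm) (extChartAt I (f q) (f q)) w₀ w₀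
      = 0 := by
  obtain ⟨ε, hε, γ, y, w, hγ, hγ0, hv0, hy0, hw0, hode⟩ :=
    exists_isNullGeodesicOn hG hs hnd (f q) hne hnull
  have h0 : (0 : ℝ) ∈ Ioo (-ε) ε := ⟨by linarith, hε⟩
  have bundle_eq : ∀ (a b : L) (v' w' : E), a = b → v' = w' →
      (⟨a, v'⟩ : TangentBundle I L) = ⟨b, w'⟩ := by
    rintro a b v' w' rfl rfl
    rfl
  have htan := hP.null_geodesics γ _ hγ 0 h0
    ⟨q, v, bundle_eq _ _ _ _ hγ0.symm (hw₀.trans hv0.symm)⟩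
  set û := u ∘ (extChartAt I (f q)).symm with hû
  have hycont : ContinuousAt y 0 := (hode 0 h0).2.1.continuousAt
  have hγcont : Tendsto γ (𝓝 0) (𝓝 (f q)) := by
    have h1 : Tendsto (fun s => (extChartAt I (f q)).symm (y s)) (𝓝 0) (𝓝 (f q)) := by
      have h2 := (continuousAt_extChartAt_symm (I := I) (f q)).tendsto
      rw [extChartAt_to_inv] at h2
      rw [ContinuousAt, hy0] at hycont
      exact h2.comp hycont
    refine h1.congr' ?_
    filter_upwards [isOpen_Ioo.mem_nhds h0] with s hs' using ((hode s hs').1).symm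
  have hconst : ∀ᶠ s in 𝓝 (0 : ℝ), û (y s) = u (f q) := by
    rw [hP.embedding.isEmbedding.nhds_eq_comap, eventually_comap] at hc
    filter_upwards [isOpen_Ioo.mem_nhds h0, hγcont.eventually hc] with s hs' h1
    obtain ⟨q', v', h2⟩ := htan s hs'
    have h3 : f q' = γ s := congrArg (fun b : TangentBundle I L => b.1) h2
    rw [hû, Function.comp_apply, ← (hode s hs').1, ← h3]
    exact h1 q' h3
  have hd : ∀ᶠ z in 𝓝 (extChartAt I (f q) (f q)), DifferentiableAt ℝ û z := by
    filter_upwards [(hu.of_le two_le_infty).eventually (by simp)] with z hz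
      using hz.differentiableAt (by simp)
  have hd2 : DifferentiableAt ℝ (fderiv ℝ û) (y 0) := by
    rw [hy0]
    exact (hu.fderiv_right (m := 1) (by norm_cast)).differentiableAt (by simp)
  have hderiv : ∀ᶠ s in 𝓝 (0 : ℝ), fderiv ℝ û (y s) (w s) = 0 := by
    rw [ContinuousAt, hy0] at hycont
    filter_upwards [isOpen_Ioo.mem_nhds h0, hycont.eventually hd, hconst.eventually_nhds]
      with s hs' h1 h2
    have h3 := h1.hasFDerivAt.comp_hasDerivAt s (hode s hs').2.1
    have h4 : HasDerivAt (û ∘ y) 0 s :=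
      (hasDerivAt_const s (u (f q))).congr_of_eventuallyEq h2
    exact h3.unique h4
  have h5 : HasDerivAt (fun s => fderiv ℝ û (y s) (w s))
      (fderiv ℝ (fderiv ℝ û) (y 0) (w 0) (w 0)
        + fderiv ℝ û (y 0) (-christoffel (inChart I G (f q)) (y 0) (w 0) (w 0))) 0 :=
    (hd2.hasFDerivAt.comp_hasDerivAt (0 : ℝ) (hode 0 h0).2.1).clm_apply (hode 0 h0).2.2
  have h6 : HasDerivAt (fun s => fderiv ℝ û (y s) (w s)) 0 0 :=
    (hasDerivAt_const (0 : ℝ) (0 : ℝ)).congr_of_eventuallyEq hderiv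
  have h7 := h5.unique h6
  rw [hy0, hw0, map_neg] at h7
  rw [covHess_apply]
  linarith

end PhotonSurface

section StaticPhotonSurface

variable {M : Type*} [TopologicalSpace M] [ChartedSpace E3 M] [IsManifold (𝓡 3) ∞ M]
  {P : Type*} [TopologicalSpace P] [ChartedSpace E3 P]
  {g : RiemMetric3 M} {N : M → ℝ} {f : P → ℝ × M} {q : P}

theorem IsPhotonSurface.mfderiv_injective
    (hP : IsPhotonSurface I4 (𝓡 3) (staticMetric g N) f) :
    Function.Injective (mfderiv (𝓡 3) I4 f q) :=
  mfderiv_injective_of_isImmersionAt (hP.embedding.isImmersion.isImmersionAt q)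

theorem IsPhotonSurface.hasMFDerivAt
    (hP : IsPhotonSurface I4 (𝓡 3) (staticMetric g N) f) :
    HasMFDerivAt (𝓡 3) I4 f q (mfderiv (𝓡 3) I4 f q) :=
  ((hP.embedding.isImmersion.isImmersionAt q).contMDiffAt.mdifferentiableAt
    (by simp)).hasMFDerivAt

/-- The differential of a function on `M` which is constant on a photon surface vanishes on the
spatial parts of the vectors tangent to the photon surface. -/
theorem IsPhotonSurface.apply_mfderiv_eq_zero
    (hP : IsPhotonSurface I4 (𝓡 3) (staticMetric g N) f) {u : M → ℝ} {l : E3 →L[ℝ] ℝ}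
    (hu : HasMFDerivAt (𝓡 3) 𝓘(ℝ, ℝ) u (f q).2 l)
    (hc : ∀ᶠ q' in 𝓝 q, u (f q').2 = u (f q).2) (v : TangentSpace (𝓡 3) q) :
    l ((mfderiv (𝓡 3) I4 f q v : ℝ × E3)).2 = 0 := by
  have h1 : HasMFDerivAt (𝓡 3) 𝓘(ℝ, ℝ) (fun q' => u (f q').2) q
      (l.comp ((ContinuousLinearMap.snd ℝ ℝ E3).comp
        (mfderiv (𝓡 3) I4 f q : E3 →L[ℝ] ℝ × E3))) :=
    hu.comp q ((hasMFDerivAt_snd (I := 𝓘(ℝ, ℝ)) (I' := 𝓡 3) (f q)).comp q hP.hasMFDerivAt)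
  have h2 : HasMFDerivAt (𝓡 3) 𝓘(ℝ, ℝ) (fun q' => u (f q').2) q (0 : E3 →L[ℝ] ℝ) :=
    (hasMFDerivAt_const (u (f q).2) q).congr_of_eventuallyEq hc
  exact congrArg (fun A : E3 →L[ℝ] ℝ => A v) (hasMFDerivAt_unique h1 h2)

/-- The tangent spaces of a photon surface in a regular level set. -/
theorem IsPhotonSurface.exists_mfderiv_eq
    (hP : IsPhotonSurface I4 (𝓡 3) (staticMetric g N) f) {u : M → ℝ} {l : E3 →L[ℝ] ℝ}
    (hu : HasMFDerivAt (𝓡 3) 𝓘(ℝ, ℝ) u (f q).2 l) (hl : l ≠ 0)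
    (hc : ∀ᶠ q' in 𝓝 q, u (f q').2 = u (f q).2) {w : ℝ × E3} (hw : l w.2 = 0) :
    ∃ v : TangentSpace (𝓡 3) q, (mfderiv (𝓡 3) I4 f q v : ℝ × E3) = w := by
  let D : E3 →ₗ[ℝ] ℝ × E3 := (mfderiv (𝓡 3) I4 f q : E3 →L[ℝ] ℝ × E3).toLinearMap
  let l' : ℝ × E3 →ₗ[ℝ] ℝ := l.toLinearMap ∘ₗ LinearMap.snd ℝ ℝ E3
  have h1 : LinearMap.range D ≤ LinearMap.ker l' := by
    rintro _ ⟨v, rfl⟩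
    exact hP.apply_mfderiv_eq_zero hu hc v
  have h2 : Module.finrank ℝ (LinearMap.range D) = 3 := by
    have hD : Function.Injective D := hP.mfderiv_injective (q := q)
    rw [LinearMap.finrank_range_of_inj hD]
    simp
  have h3 : Module.finrank ℝ (LinearMap.ker l') = 3 := by
    have h4 := LinearMap.finrank_range_add_finrank_ker l'
    have h5 : Function.Surjective l' := by
      refine LinearMap.surjective fun h => hl ?_
      ext v
      exact congrArg (fun A : ℝ × E3 →ₗ[ℝ] ℝ => A (0, v)) h
    rw [LinearMap.range_eq_top.2 h5, finrank_top] at h4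
    simp at h4
    omega
  have h6 := Submodule.eq_of_le_of_finrank_eq h1 (h2.trans h3.symm)
  have h7 : w ∈ LinearMap.range D := by
    rw [h6]
    exact hw
  exact h7

/-- A photon surface in a regular level set of a function is umbilic: the tangential part of the
Hessian is a multiple of the metric. -/
theorem IsPhotonSurface.covHess_tangential
    (hP : IsPhotonSurface I4 (𝓡 3) (staticMetric g N) f)
    (hN : ContMDiff (𝓡 3) 𝓘(ℝ, ℝ) ∞ N) (hpos : ∀ x, 0 < N x) {u : M → ℝ} {x : M}
    (hx : (f q).2 = x) {l : E3 →L[ℝ] ℝ} (hu' : HasMFDerivAt (𝓡 3) 𝓘(ℝ, ℝ) u x l) (hl : l ≠ 0)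
    (hu : ContDiffAt ℝ ∞ (chartFun u x) (extChartAt (𝓡 3) x x))
    (hc : ∀ᶠ q' in 𝓝 q, u (f q').2 = u x) {e : E3} (he : l e = 0) :
    covHess (chartMetric g x) (chartFun u x) (extChartAt (𝓡 3) x x) e e
      = chartMetric g x (extChartAt (𝓡 3) x x) e e
        * fderiv ℝ (chartFun u x) (extChartAt (𝓡 3) x x)
          (covGrad (chartMetric g x) (chartFun N x) (extChartAt (𝓡 3) x x)) / N x := by
  subst hx
  rcases eq_or_ne e 0 with rfl | he0
  · simp
  set x := (f q).2 with hx
  set t := (f q).1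
  set y := extChartAt (𝓡 3) x x
  have hst := isStaticOn_chart g hN hpos x
  have hyt : y ∈ (extChartAt (𝓡 3) x).target := mem_extChartAt_target x
  have hNx := hpos x
  have hgpos : 0 < chartMetric g x y e e := hst.pos y hyt e he0
  set a := Real.sqrt (chartMetric g x y e e) / N x with ha
  have ha2 : a * a * (N x) ^ 2 = chartMetric g x y e e := by
    rw [ha]
    field_simp
    rw [Real.sq_sqrt hgpos.le]
  obtain ⟨v, hv⟩ := hP.exists_mfderiv_eq hu' hl hc (w := (a, e)) he
  have hcen : extChartAt I4 (f q) (f q) = (t, y) := extChartAt_I4_apply _ _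
  have hcomp : (fun z : ℝ × M => u z.2) ∘ (extChartAt I4 (f q)).symm
      = chartFun u x ∘ Prod.snd := by
    ext z
    simp only [Function.comp_apply, extChartAt_I4_symm_apply]
    rfl
  have hu4 : ContDiffAt ℝ ∞ (chartFun u x ∘ Prod.snd) ((t, y) : ℝ × E3) :=
    ContDiffAt.comp ((t, y) : ℝ × E3) hu contDiffAt_snd
  have h1 := hP.covHess_eq_zero (q := q) (u := fun z => u z.2) (w₀ := ((a, e) : ℝ × E3))
    (smoothBilin_staticMetric g hN hpos) (staticMetric_symm g hN hpos)
    (staticMetric_nondeg g hN hpos) (by rw [hcomp, hcen]; exact hu4) hc hv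
    (fun h => he0 (congrArg Prod.snd h)) (by
      rw [staticMetric_apply, ← chartMetric_self]
      change -(N x) ^ 2 * (a * a) + chartMetric g x y e e = 0
      linarith)
  rw [hcomp, hcen, covHess_apply] at h1
  have hev : inChart I4 (staticMetric g N) (f q)
      =ᶠ[𝓝 ((t, y) : ℝ × E3)] staticCoord (chartMetric g x) (chartFun N x) := by
    have h2 : ∀ᶠ z in 𝓝 ((t, y) : ℝ × E3), z.2 ∈ (extChartAt (𝓡 3) x).target :=
      continuousAt_snd.eventually ((isOpen_extChartAt_target (I := 𝓡 3) x).mem_nhds hyt)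
    filter_upwards [h2] with z hz
    exact inChart_staticMetric g N hz
  rw [(christoffel_congr hev).eq_of_nhds, hst.christoffel_staticCoord hyt] at h1
  have hd : ∀ᶠ z in 𝓝 y, DifferentiableAt ℝ (chartFun u x) z := by
    filter_upwards [(hu.of_le two_le_infty).eventually (by simp)] with z hz
      using hz.differentiableAt (by simp)
  have hfd : ∀ z : ℝ × E3, DifferentiableAt ℝ (chartFun u x) z.2 →
      fderiv ℝ (chartFun u x ∘ Prod.snd) z
        = (fderiv ℝ (chartFun u x) z.2).comp (ContinuousLinearMap.snd ℝ ℝ E3) := fun z hz =>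
    (hz.hasFDerivAt.comp z hasFDerivAt_snd).fderiv
  have hev2 : fderiv ℝ (chartFun u x ∘ Prod.snd) =ᶠ[𝓝 ((t, y) : ℝ × E3)]
      fun z => (fderiv ℝ (chartFun u x) z.2).comp (ContinuousLinearMap.snd ℝ ℝ E3) := by
    have h2 : ∀ᶠ z in 𝓝 ((t, y) : ℝ × E3), DifferentiableAt ℝ (chartFun u x) z.2 :=
      continuousAt_snd.eventually hd
    filter_upwards [h2] with z hz using hfd z hz
  have hd2 : DifferentiableAt ℝ (fderiv ℝ (chartFun u x)) y :=
    (hu.fderiv_right (m := 1) (by norm_cast)).differentiableAt (by simp)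
  have h3 : fderiv ℝ (fderiv ℝ (chartFun u x ∘ Prod.snd)) ((t, y) : ℝ × E3) (a, e) (a, e)
      = fderiv ℝ (fderiv ℝ (chartFun u x)) y e e := by
    rw [hev2.fderiv_eq]
    have h4 : HasFDerivAt (fun z : ℝ × E3 => fderiv ℝ (chartFun u x) z.2)
        ((fderiv ℝ (fderiv ℝ (chartFun u x)) y).comp (ContinuousLinearMap.snd ℝ ℝ E3)) (t, y) :=
      HasFDerivAt.comp (x := ((t, y) : ℝ × E3)) (g := fderiv ℝ (chartFun u x)) (f := Prod.snd)
        hd2.hasFDerivAt hasFDerivAt_snd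
    rw [(h4.clm_comp (hasFDerivAt_const (ContinuousLinearMap.snd ℝ ℝ E3) _)).fderiv]
    simp
  rw [h3, hfd _ (hd.self_of_nhds)] at h1
  simp only [ContinuousLinearMap.comp_apply, ContinuousLinearMap.coe_snd', map_add, map_smul,
    smul_eq_mul, chartFun_self] at h1
  rw [covHess_apply, eq_div_iff hNx.ne', ← ha2]
  have h8 : chartFun N x y = N x := chartFun_self N x
  rw [h8] at h1
  linear_combination N x * h1

end StaticPhotonSurface

/-! ### Extension of potentials over regular level sets -/

section EuclideanExtension

variable {X : Type*} [NormedAddCommGroup X] [NormedSpace ℝ X]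

theorem eq_of_hasFDerivAt_zero {d : X → ℝ} {S : Set X} (hS : Convex ℝ S)
    (hd : ∀ z ∈ S, HasFDerivAt d (0 : X →L[ℝ] ℝ) z) {a b : X} (ha : a ∈ S) (hb : b ∈ S) :
    d a = d b := by
  have h1 := hS.norm_image_sub_le_of_norm_hasFDerivWithin_le (f := d) (f' := fun _ => 0) (C := 0)
    (fun z hz => (hd z hz).hasFDerivWithinAt) (fun z _ => by simp) hb ha
  rw [zero_mul, norm_le_zero_iff, sub_eq_zero] at h1
  exact h1

/-- A function which is locally constant on the superlevel set of a regular value is constant on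
the part of it in a neighbourhood of a point of the level set. -/
theorem eventually_eq_of_superlevel {h d : X → ℝ} {y₀ : X} {l : X →L[ℝ] ℝ}
    (hh : HasStrictFDerivAt h l y₀) (hl : l ≠ 0)
    (hd : ∀ᶠ z in 𝓝 y₀, h y₀ < h z → HasFDerivAt d (0 : X →L[ℝ] ℝ) z) :
    ∃ k, ∀ᶠ z in 𝓝 y₀, h y₀ < h z → d z = k := by
  obtain ⟨v, hv⟩ : ∃ v, l v = 1 := by
    obtain ⟨v, hv⟩ : ∃ v, l v ≠ 0 := by
      by_contra! hc
      exact hl (by ext v; simpa using hc v)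
    exact ⟨(l v)⁻¹ • v, by rw [map_smul, smul_eq_mul, inv_mul_cancel₀ hv]⟩
  have hv0 : 0 < ‖v‖ := norm_pos_iff.2 fun h0 => by simp [h0] at hv
  have h1 := hh.isLittleO.def (c := 1 / (2 * ‖v‖)) (by positivity)
  rw [nhds_prod_eq] at h1
  obtain ⟨A, hA, B, hB, hAB⟩ := eventually_prod_iff.1 h1
  obtain ⟨ρ, hρ, hball⟩ := Metric.eventually_nhds_iff_ball.1 ((hA.and hB).and hd)
  have hmono : ∀ z ∈ Metric.ball y₀ ρ, ∀ t : ℝ, 0 ≤ t → z + t • v ∈ Metric.ball y₀ ρ →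
      h z + t / 2 ≤ h (z + t • v) := by
    intro z hz t ht hzt
    have h2 := hAB (hball _ hzt).1.1 (hball _ hz).1.2
    simp only [add_sub_cancel_left, map_smul, hv, smul_eq_mul, mul_one, norm_smul,
      Real.norm_eq_abs, abs_of_nonneg ht] at h2
    have h3 : 1 / (2 * ‖v‖) * (t * ‖v‖) = t / 2 := by field_simp
    rw [h3] at h2
    linarith [(abs_le.1 h2).1]
  set s := ρ / (2 * ‖v‖) with hs
  have hs0 : 0 < s := by positivity
  have hsv : ‖s • v‖ = ρ / 2 := by
    rw [norm_smul, Real.norm_eq_abs, abs_of_pos hs0, hs]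
    field_simp
  obtain ⟨δ', hδ', hnear⟩ := Metric.eventually_nhds_iff_ball.1
    (hh.hasFDerivAt.continuousAt.eventually (lt_mem_nhds (show h y₀ - s / 2 < h y₀ by linarith)))
  set δ := min δ' (ρ / 2)
  have hδ0 : 0 < δ := lt_min hδ' (by linarith)
  have hδρ : δ ≤ ρ / 2 := min_le_right _ _
  have hin : ∀ z ∈ Metric.ball y₀ δ, ∀ t ∈ Icc 0 s, z + t • v ∈ Metric.ball y₀ ρ := by
    intro z hz t ht
    rw [mem_ball_iff_norm] at hz ⊢
    have h2 : ‖t • v‖ ≤ ‖s • v‖ := by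
      rw [norm_smul, norm_smul, Real.norm_eq_abs, Real.norm_eq_abs, abs_of_nonneg ht.1,
        abs_of_pos hs0]
      exact mul_le_mul_of_nonneg_right ht.2 hv0.le
    calc ‖z + t • v - y₀‖ = ‖(z - y₀) + t • v‖ := by congr 1; abel
      _ ≤ ‖z - y₀‖ + ‖t • v‖ := norm_add_le _ _
      _ < ρ := by linarith
  have hup : ∀ z ∈ Metric.ball y₀ δ, h y₀ < h z → d z = d (z + s • v) := by
    intro z hz hzh
    refine eq_of_hasFDerivAt_zero (convex_segment z (z + s • v)) (fun w hw => ?_)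
      (left_mem_segment ℝ _ _) (right_mem_segment ℝ _ _)
    rw [segment_eq_image'] at hw
    obtain ⟨θ, hθ, rfl⟩ := hw
    have h0 : z + θ • (s • v) = z + (θ * s) • v := by rw [smul_smul]
    simp only [add_sub_cancel_left, h0]
    have h2 : θ * s ∈ Icc 0 s := ⟨mul_nonneg hθ.1 hs0.le, mul_le_of_le_one_left hs0.le hθ.2⟩
    have h3 := hin z hz _ h2
    refine (hball _ h3).2 ?_
    have h4 := hmono z (by simpa using hin z hz 0 ⟨le_rfl, hs0.le⟩) _ h2.1 h3
    linarith [h2.1]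
  have htop : ∀ z ∈ Metric.ball y₀ δ, ∀ z' ∈ Metric.ball y₀ δ, d (z + s • v) = d (z' + s • v) := by
    intro z hz z' hz'
    refine eq_of_hasFDerivAt_zero (d := fun w => d (w + s • v)) (convex_ball y₀ δ)
      (fun w hw => ?_) hz hz'
    have h3 := hin w hw s ⟨hs0.le, le_rfl⟩
    have h4 := hmono w (by simpa using hin w hw 0 ⟨le_rfl, hs0.le⟩) s hs0.le h3
    have h5 := hnear w (Metric.ball_subset_ball (min_le_left _ _) hw)
    exact (hasFDerivAt_comp_add_right (s • v)).2 ((hball _ h3).2 (by linarith))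
  by_cases hex : ∃ z ∈ Metric.ball y₀ δ, h y₀ < h z
  · obtain ⟨z₁, hz₁, hz₁'⟩ := hex
    refine ⟨d z₁, ?_⟩
    filter_upwards [Metric.ball_mem_nhds y₀ hδ0] with z hz hzh
    rw [hup z hz hzh, hup z₁ hz₁ hz₁', htop z hz z₁ hz₁]
  · refine ⟨0, ?_⟩
    filter_upwards [Metric.ball_mem_nhds y₀ hδ0] with z hz hzh
    exact absurd ⟨z, hz, hzh⟩ hex

end EuclideanExtension

section Extension

variable {M : Type*} [TopologicalSpace M] [ChartedSpace E3 M] [IsManifold (𝓡 3) ∞ M]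
  {α : M → E3 →L[ℝ] ℝ} {p q h : M → ℝ} {x : M}

theorem fderiv_chartFun_self (hh : MDifferentiableAt (𝓡 3) 𝓘(ℝ, ℝ) h x) :
    fderiv ℝ (chartFun h x) (extChartAt (𝓡 3) x x)
      = (mfderiv (𝓡 3) 𝓘(ℝ, ℝ) h x : E3 →L[ℝ] ℝ) := by
  have : IsManifold (𝓡 3) 1 M := isManifold_one
  have h1 : HasMFDerivAt (𝓡 3) 𝓘(ℝ, ℝ) h ((extChartAt (𝓡 3) x).symm (extChartAt (𝓡 3) x x))
      (mfderiv (𝓡 3) 𝓘(ℝ, ℝ) h x : E3 →L[ℝ] ℝ) := by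
    rw [extChartAt_to_inv]
    exact hh.hasMFDerivAt
  have h2 := (fderiv_comp_symm (mem_extChartAt_target x) h1).fderiv
  rw [chartInv_self] at h2
  exact h2

theorem contDiffAt_chartFun_self (hh : ContMDiffAt (𝓡 3) 𝓘(ℝ, ℝ) ∞ h x) :
    ContDiffAt ℝ ∞ (chartFun h x) (extChartAt (𝓡 3) x x) := by
  have h1 : ContMDiffAt 𝓘(ℝ, E3) (𝓡 3) ∞ (extChartAt (𝓡 3) x).symm (extChartAt (𝓡 3) x x) :=
    (contMDiffOn_extChartAt_symm x).contMDiffAt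
      ((isOpen_extChartAt_target x).mem_nhds (mem_extChartAt_target x))
  have h2 : ContMDiffAt (𝓡 3) 𝓘(ℝ, ℝ) ∞ h
      ((extChartAt (𝓡 3) x).symm (extChartAt (𝓡 3) x x)) := by
    rwa [extChartAt_to_inv]
  exact (h2.comp _ h1).contDiffAt

theorem eventually_chart {Q : M → Prop} (hQ : ∀ᶠ y in 𝓝 x, Q y) :
    ∀ᶠ z in 𝓝 (extChartAt (𝓡 3) x x), Q ((extChartAt (𝓡 3) x).symm z) := by
  have h1 := tendsto_extChartAt_symm (mem_extChartAt_target (I := 𝓡 3) x)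
  rw [extChartAt_to_inv] at h1
  exact h1.eventually hQ

theorem eventually_of_chart {Q : M → Prop}
    (hQ : ∀ᶠ z in 𝓝 (extChartAt (𝓡 3) x x), Q ((extChartAt (𝓡 3) x).symm z)) :
    ∀ᶠ y in 𝓝 x, Q y := by
  filter_upwards [(continuousAt_extChartAt x).eventually hQ,
    extChartAt_source_mem_nhds (I := 𝓡 3) x] with y hy hy'
  rwa [(extChartAt (𝓡 3) x).left_inv hy'] at hy

theorem IsLocalMax.mfderiv_eq_zero (hh : MDifferentiableAt (𝓡 3) 𝓘(ℝ, ℝ) h x)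
    (hmax : IsLocalMax h x) : (mfderiv (𝓡 3) 𝓘(ℝ, ℝ) h x : E3 →L[ℝ] ℝ) = 0 := by
  rw [← fderiv_chartFun_self hh]
  refine IsLocalMax.fderiv_eq_zero ?_
  filter_upwards [eventually_chart hmax] with z hz
  rw [chartFun_self]
  exact hz

/-- A potential on the regular superlevel set of a function extends to the points of the level
set. -/
theorem IsClosedForm.exists_potential_superlevel (hα : IsClosedForm α)
    (hh : ContMDiffAt (𝓡 3) 𝓘(ℝ, ℝ) ∞ h x)
    (hd : (mfderiv (𝓡 3) 𝓘(ℝ, ℝ) h x : E3 →L[ℝ] ℝ) ≠ 0)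
    (hp : ∀ᶠ y in 𝓝 x, h x < h y → IsPotentialAt α p y) :
    ∃ q, IsPotentialAt α q x ∧ ∀ᶠ y in 𝓝 x, h x < h y → p y = q y := by
  obtain ⟨q, hq⟩ := hα.exists_potential x
  have hst := (contDiffAt_chartFun_self hh).hasStrictFDerivAt (by simp)
  rw [fderiv_chartFun_self (hh.mdifferentiableAt (by simp))] at hst
  obtain ⟨k, hk⟩ := eventually_eq_of_superlevel (d := fun z => chartFun p x z - chartFun q x z)
    hst hd (by
      filter_upwards [eventually_chart hp, eventually_chart hq.eventually,
        eventually_mem_target (mem_extChartAt_target (I := 𝓡 3) x)] with z hz hz' hzt hlt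
      rw [chartFun_self] at hlt
      have h1 := ((hz hlt).chart hzt).self_of_nhds.sub (hz'.chart hzt).self_of_nhds
      rwa [sub_self] at h1)
  refine ⟨fun y => q y + k, hq.add_const k, eventually_of_chart ?_⟩
  filter_upwards [hk] with z hz hlt
  rw [chartFun_self] at hz
  have h1 := hz hlt
  simp only [Function.comp_apply] at h1
  linarith

/-- A function takes larger values near its regular points. -/
theorem frequently_lt_of_mfderiv_ne_zero (hh : MDifferentiableAt (𝓡 3) 𝓘(ℝ, ℝ) h x)
    (hd : (mfderiv (𝓡 3) 𝓘(ℝ, ℝ) h x : E3 →L[ℝ] ℝ) ≠ 0) : ∃ᶠ y in 𝓝 x, h x < h y := by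
  intro hc
  refine hd (IsLocalMax.mfderiv_eq_zero hh ?_)
  filter_upwards [hc] with y hy using not_lt.1 hy

theorem IsPotentialAt.eventuallyEq_of_eq (hq : IsPotentialAt α q x) (hp : IsPotentialAt α p x)
    (he : ∃ᶠ y in 𝓝 x, q y = p y) : q =ᶠ[𝓝 x] p := by
  obtain ⟨c, hc⟩ := hq.eventually_eq_add_const hp
  obtain ⟨y, hy, hy'⟩ := (he.and_eventually hc).exists
  have hc0 : c = 0 := by linarith
  filter_upwards [hc] with y hy
  rw [hy, hc0, add_zero]

/-- Consistent germs of potentials along a set are the germs of one function. -/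
theorem exists_glue_potential [T2Space M] [SecondCountableTopology M] {A : Set M}
    {q : M → M → ℝ} (hq : ∀ x ∈ A, IsPotentialAt α (q x) x)
    (hc : ∀ x ∈ A, ∀ᶠ x' in 𝓝 x, x' ∈ A → q x =ᶠ[𝓝 x'] q x') :
    ∃ Q : M → ℝ, ∀ x ∈ A, Q =ᶠ[𝓝 x] q x := by
  have : LocallyCompactSpace M := ChartedSpace.locallyCompactSpace E3 M
  have : LocallyConnectedSpace M := ChartedSpace.locallyConnectedSpace E3 M
  let _ : MetricSpace M := TopologicalSpace.metrizableSpaceMetric M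
  have h1 : ∀ x, ∃ r > 0, x ∈ A → ∀ y ∈ Metric.ball x (3 * r), IsPotentialAt α (q x) y ∧
      (y ∈ A → q x =ᶠ[𝓝 y] q y) := by
    intro x
    by_cases hx : x ∈ A
    · obtain ⟨r, hr, h⟩ := Metric.eventually_nhds_iff_ball.1 ((hq x hx).eventually.and (hc x hx))
      exact ⟨r / 3, by positivity, fun _ => by rwa [mul_div_cancel₀ r (by norm_num)]⟩
    · exact ⟨1, one_pos, fun h => absurd h hx⟩
  choose r hr h1 using h1
  have h2 : ∀ x, ∃ V ⊆ Metric.ball x (r x), IsOpen V ∧ x ∈ V ∧ IsConnected V := fun x =>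
    locallyConnectedSpace_iff_subsets_isOpen_isConnected.1 this x _ (Metric.ball_mem_nhds x (hr x))
  choose V hVr hVo hxV hVc using h2
  have key : ∀ x ∈ A, ∀ x' ∈ A, r x' ≤ r x → ∀ y ∈ V x, y ∈ V x' → q x y = q x' y := by
    intro x hx x' hx' hrr y hy hy'
    have hsub : V x' ⊆ Metric.ball x (3 * r x) := by
      intro z hz
      have e1 := Metric.mem_ball.1 (hVr x' hz)
      have e2 := Metric.mem_ball'.1 (hVr x' hy')
      have e3 := Metric.mem_ball.1 (hVr x hy)
      have e4 := dist_triangle4 z x' y x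
      rw [Metric.mem_ball]
      linarith
    have hsub' : V x' ⊆ Metric.ball x' (3 * r x') := (hVr x').trans
      (Metric.ball_subset_ball (by linarith [hr x']))
    obtain ⟨c, hc'⟩ := exists_eq_add_const_of_isPreconnected (hVo x') (hVc x').isPreconnected
      (fun z hz => (h1 x hx z (hsub hz)).1) (fun z hz => (h1 x' hx' z (hsub' hz)).1)
    have e1 := ((h1 x hx x' (hsub (hxV x'))).2 hx').self_of_nhds
    have e2 := hc' x' (hxV x')
    have e3 := hc' y hy'
    linarith
  have key' : ∀ x ∈ A, ∀ x' ∈ A, ∀ y ∈ V x, y ∈ V x' → q x y = q x' y := by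
    intro x hx x' hx' y hy hy'
    rcases le_total (r x') (r x) with hle | hle
    · exact key x hx x' hx' hle y hy hy'
    · exact (key x' hx' x hx hle y hy' hy).symm
  classical
  refine ⟨fun y => if hy : ∃ x ∈ A, y ∈ V x then q hy.choose y else 0, fun x hx => ?_⟩
  filter_upwards [(hVo x).mem_nhds (hxV x)] with y hy
  have hex : ∃ x ∈ A, y ∈ V x := ⟨x, hx, hy⟩
  rw [dif_pos hex]
  exact key' _ hex.choose_spec.1 x hx y hex.choose_spec.2 hy

end Extension

section Sweep

variable {M : Type*} [TopologicalSpace M] [T2Space M] [SecondCountableTopology M]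
  [ChartedSpace E3 M] [IsManifold (𝓡 3) ∞ M]
  {α : M → E3 →L[ℝ] ℝ} {p p' h ψ₁ : M → ℝ} {O : Set M} {a c c₁ : ℝ}

/-- Uniqueness of the extension of a potential to lower superlevel sets. -/
theorem eq_of_isPotentialAt_superlevel (hh : ContMDiff (𝓡 3) 𝓘(ℝ, ℝ) ∞ h) (hO : IsOpen O)
    (hd : ∀ x ∈ O, (mfderiv (𝓡 3) 𝓘(ℝ, ℝ) h x : E3 →L[ℝ] ℝ) ≠ 0)
    (hK : ∀ c', c < c' → IsCompact (O ∩ h ⁻¹' Icc c' c₁))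
    (hp : ∀ x ∈ O, c < h x → IsPotentialAt α p x)
    (hp' : ∀ x ∈ O, c < h x → IsPotentialAt α p' x)
    (he : ∀ x ∈ O, c₁ < h x → p x = p' x) {x : M} (hx : x ∈ O) (hcx : c < h x) : p x = p' x := by
  by_contra hne
  have hcont : Continuous h := hh.continuous
  let D := {y | p =ᶠ[𝓝 y] p'}
  have hD : IsOpen D := isOpen_iff_eventually.2 fun y hy => Filter.Eventually.eventually_nhds hy
  have hup : ∀ y ∈ O, c₁ < h y → y ∈ D := by
    intro y hy hlt
    filter_upwards [hO.mem_nhds hy, hcont.continuousAt.eventually (lt_mem_nhds hlt)] with z hz hz'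
      using he z hz hz'
  have hxD : x ∉ D := fun h' => hne h'.self_of_nhds
  have hx₁ : h x ≤ c₁ := not_lt.1 fun h' => hxD (hup x hx h')
  have hKD : IsCompact ((O ∩ h ⁻¹' Icc (h x) c₁) \ D) := (hK _ hcx).diff hD
  obtain ⟨z, hz, hmax⟩ := hKD.exists_isMaxOn ⟨x, ⟨hx, le_rfl, hx₁⟩, hxD⟩ hcont.continuousOn
  have hzc : c < h z := hcx.trans_le hz.1.2.1
  refine hd z hz.1.1 (IsLocalMax.mfderiv_eq_zero (hh.mdifferentiable (by simp) z) ?_)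
  obtain ⟨k, hk⟩ := (hp z hz.1.1 hzc).eventually_eq_add_const (hp' z hz.1.1 hzc)
  have hk0 : k ≠ 0 := by
    rintro rfl
    refine hz.2 ?_
    filter_upwards [hk] with y hy
    rw [hy, add_zero]
  filter_upwards [hk, hO.mem_nhds hz.1.1] with y hy hyO
  by_contra hlt
  rw [not_le] at hlt
  have hyD : y ∉ D := by
    intro h'
    have := h'.self_of_nhds
    exact hk0 (by linarith)
  have hy₁ : h y ≤ c₁ := not_lt.1 fun h' => hyD (hup y hyO h')
  exact absurd (hmax ⟨⟨hyO, hz.1.2.1.trans hlt.le, hy₁⟩, hyD⟩) (not_le.2 hlt)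

/-- A potential on a superlevel set extends to slightly lower superlevel sets. -/
theorem exists_lower_potential (hα : IsClosedForm α) (hh : ContMDiff (𝓡 3) 𝓘(ℝ, ℝ) ∞ h)
    (hO : IsOpen O) (hd : ∀ x ∈ O, (mfderiv (𝓡 3) 𝓘(ℝ, ℝ) h x : E3 →L[ℝ] ℝ) ≠ 0) (hac : a < c)
    (hK : ∀ c', a < c' → IsCompact (O ∩ h ⁻¹' Icc c' c))
    (hp : ∀ x ∈ O, c < h x → IsPotentialAt α p x) :
    ∃ c' ∈ Ioo a c, ∃ p' : M → ℝ, (∀ x ∈ O, c' < h x → IsPotentialAt α p' x) ∧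
      ∀ x, c < h x → p' x = p x := by
  have hcont : Continuous h := hh.continuous
  let A := {x | x ∈ O ∧ h x = c}
  have h1 : ∀ x, ∃ q : M → ℝ, x ∈ A → IsPotentialAt α q x ∧ ∀ᶠ y in 𝓝 x, c < h y → p y = q y := by
    intro x
    by_cases hx : x ∈ A
    · obtain ⟨q, hq, hq'⟩ := hα.exists_potential_superlevel (hh x) (hd x hx.1) (p := p) (by
        filter_upwards [hO.mem_nhds hx.1] with y hy hlt
        exact hp y hy (hx.2 ▸ hlt))
      rw [hx.2] at hq'
      exact ⟨q, fun _ => ⟨hq, hq'⟩⟩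
    · exact ⟨0, fun h' => absurd h' hx⟩
  choose q hq using h1
  obtain ⟨Q, hQ⟩ := exists_glue_potential (A := A) (fun x hx => (hq x hx).1) (by
    intro x hx
    filter_upwards [(hq x hx).1.eventually, (hq x hx).2.eventually_nhds] with x' hx' hx'' hxA
    refine hx'.eventuallyEq_of_eq (hq x' hxA).1 ?_
    have h2 := frequently_lt_of_mfderiv_ne_zero (hh.mdifferentiable (by simp) x') (hd x' hxA.1)
    rw [hxA.2] at h2
    refine (h2.and_eventually (hx''.and (hq x' hxA).2)).mono fun y hy => ?_
    rw [← hy.2.1 hy.1, hy.2.2 hy.1])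
  classical
  let p' : M → ℝ := fun x => if c < h x then p x else Q x
  have hpA : ∀ x ∈ A, IsPotentialAt α p' x := by
    intro x hx
    refine (hq x hx).1.congr ?_
    filter_upwards [hQ x hx, (hq x hx).2] with y hy hy'
    by_cases hlt : c < h y
    · simp only [p', if_pos hlt, hy' hlt]
    · simp only [p', if_neg hlt, hy]
  have hpc : ∀ x ∈ O, c ≤ h x → IsPotentialAt α p' x := by
    intro x hx hle
    rcases hle.eq_or_lt with heq | hlt
    · exact hpA x ⟨hx, heq.symm⟩
    · refine (hp x hx hlt).congr ?_
      filter_upwards [hcont.continuousAt.eventually (lt_mem_nhds hlt)] with y hy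
      exact if_pos hy
  have hW : IsOpen {x | IsPotentialAt α p' x} :=
    isOpen_iff_eventually.2 fun y hy => IsPotentialAt.eventually hy
  have hKW := (hK ((a + c) / 2) (by linarith)).diff hW
  have hres : ∃ c' ∈ Ioo a c, ∀ x ∈ O, c' < h x → IsPotentialAt α p' x := by
    rcases ((O ∩ h ⁻¹' Icc ((a + c) / 2) c) \ {x | IsPotentialAt α p' x}).eq_empty_or_nonempty
      with he | hne
    · refine ⟨(a + c) / 2, ⟨by linarith, by linarith⟩, fun x hx hlt => ?_⟩
      by_contra hcon
      have hle : h x ≤ c := not_lt.1 fun h' => hcon (hpc x hx h'.le)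
      exact (he.subset ⟨⟨hx, hlt.le, hle⟩, hcon⟩ : x ∈ (∅ : Set M))
    · obtain ⟨z, hz, hmax⟩ := hKW.exists_isMaxOn hne hcont.continuousOn
      have hzc : h z < c := not_le.1 fun h' => hz.2 (hpc z hz.1.1 h')
      refine ⟨h z, ⟨by linarith [hz.1.2.1], hzc⟩, fun x hx hlt => ?_⟩
      by_contra hcon
      have hle : h x ≤ c := not_lt.1 fun h' => hcon (hpc x hx h'.le)
      exact absurd (hmax ⟨⟨hx, hz.1.2.1.trans hlt.le, hle⟩, hcon⟩) (not_le.2 hlt)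
  obtain ⟨c', hc', hres⟩ := hres
  exact ⟨c', hc', p', hres, fun x hx => if_pos hx⟩

/-- A potential on a superlevel set extends to the whole of a set foliated by level sets. -/
theorem exists_potential_of_foliation (hα : IsClosedForm α) (hh : ContMDiff (𝓡 3) 𝓘(ℝ, ℝ) ∞ h)
    (hO : IsOpen O) (hd : ∀ x ∈ O, (mfderiv (𝓡 3) 𝓘(ℝ, ℝ) h x : E3 →L[ℝ] ℝ) ≠ 0) (hac : a < c₁)
    (hlow : ∀ x ∈ O, a < h x) (hK : ∀ c, a < c → IsCompact (O ∩ h ⁻¹' Icc c c₁))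
    (hψ : ∀ x ∈ O, c₁ < h x → IsPotentialAt α ψ₁ x) :
    ∃ ψ : M → ℝ, ∀ x ∈ O, IsPotentialAt α ψ x ∧ (c₁ < h x → ψ x = ψ₁ x) := by
  have hcont : Continuous h := hh.continuous
  let S : ℝ → (M → ℝ) → Prop := fun c p =>
    (∀ x ∈ O, c < h x → IsPotentialAt α p x) ∧ ∀ x ∈ O, c₁ < h x → p x = ψ₁ x
  have hmono : ∀ {c c' p}, S c p → c ≤ c' → S c' p := fun hS hle =>
    ⟨fun x hx hlt => hS.1 x hx (hle.trans_lt hlt), hS.2⟩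
  have hlim : ∀ c, a ≤ c → c < c₁ → (∀ c' ∈ Ioc c c₁, ∃ p, S c' p) → ∃ p, S c p := by
    intro c hc hc₁ hex
    have hex' : ∀ c', ∃ p, c' ∈ Ioc c c₁ → S c' p := fun c' => by
      by_cases h' : c' ∈ Ioc c c₁
      · exact (hex c' h').imp fun p hp _ => hp
      · exact ⟨0, fun h'' => absurd h'' h'⟩
    choose P hP using hex'
    have huniq : ∀ c' ∈ Ioc c c₁, ∀ c'' ∈ Ioc c c₁, ∀ x ∈ O, c' < h x → c'' < h x →
        P c' x = P c'' x := by
      intro c' hc' c'' hc'' x hx h1 h2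
      refine eq_of_isPotentialAt_superlevel (α := α) (c := max c' c'') (c₁ := c₁) hh hO hd
        (fun e he => hK e (hc.trans_lt (hc'.1.trans ((le_max_left _ _).trans_lt he))))
        (hmono (hP c' hc') (le_max_left _ _)).1 (hmono (hP c'' hc'') (le_max_right _ _)).1
        (fun y hy hlt => ?_) hx (max_lt h1 h2)
      rw [(hP c' hc').2 y hy hlt, (hP c'' hc'').2 y hy hlt]
    let k : M → ℝ := fun x => (c + min (h x) c₁) / 2
    have hk : ∀ x, c < h x → k x ∈ Ioc c c₁ ∧ k x < h x := by
      intro x hx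
      have h1 := lt_min hx hc₁
      have h2 := min_le_left (h x) c₁
      have h3 := min_le_right (h x) c₁
      exact ⟨⟨by simp only [k]; linarith, by simp only [k]; linarith⟩, by simp only [k]; linarith⟩
    refine ⟨fun x => P (k x) x, fun x hx hlt => ?_, fun x hx hlt => ?_⟩
    · refine ((hP (k x) (hk x hlt).1).1 x hx (hk x hlt).2).congr ?_
      filter_upwards [hO.mem_nhds hx, hcont.continuousAt.eventually (lt_mem_nhds hlt),
        hcont.continuousAt.eventually (lt_mem_nhds (hk x hlt).2)] with y hy h1 h2
      exact huniq _ (hk y h1).1 _ (hk x hlt).1 y hy (hk y h1).2 h2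
    · exact (hP _ (hk x (hc₁.trans hlt)).1).2 x hx hlt
  let T := {c | c ∈ Icc a c₁ ∧ ∃ p, S c p}
  have hT₁ : c₁ ∈ T := ⟨⟨hac.le, le_rfl⟩, ψ₁, hψ, fun _ _ _ => rfl⟩
  have hTb : BddBelow T := ⟨a, fun c hc => hc.1.1⟩
  set s := sInf T
  have hsa : a ≤ s := le_csInf ⟨c₁, hT₁⟩ fun c hc => hc.1.1
  have hs₁ : s ≤ c₁ := csInf_le hTb hT₁
  have hsT : ∃ p, S s p := by
    rcases hs₁.eq_or_lt with heq | hlt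
    · rw [heq]
      exact hT₁.2
    · refine hlim s hsa hlt fun c' hc' => ?_
      obtain ⟨c, hc, hcc⟩ := exists_lt_of_csInf_lt ⟨c₁, hT₁⟩ hc'.1
      obtain ⟨p, hp⟩ := hc.2
      exact ⟨p, hmono hp hcc.le⟩
  obtain ⟨p, hp⟩ := hsT
  have hsa' : s = a := by
    by_contra hne
    have hlt : a < s := lt_of_le_of_ne hsa (Ne.symm hne)
    obtain ⟨c', hc', p', hp', hpp⟩ := exists_lower_potential hα hh hO hd hlt
      (fun e he => by
        have h1 : O ∩ h ⁻¹' Icc e s = (O ∩ h ⁻¹' Icc e c₁) ∩ h ⁻¹' Iic s := by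
          ext y
          simp only [mem_inter_iff, mem_preimage, mem_Icc, mem_Iic]
          exact ⟨fun h' => ⟨⟨h'.1, h'.2.1, h'.2.2.trans hs₁⟩, h'.2.2⟩,
            fun h' => ⟨h'.1.1, h'.1.2.1, h'.2⟩⟩
        rw [h1]
        exact (hK e he).inter_right (isClosed_Iic.preimage hcont)) hp.1
    have h1 : c' ∈ T := ⟨⟨hc'.1.le, hc'.2.le.trans hs₁⟩, p', hp', fun x hx hlt' => by
      rw [hpp x (hs₁.trans_lt hlt'), hp.2 x hx hlt']⟩
    exact absurd (csInf_le hTb h1) (not_le.2 hc'.2)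
  rw [hsa'] at hp
  exact ⟨p, fun x hx => ⟨hp.1 x hx (hlow x hx), hp.2 x hx⟩⟩

end Sweep

/-! ### Potentials on the asymptotic end -/

section Decay

variable {X : Type*} [NormedAddCommGroup X] [InnerProductSpace ℝ X]

/-- Along rays, a function whose differential is bounded by `C / |x|²` has a limit, up to which it
is bounded by `C / |x|`. -/
theorem exists_tendsto_ray {p : X → ℝ} {e : X → X →L[ℝ] ℝ} {C : ℝ} {x : X} (hx : x ≠ 0)
    (hp : ∀ s : ℝ, 1 ≤ s → HasFDerivAt p (e (s • x)) (s • x))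
    (hC : ∀ s : ℝ, 1 ≤ s → ‖e (s • x)‖ ≤ C / ‖s • x‖ ^ 2) :
    ∃ L, Tendsto (fun s : ℝ => p (s • x)) atTop (𝓝 L) ∧ |p x - L| ≤ C / ‖x‖ := by
  have hx0 : 0 < ‖x‖ := norm_pos_iff.2 hx
  have hC0 : 0 ≤ C := by
    have h1 := (norm_nonneg _).trans (hC 1 le_rfl)
    rw [one_smul] at h1
    by_contra hc
    exact absurd h1 (not_le.2 (div_neg_of_neg_of_pos (not_le.1 hc) (by positivity)))
  have hd : ∀ s : ℝ, 1 ≤ s → HasDerivAt (fun s : ℝ => p (s • x)) (e (s • x) x) s := fun s hs => by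
    have h1 : HasDerivAt (fun s : ℝ => s • x) x s := by
      simpa using (hasDerivAt_id s).smul_const x
    exact (hp s hs).comp_hasDerivAt s h1
  have hq : ∀ s : ℝ, 1 ≤ s → HasDerivAt (fun s : ℝ => C / ‖x‖ * s⁻¹) (C / ‖x‖ * -(s ^ 2)⁻¹) s :=
    fun s hs => (hasDerivAt_inv (by linarith)).const_mul _
  have hb : ∀ s : ℝ, 1 ≤ s → |e (s • x) x| ≤ C / ‖x‖ * (s ^ 2)⁻¹ := by
    intro s hs
    have hs0 : 0 < s := by linarith
    calc |e (s • x) x| ≤ ‖e (s • x)‖ * ‖x‖ := (e (s • x)).le_opNorm x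
      _ ≤ C / ‖s • x‖ ^ 2 * ‖x‖ := mul_le_mul_of_nonneg_right (hC s hs) hx0.le
      _ = C / ‖x‖ * (s ^ 2)⁻¹ := by
        rw [norm_smul, Real.norm_eq_abs, abs_of_pos hs0]
        field_simp
  have hone : ∀ s ∈ interior (Ici (1 : ℝ)), (1 : ℝ) ≤ s := fun s hs => interior_subset hs
  have hmono : MonotoneOn (fun s : ℝ => p (s • x) - C / ‖x‖ * s⁻¹) (Ici 1) := by
    refine monotoneOn_of_deriv_nonneg (convex_Ici 1)
      (fun s hs => ((hd s hs).sub (hq s hs)).continuousAt.continuousWithinAt)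
      (fun s hs => ((hd s (hone s hs)).sub (hq s (hone s hs))).differentiableAt.differentiableWithinAt)
      fun s hs => ?_
    refine le_of_le_of_eq ?_ (HasDerivAt.deriv ((hd s (hone s hs)).sub (hq s (hone s hs)))).symm
    linarith [(abs_le.1 (hb s (hone s hs))).1]
  have hanti : AntitoneOn (fun s : ℝ => p (s • x) + C / ‖x‖ * s⁻¹) (Ici 1) := by
    refine antitoneOn_of_deriv_nonpos (convex_Ici 1)
      (fun s hs => ((hd s hs).add (hq s hs)).continuousAt.continuousWithinAt)
      (fun s hs => ((hd s (hone s hs)).add (hq s (hone s hs))).differentiableAt.differentiableWithinAt)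
      fun s hs => ?_
    refine le_of_eq_of_le (HasDerivAt.deriv ((hd s (hone s hs)).add (hq s (hone s hs)))) ?_
    linarith [(abs_le.1 (hb s (hone s hs))).2]
  have hlow : ∀ s : ℝ, 1 ≤ s → p x - C / ‖x‖ ≤ p (s • x) - C / ‖x‖ * s⁻¹ := fun s hs => by
    have := hmono (mem_Ici.2 le_rfl) hs hs
    simpa using this
  have hupp : ∀ s : ℝ, 1 ≤ s → p (s • x) + C / ‖x‖ * s⁻¹ ≤ p x + C / ‖x‖ := fun s hs => by
    have := hanti (mem_Ici.2 le_rfl) hs hs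
    simpa using this
  have hq0 : ∀ s : ℝ, 1 ≤ s → 0 ≤ C / ‖x‖ * s⁻¹ := fun s hs => by positivity
  have hm : Monotone fun s : ℝ => p (max s 1 • x) - C / ‖x‖ * (max s 1)⁻¹ := fun a b hab =>
    hmono (mem_Ici.2 (le_max_right _ _)) (mem_Ici.2 (le_max_right _ _)) (max_le_max_right 1 hab)
  have hbd : BddAbove (range fun s : ℝ => p (max s 1 • x) - C / ‖x‖ * (max s 1)⁻¹) := by
    refine ⟨p x + C / ‖x‖, ?_⟩
    rintro _ ⟨s, rfl⟩
    have h1 := hupp _ (le_max_right s 1)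
    have h2 := hq0 _ (le_max_right s 1)
    simp only
    linarith
  have ht := tendsto_atTop_ciSup hm hbd
  set L := ⨆ s : ℝ, (p (max s 1 • x) - C / ‖x‖ * (max s 1)⁻¹)
  have h0 : Tendsto (fun s : ℝ => C / ‖x‖ * s⁻¹) atTop (𝓝 0) := by
    simpa using tendsto_inv_atTop_zero.const_mul (C / ‖x‖)
  have hlim : Tendsto (fun s : ℝ => p (s • x)) atTop (𝓝 L) := by
    have h1 := ht.add h0
    rw [add_zero] at h1
    refine h1.congr' ?_
    filter_upwards [eventually_ge_atTop (1 : ℝ)] with s hs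
    rw [max_eq_left hs]
    ring
  refine ⟨L, hlim, ?_⟩
  have h1 : p x - C / ‖x‖ ≤ L := ge_of_tendsto hlim (by
    filter_upwards [eventually_ge_atTop (1 : ℝ)] with s hs
    linarith [hlow s hs, hq0 s hs])
  have h2 : L ≤ p x + C / ‖x‖ := le_of_tendsto hlim (by
    filter_upwards [eventually_ge_atTop (1 : ℝ)] with s hs
    linarith [hupp s hs, hq0 s hs])
  rw [abs_le]
  constructor <;> linarith

/-- Smooth closed one-forms which decay like `|x|⁻²` near infinity have a potential which decays
like `|x|⁻¹`. -/
theorem exists_potential_of_decay {e : X → X →L[ℝ] ℝ} {R C : ℝ} (hR : 0 < R)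
    (hd : ∀ x, R < ‖x‖ → DifferentiableAt ℝ e x)
    (hs : ∀ x, R < ‖x‖ → ∀ v w, fderiv ℝ e x v w = fderiv ℝ e x w v)
    (hC : ∀ x, R < ‖x‖ → ‖e x‖ ≤ C / ‖x‖ ^ 2) :
    ∃ ψ : X → ℝ, (∀ x, R < ‖x‖ → HasFDerivAt ψ (e x) x) ∧ ∀ x, R < ‖x‖ → |ψ x| ≤ C / ‖x‖ := by
  let S : X → Set X := fun n => {y | R * ‖n‖ < inner ℝ n y}
  have hSo : ∀ n, IsOpen (S n) := fun n => isOpen_lt continuous_const (by fun_prop)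
  have hSc : ∀ n, Convex ℝ (S n) := fun n =>
    convex_halfSpace_gt ((innerSL ℝ n).toLinearMap.isLinear) _
  have hSR : ∀ n y, y ∈ S n → R < ‖y‖ := by
    intro n y hy
    have h1 : R * ‖n‖ < inner ℝ n y := hy
    have h2 := real_inner_le_norm n y
    have h3 : 0 ≤ ‖n‖ := norm_nonneg n
    by_contra hc
    have h4 : ‖n‖ * ‖y‖ ≤ ‖n‖ * R := mul_le_mul_of_nonneg_left (not_lt.1 hc) h3
    linarith
  have hself : ∀ x, R < ‖x‖ → x ∈ S x := by
    intro x hx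
    change R * ‖x‖ < inner ℝ x x
    rw [real_inner_self_eq_norm_mul_norm]
    exact mul_lt_mul_of_pos_right hx (hR.trans hx)
  have hsm : ∀ n y, y ∈ S n → ∀ s : ℝ, 1 ≤ s → s • y ∈ S n := by
    intro n y hy s hs'
    have h1 : R * ‖n‖ < inner ℝ n y := hy
    change R * ‖n‖ < inner ℝ n (s • y)
    rw [real_inner_smul_right]
    have h2 : 0 ≤ R * ‖n‖ := by positivity
    nlinarith
  have hex : ∀ n, ∃ p : X → ℝ, ∀ y ∈ S n, HasFDerivAt p (e y) y ∧ |p y| ≤ C / ‖y‖ ∧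
      Tendsto (fun s : ℝ => p (s • y)) atTop (𝓝 0) := by
    intro n
    obtain ⟨p, hp⟩ := (hSc n).exists_forall_hasFDerivAt_of_fderiv_symmetric (hSo n)
      (fun y hy => (hd y (hSR n y hy)).differentiableWithinAt)
      (fun y hy v w => hs y (hSR n y hy) v w)
    have hray : ∀ y ∈ S n, ∃ L, Tendsto (fun s : ℝ => p (s • y)) atTop (𝓝 L) ∧
        |p y - L| ≤ C / ‖y‖ := fun y hy =>
      exists_tendsto_ray (norm_pos_iff.1 (hR.trans (hSR n y hy)))
        (fun s hs' => hp _ (hsm n y hy s hs')) fun s hs' => hC _ (hSR n _ (hsm n y hy s hs'))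
    rcases (S n).eq_empty_or_nonempty with he | ⟨y₀, hy₀⟩
    · exact ⟨p, fun y hy => absurd hy (by rw [he]; exact notMem_empty y)⟩
    obtain ⟨L, hL, -⟩ := hray y₀ hy₀
    have huniq : ∀ y ∈ S n, Tendsto (fun s : ℝ => p (s • y)) atTop (𝓝 L) := by
      intro y hy
      have h1 : ∀ s : ℝ, 1 ≤ s → ‖p (s • y) - p (s • y₀)‖ ≤ |C| * ‖y - y₀‖ / R ^ 2 * s⁻¹ := by
        intro s hs'
        have hs0 : 0 < s := by linarith
        have hconv : Convex ℝ (segment ℝ y₀ y) := convex_segment _ _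
        have hseg : segment ℝ y₀ y ⊆ S n := (hSc n).segment_subset hy₀ hy
        have hmv := Convex.norm_image_sub_le_of_norm_hasFDerivWithin_le
          (f := fun z => p (s • z)) (f' := fun z => s • e (s • z)) (C := |C| / R ^ 2 * s⁻¹)
          (fun z hz => by
            have h2 := (hp (s • z) (hsm n z (hseg hz) s hs')).comp z
              ((hasFDerivAt_id z).const_smul s)
            have h3 : (e (s • z)).comp (s • ContinuousLinearMap.id ℝ X) = s • e (s • z) := by
              ext v
              simp
            rw [h3] at h2
            exact h2.hasFDerivWithinAt)
          (fun z hz => by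
            have h2 := hSR n z (hseg hz)
            have h3 := hC _ (hSR n _ (hsm n z (hseg hz) s hs'))
            rw [norm_smul, Real.norm_eq_abs, abs_of_pos hs0]
            calc s * ‖e (s • z)‖ ≤ s * (C / ‖s • z‖ ^ 2) := mul_le_mul_of_nonneg_left h3 hs0.le
              _ ≤ s * (|C| / (s * R) ^ 2) := by
                refine mul_le_mul_of_nonneg_left ?_ hs0.le
                rw [norm_smul, Real.norm_eq_abs, abs_of_pos hs0]
                refine div_le_div₀ (abs_nonneg C) (le_abs_self C) (by positivity) ?_
                exact pow_le_pow_left₀ (by positivity) (mul_le_mul_of_nonneg_left h2.le hs0.le) 2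
              _ = |C| / R ^ 2 * s⁻¹ := by field_simp)
          hconv (left_mem_segment ℝ _ _) (right_mem_segment ℝ _ _)
        refine hmv.trans (le_of_eq ?_)
        ring
      have h2 : Tendsto (fun s : ℝ => |C| * ‖y - y₀‖ / R ^ 2 * s⁻¹) atTop (𝓝 0) := by
        simpa using tendsto_inv_atTop_zero.const_mul (|C| * ‖y - y₀‖ / R ^ 2)
      have h3 : Tendsto (fun s : ℝ => p (s • y) - p (s • y₀)) atTop (𝓝 0) :=
        squeeze_zero_norm' ((eventually_ge_atTop 1).mono h1) h2
      simpa using h3.add hL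
    refine ⟨fun y => p y - L, fun y hy => ⟨(hp y hy).sub_const L, ?_, ?_⟩⟩
    · obtain ⟨L', hL', hb⟩ := hray y hy
      rwa [tendsto_nhds_unique hL' (huniq y hy)] at hb
    · simpa using (huniq y hy).sub_const L
  choose p hp using hex
  refine ⟨fun x => p x x, fun x hx => ?_, fun x hx => (hp x x (hself x hx)).2.1⟩
  refine ((hp x x (hself x hx)).1).congr_of_eventuallyEq ?_
  filter_upwards [(hSo x).mem_nhds (hself x hx)] with y hy
  have hy' := hself y (hSR x y hy)
  have h1 : ∀ s : ℝ, 1 ≤ s → p y (s • y) - p x (s • y) = p y y - p x y := by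
    intro s hs'
    exact eq_of_hasFDerivAt_zero (d := fun z => p y z - p x z) ((hSc y).inter (hSc x))
      (fun z hz => by
        have := (hp y z hz.1).1.sub (hp x z hz.2).1
        rwa [sub_self] at this)
      ⟨hsm y y hy' s hs', hsm x y hy s hs'⟩ ⟨hy', hy⟩
  have h2 := (hp y y hy').2.2.sub (hp x y hy).2.2
  have h3 : Tendsto (fun s : ℝ => p y (s • y) - p x (s • y)) atTop (𝓝 (p y y - p x y)) :=
    tendsto_const_nhds.congr' ((eventually_ge_atTop 1).mono fun s hs' => (h1 s hs').symm)
  have h4 := tendsto_nhds_unique h3 h2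
  linarith

end Decay

/-! ### The asymptotic end -/

section End

theorem exists_forall_of_eventually_cobounded {X : Type*} [SeminormedAddCommGroup X] {Q : X → Prop}
    (h : ∀ᶠ x in cobounded X, Q x) : ∃ R : ℝ, ∀ x, R < ‖x‖ → Q x := by
  obtain ⟨R, -, hR⟩ := (hasBasis_cobounded_norm (E := X)).eventually_iff.1 h
  exact ⟨R, fun x hx => hR (le_of_lt hx)⟩

variable {M : Type*} [TopologicalSpace M] [ChartedSpace E3 M] [IsManifold (𝓡 3) ∞ M]
  {g : RiemMetric3 M} {N : M → ℝ} {F : BilinField I4 (ℝ × M)} {K : Set M}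
  {φ : PartialDiffeomorph (𝓡 3) (𝓡 3) M E3 ∞} {m Q : ℝ} {α : M → E3 →L[ℝ] ℝ} {x : E3}

/-- The coordinate expression of a one-form in the coordinates `φ`. -/
noncomputable def endForm (α : M → E3 →L[ℝ] ℝ) (φ : PartialDiffeomorph (𝓡 3) (𝓡 3) M E3 ∞)
    (x : E3) : E3 →L[ℝ] ℝ :=
  (α (φ.symm x)).comp (mfderiv (𝓡 3) (𝓡 3) φ.symm x : E3 →L[ℝ] E3)

theorem contMDiffAt_symm (hx : x ∈ φ.target) : ContMDiffAt (𝓡 3) (𝓡 3) ∞ φ.symm x :=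
  φ.contMDiffOn_invFun.contMDiffAt (φ.open_target.mem_nhds hx)

theorem continuousAt_symm (hx : x ∈ φ.target) : ContinuousAt φ.symm x :=
  (contMDiffAt_symm hx).continuousAt

theorem hasFDerivAt_comp_symm (hx : x ∈ φ.target) {p : M → ℝ}
    (hp : HasMFDerivAt (𝓡 3) 𝓘(ℝ, ℝ) p (φ.symm x) (α (φ.symm x))) :
    HasFDerivAt (p ∘ φ.symm) (endForm α φ x) x :=
  (hp.comp x ((contMDiffAt_symm hx).mdifferentiableAt (by simp)).hasMFDerivAt).hasFDerivAt

theorem mfderiv_symm_comp_mfderiv {z : M} (hz : z ∈ φ.source) (v : E3) :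
    (mfderiv (𝓡 3) (𝓡 3) φ.symm (φ z) : E3 →L[ℝ] E3)
      ((mfderiv (𝓡 3) (𝓡 3) φ z : E3 →L[ℝ] E3) v) = v := by
  have h1 : MDifferentiableAt (𝓡 3) (𝓡 3) φ z :=
    (φ.contMDiffOn_toFun.contMDiffAt (φ.open_source.mem_nhds hz)).mdifferentiableAt (by simp)
  have h2 : MDifferentiableAt (𝓡 3) (𝓡 3) φ.symm (φ z) :=
    (contMDiffAt_symm (φ.map_source hz)).mdifferentiableAt (by simp)
  have h3 := h2.hasMFDerivAt.comp z h1.hasMFDerivAt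
  have h4 : HasMFDerivAt (𝓡 3) (𝓡 3) (φ.symm ∘ φ) z (ContinuousLinearMap.id ℝ E3) := by
    refine (hasMFDerivAt_id z).congr_of_eventuallyEq ?_
    filter_upwards [φ.open_source.mem_nhds hz] with y hy using φ.left_inv hy
  exact congrArg (fun A : E3 →L[ℝ] E3 => A v) (hasMFDerivAt_unique h3 h4)

theorem mfderiv_symm_surjective (hx : x ∈ φ.target) :
    Function.Surjective (mfderiv (𝓡 3) (𝓡 3) φ.symm x : E3 →L[ℝ] E3) := by
  intro v
  have h1 := mfderiv_symm_comp_mfderiv (φ := φ) (z := φ.symm x) (φ.map_target hx) v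
  have h2 : φ (φ.symm x) = x := φ.right_inv hx
  rw [h2] at h1
  exact ⟨_, h1⟩

theorem tendsto_symm (hx : x ∈ φ.target) : Tendsto φ.symm (𝓝 x) (𝓝 (φ.symm x)) :=
  continuousAt_symm hx

theorem IsPotentialAt.endForm_eq (hx : x ∈ φ.target) {p : M → ℝ}
    (hp : IsPotentialAt α p (φ.symm x)) :
    ∀ᶠ z in 𝓝 x, HasFDerivAt (p ∘ φ.symm) (endForm α φ z) z := by
  filter_upwards [(tendsto_symm hx).eventually hp, φ.open_target.mem_nhds hx] with z hz hz'
    using hasFDerivAt_comp_symm hz' hz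

theorem IsPotentialAt.contMDiffAt (hα : IsClosedForm α) {p : M → ℝ} {z : M}
    (hp : IsPotentialAt α p z) : ContMDiffAt (𝓡 3) 𝓘(ℝ, ℝ) ∞ p z := by
  have h1 : IsPotentialAt α p ((extChartAt (𝓡 3) z).symm (extChartAt (𝓡 3) z z)) := by
    rwa [extChartAt_to_inv]
  have h2 := (h1.contDiffAt_chart hα (mem_extChartAt_target z)).contMDiffAt.comp z
    (contMDiffAt_extChartAt (I := 𝓡 3) (n := ∞) (x := z))
  refine h2.congr_of_eventuallyEq ?_
  filter_upwards [extChartAt_source_mem_nhds (I := 𝓡 3) z] with y hy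
  simp only [Function.comp_apply, (extChartAt (𝓡 3) z).left_inv hy]

theorem IsClosedForm.endForm_closed (hα : IsClosedForm α) (hx : x ∈ φ.target) :
    DifferentiableAt ℝ (endForm α φ) x ∧
      ∀ v w, fderiv ℝ (endForm α φ) x v w = fderiv ℝ (endForm α φ) x w v := by
  obtain ⟨p, hp⟩ := hα.exists_potential (φ.symm x)
  have h1 := hp.endForm_eq hx
  have h2 : ContDiffAt ℝ ∞ (p ∘ φ.symm) x :=
    ((hp.contMDiffAt hα).comp x (contMDiffAt_symm hx)).contDiffAt
  have h3 : endForm α φ =ᶠ[𝓝 x] fderiv ℝ (p ∘ φ.symm) := by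
    filter_upwards [h1] with z hz using hz.fderiv.symm
  refine ⟨((h2.fderiv_right (m := 1) (by norm_cast)).differentiableAt
    (by simp)).congr_of_eventuallyEq h3, fun v w => ?_⟩
  rw [h3.fderiv_eq]
  exact ((h2.of_le minSmoothness_two_le).isSymmSndFDerivAt le_rfl).eq v w

theorem norm_le_sum_apply_single (l : E3 →L[ℝ] ℝ) :
    ‖l‖ ≤ ∑ i, |l (EuclideanSpace.single i (1 : ℝ))| := by
  refine l.opNorm_le_bound (Finset.sum_nonneg fun i _ => abs_nonneg _) fun v => ?_
  have h1 : v = ∑ i, v i • EuclideanSpace.single i (1 : ℝ) := by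
    have h2 := (EuclideanSpace.basisFun (Fin 3) ℝ).sum_repr v
    simpa using h2.symm
  have h3 : l v = ∑ i, v i * l (EuclideanSpace.single i (1 : ℝ)) := by
    conv_lhs => rw [h1]
    simp [map_sum]
  rw [h3, Real.norm_eq_abs, Finset.sum_mul]
  refine (Finset.abs_sum_le_sum_abs _ _).trans (Finset.sum_le_sum fun i _ => ?_)
  rw [abs_mul, mul_comm]
  exact mul_le_mul_of_nonneg_left (EuclideanSpace.norm_eq v ▸ (by
    rw [← Real.sqrt_sq (abs_nonneg (v i))]
    refine Real.sqrt_le_sqrt ?_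
    have := Finset.single_le_sum (f := fun j => ‖v j‖ ^ 2) (fun j _ => sq_nonneg _)
      (Finset.mem_univ i)
    simpa using this)) (abs_nonneg _)

namespace IsAsymptoticallyFlat

variable (hflat : IsAsymptoticallyFlat g N F K φ m Q)

include hflat

theorem mem_target (hx : 1 < ‖x‖) : x ∈ φ.target := by
  rw [hflat.target]
  simpa using hx

theorem isBigO_endForm (i : Fin 3) :
    (fun x => endForm (elecForm F) φ x (EuclideanSpace.single i (1 : ℝ))
      - Q / ‖x‖ ^ 2 * (x i / ‖x‖)) =O[cobounded E3] fun x => (‖x‖ ^ 3)⁻¹ := by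
  refine ((hflat.field_time 0 i).neg_left).congr_left fun x => ?_
  have h1 : endForm (elecForm F) φ x (EuclideanSpace.single i (1 : ℝ))
      = -F (0, φ.symm x) ((1, 0) : ℝ × E3) ((0, coordVec φ x i) : ℝ × E3) := rfl
  rw [h1]
  ring

theorem exists_norm_endForm_le : ∃ C R : ℝ, 1 < R ∧
    ∀ x, R < ‖x‖ → ‖endForm (elecForm F) φ x‖ ≤ C / ‖x‖ ^ 2 := by
  have h1 : ∀ i, ∃ c R : ℝ, ∀ x : E3, R < ‖x‖ → |endForm (elecForm F) φ x (EuclideanSpace.single i (1 : ℝ))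
      - Q / ‖x‖ ^ 2 * (x i / ‖x‖)| ≤ c * (‖x‖ ^ 3)⁻¹ := by
    intro i
    obtain ⟨c, hc⟩ := (hflat.isBigO_endForm i).bound
    obtain ⟨R, hR⟩ := exists_forall_of_eventually_cobounded hc
    refine ⟨c, R, fun x hx => ?_⟩
    have h2 := hR x hx
    rwa [Real.norm_eq_abs, Real.norm_eq_abs, abs_of_nonneg (by positivity : 0 ≤ (‖x‖ ^ 3)⁻¹)] at h2
  choose c R hR using h1
  refine ⟨∑ i, (|Q| + |c i|), 2 + ∑ i, |R i|, ?_, fun x hx => ?_⟩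
  · have : 0 ≤ ∑ i, |R i| := Finset.sum_nonneg fun i _ => abs_nonneg _
    linarith
  refine (norm_le_sum_apply_single _).trans ?_
  rw [Finset.sum_div]
  refine Finset.sum_le_sum fun i _ => ?_
  have h2 : |R i| ≤ ∑ i, |R i| :=
    Finset.single_le_sum (f := fun i => |R i|) (fun i _ => abs_nonneg _) (Finset.mem_univ i)
  have h3 := hR i x (by linarith [le_abs_self (R i)])
  have hx1 : 1 < ‖x‖ := by linarith [abs_nonneg (R i)]
  have hx0 : 0 < ‖x‖ := by linarith
  have h4 : |x i / ‖x‖| ≤ 1 := by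
    rw [abs_div, abs_of_pos hx0, div_le_one hx0]
    exact EuclideanSpace.norm_eq x ▸ (by
      rw [← Real.sqrt_sq (abs_nonneg (x i))]
      refine Real.sqrt_le_sqrt ?_
      have := Finset.single_le_sum (f := fun j => ‖x j‖ ^ 2) (fun j _ => sq_nonneg _)
        (Finset.mem_univ i)
      simpa using this)
  have h5 : |Q / ‖x‖ ^ 2 * (x i / ‖x‖)| ≤ |Q| / ‖x‖ ^ 2 := by
    rw [abs_mul, abs_div, abs_of_pos (by positivity : 0 < ‖x‖ ^ 2)]
    exact mul_le_of_le_one_right (by positivity) h4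
  have h6 : c i * (‖x‖ ^ 3)⁻¹ ≤ |c i| / ‖x‖ ^ 2 := by
    rw [div_eq_mul_inv]
    refine mul_le_mul (le_abs_self _) ?_ (by positivity) (abs_nonneg _)
    exact inv_anti₀ (by positivity) (pow_le_pow_right₀ hx1.le (by norm_num))
  rw [add_div]
  have h7 := abs_add_le (endForm (elecForm F) φ x (EuclideanSpace.single i (1 : ℝ))
      - Q / ‖x‖ ^ 2 * (x i / ‖x‖)) (Q / ‖x‖ ^ 2 * (x i / ‖x‖))
  rw [sub_add_cancel] at h7
  linarith

/-- The electric potential of the end. -/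
theorem exists_end_potential (hα : IsClosedForm (elecForm F)) :
    ∃ ψ : M → ℝ, ∃ R : ℝ, 1 < R ∧ (∀ x, R < ‖x‖ → IsPotentialAt (elecForm F) ψ (φ.symm x)) ∧
      Tendsto (ψ ∘ φ.symm) (cobounded E3) (𝓝 0) := by
  obtain ⟨C, R, hR, hC⟩ := hflat.exists_norm_endForm_le
  have htar : ∀ x : E3, R < ‖x‖ → x ∈ φ.target := fun x hx => hflat.mem_target (hR.trans hx)
  obtain ⟨ψ, hψ, hψC⟩ := exists_potential_of_decay (by linarith : 0 < R)
    (fun x hx => (hα.endForm_closed (htar x hx)).1)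
    (fun x hx => (hα.endForm_closed (htar x hx)).2) hC
  have hinv : ∀ x, R < ‖x‖ → φ (φ.symm x) = x := fun x hx => φ.right_inv (htar x hx)
  refine ⟨ψ ∘ φ, R, hR, fun x hx => ?_, ?_⟩
  · have hsrc : φ.symm x ∈ φ.source := φ.map_target (htar x hx)
    have hcont : ContinuousAt φ (φ.symm x) :=
      (φ.contMDiffOn_toFun.contMDiffAt (φ.open_source.mem_nhds hsrc)).continuousAt
    have h1 : ∀ᶠ z in 𝓝 (φ.symm x), R < ‖φ z‖ := by
      have h2 := hcont.tendsto
      rw [hinv x hx] at h2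
      exact h2.eventually ((isOpen_lt continuous_const continuous_norm).mem_nhds hx)
    filter_upwards [h1, φ.open_source.mem_nhds hsrc] with z hz hzs
    have h3 : MDifferentiableAt (𝓡 3) (𝓡 3) φ z :=
      (φ.contMDiffOn_toFun.contMDiffAt (φ.open_source.mem_nhds hzs)).mdifferentiableAt (by simp)
    have h4 := (hψ (φ z) hz).hasMFDerivAt.comp z h3.hasMFDerivAt
    have h5 : (endForm (elecForm F) φ (φ z)).comp (mfderiv (𝓡 3) (𝓡 3) φ z : E3 →L[ℝ] E3)
        = elecForm F z := by
      refine ContinuousLinearMap.ext fun v => ?_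
      have h6 : φ.symm (φ z) = z := φ.left_inv hzs
      change elecForm F (φ.symm (φ z)) ((mfderiv (𝓡 3) (𝓡 3) φ.symm (φ z) : E3 →L[ℝ] E3)
        ((mfderiv (𝓡 3) (𝓡 3) φ z : E3 →L[ℝ] E3) v)) = elecForm F z v
      exact (congrArg (elecForm F (φ.symm (φ z))) (mfderiv_symm_comp_mfderiv hzs v)).trans
        (by rw [h6])
    rw [← h5]
    exact h4
  · have h1 : Tendsto (fun x : E3 => C / ‖x‖) (cobounded E3) (𝓝 0) :=
      tendsto_norm_cobounded_atTop.const_div_atTop C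
    refine squeeze_zero_norm' ?_ h1
    filter_upwards [tendsto_norm_cobounded_atTop.eventually (eventually_gt_atTop R)] with x hx
    rw [Function.comp_apply, Function.comp_apply, hinv x hx]
    exact hψC x hx

theorem tendsto_lapse : Tendsto (N ∘ φ.symm) (cobounded E3) (𝓝 1) := by
  have h1 : Tendsto (fun x : E3 => (‖x‖ ^ 2)⁻¹) (cobounded E3) (𝓝 0) :=
    ((tendsto_pow_atTop two_ne_zero).comp tendsto_norm_cobounded_atTop).inv_tendsto_atTop
  have h2 : Tendsto (fun x : E3 => m / ‖x‖) (cobounded E3) (𝓝 0) :=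
    tendsto_norm_cobounded_atTop.const_div_atTop m
  have h3 := (hflat.lapse.trans_tendsto h1).add (h2.const_sub 1)
  have h4 : Tendsto (fun x => N (φ.symm x)) (cobounded E3) (𝓝 1) := by simpa using h3
  exact h4

theorem eventually_lapse_lt_one (hm : 0 < m) : ∀ᶠ x in cobounded E3, N (φ.symm x) < 1 := by
  obtain ⟨C, hC⟩ := hflat.lapse.bound
  filter_upwards [hC, tendsto_norm_cobounded_atTop.eventually (eventually_gt_atTop 1),
    tendsto_norm_cobounded_atTop.eventually (eventually_gt_atTop (C / m))] with x hx hx1 hxC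
  have hx0 : 0 < ‖x‖ := by linarith
  rw [Real.norm_eq_abs, Real.norm_eq_abs, abs_of_nonneg (by positivity : 0 ≤ (‖x‖ ^ 2)⁻¹)] at hx
  have h1 : C * (‖x‖ ^ 2)⁻¹ < m / ‖x‖ := by
    rw [div_lt_iff₀ hm] at hxC
    rw [← div_eq_mul_inv, div_lt_div_iff₀ (by positivity) hx0]
    nlinarith
  linarith [(abs_le.1 hx).2]

theorem exists_elecForm_ne_zero (hQ : Q ≠ 0) (R : ℝ) :
    ∃ x, R < ‖x‖ ∧ elecForm F (φ.symm x) ≠ 0 := by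
  obtain ⟨c, hc⟩ := (hflat.isBigO_endForm 0).bound
  obtain ⟨R', hR'⟩ := exists_forall_of_eventually_cobounded hc
  have hQ' : 0 < |Q| := abs_pos.2 hQ
  set r : ℝ := |R| + |R'| + |c| / |Q| + 1
  have hr0 : 0 < r := by positivity
  have h0 : 0 ≤ |c| / |Q| := by positivity
  set x : E3 := EuclideanSpace.single 0 r with hx
  have hxr : ‖x‖ = r := by rw [hx, EuclideanSpace.norm_single, Real.norm_eq_abs, abs_of_pos hr0]
  refine ⟨x, by linarith [le_abs_self R, abs_nonneg R'], fun he => ?_⟩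
  have h1 := hR' x (by linarith [le_abs_self R', abs_nonneg R])
  have h2 : endForm (elecForm F) φ x (EuclideanSpace.single 0 (1 : ℝ)) = 0 := by
    rw [endForm, he]
    rfl
  have h3 : x 0 = r := by simp [hx]
  rw [h2, hxr, h3, div_self hr0.ne', mul_one, zero_sub, norm_neg, Real.norm_eq_abs,
    Real.norm_eq_abs, abs_div, abs_of_pos (by positivity : 0 < r ^ 2),
    abs_of_pos (by positivity : 0 < (r ^ 3)⁻¹), ← div_eq_mul_inv,
    div_le_div_iff₀ (by positivity) (by positivity)] at h1
  have h4 : |Q| * r ≤ c := by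
    have : (|Q| * r) * r ^ 2 ≤ c * r ^ 2 := by linarith [h1]
    exact le_of_mul_le_mul_right this (by positivity)
  have h5 : |c| < |Q| * r := by
    have h6 : |c| = |Q| * (|c| / |Q|) := by field_simp
    rw [h6]
    exact mul_lt_mul_of_pos_left (by linarith [abs_nonneg R, abs_nonneg R']) hQ'
  linarith [le_abs_self c]

theorem eventually_half_norm_sq_le : ∀ᶠ x in cobounded E3, ∀ w : E3,
    1 / 2 * ‖w‖ ^ 2 ≤ (g.inner (φ.symm x) : E3 →L[ℝ] E3 →L[ℝ] ℝ)
      ((mfderiv (𝓡 3) (𝓡 3) φ.symm x : E3 →L[ℝ] E3) w)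
      ((mfderiv (𝓡 3) (𝓡 3) φ.symm x : E3 →L[ℝ] E3) w) := by
  have h1 : ∀ i j : Fin 3, ∀ᶠ x in cobounded E3,
      |(g.inner (φ.symm x) : E3 →L[ℝ] E3 →L[ℝ] ℝ) (coordVec φ x i) (coordVec φ x j)
        - if i = j then 1 else 0| ≤ 1 / 18 := by
    intro i j
    have h2 : Tendsto (fun x : E3 => ‖x‖⁻¹) (cobounded E3) (𝓝 0) :=
      tendsto_norm_cobounded_atTop.inv_tendsto_atTop
    have h3 := ((hflat.metric i j).trans_tendsto h2).abs
    rw [abs_zero] at h3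
    exact (h3.eventually (ge_mem_nhds (by norm_num : (0 : ℝ) < 1 / 18)))
  filter_upwards [eventually_all.2 fun i => eventually_all.2 fun j => h1 i j] with x hx w
  set B : E3 →L[ℝ] E3 →L[ℝ] ℝ := g.inner (φ.symm x)
  set D : E3 →L[ℝ] E3 := mfderiv (𝓡 3) (𝓡 3) φ.symm x
  have hw : w = ∑ i, w i • EuclideanSpace.single i (1 : ℝ) := by
    have h2 := (EuclideanSpace.basisFun (Fin 3) ℝ).sum_repr w
    simpa using h2.symm
  have hcv : ∀ i, D (EuclideanSpace.single i (1 : ℝ)) = coordVec φ x i := fun i => rfl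
  have hDw : D w = ∑ i, w i • coordVec φ x i := by
    conv_lhs => rw [hw]
    simp only [map_sum, map_smul, hcv]
  have hexp : B (D w) (D w) = ∑ i, ∑ j, w i * w j * B (coordVec φ x i) (coordVec φ x j) := by
    rw [hDw]
    simp only [map_sum, map_smul, ContinuousLinearMap.sum_apply, smul_apply,
      smul_eq_mul, Finset.mul_sum]
    rw [Finset.sum_comm]
    exact Finset.sum_congr rfl fun i _ => Finset.sum_congr rfl fun j _ => by ring
  have hnorm : ‖w‖ ^ 2 = ∑ i, w i ^ 2 := by
    rw [EuclideanSpace.norm_sq_eq]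
    simp
  have hwi : ∀ i, |w i| ≤ ‖w‖ := by
    intro i
    refine abs_le_of_sq_le_sq ?_ (norm_nonneg w)
    rw [hnorm]
    exact Finset.single_le_sum (f := fun j => w j ^ 2) (fun j _ => sq_nonneg _) (Finset.mem_univ i)
  have hterm : ∀ i j, w i * w j * (if i = j then 1 else 0) - ‖w‖ ^ 2 / 18
      ≤ w i * w j * B (coordVec φ x i) (coordVec φ x j) := by
    intro i j
    have h2 := hx i j
    have h3 : |w i * w j * (B (coordVec φ x i) (coordVec φ x j) - if i = j then 1 else 0)|
        ≤ ‖w‖ * ‖w‖ * (1 / 18) := by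
      rw [abs_mul, abs_mul]
      exact mul_le_mul (mul_le_mul (hwi i) (hwi j) (abs_nonneg _) (norm_nonneg _)) h2
        (abs_nonneg _) (by positivity)
    have h4 := (abs_le.1 h3).1
    nlinarith
  have hsum := Finset.sum_le_sum fun i (_ : i ∈ Finset.univ) =>
    Finset.sum_le_sum fun j (_ : j ∈ Finset.univ) => hterm i j
  refine (le_trans (le_of_eq ?_) hsum).trans (le_of_eq hexp.symm)
  rw [hnorm]
  simp [Fin.sum_univ_three]
  ring

theorem tendsto_formInner :
    Tendsto (formInner g (elecForm F) (elecForm F) ∘ φ.symm) (cobounded E3) (𝓝 0) := by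
  obtain ⟨C, R, hR, hC⟩ := hflat.exists_norm_endForm_le
  have h1 : Tendsto (fun x : E3 => (‖x‖ ^ 2)⁻¹) (cobounded E3) (𝓝 0) :=
    ((tendsto_pow_atTop two_ne_zero).comp tendsto_norm_cobounded_atTop).inv_tendsto_atTop
  have h2 : Tendsto (fun x : E3 => 2 * (C * (‖x‖ ^ 2)⁻¹) ^ 2) (cobounded E3) (𝓝 0) := by
    simpa using ((h1.const_mul C).pow 2).const_mul 2
  refine squeeze_zero_norm' ?_ h2
  filter_upwards [hflat.eventually_half_norm_sq_le,
    tendsto_norm_cobounded_atTop.eventually (eventually_gt_atTop R)] with x hx hxR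
  have hxt := hflat.mem_target (hR.trans hxR)
  have hCx := hC x hxR
  set B : E3 →L[ℝ] E3 →L[ℝ] ℝ := g.inner (φ.symm x)
  set l := elecForm F (φ.symm x)
  obtain ⟨w, hw⟩ : ∃ w : E3, (mfderiv (𝓡 3) (𝓡 3) φ.symm x : E3 →L[ℝ] E3) w = B.inverse l :=
    mfderiv_symm_surjective hxt (B.inverse l)
  have h3 := hx w
  have h4 : B (B.inverse l) = l := apply_inverse_of_nondeg (inner_nondeg g (φ.symm x)) l
  have h5 : formInner g (elecForm F) (elecForm F) (φ.symm x) = l (B.inverse l) := rfl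
  have h6 : l (B.inverse l) = endForm (elecForm F) φ x w := by
    rw [← hw]
    rfl
  replace h3 : 1 / 2 * ‖w‖ ^ 2 ≤ l (B.inverse l) := by
    have h7 : B (B.inverse l) (B.inverse l) = l (B.inverse l) := by rw [h4]
    refine h3.trans (le_of_eq (Eq.trans ?_ h7))
    exact congrArg (fun a => B a a) hw
  have h7 := (le_abs_self _).trans ((endForm (elecForm F) φ x).le_opNorm w)
  rw [Function.comp_apply, h5, Real.norm_eq_abs, abs_of_nonneg ((by positivity :
    (0 : ℝ) ≤ 1 / 2 * ‖w‖ ^ 2).trans h3)]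
  rw [← div_eq_mul_inv]
  set e := ‖endForm (elecForm F) φ x‖
  have he0 : 0 ≤ e := norm_nonneg _
  have h8 : ‖w‖ ≤ 2 * e := by
    by_contra hc
    rw [not_le] at hc
    have : 0 < ‖w‖ := by linarith
    nlinarith
  calc l (B.inverse l) ≤ e * ‖w‖ := by rw [h6]; exact h7
    _ ≤ e * (2 * e) := mul_le_mul_of_nonneg_left h8 he0
    _ = 2 * e ^ 2 := by ring
    _ ≤ 2 * (C / ‖x‖ ^ 2) ^ 2 :=
      mul_le_mul_of_nonneg_left (pow_le_pow_left₀ he0 hCx 2) (by norm_num)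

end IsAsymptoticallyFlat

end End

/-! ### The exterior region and the maximum principle -/

section Exterior

variable {M : Type*} [TopologicalSpace M] [ChartedSpace E3 M] [IsManifold (𝓡 3) ∞ M]
  {P : Type*} [TopologicalSpace P] [ChartedSpace E3 P]
  {g : RiemMetric3 M} {N : M → ℝ} {F : BilinField I4 (ℝ × M)} {K : Set M}
  {φ : PartialDiffeomorph (𝓡 3) (𝓡 3) M E3 ∞} {m Q : ℝ} {f : P → ℝ × M} {U : Set M}

/-- The part of the end outside of a ball. -/
def endRegion (φ : PartialDiffeomorph (𝓡 3) (𝓡 3) M E3 ∞) (R : ℝ) : Set M :=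
  φ.symm '' {x : E3 | R < ‖x‖}

theorem IsAsymptoticallyFlat.isOpen_endRegion (hflat : IsAsymptoticallyFlat g N F K φ m Q) {R : ℝ}
    (hR : 1 ≤ R) : IsOpen (endRegion φ R) :=
  φ.toOpenPartialHomeomorph.symm.isOpen_image_of_subset_source
    (isOpen_lt continuous_const continuous_norm) fun _ hx => hflat.mem_target (hR.trans_lt hx)

namespace IsRegularExterior

variable (hU : IsRegularExterior g N φ f U)

include hU

theorem closure_cases {x : M} (hx : x ∈ closure U) : x ∈ U ∨ x ∈ frontier U := by
  by_cases h : x ∈ U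
  · exact Or.inl h
  · rw [hU.isOpen.frontier_eq]
    exact Or.inr ⟨hx, h⟩

theorem notMem_of_mem_frontier {x : M} (hx : x ∈ frontier U) : x ∉ U := by
  rw [hU.isOpen.frontier_eq] at hx
  exact hx.2

theorem mfderiv_ne_zero {x : M} (hx : x ∈ U) :
    (mfderiv (𝓡 3) 𝓘(ℝ, ℝ) N x : E3 →L[ℝ] ℝ) ≠ 0 := by
  intro h0
  refine hU.regular x hx ?_
  have h1 : gradient3 g N x = 0 := by
    have h2 : gradient3 g N x = ContinuousLinearMap.inverse
      (g.inner x : E3 →L[ℝ] E3 →L[ℝ] ℝ) (mfderiv (𝓡 3) 𝓘(ℝ, ℝ) N x : E3 →L[ℝ] ℝ) := rfl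
    rw [h2, h0]
    exact map_zero _
  rw [h1]
  exact map_zero _

theorem exists_isCompact (hflat : IsAsymptoticallyFlat g N F K φ m Q) :
    ∃ R : ℝ, 1 < R ∧ ∀ R', R ≤ R' → endRegion φ R' ⊆ U ∧ IsCompact (closure U \ endRegion φ R') := by
  obtain ⟨R, hR, hRU, hRc⟩ := hU.ends
  refine ⟨R, hR, fun R' hR' => ⟨?_, ?_⟩⟩
  · rintro _ ⟨x, hx, rfl⟩
    exact hRU ⟨x, hR'.trans_lt hx, rfl⟩
  · have h1 : IsCompact (φ.symm '' (Metric.closedBall (0 : E3) R' ∩ {x | R ≤ ‖x‖})) := by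
      refine ((isCompact_closedBall _ _).inter_right
        (isClosed_le continuous_const continuous_norm)).image_of_continuousOn fun x hx => ?_
      exact (continuousAt_symm (hflat.mem_target (hR.trans_le hx.2))).continuousWithinAt
    refine (hRc.union h1).of_isClosed_subset ?_ ?_
    · exact isClosed_closure.sdiff (hflat.isOpen_endRegion (hR.le.trans hR'))
    · rintro z ⟨hz, hz'⟩
      by_cases hzR : z ∈ φ.symm '' {x : E3 | R < ‖x‖}
      · obtain ⟨x, hx, rfl⟩ := hzR
        refine Or.inr ⟨x, ⟨?_, le_of_lt (show R < ‖x‖ from hx)⟩, rfl⟩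
        rw [mem_closedBall_zero_iff]
        by_contra hc
        exact hz' ⟨x, not_le.1 hc, rfl⟩
      · exact Or.inl ⟨hz, hzR⟩

theorem exists_endRegion_of_eventually (hflat : IsAsymptoticallyFlat g N F K φ m Q) {p : M → Prop}
    (hp : ∀ᶠ x in cobounded E3, p (φ.symm x)) :
    ∃ R : ℝ, 1 < R ∧ endRegion φ R ⊆ U ∧ IsCompact (closure U \ endRegion φ R) ∧
      ∀ z ∈ endRegion φ R, p z := by
  obtain ⟨R₁, hR₁⟩ := exists_forall_of_eventually_cobounded hp
  obtain ⟨R, hR, h⟩ := hU.exists_isCompact hflat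
  obtain ⟨h1, h2⟩ := h (max R R₁) (le_max_left _ _)
  refine ⟨max R R₁, lt_max_of_lt_left hR, h1, h2, ?_⟩
  rintro _ ⟨x, hx, rfl⟩
  exact hR₁ x ((le_max_right _ _).trans_lt hx)

/-- A continuous function which somewhere exceeds its limit at infinity attains its maximum. -/
theorem exists_isMaxOn_closure (hflat : IsAsymptoticallyFlat g N F K φ m Q) {u : M → ℝ} {ℓ : ℝ}
    (hc : ContinuousOn u (closure U)) (ht : Tendsto (u ∘ φ.symm) (cobounded E3) (𝓝 ℓ)) {x₀ : M}
    (hx₀ : x₀ ∈ closure U) (hlt : ℓ < u x₀) :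
    ∃ z ∈ closure U, ∀ y ∈ closure U, u y ≤ u z := by
  obtain ⟨R, -, -, hR, hR'⟩ := hU.exists_endRegion_of_eventually hflat (p := fun z => u z < u x₀)
    (ht.eventually (gt_mem_nhds hlt))
  have hx₀' : x₀ ∈ closure U \ endRegion φ R := ⟨hx₀, fun h => lt_irrefl _ (hR' x₀ h)⟩
  obtain ⟨z, hz, hmax⟩ := hR.exists_isMaxOn ⟨x₀, hx₀'⟩ (hc.mono diff_subset)
  refine ⟨z, hz.1, fun y hy => ?_⟩
  by_cases hyR : y ∈ endRegion φ R
  · exact (hR' y hyR).le.trans (hmax hx₀')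
  · exact hmax ⟨hy, hyR⟩

variable {N₀ : ℝ} (hN₀ : ∀ q, N (f q).2 = N₀)

include hN₀

theorem lapse_frontier {x : M} (hx : x ∈ frontier U) : N x = N₀ := by
  rw [hU.frontier_eq] at hx
  obtain ⟨q, hq⟩ := hx
  rw [← hN₀ q, hq]

variable (hN : ContMDiff (𝓡 3) 𝓘(ℝ, ℝ) ∞ N) (hflat : IsAsymptoticallyFlat g N F K φ m Q)
  (hm : 0 < m)

include hN

omit hN₀ in
theorem not_isLocalMax_lapse {x : M} (hx : x ∈ U) : ¬IsLocalMax N x := fun h =>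
  hU.mfderiv_ne_zero hx (IsLocalMax.mfderiv_eq_zero (hN.mdifferentiable (by simp) x) h)

omit hN₀ in
theorem mfderiv_neg_ne_zero {x : M} (hx : x ∈ U) :
    (mfderiv (𝓡 3) 𝓘(ℝ, ℝ) (-N) x : E3 →L[ℝ] ℝ) ≠ 0 := by
  have h1 := ((hN.mdifferentiable (by simp) x).hasMFDerivAt.neg).mfderiv
  intro h0
  refine hU.mfderiv_ne_zero hx (neg_eq_zero.1 ?_)
  exact h1.symm.trans h0

omit hN₀ in
theorem not_isLocalMin_lapse {x : M} (hx : x ∈ U) : ¬IsLocalMin N x := fun h =>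
  hU.mfderiv_neg_ne_zero hN hx
    (IsLocalMax.mfderiv_eq_zero (hN.neg.mdifferentiable (by simp) x) h.neg)

include hflat hm

/-- The minimum of the lapse function is attained exactly on the boundary. -/
theorem lapse_bounds : (frontier U).Nonempty ∧ N₀ < 1 ∧ (∀ x ∈ U, N₀ < N x) ∧
    ∀ x ∈ closure U, N x < 1 := by
  have hcont : Continuous N := hN.continuous
  have hnhds : ∀ x ∈ U, ∀ {p : M → Prop}, (∀ y ∈ closure U, p y) → ∀ᶠ y in 𝓝 x, p y := by
    intro x hx p hp
    filter_upwards [hU.isOpen.mem_nhds hx] with y hy using hp y (subset_closure hy)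
  obtain ⟨R, hR, hRU, -, hR1⟩ := hU.exists_endRegion_of_eventually hflat (p := fun z => N z < 1)
    (hflat.eventually_lapse_lt_one hm)
  have hx₁ : ∃ x₁ ∈ U, N x₁ < 1 := by
    have h1 : φ.symm (EuclideanSpace.single 0 (R + 1)) ∈ endRegion φ R := by
      refine ⟨_, ?_, rfl⟩
      rw [mem_setOf_eq, EuclideanSpace.norm_single, Real.norm_eq_abs,
        abs_of_pos (by linarith : 0 < R + 1)]
      linarith
    exact ⟨_, hRU h1, hR1 _ h1⟩
  obtain ⟨x₁, hx₁, hx₁'⟩ := hx₁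
  have hlim := hflat.tendsto_lapse
  obtain ⟨z, hz, hmin⟩ := hU.exists_isMaxOn_closure hflat (u := fun x => -N x) (ℓ := -1)
    hcont.neg.continuousOn hlim.neg (subset_closure hx₁) (by linarith)
  have hmin' : ∀ y ∈ closure U, N z ≤ N y := fun y hy => neg_le_neg_iff.1 (hmin y hy)
  have hzU : z ∉ U := fun h => hU.not_isLocalMin_lapse hN h (hnhds z h hmin')
  have hzf : z ∈ frontier U := (hU.closure_cases hz).resolve_left hzU
  have hzN : N z = N₀ := hU.lapse_frontier hN₀ hzf
  have hN₀1 : N₀ < 1 := by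
    have := hmin' x₁ (subset_closure hx₁)
    linarith
  refine ⟨⟨z, hzf⟩, hN₀1, fun x hx => ?_, fun x hx => ?_⟩
  · refine lt_of_le_of_ne (hzN ▸ hmin' x (subset_closure hx)) fun heq => ?_
    refine hU.not_isLocalMin_lapse hN hx (hnhds x hx fun y hy => ?_)
    rw [← heq, ← hzN]
    exact hmin' y hy
  · have hle : ∀ y ∈ closure U, N y ≤ 1 := by
      by_contra! hcon
      obtain ⟨y, hy, hy1⟩ := hcon
      obtain ⟨w, hw, hmax⟩ := hU.exists_isMaxOn_closure hflat hcont.continuousOn hlim hy hy1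
      rcases hU.closure_cases hw with hwU | hwf
      · exact hU.not_isLocalMax_lapse hN hwU (hnhds w hwU hmax)
      · have h1 := hmax y hy
        rw [hU.lapse_frontier hN₀ hwf] at h1
        linarith
    refine lt_of_le_of_ne (hle x hx) fun heq => ?_
    rcases hU.closure_cases hx with hxU | hxf
    · refine hU.not_isLocalMax_lapse hN hxU (hnhds x hxU fun y hy => ?_)
      rw [heq]
      exact hle y hy
    · rw [hU.lapse_frontier hN₀ hxf] at heq
      linarith

omit hN hm hN₀ in
theorem isCompact_frontier : IsCompact (frontier U) := by
  obtain ⟨R, hR, h⟩ := hU.exists_isCompact hflat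
  obtain ⟨h1, h2⟩ := h R le_rfl
  refine h2.of_isClosed_subset isClosed_frontier fun x hx => ⟨hx.1, fun h3 => ?_⟩
  exact hU.notMem_of_mem_frontier hx (h1 h3)

omit hN₀ hm in
theorem isCompact_closure_inter {b : ℝ} (hb : b < 1) : IsCompact (closure U ∩ N ⁻¹' Iic b) := by
  obtain ⟨R, -, -, hR, hR'⟩ := hU.exists_endRegion_of_eventually hflat (p := fun z => b < N z)
    (hflat.tendsto_lapse.eventually (lt_mem_nhds hb))
  refine hR.of_isClosed_subset (isClosed_closure.inter (isClosed_Iic.preimage hN.continuous)) ?_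
  exact fun x hx => ⟨hx.1, fun h => absurd (hR' x h) (not_lt.2 hx.2)⟩

omit hm in
theorem isCompact_inter {a b : ℝ} (ha : N₀ < a) (hb : b < 1) :
    IsCompact (U ∩ N ⁻¹' Icc a b) := by
  have h1 : U ∩ N ⁻¹' Icc a b = (closure U ∩ N ⁻¹' Iic b) ∩ N ⁻¹' Ici a := by
    ext x
    constructor
    · exact fun hx => ⟨⟨subset_closure hx.1, hx.2.2⟩, hx.2.1⟩
    · rintro ⟨⟨hx, hxb⟩, hxa⟩
      refine ⟨(hU.closure_cases hx).resolve_right fun hf => ?_, hxa, hxb⟩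
      have h2 : a ≤ N x := hxa
      rw [hU.lapse_frontier hN₀ hf] at h2
      linarith
  rw [h1]
  exact (hU.isCompact_closure_inter hN hflat hb).inter_right (isClosed_Ici.preimage hN.continuous)

end IsRegularExterior

/-- The operator `Δ u - ⟨∇N, ∇u⟩ / N` at a point of the manifold. -/
noncomputable def driftAt (g : RiemMetric3 M) (N u : M → ℝ) (x : M) : ℝ :=
  driftLap (chartMetric g x) (chartFun N x) (chartFun u x) (extChartAt (𝓡 3) x x)

/-- The weak maximum principle for the operator `driftAt`. -/
theorem IsRegularExterior.le_of_driftAt_nonneg (hU : IsRegularExterior g N φ f U)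
    (h : IsStaticElectrovac g N F) (hflat : IsAsymptoticallyFlat g N F K φ m Q) (hm : 0 < m)
    {N₀ : ℝ} (hN₀ : ∀ q, N (f q).2 = N₀) {u : M → ℝ} {k ℓ : ℝ}
    (hc : ContinuousOn u (closure U)) (hs : ∀ x ∈ U, ContMDiffAt (𝓡 3) 𝓘(ℝ, ℝ) ∞ u x)
    (hL : ∀ x ∈ U, 0 ≤ driftAt g N u x) (hf : ∀ x ∈ frontier U, u x ≤ k)
    (ht : Tendsto (u ∘ φ.symm) (cobounded E3) (𝓝 ℓ)) (hℓ : ℓ ≤ k) {x : M} (hx : x ∈ closure U) :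
    u x ≤ k := by
  by_contra hlt
  rw [not_le] at hlt
  obtain ⟨-, hN₀1, -, hN1⟩ := hU.lapse_bounds hN₀ h.lapse_smooth hflat hm
  have hcont : Continuous N := h.lapse_smooth.continuous
  set ε := (u x - k) / 2 with hε
  have hε0 : 0 < ε := by linarith
  let v : M → ℝ := fun y => u y + ε * (N y * (N y * N y))
  have hcube : ∀ y, N y < 1 → N y * (N y * N y) < 1 := by
    intro y hy
    have h1 := h.lapse_pos y
    have h2 : N y * N y < 1 := by nlinarith
    nlinarith
  have hcube0 : ∀ y, 0 < N y * (N y * N y) := fun y =>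
    mul_pos (h.lapse_pos y) (mul_pos (h.lapse_pos y) (h.lapse_pos y))
  have hv : Tendsto (v ∘ φ.symm) (cobounded E3) (𝓝 (ℓ + ε)) := by
    have h1 := hflat.tendsto_lapse
    have h2 := ht.add ((h1.mul (h1.mul h1)).const_mul ε)
    simp only [mul_one] at h2
    exact h2
  obtain ⟨z, hz, hmax⟩ := hU.exists_isMaxOn_closure hflat (u := v)
    (hc.add ((hcont.mul (hcont.mul hcont)).const_mul ε).continuousOn) hv hx (by
      have h1 : 0 < ε * (N x * (N x * N x)) := mul_pos hε0 (hcube0 x)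
      simp only [v]
      linarith)
  have hvz := hmax x hx
  have hvx : k + ε < v x := by
    have h1 : 0 < ε * (N x * (N x * N x)) := mul_pos hε0 (hcube0 x)
    simp only [v]
    linarith
  rcases hU.closure_cases hz with hzU | hzf
  · obtain ⟨ψ, hψ⟩ := h.isClosedForm_elecForm.exists_potential z
    obtain ⟨Ω, -, hΩ, -⟩ := h.exists_electrovacOn hψ
    obtain ⟨b, hb, -⟩ := hΩ.exists_basis 0
    have hu := contDiffAt_chartFun_self (hs z hzU)
    have hNz := hΩ.contDiffAt_lapse
    have hN3 : ContDiffAt ℝ ∞ (fun y => chartFun N z y * (chartFun N z y * chartFun N z y))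
        (extChartAt (𝓡 3) z z) := hNz.mul (hNz.mul hNz)
    have h1 : driftLap (chartMetric g z) (chartFun N z)
        (fun y => chartFun u z y + ε * (chartFun N z y * (chartFun N z y * chartFun N z y)))
        (extChartAt (𝓡 3) z z) ≤ 0 := by
      refine driftLap_nonpos_of_isLocalMax hΩ.static.metric hΩ.mem hb
        (hu.add (contDiffAt_const.mul hN3)) ?_
      have h2 : ∀ᶠ y in 𝓝 z, v y ≤ v z := by
        filter_upwards [hU.isOpen.mem_nhds hzU] with y hy using hmax y (subset_closure hy)
      filter_upwards [eventually_chart h2] with y hy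
      rw [chartFun_self, chartFun_self]
      exact hy
    have h3 := hΩ.driftLap_lapse_cube
    have h4 := hL z hzU
    rw [driftLap_add hΩ.static.metric hΩ.mem hb hu (contDiffAt_const.mul hN3),
      driftLap_const_mul hΩ.static.metric hΩ.mem hb ε hN3] at h1
    have h5 : fderiv ℝ (chartFun N z) (extChartAt (𝓡 3) z z) ≠ 0 := by
      rw [fderiv_chartFun_self (h.lapse_smooth.mdifferentiable (by simp) z)]
      exact hU.mfderiv_ne_zero hzU
    have h6 := mul_pos (mul_pos three_pos (hΩ.static.lapse_pos _ hΩ.mem)) (hΩ.gradSq_pos h5)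
    have h7 := mul_pos hε0 (h6.trans_le h3)
    rw [driftAt] at h4
    linarith
  · have h1 : v z ≤ k + ε := by
      have h2 := mul_lt_mul_of_pos_left (hcube z (hN1 z hz)) hε0
      have h3 := hf z hzf
      simp only [v]
      linarith
    linarith

end Exterior

/-! ### The electric potential of the exterior region -/

section GlobalPotential

variable {M : Type*} [TopologicalSpace M] [ChartedSpace E3 M] [IsManifold (𝓡 3) ∞ M]
  {P : Type*} [TopologicalSpace P] [ChartedSpace E3 P]
  {g : RiemMetric3 M} {N : M → ℝ} {F : BilinField I4 (ℝ × M)} {K : Set M}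
  {φ : PartialDiffeomorph (𝓡 3) (𝓡 3) M E3 ∞} {m Q : ℝ} {f : P → ℝ × M} {U : Set M}

/-- The electric field is normal to a photon sphere. -/
theorem IsPhotonSphere.elecForm_apply_eq_zero (hP : IsPhotonSphere g N F f)
    (h : IsStaticElectrovac g N F) {q : P} (v : TangentSpace (𝓡 3) q) :
    elecForm F (f q).2 ((mfderiv (𝓡 3) I4 f q v : ℝ × E3)).2 = 0 := by
  have h1 := h.field_eq (f q).1 (f q).2 (1, 0) (mfderiv (𝓡 3) I4 f q v : ℝ × E3)
  have h2 : (F ((f q).1, (f q).2) : (ℝ × E3) →L[ℝ] (ℝ × E3) →L[ℝ] ℝ) (1, 0)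
      (mfderiv (𝓡 3) I4 f q v : ℝ × E3) = 0 := hP.normal_field q v
  rw [h2] at h1
  simp only [map_zero, mul_zero, one_mul, zero_sub] at h1
  exact neg_eq_zero.1 h1.symm

/-- Electric potentials are locally constant on a photon sphere. -/
theorem IsPhotonSphere.eventually_potential_eq [IsManifold (𝓡 3) ∞ P]
    (hP : IsPhotonSphere g N F f) (h : IsStaticElectrovac g N F) {q : P} {p : M → ℝ}
    (hp : IsPotentialAt (elecForm F) p (f q).2) : ∀ᶠ q' in 𝓝 q, p (f q').2 = p (f q).2 := by
  have hcont : ContinuousAt (fun q' => (f q').2) q :=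
    (continuous_snd.comp hP.photonSurface.embedding.isEmbedding.continuous).continuousAt
  have h1 : IsPotentialAt (M := P) 0 (fun q' => p (f q').2) q := by
    filter_upwards [hcont.eventually hp] with q' hq'
    have h2 : HasMFDerivAt (𝓡 3) 𝓘(ℝ, ℝ) (fun q' => p (f q').2) q'
        ((elecForm F (f q').2).comp ((ContinuousLinearMap.snd ℝ ℝ E3).comp
          (mfderiv (𝓡 3) I4 f q' : E3 →L[ℝ] ℝ × E3))) :=
      hq'.comp q' ((hasMFDerivAt_snd (I := 𝓘(ℝ, ℝ)) (I' := 𝓡 3) (f q')).comp q'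
        hP.photonSurface.hasMFDerivAt)
    have h3 : (elecForm F (f q').2).comp ((ContinuousLinearMap.snd ℝ ℝ E3).comp
        (mfderiv (𝓡 3) I4 f q' : E3 →L[ℝ] ℝ × E3)) = (0 : P → E3 →L[ℝ] ℝ) q' :=
      ContinuousLinearMap.ext fun v => hP.elecForm_apply_eq_zero h v
    rw [← h3]
    exact h2
  have h2 : IsPotentialAt (M := P) 0 (fun _ => (0 : ℝ)) q :=
    Eventually.of_forall fun q' => hasMFDerivAt_const (0 : ℝ) q'
  obtain ⟨c, hc⟩ := h1.eventually_eq_add_const h2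
  filter_upwards [hc] with q' hq'
  rw [hq', hc.self_of_nhds]

/-- Near an intersection point of a photon sphere with a time slice, the intersection is contained
in any set whose trace on the photon sphere is a neighbourhood of the point. -/
theorem IsRegularExterior.eventually_frontier (hU : IsRegularExterior g N φ f U)
    (hP : IsPhotonSphere g N F f) {q : P} {x : M} (hq : f q = (0, x)) {p : M → Prop}
    (hp : ∀ᶠ q' in 𝓝 q, p (f q').2) : ∀ᶠ x' in 𝓝 x, x' ∈ frontier U → p x' := by
  rw [hP.photonSurface.embedding.isEmbedding.nhds_eq_comap, eventually_comap, hq] at hp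
  have h1 : Tendsto (fun x' : M => ((0 : ℝ), x')) (𝓝 x) (𝓝 (0, x)) :=
    (continuous_const.prodMk continuous_id).continuousAt
  filter_upwards [h1.eventually hp] with x' hx' hf
  rw [hU.frontier_eq] at hf
  obtain ⟨q', hq'⟩ := hf
  have h2 := hx' q' hq'
  rwa [hq'] at h2

variable [T2Space M] [SecondCountableTopology M] [IsManifold (𝓡 3) ∞ P]

/-- The germs of the electric potential along the boundary of the exterior region. -/
theorem IsRegularExterior.exists_potential_frontier (hU : IsRegularExterior g N φ f U)
    (h : IsStaticElectrovac g N F) (hP : IsPhotonSphere g N F f) :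
    ∃ p : M → ℝ, ∀ x ∈ frontier U, IsPotentialAt (elecForm F) p x ∧ p x = 0 := by
  have hα := h.isClosedForm_elecForm
  have h1 : ∀ x, ∃ q : M → ℝ, IsPotentialAt (elecForm F) q x ∧ q x = 0 := by
    intro x
    obtain ⟨q, hq⟩ := hα.exists_potential x
    exact ⟨fun y => q y + -q x, hq.add_const _, add_neg_cancel _⟩
  choose q hq hq0 using h1
  obtain ⟨p, hp⟩ := exists_glue_potential (A := frontier U) (fun x _ => hq x) (by
    intro x hx
    obtain ⟨a, ha⟩ : ∃ a, f a = (0, x) := by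
      rw [hU.frontier_eq] at hx
      exact hx
    have h2 := hP.eventually_potential_eq h (q := a) (p := q x) (by rw [ha]; exact hq x)
    rw [ha] at h2
    filter_upwards [(hq x).eventually, hU.eventually_frontier hP ha (p := fun x' => q x x' = q x x)
      h2] with x' hx' hx'' hf
    have h3 : q x x' = q x' x' := by rw [hx'' hf, hq0, hq0]
    exact hx'.eventuallyEq_of_eq (hq x') fun hc => hc.self_of_nhds h3)
  exact ⟨p, fun x hx => ⟨(hq x).congr (hp x hx), (hp x hx).self_of_nhds.trans (hq0 x)⟩⟩

/-- The electric potential of the exterior region which vanishes at infinity. -/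
theorem IsRegularExterior.exists_potential (hU : IsRegularExterior g N φ f U)
    (h : IsStaticElectrovac g N F) (hP : IsPhotonSphere g N F f)
    (hflat : IsAsymptoticallyFlat g N F K φ m Q) (hm : 0 < m) {N₀ : ℝ}
    (hN₀ : ∀ q, N (f q).2 = N₀) :
    ∃ (ψ : M → ℝ) (ψ₀ : ℝ), (∀ x ∈ closure U, IsPotentialAt (elecForm F) ψ x) ∧
      (∀ x ∈ frontier U, ψ x = ψ₀) ∧ Tendsto (ψ ∘ φ.symm) (cobounded E3) (𝓝 0) := by
  have hα := h.isClosedForm_elecForm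
  have hN := h.lapse_smooth
  have hcont : Continuous N := hN.continuous
  obtain ⟨⟨z₀, hz₀⟩, hN₀1, hNlow, hN1⟩ := hU.lapse_bounds hN₀ hN hflat hm
  obtain ⟨ψe, Re, hRe, hψe, hψe0⟩ := hflat.exists_end_potential hα
  obtain ⟨R, hR, hRc⟩ := hU.exists_isCompact hflat
  obtain ⟨hRU, hRc⟩ := hRc (max R Re) (le_max_left _ _)
  have hend : ∀ z ∈ endRegion φ (max R Re), IsPotentialAt (elecForm F) ψe z := by
    rintro _ ⟨x, hx, rfl⟩
    exact hψe x ((le_max_right _ _).trans_lt hx)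
  have hz₀' : z₀ ∈ closure U \ endRegion φ (max R Re) :=
    ⟨hz₀.1, fun h' => hU.notMem_of_mem_frontier hz₀ (hRU h')⟩
  obtain ⟨zM, hzM, hmaxM⟩ := hRc.exists_isMaxOn ⟨z₀, hz₀'⟩ hcont.continuousOn
  have hzM1 := hN1 zM hzM.1
  have hzM0 : N₀ ≤ N zM := by
    have h1 : N z₀ ≤ N zM := hmaxM hz₀'
    rwa [hU.lapse_frontier hN₀ hz₀] at h1
  set c₁ := (N zM + 1) / 2 with hc₁
  have hup : ∀ x ∈ U, c₁ < N x → x ∈ endRegion φ (max R Re) := by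
    intro x hx hlt
    by_contra hcon
    have h1 : N x ≤ N zM := hmaxM ⟨subset_closure hx, hcon⟩
    linarith
  obtain ⟨ψu, hψu⟩ := exists_potential_of_foliation (α := elecForm F) (ψ₁ := ψe) (a := N₀)
    (c₁ := c₁) hα hN hU.isOpen (fun x hx => hU.mfderiv_ne_zero hx) (by linarith) hNlow
    (fun c hc => hU.isCompact_inter hN₀ hN hflat hc (by linarith))
    (fun x hx hlt => hend x (hup x hx hlt))
  have hψulim : Tendsto (ψu ∘ φ.symm) (cobounded E3) (𝓝 0) := by
    refine hψe0.congr' ?_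
    have h1 := hflat.tendsto_lapse.eventually (lt_mem_nhds (by linarith : c₁ < 1))
    filter_upwards [h1, tendsto_norm_cobounded_atTop.eventually (eventually_gt_atTop (max R Re))]
      with x hx hxR
    exact ((hψu _ (hRU ⟨x, hxR, rfl⟩)).2 hx).symm
  obtain ⟨p, hp⟩ := hU.exists_potential_frontier h hP
  set W := {x | IsPotentialAt (elecForm F) p x}
  have hWo : IsOpen W := isOpen_iff_eventually.2 fun y hy => IsPotentialAt.eventually hy
  have hb : ∃ b, N₀ < b ∧ b ≤ c₁ ∧ ∀ x ∈ U, N x < b → x ∈ W := by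
    have hK := (hU.isCompact_closure_inter hN hflat (by linarith : c₁ < 1)).diff hWo
    rcases ((closure U ∩ N ⁻¹' Iic c₁) \ W).eq_empty_or_nonempty with he | hne
    · refine ⟨c₁, by linarith, le_rfl, fun x hx hlt => ?_⟩
      by_contra hcon
      exact (he.subset ⟨⟨subset_closure hx, hlt.le⟩, hcon⟩ : x ∈ (∅ : Set M))
    · obtain ⟨z, hz, hmin⟩ := hK.exists_isMinOn hne hcont.continuousOn
      have hzU : z ∈ U := (hU.closure_cases hz.1.1).resolve_right fun hf => hz.2 (hp z hf).1
      refine ⟨N z, hNlow z hzU, hz.1.2, fun x hx hlt => ?_⟩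
      by_contra hcon
      exact absurd (hmin ⟨⟨subset_closure hx, hlt.le.trans hz.1.2⟩, hcon⟩) (not_le.2 hlt)
  obtain ⟨b, hbN, hbc, hbW⟩ := hb
  have hzero : ∀ (ψ : M → ℝ) (x : M) (c : ℝ), (∀ᶠ y in 𝓝 x, ψ y = c) →
      IsPotentialAt 0 ψ x := fun ψ x c hc => by
    have h1 : IsPotentialAt 0 (fun _ : M => c) x :=
      Eventually.of_forall fun y => hasMFDerivAt_const c y
    exact h1.congr hc
  obtain ⟨D, hD⟩ := exists_potential_of_foliation (M := M) (α := 0) (h := -N)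
    (ψ₁ := fun x => ψu x - p x) (a := -1) (c₁ := -b) (O := U) isClosedForm_zero hN.neg hU.isOpen
    (fun x hx => hU.mfderiv_neg_ne_zero hN hx) (by linarith)
    (fun x hx => neg_lt_neg (hN1 x (subset_closure hx)))
    (fun c hc => by
      have h1 : U ∩ (-N) ⁻¹' Icc c (-b) = U ∩ N ⁻¹' Icc b (-c) := by
        ext x
        simp only [mem_inter_iff, mem_preimage, mem_Icc, Pi.neg_apply]
        constructor
        · exact fun h' => ⟨h'.1, by linarith [h'.2.2], by linarith [h'.2.1]⟩
        · exact fun h' => ⟨h'.1, by linarith [h'.2.2], by linarith [h'.2.1]⟩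
      rw [h1]
      exact hU.isCompact_inter hN₀ hN hflat hbN (by linarith))
    (fun x hx hlt => by
      have h1 : x ∈ W := hbW x hx (neg_lt_neg_iff.1 hlt)
      obtain ⟨c, hc⟩ := (hψu x hx).1.eventually_eq_add_const h1
      exact hzero _ x c (hc.mono fun y hy => by linarith))
  obtain ⟨ψ₀, hψ₀⟩ := exists_eq_add_const_of_isPreconnected hU.isOpen hU.isConnected.isPreconnected
    (fun x hx => (hD x hx).1) (fun x _ => hzero (fun _ => 0) x 0 (Eventually.of_forall fun _ => rfl))
  have hglue : ∀ x ∈ U, N x < b → ψu x = p x + ψ₀ := by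
    intro x hx hlt
    have h1 := (hD x hx).2 (neg_lt_neg hlt)
    have h2 := hψ₀ x hx
    linarith
  classical
  refine ⟨fun x => if x ∈ U then ψu x else p x + ψ₀, ψ₀, fun x hx => ?_, fun x hx => ?_, ?_⟩
  · rcases hU.closure_cases hx with hxU | hxf
    · refine (hψu x hxU).1.congr ?_
      filter_upwards [hU.isOpen.mem_nhds hxU] with y hy using if_pos hy
    · refine ((hp x hxf).1.add_const ψ₀).congr ?_
      have h1 : N x < b := by rwa [hU.lapse_frontier hN₀ hxf]
      filter_upwards [hcont.continuousAt.eventually (gt_mem_nhds h1)] with y hy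
      by_cases hyU : y ∈ U
      · rw [if_pos hyU, hglue y hyU hy]
      · rw [if_neg hyU]
  · simp only [if_neg (hU.notMem_of_mem_frontier hx), (hp x hx).2, zero_add]
  · refine hψulim.congr' ?_
    filter_upwards [tendsto_norm_cobounded_atTop.eventually (eventually_gt_atTop (max R Re))]
      with x hx
    exact (if_pos (hRU ⟨x, hx, rfl⟩)).symm

end GlobalPotential

/-! ### The functional relation between lapse and potential -/

section Relation

variable {M : Type*} [TopologicalSpace M] [ChartedSpace E3 M] [IsManifold (𝓡 3) ∞ M]
  {P : Type*} [TopologicalSpace P] [ChartedSpace E3 P]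
  {g : RiemMetric3 M} {N : M → ℝ} {F : BilinField I4 (ℝ × M)} {K : Set M}
  {φ : PartialDiffeomorph (𝓡 3) (𝓡 3) M E3 ∞} {m Q : ℝ} {f : P → ℝ × M} {U : Set M}
  {ψ : M → ℝ} {ψ₀ N₀ c : ℝ} {x : M}

theorem IsPotentialAt.hasMFDerivAt {α : M → E3 →L[ℝ] ℝ} (hψ : IsPotentialAt α ψ x) :
    HasMFDerivAt (𝓡 3) 𝓘(ℝ, ℝ) ψ x (α x) := hψ.self_of_nhds

theorem IsPotentialAt.fderiv_chartFun {α : M → E3 →L[ℝ] ℝ} (hψ : IsPotentialAt α ψ x) :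
    fderiv ℝ (chartFun ψ x) (extChartAt (𝓡 3) x x) = α x := by
  rw [fderiv_chartFun_self hψ.hasMFDerivAt.mdifferentiableAt]
  exact hψ.hasMFDerivAt.mfderiv

theorem IsPotentialAt.eq_zero_of_eventually_eq {α : M → E3 →L[ℝ] ℝ} (hψ : IsPotentialAt α ψ x)
    (h0 : ∀ᶠ y in 𝓝 x, ψ y = c) : α x = 0 := by
  have h1 : HasMFDerivAt (𝓡 3) 𝓘(ℝ, ℝ) ψ x (0 : E3 →L[ℝ] ℝ) :=
    (hasMFDerivAt_const c x).congr_of_eventuallyEq h0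
  exact hasMFDerivAt_unique hψ.hasMFDerivAt h1

/-- An electric potential on the closure of the exterior region which is constant on the boundary
and vanishes at infinity. -/
structure IsExteriorPotential (F : BilinField I4 (ℝ × M))
    (φ : PartialDiffeomorph (𝓡 3) (𝓡 3) M E3 ∞) (U : Set M) (ψ : M → ℝ) (ψ₀ : ℝ) : Prop where
  potential : ∀ x ∈ closure U, IsPotentialAt (elecForm F) ψ x
  frontier : ∀ x ∈ frontier U, ψ x = ψ₀
  tendsto : Tendsto (ψ ∘ φ.symm) (cobounded E3) (𝓝 0)

namespace IsExteriorPotential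

variable (hψ : IsExteriorPotential F φ U ψ ψ₀) (h : IsStaticElectrovac g N F)
  (hflat : IsAsymptoticallyFlat g N F K φ m Q) (hm : 0 < m) (hQ : Q ≠ 0)
  (hU : IsRegularExterior g N φ f U) (hN₀ : ∀ q, N (f q).2 = N₀)

include hψ h

theorem contMDiffAt (hx : x ∈ closure U) : ContMDiffAt (𝓡 3) 𝓘(ℝ, ℝ) ∞ ψ x :=
  (hψ.potential x hx).contMDiffAt h.isClosedForm_elecForm

theorem continuousOn : ContinuousOn ψ (closure U) := fun _ hx =>
  (hψ.contMDiffAt h hx).continuousAt.continuousWithinAt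

omit hψ in
theorem driftAt_combination {x : M} (hψ : IsPotentialAt (elecForm F) ψ x) (a b s : ℝ) :
    driftAt g N (fun x => a * (N x * N x) + (b * (ψ x * ψ x) + s * ψ x)) x
      = 2 * (a + b) * formInner g (elecForm F) (elecForm F) x := by
  obtain ⟨Ω, -, hΩ, -⟩ := h.exists_electrovacOn hψ
  obtain ⟨e, he, -⟩ := hΩ.exists_basis 0
  have hN := hΩ.contDiffAt_lapse
  have hp := hΩ.contDiffAt_potential
  have hg := hΩ.static.metric
  have h1 : driftAt g N (fun x => a * (N x * N x) + (b * (ψ x * ψ x) + s * ψ x)) x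
      = driftLap (chartMetric g x) (chartFun N x) (fun y => a * (chartFun N x y * chartFun N x y)
        + (b * (chartFun ψ x y * chartFun ψ x y) + s * chartFun ψ x y))
        (extChartAt (𝓡 3) x x) := rfl
  rw [h1, driftLap_add hg hΩ.mem he (contDiffAt_const.mul (hN.mul hN))
      ((contDiffAt_const.mul (hp.mul hp)).add (contDiffAt_const.mul hp)),
    driftLap_add hg hΩ.mem he (contDiffAt_const.mul (hp.mul hp)) (contDiffAt_const.mul hp),
    driftLap_const_mul hg hΩ.mem he _ (hN.mul hN), driftLap_const_mul hg hΩ.mem he _ (hp.mul hp),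
    driftLap_const_mul hg hΩ.mem he _ hp, hΩ.driftLap_lapse_sq, hΩ.driftLap_potential_sq,
    hΩ.driftLap_potential, formInner_self_eq, ← hψ.fderiv_chartFun]
  simp only [covGrad]
  ring

include hflat hm hU hN₀

theorem combination_le (a s : ℝ) {k : ℝ}
    (hk : a * (N₀ * N₀) + (-a * (ψ₀ * ψ₀) + s * ψ₀) ≤ k) (ha : a ≤ k) {x : M} (hx : x ∈ closure U) :
    a * (N x * N x) + (-a * (ψ x * ψ x) + s * ψ x) ≤ k := by
  have hc := h.lapse_smooth.continuous.continuousOn (s := closure U)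
  have hp := hψ.continuousOn h
  have hs : ∀ x ∈ U, ContMDiffAt (𝓡 3) 𝓘(ℝ, ℝ) ∞
      (fun x => a * (N x * N x) + (-a * (ψ x * ψ x) + s * ψ x)) x := by
    intro x hx
    have h1 := h.lapse_smooth x
    have h2 := hψ.contMDiffAt h (subset_closure hx)
    exact (contMDiffAt_const.mul (h1.mul h1)).add
      ((contMDiffAt_const.mul (h2.mul h2)).add (contMDiffAt_const.mul h2))
  refine hU.le_of_driftAt_nonneg (ℓ := a) h hflat hm hN₀
    (u := fun x => a * (N x * N x) + (-a * (ψ x * ψ x) + s * ψ x)) ?_ hs (fun x hx => ?_)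
    (fun x hx => ?_) ?_ ha hx
  · exact (continuousOn_const.mul (hc.mul hc)).add
      ((continuousOn_const.mul (hp.mul hp)).add (continuousOn_const.mul hp))
  · rw [driftAt_combination h (hψ.potential x (subset_closure hx))]
    simp
  · simp only [hU.lapse_frontier hN₀ hx, hψ.frontier x hx]
    exact hk
  · have h1 := hflat.tendsto_lapse
    have h2 := hψ.tendsto
    have h3 := ((h1.mul h1).const_mul a).add (((h2.mul h2).const_mul (-a)).add (h2.const_mul s))
    simp only [mul_one, mul_zero, add_zero] at h3
    exact h3

include hQ

theorem boundary_value_ne_zero : ψ₀ ≠ 0 := by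
  rintro rfl
  have h1 : ∀ x ∈ closure U, ψ x = 0 := by
    intro x hx
    have h2 := hψ.combination_le h hflat hm hU hN₀ 0 1 (k := 0) (by simp) le_rfl hx
    have h3 := hψ.combination_le h hflat hm hU hN₀ 0 (-1) (k := 0) (by simp) le_rfl hx
    linarith
  obtain ⟨R, hR, hRU⟩ := hU.exists_isCompact hflat
  obtain ⟨x, hx, hne⟩ := hflat.exists_elecForm_ne_zero hQ R
  have hxU : φ.symm x ∈ U := (hRU R le_rfl).1 ⟨x, hx, rfl⟩
  refine hne ((hψ.potential _ (subset_closure hxU)).eq_zero_of_eventually_eq (c := 0) ?_)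
  filter_upwards [hU.isOpen.mem_nhds hxU] with y hy using h1 y (subset_closure hy)

/-- The lapse function is a function of the electric potential. -/
theorem exists_lapse_sq_eq : ∃ c : ℝ, ∀ x ∈ closure U,
    N x * N x = 1 + ψ x * ψ x - 2 * c * ψ x := by
  have h0 := hψ.boundary_value_ne_zero h hflat hm hQ hU hN₀
  set c := (1 - N₀ * N₀ + ψ₀ * ψ₀) / (2 * ψ₀) with hc
  have hc' : 2 * c * ψ₀ = 1 - N₀ * N₀ + ψ₀ * ψ₀ := by
    rw [hc]
    field_simp
  refine ⟨c, fun x hx => ?_⟩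
  have h2 := hψ.combination_le h hflat hm hU hN₀ 1 (2 * c) (k := 1) (by linarith) le_rfl hx
  have h3 := hψ.combination_le h hflat hm hU hN₀ (-1) (-(2 * c)) (k := -1) (by linarith) le_rfl hx
  linarith

omit hN₀ hU hflat hm hQ in
/-- The differential of the relation between lapse and potential. -/
theorem lapse_mul_mfderiv (hUo : IsOpen U)
    (hc : ∀ x ∈ closure U, N x * N x = 1 + ψ x * ψ x - 2 * c * ψ x) (hx : x ∈ closure U) :
    N x • (mfderiv (𝓡 3) 𝓘(ℝ, ℝ) N x : E3 →L[ℝ] ℝ) = (ψ x - c) • elecForm F x := by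
  have hN := contDiffAt_chartFun_self (h.lapse_smooth x)
  have hp := contDiffAt_chartFun_self (hψ.contMDiffAt h hx)
  have hev : ∀ {u : E3 → ℝ} {y : E3}, ContDiffAt ℝ ∞ u y → ∀ᶠ z in 𝓝 y, DifferentiableAt ℝ u z := by
    intro u y hu
    filter_upwards [(hu.of_le two_le_infty).eventually (by simp)] with z hz
      using hz.differentiableAt (by simp)
  set D : E3 → E3 →L[ℝ] ℝ := fun z => chartFun N x z • fderiv ℝ (chartFun N x) z
    - (chartFun ψ x z - c) • fderiv ℝ (chartFun ψ x) z with hD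
  have hDc : ContinuousAt D (extChartAt (𝓡 3) x x) :=
    (hN.continuousAt.smul (hN.fderiv_right (m := 0) (by simp)).continuousAt).sub
      ((hp.continuousAt.sub continuousAt_const).smul
        (hp.fderiv_right (m := 0) (by simp)).continuousAt)
  have hfreq : ∃ᶠ z in 𝓝 (extChartAt (𝓡 3) x x), D z = 0 := by
    intro hcon
    have h1 : ∀ᶠ y in 𝓝 x, y ∉ U := by
      refine eventually_of_chart ?_
      filter_upwards [hcon, hev hN, hev hp, eventually_mem_target (mem_extChartAt_target (I := 𝓡 3) x)]
        with z hz hzN hzp hzt hzU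
      refine hz ?_
      have h2 : (fun y => chartFun N x y * chartFun N x y
          - (chartFun ψ x y * chartFun ψ x y - 2 * c * chartFun ψ x y)) =ᶠ[𝓝 z] fun _ => 1 := by
        filter_upwards [(tendsto_extChartAt_symm hzt).eventually (hUo.mem_nhds hzU)] with y hy
        have h3 := hc _ (subset_closure hy)
        simp only [Function.comp_apply]
        linarith
      have h4 := ((hzN.hasFDerivAt.mul hzN.hasFDerivAt).sub
        ((hzp.hasFDerivAt.mul hzp.hasFDerivAt).sub (hzp.hasFDerivAt.const_mul (2 * c)))).unique
        ((hasFDerivAt_const (1 : ℝ) z).congr_of_eventuallyEq h2)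
      refine ContinuousLinearMap.ext fun v => ?_
      have h5 := congrArg (fun A : E3 →L[ℝ] ℝ => A v) h4
      simp only [sub_apply, add_apply, smul_apply, smul_eq_mul,
        zero_apply] at h5
      simp only [hD, sub_apply, smul_apply, smul_eq_mul, zero_apply]
      linarith
    exact (mem_closure_iff_frequently.1 hx) h1
  have hD0 : D (extChartAt (𝓡 3) x x) = 0 := by
    by_contra hne
    exact hfreq (hDc.eventually_ne hne)
  rw [hD] at hD0
  simp only [chartFun_self, fderiv_chartFun_self (h.lapse_smooth.mdifferentiable (by simp) x),
    (hψ.potential x hx).fderiv_chartFun] at hD0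
  exact sub_eq_zero.1 hD0

end IsExteriorPotential

end Relation

/-! ### The boundary is not totally critical for the lapse function -/

section Critical

variable {M : Type*} [TopologicalSpace M] [ChartedSpace E3 M] [IsManifold (𝓡 3) ∞ M]
  {P : Type*} [TopologicalSpace P] [ChartedSpace E3 P]
  {g : RiemMetric3 M} {N : M → ℝ} {F : BilinField I4 (ℝ × M)} {K : Set M}
  {φ : PartialDiffeomorph (𝓡 3) (𝓡 3) M E3 ∞} {m Q : ℝ} {f : P → ℝ × M} {U : Set M}
  {ψ : M → ℝ} {ψ₀ N₀ c : ℝ} {x : M}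

theorem contMDiffAt_of_chartFun {u : M → ℝ}
    (hu : ContDiffAt ℝ ∞ (chartFun u x) (extChartAt (𝓡 3) x x)) :
    ContMDiffAt (𝓡 3) 𝓘(ℝ, ℝ) ∞ u x := by
  refine (hu.contMDiffAt.comp x
    (contMDiffAt_extChartAt (I := 𝓡 3) (n := ∞) (x := x))).congr_of_eventuallyEq ?_
  filter_upwards [extChartAt_source_mem_nhds (I := 𝓡 3) x] with y hy
  simp only [Function.comp_apply, (extChartAt (𝓡 3) x).left_inv hy]

theorem ElectrovacOn.mono {g : E3 → E3 →L[ℝ] E3 →L[ℝ] ℝ} {N ψ : E3 → ℝ} {Ω Ω' : Set E3} {y₀ : E3}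
    (h : ElectrovacOn g N ψ Ω y₀) (ho : IsOpen Ω') (hs : Ω' ⊆ Ω) (hy : y₀ ∈ Ω') :
    ElectrovacOn g N ψ Ω' y₀ where
  static := h.static.mono ho hs
  mem := hy
  potential_smooth := h.potential_smooth.mono hs
  potential_eq y hy := h.potential_eq y (hs hy)
  lapse_eq y hy := h.lapse_eq y (hs hy)
  ricci_eq := h.ricci_eq

theorem eventually_lt_of_hasDerivAt {a : ℝ → ℝ} {a' : ℝ} (ha : HasDerivAt a a' 0) (h0 : 0 < a') :
    ∀ᶠ t in 𝓝[>] 0, a 0 < a t := by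
  have h1 := (hasDerivAt_iff_tendsto_slope.1 ha).eventually (lt_mem_nhds h0)
  have h2 : 𝓝[>] (0 : ℝ) ≤ 𝓝[≠] 0 := nhdsWithin_mono _ fun t ht => ne_of_gt ht
  filter_upwards [h2 h1, self_mem_nhdsWithin] with t ht ht0
  rw [slope_def_field, sub_zero] at ht
  have h3 := mul_pos ht (show 0 < t from ht0)
  rw [div_mul_cancel₀ _ (ne_of_gt ht0)] at h3
  linarith

/-- The quantity `|E|² / N²`. -/
noncomputable def fieldSq (g : RiemMetric3 M) (N : M → ℝ) (F : BilinField I4 (ℝ × M)) (x : M) : ℝ :=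
  formInner g (elecForm F) (elecForm F) x / (N x * N x)

theorem formInner_self_pos (g : RiemMetric3 M) {α : M → E3 →L[ℝ] ℝ} (hα : α x ≠ 0) :
    0 < formInner g α α x := by
  set B : E3 →L[ℝ] E3 →L[ℝ] ℝ := g.inner x
  have h1 : B (B.inverse (α x)) = α x := apply_inverse_of_nondeg (inner_nondeg g x) (α x)
  have h2 : B.inverse (α x) ≠ 0 := fun h0 => hα (by rw [← h1, h0, map_zero])
  have h3 : 0 < B (B.inverse (α x)) (B.inverse (α x)) := g.pos x _ h2
  rw [h1] at h3
  exact h3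

/-- The exterior region contains the superlevel set of a function near a regular boundary point, if
the function is constant on the boundary and larger inside. -/
theorem IsRegularExterior.eventually_mem_of_lt (hU : IsRegularExterior g N φ f U) {u : M → ℝ}
    (hx : x ∈ frontier U) (hu : ContMDiffAt (𝓡 3) 𝓘(ℝ, ℝ) ∞ u x)
    (hd : (mfderiv (𝓡 3) 𝓘(ℝ, ℝ) u x : E3 →L[ℝ] ℝ) ≠ 0)
    (hf : ∀ y ∈ frontier U, u y = u x) (hlt : ∀ y ∈ U, u x < u y) :
    ∀ᶠ y in 𝓝 x, u x < u y → y ∈ U := by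
  classical
  have hconst : ∀ (p : M → ℝ) (y : M) (k : ℝ), (∀ᶠ z in 𝓝 y, p z = k) → IsPotentialAt 0 p y :=
    fun p y k hk => by
      have h1 : IsPotentialAt 0 (fun _ : M => k) y :=
        Eventually.of_forall fun z => hasMFDerivAt_const k z
      exact h1.congr hk
  obtain ⟨q, hq, hq'⟩ := isClosedForm_zero.exists_potential_superlevel
    (p := fun y => if y ∈ U then (1 : ℝ) else 0) hu hd (Eventually.of_forall fun y hy => by
      by_cases hyU : y ∈ U
      · refine hconst _ y 1 ?_
        filter_upwards [hU.isOpen.mem_nhds hyU] with z hz using if_pos hz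
      · have hyc : y ∉ closure U := fun hc => by
          rcases hU.closure_cases hc with h1 | h1
          · exact hyU h1
          · exact absurd (hf y h1) (ne_of_gt hy)
        refine hconst _ y 0 ?_
        filter_upwards [isClosed_closure.isOpen_compl.mem_nhds hyc] with z hz
          using if_neg fun h1 => hz (subset_closure h1))
  obtain ⟨k, hk⟩ := hq.eventually_eq_add_const (hconst (fun _ => 0) x 0 (Eventually.of_forall
    fun _ => rfl))
  obtain ⟨y, hyU, hy1, hy2⟩ := ((mem_closure_iff_frequently.1 hx.1).and_eventually
    (hq'.and hk)).exists
  have hk1 : k = 1 := by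
    have h1 := hy1 (hlt y hyU)
    rw [if_pos hyU] at h1
    linarith
  filter_upwards [hq', hk] with z hz1 hz2 hz
  by_contra hzU
  have h1 := hz1 hz
  rw [if_neg hzU] at h1
  linarith

section FieldSq

variable (h : IsStaticElectrovac g N F)

include h

theorem IsStaticElectrovac.fieldSq_pos (h0 : elecForm F x ≠ 0) : 0 < fieldSq g N F x :=
  div_pos (formInner_self_pos g h0) (mul_pos (h.lapse_pos x) (h.lapse_pos x))

omit h in
theorem fieldSq_of_eq_zero (h0 : elecForm F x = 0) : fieldSq g N F x = 0 := by
  have h2 : formInner g (elecForm F) (elecForm F) x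
    = elecForm F x (ContinuousLinearMap.inverse (g.inner x : E3 →L[ℝ] E3 →L[ℝ] ℝ)
      (elecForm F x)) := rfl
  have h3 : formInner g (elecForm F) (elecForm F) x = 0 := by
    rw [h2, h0]
    exact zero_apply _
  rw [fieldSq, h3, zero_div]

theorem IsStaticElectrovac.contDiffAt_chartFun_fieldSq :
    ContDiffAt ℝ ∞ (chartFun (fieldSq g N F) x) (extChartAt (𝓡 3) x x) := by
  have hx := mem_extChartAt_target (I := 𝓡 3) x
  have hE : ContDiffAt ℝ ∞ (chartForm (elecForm F) x) (extChartAt (𝓡 3) x x) :=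
    (h.isClosedForm_elecForm.smooth x).contDiffAt ((isOpen_extChartAt_target x).mem_nhds hx)
  have hN := contDiffAt_chartFun_self (h.lapse_smooth x)
  have h1 : ContDiffAt ℝ ∞ (fun y => chartForm (elecForm F) x y
      ((chartMetric g x y).inverse (chartForm (elecForm F) x y))
        / (chartFun N x y * chartFun N x y)) (extChartAt (𝓡 3) x x) := by
    refine (hE.clm_apply (((isMetricOn_chartMetric g x).contDiffAt_inverse hx).clm_apply hE)).div
      (hN.mul hN) ?_
    rw [chartFun_self]
    exact (mul_pos (h.lapse_pos x) (h.lapse_pos x)).ne'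
  refine h1.congr_of_eventuallyEq ?_
  filter_upwards [eventually_mem_target hx] with y hy
  rw [← formInner_chart g _ _ hy]
  rfl

theorem IsStaticElectrovac.contMDiffAt_fieldSq :
    ContMDiffAt (𝓡 3) 𝓘(ℝ, ℝ) ∞ (fieldSq g N F) x :=
  contMDiffAt_of_chartFun h.contDiffAt_chartFun_fieldSq

theorem IsStaticElectrovac.tendsto_fieldSq (hflat : IsAsymptoticallyFlat g N F K φ m Q) :
    Tendsto (fieldSq g N F ∘ φ.symm) (cobounded E3) (𝓝 0) := by
  have h1 := hflat.tendsto_lapse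
  have h2 := hflat.tendsto_formInner.div (h1.mul h1) (by norm_num)
  rw [zero_div] at h2
  exact h2

omit h in
/-- The chart expression of `|E|² / N²` in terms of a potential. -/
theorem chartFun_fieldSq_mul (hpos : ∀ x, 0 < N x) {y : E3} (hy : y ∈ (extChartAt (𝓡 3) x).target)
    (hψ : HasFDerivAt (chartFun ψ x) (chartForm (elecForm F) x y) y) :
    chartFun (fieldSq g N F) x y * (chartFun N x y * chartFun N x y)
      = fderiv ℝ (chartFun ψ x) y (covGrad (chartMetric g x) (chartFun ψ x) y) := by
  have h1 : chartFun (fieldSq g N F) x y = formInner g (elecForm F) (elecForm F)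
      ((extChartAt (𝓡 3) x).symm y) / (chartFun N x y * chartFun N x y) := rfl
  have h2 : chartFun N x y * chartFun N x y ≠ 0 := (mul_pos (hpos _) (hpos _)).ne'
  rw [h1, div_mul_cancel₀ _ h2, formInner_chart g _ _ hy, covGrad, hψ.fderiv]

end FieldSq

namespace IsExteriorPotential

variable (hψ : IsExteriorPotential F φ U ψ ψ₀) (h : IsStaticElectrovac g N F)
  (hflat : IsAsymptoticallyFlat g N F K φ m Q) (hm : 0 < m) (hQ : Q ≠ 0)
  (hU : IsRegularExterior g N φ f U) (hN₀ : ∀ q, N (f q).2 = N₀)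
  (hc : ∀ x ∈ closure U, N x * N x = 1 + ψ x * ψ x - 2 * c * ψ x)

include hψ h hU hc

theorem driftAt_fieldSq_nonneg (hx : x ∈ U) (s : ℝ) :
    0 ≤ driftAt g N (fun x => fieldSq g N F x + s * ψ x) x := by
  have hψx := hψ.potential x (subset_closure hx)
  obtain ⟨Ω, hΩt, hΩ, hΩψ⟩ := h.exists_electrovacOn hψx
  have h1 : ∀ᶠ z in 𝓝 (extChartAt (𝓡 3) x x), z ∈ Ω ∧ (extChartAt (𝓡 3) x).symm z ∈ U :=
    (show ∀ᶠ z in 𝓝 (extChartAt (𝓡 3) x x), z ∈ Ω from hΩ.static.metric.mem_nhds hΩ.mem).and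
      (eventually_chart (hU.isOpen.mem_nhds hx))
  obtain ⟨Ω', hΩ', hΩo, hmem⟩ := eventually_nhds_iff.1 h1
  have hE := hΩ.mono hΩo (fun z hz => (hΩ' z hz).1) hmem
  obtain ⟨e, he, -⟩ := hE.exists_basis 0
  have h2 : 0 ≤ driftLap (chartMetric g x) (chartFun N x) (chartFun (fieldSq g N F) x)
      (extChartAt (𝓡 3) x x) := by
    refine hE.driftLap_gradSq_nonneg (c := c) (fun y hy => ?_) fun y hy =>
      chartFun_fieldSq_mul h.lapse_pos (hΩt (hΩ' y hy).1) (hΩψ y (hΩ' y hy).1)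
    have hyU := subset_closure (hΩ' y hy).2
    have h3 := hψ.lapse_mul_mfderiv h hU.isOpen hc hyU
    have : IsManifold (𝓡 3) 1 M := isManifold_one
    have h4 := fderiv_comp_symm (hΩt (hΩ' y hy).1)
      (h.lapse_smooth.mdifferentiable (by simp) ((extChartAt (𝓡 3) x).symm y)).hasMFDerivAt
    rw [(hΩψ y (hΩ' y hy).1).fderiv, h4.fderiv]
    refine ContinuousLinearMap.ext fun v => ?_
    exact congrArg (fun A : E3 →L[ℝ] ℝ => A (chartInv (𝓡 3) x y v)) h3
  have h5 : driftAt g N (fun x => fieldSq g N F x + s * ψ x) x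
      = driftLap (chartMetric g x) (chartFun N x)
        (fun y => chartFun (fieldSq g N F) x y + s * chartFun ψ x y) (extChartAt (𝓡 3) x x) := rfl
  rw [h5, driftLap_add hE.static.metric hE.mem he h.contDiffAt_chartFun_fieldSq
    (contDiffAt_const.mul hE.contDiffAt_potential),
    driftLap_const_mul hE.static.metric hE.mem he _ hE.contDiffAt_potential,
    hE.driftLap_potential, mul_zero, add_zero]
  exact h2

include hflat hm hN₀

theorem fieldSq_add_le (s : ℝ) {k : ℝ} (hk : ∀ y ∈ _root_.frontier U, fieldSq g N F y + s * ψ₀ ≤ k)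
    (hk0 : 0 ≤ k) (hx : x ∈ closure U) : fieldSq g N F x + s * ψ x ≤ k := by
  refine hU.le_of_driftAt_nonneg (u := fun x => fieldSq g N F x + s * ψ x) (ℓ := 0) h hflat hm hN₀
    ?_ (fun y hy => ?_) (fun y hy => hψ.driftAt_fieldSq_nonneg h hU hc hy s) (fun y hy => ?_) ?_
    hk0 hx
  · exact ContinuousOn.add (fun y _ => h.contMDiffAt_fieldSq.continuousAt.continuousWithinAt)
      (continuousOn_const.mul (hψ.continuousOn h))
  · exact h.contMDiffAt_fieldSq.add (contMDiffAt_const.mul (hψ.contMDiffAt h (subset_closure hy)))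
  · simp only [hψ.frontier y hy]
    exact hk y hy
  · have h1 := (h.tendsto_fieldSq hflat).add (hψ.tendsto.const_mul s)
    rw [mul_zero, add_zero] at h1
    exact h1

include hQ

theorem exists_fieldSq_pos : ∃ x ∈ U, 0 < fieldSq g N F x := by
  obtain ⟨R, hR, hRU⟩ := hU.exists_isCompact hflat
  obtain ⟨x, hx, hne⟩ := hflat.exists_elecForm_ne_zero hQ R
  exact ⟨_, (hRU R le_rfl).1 ⟨x, hx, rfl⟩, h.fieldSq_pos hne⟩

/-- The gradient of the lapse function does not vanish identically on the boundary. -/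
theorem exists_mfderiv_ne_zero [IsManifold (𝓡 3) ∞ P] (hP : IsPhotonSphere g N F f) :
    ∃ x ∈ _root_.frontier U, (mfderiv (𝓡 3) 𝓘(ℝ, ℝ) N x : E3 →L[ℝ] ℝ) ≠ 0 := by
  by_contra! hcrit
  obtain ⟨x₁, hx₁, hpos₁⟩ := hψ.exists_fieldSq_pos h hflat hm hQ hU hN₀ hc
  obtain ⟨hne, hN₀1, hlow, hN1⟩ := hU.lapse_bounds hN₀ h.lapse_smooth hflat hm
  have hfr : ∀ y ∈ _root_.frontier U, (ψ₀ - c) • elecForm F y = 0 := by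
    intro y hy
    have h1 := hψ.lapse_mul_mfderiv h hU.isOpen hc hy.1
    rw [hcrit y hy, smul_zero, hψ.frontier y hy] at h1
    exact h1.symm
  by_cases hψc : ψ₀ = c
  swap
  · have h1 : ∀ y ∈ _root_.frontier U, fieldSq g N F y + 0 * ψ₀ ≤ 0 := by
      intro y hy
      rw [zero_mul, add_zero, fieldSq_of_eq_zero]
      exact (smul_eq_zero.1 (hfr y hy)).resolve_left (sub_ne_zero.2 hψc)
    have h2 := hψ.fieldSq_add_le h hflat hm hU hN₀ hc 0 h1 le_rfl (subset_closure hx₁)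
    linarith
  subst hψc
  have hNN₀ : N₀ * N₀ = 1 - ψ₀ * ψ₀ := by
    obtain ⟨z, hz⟩ := hne
    have h1 := hc z hz.1
    rw [hU.lapse_frontier hN₀ hz, hψ.frontier z hz] at h1
    linarith
  have hN₀pos : 0 < N₀ := by
    obtain ⟨z, hz⟩ := hne
    rw [← hU.lapse_frontier hN₀ hz]
    exact h.lapse_pos z
  have hneq : ∀ y ∈ U, ψ y ≠ ψ₀ := by
    intro y hy heq
    have h1 := hc y (subset_closure hy)
    have h2 := hlow y hy
    rw [heq] at h1
    nlinarith
  obtain ⟨s, hs1, hs⟩ : ∃ s : ℝ, s * s = 1 ∧ ∀ y ∈ U, 0 < s * (ψ y - ψ₀) := by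
    have hcont := (hψ.continuousOn h).mono (subset_closure (s := U))
    rcases lt_or_gt_of_ne (hneq x₁ hx₁) with hlt | hlt
    · refine ⟨-1, by norm_num, fun y hy => ?_⟩
      by_contra hcon
      obtain ⟨z, hz, hz'⟩ := hU.isConnected.isPreconnected.intermediate_value hx₁ hy hcont
        ⟨hlt.le, by linarith⟩
      exact hneq z hz hz'
    · refine ⟨1, by norm_num, fun y hy => ?_⟩
      by_contra hcon
      obtain ⟨z, hz, hz'⟩ := hU.isConnected.isPreconnected.intermediate_value hy hx₁ hcont
        ⟨by linarith, hlt.le⟩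
      exact hneq z hz hz'
  have hA : 0 ≤ -(s * ψ₀) := by
    have h1 : Tendsto (fun x => s * ((ψ ∘ φ.symm) x - ψ₀)) (cobounded E3) (𝓝 (s * (0 - ψ₀))) :=
      (hψ.tendsto.sub_const ψ₀).const_mul s
    obtain ⟨R, hR, hRU⟩ := hU.exists_isCompact hflat
    have h2 := ge_of_tendsto h1 (b := 0) (by
      filter_upwards [tendsto_norm_cobounded_atTop.eventually (eventually_gt_atTop R)] with x hx
      exact (hs _ ((hRU R le_rfl).1 ⟨x, hx, rfl⟩)).le)
    linarith
  set y₁ := fieldSq g N F x₁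
  set ε := y₁ / (2 * (-(s * ψ₀) + 1)) with hε
  have hε0 : 0 < ε := by positivity
  have hεA : ε * -(s * ψ₀) < y₁ := by
    have h1 : ε * (2 * (-(s * ψ₀) + 1)) = y₁ := by
      rw [hε]
      field_simp
    nlinarith [mul_nonneg hε0.le hA]
  obtain ⟨z, hz, hmax⟩ := (hU.isCompact_frontier hflat).exists_isMaxOn hne
    (f := fieldSq g N F) fun y _ => h.contMDiffAt_fieldSq.continuousAt.continuousWithinAt
  have hmax' : ∀ y ∈ _root_.frontier U, fieldSq g N F y ≤ fieldSq g N F z := fun y hy => hmax hy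
  have hx₁' := mul_pos hε0 (hs x₁ hx₁)
  set k := fieldSq g N F z + ε * s * ψ₀ with hk
  have hk0 : 0 ≤ k := by
    by_contra hneg
    rw [not_le] at hneg
    have h1 := hψ.fieldSq_add_le h hflat hm hU hN₀ hc (ε * s) (k := 0)
      (fun y hy => by linarith [hmax' y hy]) le_rfl (subset_closure hx₁)
    linarith
  have hle : ∀ y ∈ closure U, fieldSq g N F y + ε * s * ψ y ≤ k := fun y hy =>
    hψ.fieldSq_add_le h hflat hm hU hN₀ hc (ε * s) (fun w hw => by linarith [hmax' w hw]) hk0 hy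
  have hEz : elecForm F z ≠ 0 := by
    intro h0
    have h1 := hle x₁ (subset_closure hx₁)
    rw [hk, fieldSq_of_eq_zero h0] at h1
    linarith
  -- the second derivatives of the potential at the boundary maximum
  have hψz := hψ.potential z hz.1
  obtain ⟨Ω, hΩt, hΩ, hΩψ⟩ := h.exists_electrovacOn hψz
  obtain ⟨q, hq⟩ : ∃ q, f q = (0, z) := by
    have hz' := hz
    rw [hU.frontier_eq] at hz'
    exact hz'
  set p₀ := extChartAt (𝓡 3) z z
  set G := chartMetric g z
  set V := covGrad G (chartFun ψ z) p₀
  have hNcrit : fderiv ℝ (chartFun N z) p₀ = 0 := by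
    rw [fderiv_chartFun_self (h.lapse_smooth.mdifferentiable (by simp) z), hcrit z hz]
    rfl
  have hgradN : covGrad G (chartFun N z) p₀ = 0 := by
    rw [covGrad, hNcrit, map_zero]
  have hdψ : fderiv ℝ (chartFun ψ z) p₀ = elecForm F z := hψz.fderiv_chartFun
  have hψs := hΩ.contDiffAt_potential
  have htan : ∀ e, elecForm F z e = 0 → covHess G (chartFun ψ z) p₀ e e = 0 := by
    intro e he
    have h1 := hP.eventually_potential_eq h (q := q) (p := ψ) (by rw [hq]; exact hψz)
    rw [hq] at h1
    rw [hP.photonSurface.covHess_tangential (q := q) h.lapse_smooth h.lapse_pos (u := ψ) (x := z)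
      (by rw [hq]) hψz.hasMFDerivAt hEz hψs h1 he, hgradN,
      (fderiv ℝ (chartFun ψ z) p₀).map_zero, mul_zero, zero_div]
  obtain ⟨b, hb, d, hd0, hVb⟩ := hΩ.exists_basis V
  have hVne : 0 < fderiv ℝ (chartFun ψ z) p₀ V := hΩ.gradSq_pos (by rw [hdψ]; exact hEz)
  have hbtan : ∀ i, i ≠ 0 → elecForm F z (b i) = 0 := by
    intro i hi
    rw [← hdψ, ← hΩ.static.metric.apply_covGrad hΩ.mem]
    change G p₀ V (b i) = 0
    rw [hVb, map_smul, smul_apply, hb, if_neg hi.symm, smul_zero]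
  have hHV : covHess G (chartFun ψ z) p₀ V V = 0 := by
    have h1 := hΩ.potential_eq p₀ hΩ.mem
    rw [hΩ.static.metric.covLap_eq_sum hΩ.mem hb, Fin.sum_univ_three, htan _ (hbtan 1 (by simp)),
      htan _ (hbtan 2 (by simp)), hgradN, (fderiv ℝ (chartFun ψ z) p₀).map_zero, zero_div, add_zero,
      add_zero] at h1
    rw [hVb]
    simp only [map_smul, smul_apply, h1, smul_zero]
  have hys := h.contDiffAt_chartFun_fieldSq (x := z)
  have hdy : fderiv ℝ (chartFun (fieldSq g N F) z) p₀ V = 0 := by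
    have h1 : (fun y => chartFun (fieldSq g N F) z y * (chartFun N z y * chartFun N z y))
        =ᶠ[𝓝 p₀] fun y => fderiv ℝ (chartFun ψ z) y (covGrad G (chartFun ψ z) y) := by
      filter_upwards [hΩ.static.metric.mem_nhds hΩ.mem] with y hy
        using chartFun_fieldSq_mul h.lapse_pos (hΩt hy) (hΩψ y hy)
    have hNd := hΩ.contDiffAt_lapse.differentiableAt infty_ne_zero
    have hyd := hys.differentiableAt infty_ne_zero
    have h2 := congrArg (fun A : E3 →L[ℝ] ℝ => A V) h1.fderiv_eq
    rw [hΩ.static.metric.fderiv_apply_covGrad hΩ.mem hΩ.potential_smooth,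
      fderiv_fun_mul hyd (show DifferentiableAt ℝ (fun y => chartFun N z y * chartFun N z y) p₀ from
        hNd.mul hNd), fderiv_fun_mul hNd hNd, hNcrit] at h2
    change _ = 2 * covHess G (chartFun ψ z) p₀ V V at h2
    rw [hHV] at h2
    simp only [smul_zero, add_zero, zero_add, mul_zero, smul_apply,
      smul_eq_mul] at h2
    have hNz := h.lapse_pos z
    rw [chartFun_self] at h2
    exact (mul_eq_zero.1 h2).resolve_left (mul_pos hNz hNz).ne'
  have hmem : ∀ᶠ y in 𝓝 z, s * ψ z < s * ψ y → y ∈ U := by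
    refine hU.eventually_mem_of_lt (u := fun y => s * ψ y) hz
      (contMDiffAt_const.mul (hψ.contMDiffAt h hz.1)) ?_ (fun y hy => ?_) fun y hy => ?_
    · have h1 : HasMFDerivAt (𝓡 3) 𝓘(ℝ, ℝ) (fun y => s * ψ y) z (s • elecForm F z) :=
        hψz.hasMFDerivAt.const_smul s
      have h2 : (mfderiv (𝓡 3) 𝓘(ℝ, ℝ) (fun y => s * ψ y) z : E3 →L[ℝ] ℝ) = s • elecForm F z :=
        h1.mfderiv
      rw [h2]
      exact smul_ne_zero (fun h0 => by simp [h0] at hs1) hEz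
    · simp only [hψ.frontier y hy, hψ.frontier z hz]
    · simp only [hψ.frontier z hz]
      linarith [hs y hy]
  have hline : HasDerivAt (fun t : ℝ => p₀ + t • (s • V)) (s • V) 0 := by
    simpa using ((hasDerivAt_id (0 : ℝ)).smul_const (s • V)).const_add p₀
  have hl0 : p₀ + (0 : ℝ) • (s • V) = p₀ := by simp
  have hψd : HasFDerivAt (chartFun ψ z) (fderiv ℝ (chartFun ψ z) p₀) (p₀ + (0 : ℝ) • (s • V)) := by
    rw [hl0]
    exact (hψs.differentiableAt (by simp)).hasFDerivAt
  have hyd : HasFDerivAt (chartFun (fieldSq g N F) z) (fderiv ℝ (chartFun (fieldSq g N F) z) p₀)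
      (p₀ + (0 : ℝ) • (s • V)) := by
    rw [hl0]
    exact (hys.differentiableAt (by simp)).hasFDerivAt
  have hψt := hψd.comp_hasDerivAt (0 : ℝ) hline
  have hyt := hyd.comp_hasDerivAt (0 : ℝ) hline
  have e1 : fderiv ℝ (chartFun ψ z) p₀ (s • V) = s * fderiv ℝ (chartFun ψ z) p₀ V := by
    rw [map_smul, smul_eq_mul]
  have e2 : fderiv ℝ (chartFun (fieldSq g N F) z) p₀ (s • V) = 0 := by
    rw [map_smul, hdy, smul_zero]
  rw [e1] at hψt
  rw [e2] at hyt
  have ev1 := eventually_lt_of_hasDerivAt (hψt.const_mul s) (by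
    rw [← mul_assoc, hs1, one_mul]
    exact hVne)
  have ev2 := eventually_lt_of_hasDerivAt (hyt.add (hψt.const_mul (ε * s))) (by
    rw [zero_add, mul_assoc, ← mul_assoc s, hs1, one_mul]
    exact mul_pos hε0 hVne)
  have ev3 : ∀ᶠ t in 𝓝[>] (0 : ℝ), s * ψ z < s * chartFun ψ z (p₀ + t • (s • V)) →
      (extChartAt (𝓡 3) z).symm (p₀ + t • (s • V)) ∈ U := by
    have h1 := hline.continuousAt.tendsto
    rw [hl0] at h1
    exact nhdsWithin_le_nhds (h1.eventually (eventually_chart hmem))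
  obtain ⟨t, ht1, ht2, ht3⟩ := (ev1.and (ev2.and ev3)).exists
  simp only [Function.comp_apply, Pi.add_apply, hl0] at ht1 ht2 ht3
  have hzz : (extChartAt (𝓡 3) z).symm p₀ = z := extChartAt_to_inv z
  rw [hzz] at ht1 ht2
  have h1 := hle _ (subset_closure (ht3 ht1))
  rw [hψ.frontier z hz] at ht2
  linarith

end IsExteriorPotential

end Critical

/-! ### The Codazzi equation for umbilic level sets -/

section Codazzi

variable {E : Type*} [NormedAddCommGroup E] [NormedSpace ℝ E] [FiniteDimensional ℝ E]

/-- The difference of the Hessian of `n` and of the multiple `|∇n|² / n` of the metric. -/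
noncomputable def umbilicDefect (G : E → E →L[ℝ] E →L[ℝ] ℝ) (n : E → ℝ) (y : E) :
    E →L[ℝ] E →L[ℝ] ℝ :=
  covHess G n y - (fderiv ℝ n y (covGrad G n y) / n y) • G y

theorem umbilicDefect_apply (G : E → E →L[ℝ] E →L[ℝ] ℝ) (n : E → ℝ) (y v w : E) :
    umbilicDefect G n y v w
      = covHess G n y v w - fderiv ℝ n y (covGrad G n y) / n y * G y v w := rfl

/-- The orthogonal projection of `a` to the level sets of `n`, multiplied by `|∇n|²`. -/
noncomputable def levelProj (G : E → E →L[ℝ] E →L[ℝ] ℝ) (n : E → ℝ) (a y : E) : E :=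
  fderiv ℝ n y (covGrad G n y) • a - fderiv ℝ n y a • covGrad G n y

theorem fderiv_levelProj (G : E → E →L[ℝ] E →L[ℝ] ℝ) (n : E → ℝ) (a y : E) :
    fderiv ℝ n y (levelProj G n a y) = 0 := by
  rw [levelProj, map_sub, map_smul, map_smul, smul_eq_mul, smul_eq_mul]
  ring

theorem levelProj_of_tangent {G : E → E →L[ℝ] E →L[ℝ] ℝ} {n : E → ℝ} {a y : E}
    (ha : fderiv ℝ n y a = 0) : levelProj G n a y = fderiv ℝ n y (covGrad G n y) • a := by
  rw [levelProj, ha, zero_smul, sub_zero]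

variable {G : E → E →L[ℝ] E →L[ℝ] ℝ} {Ω : Set E} {n : E → ℝ} {y : E}

namespace IsMetricOn

variable (hG : IsMetricOn G Ω) (hy : y ∈ Ω) (hn : ContDiffOn ℝ ∞ n Ω)

include hG hy hn

theorem hasFDerivAt_levelProj {a : E} (ha : fderiv ℝ n y a = 0) : ∃ A : E →L[ℝ] E,
    HasFDerivAt (levelProj G n a) A y ∧ ∀ z, A z = (2 * covHess G n y z (covGrad G n y)) • a
      - (fderiv ℝ (fderiv ℝ n) y z a) • covGrad G n y := by
  have hd := (hG.differentiableAt_fderiv hy hn).hasFDerivAt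
  have hW := (((hG.contDiffOn_apply_covGrad hn).contDiffAt
    (hG.mem_nhds hy)).differentiableAt (by simp)).hasFDerivAt
  have hV := (((hG.contDiffOn_covGrad hn).contDiffAt
    (hG.mem_nhds hy)).differentiableAt (by simp)).hasFDerivAt
  refine ⟨_, (hW.smul_const a).sub ((hd.clm_apply (hasFDerivAt_const a y)).smul hV), fun z => ?_⟩
  simp [ha, hG.fderiv_apply_covGrad hy hn]

variable (hn0 : n y ≠ 0) (hW : fderiv ℝ n y (covGrad G n y) ≠ 0)
  (h0 : ∀ a b, umbilicDefect G n y (levelProj G n a y) (levelProj G n b y) = 0)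

omit hn in
include hW h0 in
theorem umbilicDefect_of_tangent (w : E) {b : E} (hb : fderiv ℝ n y b = 0) :
    umbilicDefect G n y w b
      = fderiv ℝ n y w / fderiv ℝ n y (covGrad G n y) * covHess G n y (covGrad G n y) b := by
  set W := fderiv ℝ n y (covGrad G n y) with hWdef
  have h1 := h0 w b
  rw [levelProj_of_tangent hb, ← hWdef, map_smul, smul_eq_mul] at h1
  have h2 := (mul_eq_zero.1 h1).resolve_left hW
  rw [levelProj, map_sub, map_smul, map_smul, sub_apply, smul_apply,
    smul_apply, smul_eq_mul, smul_eq_mul, ← hWdef] at h2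
  have h3 : umbilicDefect G n y (covGrad G n y) b = covHess G n y (covGrad G n y) b := by
    rw [umbilicDefect_apply, hG.apply_covGrad hy, hb, mul_zero, sub_zero]
  rw [h3] at h2
  field_simp
  linarith

include hn0 hW h0 in
/-- The Codazzi equation. -/
theorem codazzi_of_umbilic
    (hd : ∀ a b z, fderiv ℝ n y z = 0 →
      fderiv ℝ (fun x => umbilicDefect G n x (levelProj G n a x) (levelProj G n b x)) y z = 0)
    {a b z : E} (ha : fderiv ℝ n y a = 0) (hb : fderiv ℝ n y b = 0) (hz : fderiv ℝ n y z = 0) :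
    fderiv ℝ n y (covGrad G n y)
        * (fderiv ℝ (covHess G n) y z a b - covHess G n y (christoffel G y z a) b
          - covHess G n y a (christoffel G y z b)
          - 2 * covHess G n y z (covGrad G n y) / n y * G y a b)
      = covHess G n y z a * covHess G n y (covGrad G n y) b
        + covHess G n y z b * covHess G n y (covGrad G n y) a := by
  have hny := hG.contDiffAt_of_mem hn hy
  have hnd := hny.differentiableAt infty_ne_zero
  have hWd := ((hG.contDiffOn_apply_covGrad hn).contDiffAt
    (hG.mem_nhds hy)).differentiableAt infty_ne_zero
  have hT := (hG.contDiffAt_covHess hy hny).differentiableAt infty_ne_zero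
  have hL := hWd.hasFDerivAt.mul (hasFDerivAt_inv hn0 |>.comp y hnd.hasFDerivAt)
  have hD : HasFDerivAt (umbilicDefect G n) _ y :=
    hT.hasFDerivAt.sub (hL.smul (hG.differentiableAt hy).hasFDerivAt)
  obtain ⟨A, hA, hAz⟩ := hG.hasFDerivAt_levelProj hy hn ha
  obtain ⟨B, hB, hBz⟩ := hG.hasFDerivAt_levelProj hy hn hb
  have hsym := hG.covHess_symm hy hny
  have hsymD : ∀ v w, umbilicDefect G n y v w = umbilicDefect G n y w v := fun v w => by
    rw [umbilicDefect_apply, umbilicDefect_apply, hsym, hG.symm y hy]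
  have h1 := hd a b z hz
  rw [fderiv_apply₂ hD.differentiableAt hA.differentiableAt hB.differentiableAt, hA.fderiv,
    hB.fderiv, hAz, hBz, levelProj_of_tangent ha, levelProj_of_tangent hb, hD.fderiv] at h1
  have hu := hG.umbilicDefect_of_tangent hy hW h0
  have hab : umbilicDefect G n y a b = 0 := by rw [hu a hb, ha, zero_div, zero_mul]
  have hVb := hu (covGrad G n y) hb
  have hVa := hu (covGrad G n y) ha
  have hΓa := hu (christoffel G y z a) hb
  have hΓb := hu (christoffel G y z b) ha
  rw [hsymD] at hΓb
  have hza := covHess_apply G n y z a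
  have hzb := covHess_apply G n y z b
  have hdW := hG.fderiv_apply_covGrad hy hn z
  have hcomp := hG.fderiv_eq hy z a b
  rw [hG.symm y hy _ a] at hcomp
  have hflip := hsymD a (covGrad G n y)
  set W := fderiv ℝ n y (covGrad G n y) with hWdef
  simp only [map_sub, map_smul, sub_apply, add_apply, smul_apply, smul_eq_mul,
    ContinuousLinearMap.comp_apply, ContinuousLinearMap.smulRight_apply,
    hab, hflip, hVa, hVb, div_self hW, one_mul, hcomp, hz, hdW] at h1
  have e1 : ((fun x => fderiv ℝ n x (covGrad G n x)) * (fun x => x⁻¹) ∘ n) y = W / n y := rfl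
  have e2 : ((fun x : ℝ => x⁻¹) ∘ n) y = (n y)⁻¹ := rfl
  rw [umbilicDefect_apply, ← hWdef, div_mul_eq_mul_div _ W, eq_div_iff hW] at hΓa hΓb
  rw [e1, e2, map_zero] at h1
  refine mul_left_cancel₀ hW ?_
  rw [hza, hzb]
  linear_combination h1 - W * hΓa - W * hΓb

end IsMetricOn

/-- If the electric field is normal to an umbilic level set of the lapse function, then the length
of the gradient of the lapse function is constant to first order along the level set. -/
theorem ElectrovacOn.covHess_covGrad_eq_zero {G : E3 → E3 →L[ℝ] E3 →L[ℝ] ℝ} {n ψ : E3 → ℝ}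
    {Ω : Set E3} {y : E3} (h : ElectrovacOn G n ψ Ω y) (hn : fderiv ℝ n y ≠ 0)
    (hψ : ∀ z, fderiv ℝ n y z = 0 → fderiv ℝ ψ y z = 0)
    (h0 : ∀ a b, umbilicDefect G n y (levelProj G n a y) (levelProj G n b y) = 0)
    (hd : ∀ a b z, fderiv ℝ n y z = 0 →
      fderiv ℝ (fun x => umbilicDefect G n x (levelProj G n a x) (levelProj G n b x)) y z = 0)
    {z : E3} (hz : fderiv ℝ n y z = 0) : covHess G n y z (covGrad G n y) = 0 := by
  have hG := h.static.metric
  have hW := h.gradSq_pos hn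
  have hn0 := h.static.lapse_pos y h.mem
  obtain ⟨b, hb, c, -, hV⟩ := h.exists_basis (covGrad G n y)
  have hny := h.contDiffAt_lapse
  have hsym := hG.covHess_symm h.mem hny
  have hdn : ∀ i, fderiv ℝ n y (b i) = if i = 0 then c else 0 := by
    intro i
    rw [← hG.apply_covGrad h.mem, hV, map_smul, smul_apply, hb, smul_eq_mul]
    by_cases hi : i = 0
    · rw [if_pos hi, if_pos hi.symm, mul_one]
    · rw [if_neg hi, if_neg (Ne.symm hi), mul_zero]
  have hWc : fderiv ℝ n y (covGrad G n y) = c * c := by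
    rw [hV, map_smul, hdn, if_pos rfl, smul_eq_mul]
  have hc : c ≠ 0 := fun hc => by rw [hWc, hc, mul_zero] at hW; exact lt_irrefl _ hW
  have key : ∀ i j : Fin 3, i ≠ 0 → j ≠ 0 → i ≠ j → covHess G n y (b i) (b 0) = 0 := by
    intro i j hi hj hij
    have hi0 : fderiv ℝ n y (b i) = 0 := by rw [hdn, if_neg hi]
    have hj0 : fderiv ℝ n y (b j) = 0 := by rw [hdn, if_neg hj]
    have c1 := hG.codazzi_of_umbilic h.mem h.static.lapse_smooth hn0.ne' hW.ne' h0 hd hj0 hj0 hi0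
    have c2 := hG.codazzi_of_umbilic h.mem h.static.lapse_smooth hn0.ne' hW.ne' h0 hd hi0 hj0 hj0
    have u1 := hG.umbilicDefect_of_tangent h.mem hW.ne' h0 (b i) hj0
    have u2 := hG.umbilicDefect_of_tangent h.mem hW.ne' h0 (b j) hj0
    rw [hi0, zero_div, zero_mul, umbilicDefect_apply, hb, if_neg hij, mul_zero, sub_zero] at u1
    rw [hj0, zero_div, zero_mul, umbilicDefect_apply, hb, if_pos rfl, mul_one, sub_eq_zero] at u2
    have r1 := hG.ricci_identity h.mem hny (b i) (b j) (b j)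
    have r2 := h.ricci_eq (b i) (b 0)
    have hsum : ∀ r : Fin 3 → ℝ, ∑ k, r k = r 0 + r i + r j := by
      intro r
      have h1 : ∀ i j : Fin 3, i ≠ 0 → j ≠ 0 → i ≠ j → i = 1 ∧ j = 2 ∨ i = 2 ∧ j = 1 := by decide
      rw [Fin.sum_univ_three]
      rcases h1 i j hi hj hij with ⟨rfl, rfl⟩ | ⟨rfl, rfl⟩
      · rfl
      · ring
    have s1 := hG.riemann_skew h.mem (b 0) (b i) (b 0) (b 0)
    have s2 := hG.riemann_skew h.mem (b j) (b i) (b 0) (b j)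
    have a1 : riemann G y (b i) (b i) (b 0) = 0 := by
      rw [riemann]
      abel
    have a2 : riemann G y (b j) (b i) (b j) = -riemann G y (b i) (b j) (b j) := by
      rw [riemann, riemann]
      abel
    have a3 : fderiv ℝ n y (riemann G y (b i) (b j) (b j))
        = c * G y (riemann G y (b i) (b j) (b j)) (b 0) := by
      rw [← hG.apply_covGrad h.mem, hV, map_smul, smul_apply,
        hG.symm y h.mem (b 0), smul_eq_mul]
    have a4 : ∀ v, covHess G n y v (covGrad G n y) = c * covHess G n y v (b 0) := fun v => by
      rw [hV, map_smul, smul_eq_mul]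
    have a5 : G y 0 (b i) = 0 := by simp
    rw [ricci_of_orthogonal hG h.mem (fun i j hij => by rw [hb, if_neg hij]), hsum, a1, s2, a2,
      map_neg, a5, ContinuousLinearMap.neg_apply, hψ _ hi0, hb i 0, if_neg hi,
      hb, hb, hb, if_pos rfl, if_pos rfl, if_pos rfl] at r2
    rw [hsym (covGrad G n y), hb, if_pos rfl, u1] at c1
    rw [hsym (covGrad G n y), hsym (covGrad G n y), hb, if_neg hij, hsym (b j) (b i), u1, u2] at c2
    rw [a3] at r1
    set W := fderiv ℝ n y (covGrad G n y)
    rw [a4] at c1 c2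
    have c3 := mul_left_cancel₀ hW.ne' (c2.trans (show _ = W * (c * covHess G n y (b i) (b 0) / n y) by
      rw [a4]; ring))
    have c4 := (mul_eq_zero.1 (c1.trans (by ring))).resolve_left hW.ne'
    refine mul_left_cancel₀ (div_ne_zero hc hn0.ne') ?_
    linear_combination (1 / 2) * r1 - (c / 2) * r2 - (1 / 2) * c4 + (1 / 2) * c3 + (c / 4) * s1
  have h1 := b.sum_repr z
  rw [Fin.sum_univ_three] at h1
  rw [← h1, map_add, map_add, map_smul, map_smul, map_smul, hdn, hdn, hdn, if_pos rfl,
    if_neg (by decide), if_neg (by decide), smul_zero, smul_zero, add_zero, add_zero,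
    smul_eq_mul] at hz
  rw [← h1, (mul_eq_zero.1 hz).resolve_right hc, hV]
  simp only [zero_smul, zero_add, map_add, map_smul, add_apply, smul_apply,
    key 1 2 (by decide) (by decide) (by decide), key 2 1 (by decide) (by decide) (by decide),
    smul_zero, add_zero]

end Codazzi

/-! ### The gradient of the lapse function on a photon sphere -/

section LapseGradient

variable {M : Type*} [TopologicalSpace M] [ChartedSpace E3 M] [IsManifold (𝓡 3) ∞ M]
  {P : Type*} [TopologicalSpace P] [ChartedSpace E3 P]
  {g : RiemMetric3 M} {N : M → ℝ} {F : BilinField I4 (ℝ × M)} {K : Set M}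
  {φ : PartialDiffeomorph (𝓡 3) (𝓡 3) M E3 ∞} {m Q : ℝ} {f : P → ℝ × M} {U : Set M}
  {N₀ : ℝ} {x : M} {q : P}

/-- The differential of a function as a one-form. -/
noncomputable def diffForm (u : M → ℝ) (x : M) : E3 →L[ℝ] ℝ := mfderiv (𝓡 3) 𝓘(ℝ, ℝ) u x

/-- The squared length of the gradient of the lapse function. -/
noncomputable def lapseGradSq (g : RiemMetric3 M) (N : M → ℝ) (x : M) : ℝ :=
  formInner g (diffForm N) (diffForm N) x

theorem chartForm_diffForm (hN : ContMDiff (𝓡 3) 𝓘(ℝ, ℝ) ∞ N) {y : E3}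
    (hy : y ∈ (extChartAt (𝓡 3) x).target) :
    chartForm (diffForm N) x y = fderiv ℝ (chartFun N x) y :=
  have : IsManifold (𝓡 3) 1 M := isManifold_one
  (fderiv_comp_symm hy
    (hN.mdifferentiable (by simp) ((extChartAt (𝓡 3) x).symm y)).hasMFDerivAt).fderiv.symm

theorem chartFun_lapseGradSq (hN : ContMDiff (𝓡 3) 𝓘(ℝ, ℝ) ∞ N) {y : E3}
    (hy : y ∈ (extChartAt (𝓡 3) x).target) :
    chartFun (lapseGradSq g N) x y
      = fderiv ℝ (chartFun N x) y (covGrad (chartMetric g x) (chartFun N x) y) := by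
  refine (formInner_chart g (diffForm N) (diffForm N) hy).trans ?_
  rw [chartForm_diffForm hN hy, covGrad]

theorem lapseGradSq_eq (hN : ContMDiff (𝓡 3) 𝓘(ℝ, ℝ) ∞ N) (x : M) :
    lapseGradSq g N x = fderiv ℝ (chartFun N x) (extChartAt (𝓡 3) x x)
      (covGrad (chartMetric g x) (chartFun N x) (extChartAt (𝓡 3) x x)) := by
  rw [← chartFun_lapseGradSq hN (mem_extChartAt_target x), chartFun_self]

theorem contMDiff_lapseGradSq (hN : ContMDiff (𝓡 3) 𝓘(ℝ, ℝ) ∞ N) :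
    ContMDiff (𝓡 3) 𝓘(ℝ, ℝ) ∞ (lapseGradSq g N) := fun x => by
  refine contMDiffAt_of_chartFun ?_
  refine (((isMetricOn_chartMetric g x).contDiffOn_apply_covGrad
    (contDiffOn_chartFun hN x)).congr fun y hy => ?_).contDiffAt
      (eventually_mem_target (mem_extChartAt_target x))
  exact chartFun_lapseGradSq hN hy

theorem diffForm_ne_zero (h : lapseGradSq g N x ≠ 0) : diffForm N x ≠ 0 := fun h0 => by
  refine h ?_
  rw [lapseGradSq, formInner, h0]
  exact zero_apply _

theorem fderiv_chartFun_lapse (hN : ContMDiff (𝓡 3) 𝓘(ℝ, ℝ) ∞ N) (x : M) :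
    fderiv ℝ (chartFun N x) (extChartAt (𝓡 3) x x) = diffForm N x :=
  fderiv_chartFun_self (hN.mdifferentiable (by simp) x)

theorem hasMFDerivAt_diffForm {u : M → ℝ} (hu : ContMDiff (𝓡 3) 𝓘(ℝ, ℝ) ∞ u) (x : M) :
    HasMFDerivAt (𝓡 3) 𝓘(ℝ, ℝ) u x (diffForm u x) :=
  (hu.mdifferentiable (by simp) x).hasMFDerivAt

section Surface

variable (hP : IsPhotonSurface I4 (𝓡 3) (staticMetric g N) f)
  (hN : ContMDiff (𝓡 3) 𝓘(ℝ, ℝ) ∞ N) (hpos : ∀ x, 0 < N x) (hN₀ : ∀ q, N (f q).2 = N₀)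

include hP hN hpos hN₀

/-- A photon surface in a regular level set of the lapse function is umbilic, in any chart. -/
theorem IsPhotonSurface.covHess_tangential_chart {y : E3} (hy : y ∈ (extChartAt (𝓡 3) x).target)
    (hq : (extChartAt (𝓡 3) x).symm y = (f q).2) (hd : fderiv ℝ (chartFun N x) y ≠ 0) {e : E3}
    (he : fderiv ℝ (chartFun N x) y e = 0) :
    covHess (chartMetric g x) (chartFun N x) y e e
      = fderiv ℝ (chartFun N x) y (covGrad (chartMetric g x) (chartFun N x) y) / chartFun N x y
        * chartMetric g x y e e := by
  have : IsManifold (𝓡 3) 1 M := isManifold_one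
  have h1 : (extChartAt (𝓡 3) x).symm y
    ∈ (extChartAt (𝓡 3) ((extChartAt (𝓡 3) x).symm y)).source := mem_extChartAt_source _
  have hD : ∀ v, fderiv ℝ (chartFun N x) y v = diffForm N ((extChartAt (𝓡 3) x).symm y)
      (fderiv ℝ (chartChange (𝓡 3) x ((extChartAt (𝓡 3) x).symm y)) y v) := fun v => by
    rw [← chartForm_diffForm hN hy, fderiv_chartChange_self hy]
    rfl
  have hNs : ContDiffAt ℝ ∞ (chartFun N ((extChartAt (𝓡 3) x).symm y))
      (extChartAt (𝓡 3) ((extChartAt (𝓡 3) x).symm y) ((extChartAt (𝓡 3) x).symm y)) :=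
    contDiffAt_chartFun_self (hN _)
  rw [covHess_chartChange (smoothBilin_inner g) g.symm (inner_nondeg g) hy h1 hNs,
    inChart_chartChange _ hy h1, ← chartFun_lapseGradSq hN hy]
  refine (hP.covHess_tangential (q := q) hN hpos hq.symm (hasMFDerivAt_diffForm hN _)
    (fun h0 => hd (ContinuousLinearMap.ext fun v => by rw [hD, h0]; rfl)) hNs
    (Eventually.of_forall fun q' => by rw [hN₀ q', hq, hN₀ q]) ((hD e).symm.trans he)).trans ?_
  rw [← lapseGradSq_eq hN]
  change _ * lapseGradSq g N ((extChartAt (𝓡 3) x).symm y) / N ((extChartAt (𝓡 3) x).symm y)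
    = lapseGradSq g N ((extChartAt (𝓡 3) x).symm y) / N ((extChartAt (𝓡 3) x).symm y) * _
  rw [mul_comm, mul_div_right_comm]
  rfl

theorem IsPhotonSurface.umbilicDefect_levelProj_chart {y : E3}
    (hy : y ∈ (extChartAt (𝓡 3) x).target) (hq : (extChartAt (𝓡 3) x).symm y = (f q).2) (a b : E3) :
    umbilicDefect (chartMetric g x) (chartFun N x) y
      (levelProj (chartMetric g x) (chartFun N x) a y)
      (levelProj (chartMetric g x) (chartFun N x) b y) = 0 := by
  have hG := isMetricOn_chartMetric g x
  have hNy := hG.contDiffAt_of_mem (contDiffOn_chartFun hN x) hy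
  by_cases hd : fderiv ℝ (chartFun N x) y = 0
  · have h1 : levelProj (chartMetric g x) (chartFun N x) a y = 0 := by
      rw [levelProj, hd]
      simp
    rw [h1, map_zero]
    exact zero_apply _
  have hself : ∀ v, fderiv ℝ (chartFun N x) y v = 0 →
      umbilicDefect (chartMetric g x) (chartFun N x) y v v = 0 := fun v hv => by
    rw [umbilicDefect_apply, hP.covHess_tangential_chart hN hpos hN₀ hy hq hd hv, sub_self]
  set v := levelProj (chartMetric g x) (chartFun N x) a y
  set w := levelProj (chartMetric g x) (chartFun N x) b y
  have hv : fderiv ℝ (chartFun N x) y v = 0 := fderiv_levelProj _ _ _ _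
  have hw : fderiv ℝ (chartFun N x) y w = 0 := fderiv_levelProj _ _ _ _
  have h1 := hself (v + w) (by rw [map_add, hv, hw, add_zero])
  have hsym : umbilicDefect (chartMetric g x) (chartFun N x) y w v
      = umbilicDefect (chartMetric g x) (chartFun N x) y v w := by
    rw [umbilicDefect_apply, umbilicDefect_apply, hG.covHess_symm hy hNy, hG.symm y hy]
  simp only [map_add, add_apply, hself v hv, hself w hw, hsym] at h1
  linarith

end Surface

section Sphere

variable [IsManifold (𝓡 3) ∞ P] (hP : IsPhotonSphere g N F f) (h : IsStaticElectrovac g N F)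
  (hN₀ : ∀ q, N (f q).2 = N₀)

include hP h hN₀

theorem IsPhotonSphere.exists_mfderiv_eq (hd : diffForm N (f q).2 ≠ 0) {w : ℝ × E3}
    (hw : diffForm N (f q).2 w.2 = 0) :
    ∃ v : TangentSpace (𝓡 3) q, (mfderiv (𝓡 3) I4 f q v : ℝ × E3) = w :=
  hP.photonSurface.exists_mfderiv_eq (hasMFDerivAt_diffForm h.lapse_smooth _) hd
    (Eventually.of_forall fun q' => by rw [hN₀ q', hN₀ q]) hw

theorem IsPhotonSphere.diffForm_apply (v : TangentSpace (𝓡 3) q) :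
    diffForm N (f q).2 (mfderiv (𝓡 3) I4 f q v : ℝ × E3).2 = 0 :=
  hP.photonSurface.apply_mfderiv_eq_zero (hasMFDerivAt_diffForm h.lapse_smooth _)
    (Eventually.of_forall fun q' => by rw [hN₀ q', hN₀ q]) v

theorem IsPhotonSphere.covHess_covGrad_eq_zero (hd : diffForm N (f q).2 ≠ 0) {z : E3}
    (hz : diffForm N (f q).2 z = 0) :
    covHess (chartMetric g (f q).2) (chartFun N (f q).2) (extChartAt (𝓡 3) (f q).2 (f q).2) z
      (covGrad (chartMetric g (f q).2) (chartFun N (f q).2)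
        (extChartAt (𝓡 3) (f q).2 (f q).2)) = 0 := by
  obtain ⟨ψ, hψ⟩ := h.isClosedForm_elecForm.exists_potential (f q).2
  obtain ⟨Ω, -, hΩ, -⟩ := h.exists_electrovacOn hψ
  have hdn := fderiv_chartFun_lapse h.lapse_smooth (f q).2
  set x := (f q).2
  have hx := mem_extChartAt_target (I := 𝓡 3) x
  have hG := isMetricOn_chartMetric g x
  have hNx := contDiffOn_chartFun h.lapse_smooth x
  refine hΩ.covHess_covGrad_eq_zero (by rw [hdn]; exact hd) (fun w hw => ?_)
    (hP.photonSurface.umbilicDefect_levelProj_chart h.lapse_smooth h.lapse_pos hN₀ hx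
      (extChartAt_to_inv x)) (fun a b w hw => ?_) (by rw [hdn]; exact hz)
  · rw [hdn] at hw
    obtain ⟨v, hv⟩ := hP.exists_mfderiv_eq h hN₀ hd (w := (0, w)) hw
    have h1 := hP.elecForm_apply_eq_zero h v
    rw [hv] at h1
    rw [hψ.fderiv_chartFun]
    exact h1
  · rw [hdn] at hw
    obtain ⟨v, hv⟩ := hP.exists_mfderiv_eq h hN₀ hd (w := (0, w)) hw
    set S := fun y => umbilicDefect (chartMetric g x) (chartFun N x) y
      (levelProj (chartMetric g x) (chartFun N x) a y)
      (levelProj (chartMetric g x) (chartFun N x) b y)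
    have hW := (hG.contDiffOn_apply_covGrad hNx).contDiffAt (hG.mem_nhds hx)
    have hV := (hG.contDiffOn_covGrad hNx).contDiffAt (hG.mem_nhds hx)
    have hn := hG.contDiffAt_of_mem hNx hx
    have hdn' : ContDiffAt ℝ ∞ (fderiv ℝ (chartFun N x)) (extChartAt (𝓡 3) x x) :=
      hn.fderiv_right (by simp)
    have hproj : ∀ a, ContDiffAt ℝ ∞ (levelProj (chartMetric g x) (chartFun N x) a)
        (extChartAt (𝓡 3) x x) := fun a =>
      (hW.smul contDiffAt_const).sub ((hdn'.clm_apply contDiffAt_const).smul hV)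
    have hSs : ContDiffAt ℝ ∞ S (extChartAt (𝓡 3) x x) := by
      refine ContDiffAt.clm_apply (ContDiffAt.clm_apply ?_ (hproj a)) (hproj b)
      refine (hG.contDiffAt_covHess hx hn).sub ((hW.div hn ?_).smul (hG.contDiffAt hx))
      rw [chartFun_self]
      exact (h.lapse_pos x).ne'
    have hloc : chartFun (fun x' => S (extChartAt (𝓡 3) x x')) x =ᶠ[𝓝 (extChartAt (𝓡 3) x x)] S := by
      filter_upwards [eventually_mem_target hx] with y hy
      exact congrArg S ((extChartAt (𝓡 3) x).right_inv hy)
    have hSm : ContMDiffAt (𝓡 3) 𝓘(ℝ, ℝ) ∞ (fun x' => S (extChartAt (𝓡 3) x x')) x :=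
      contMDiffAt_of_chartFun (hSs.congr_of_eventuallyEq hloc)
    have hSd := hSm.mdifferentiableAt (by simp)
    have h1 := fderiv_chartFun_self hSd
    rw [hloc.fderiv_eq] at h1
    have h2 : HasMFDerivAt (𝓡 3) 𝓘(ℝ, ℝ) (fun x' => S (extChartAt (𝓡 3) x x')) x
        (diffForm (fun x' => S (extChartAt (𝓡 3) x x')) x) := hSd.hasMFDerivAt
    have hcont : ContinuousAt (fun q' => (f q').2) q :=
      (continuous_snd.comp hP.photonSurface.embedding.isEmbedding.continuous).continuousAt
    have hzero : ∀ᶠ q' in 𝓝 q, S (extChartAt (𝓡 3) x (f q').2) = 0 := by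
      filter_upwards [hcont.eventually (extChartAt_source_mem_nhds (I := 𝓡 3) x)] with q' hq'
      exact hP.photonSurface.umbilicDefect_levelProj_chart h.lapse_smooth h.lapse_pos hN₀
        ((extChartAt (𝓡 3) x).map_source hq') ((extChartAt (𝓡 3) x).left_inv hq') a b
    have h3 := hP.photonSurface.apply_mfderiv_eq_zero h2
      (hzero.mono fun q' hq' => hq'.trans hzero.self_of_nhds.symm) v
    rw [hv] at h3
    exact (congrArg (fun A : E3 →L[ℝ] ℝ => A w) h1).trans h3

/-- The length of the gradient of the lapse function is locally constant on a photon sphere. -/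
theorem IsPhotonSphere.eventually_lapseGradSq_eq (hd : lapseGradSq g N (f q).2 ≠ 0) :
    ∀ᶠ q' in 𝓝 q, lapseGradSq g N (f q').2 = lapseGradSq g N (f q).2 := by
  have hN := h.lapse_smooth
  have hW := contMDiff_lapseGradSq (g := g) hN
  have hcont : ContinuousAt (fun q' => (f q').2) q :=
    (continuous_snd.comp hP.photonSurface.embedding.isEmbedding.continuous).continuousAt
  have h1 : IsPotentialAt (M := P) 0 (fun q' => lapseGradSq g N (f q').2) q := by
    have hne := (hW.continuous.continuousAt.comp hcont).eventually_ne hd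
    filter_upwards [hne] with q' hq'
    have h2 : HasMFDerivAt (𝓡 3) 𝓘(ℝ, ℝ) (fun q' => lapseGradSq g N (f q').2) q'
        ((diffForm (lapseGradSq g N) (f q').2).comp ((ContinuousLinearMap.snd ℝ ℝ E3).comp
          (mfderiv (𝓡 3) I4 f q' : E3 →L[ℝ] ℝ × E3))) :=
      (hasMFDerivAt_diffForm hW (f q').2).comp q'
        ((hasMFDerivAt_snd (I := 𝓘(ℝ, ℝ)) (I' := 𝓡 3) (f q')).comp q'
          hP.photonSurface.hasMFDerivAt)
    have h3 : (diffForm (lapseGradSq g N) (f q').2).comp ((ContinuousLinearMap.snd ℝ ℝ E3).comp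
        (mfderiv (𝓡 3) I4 f q' : E3 →L[ℝ] ℝ × E3)) = (0 : P → E3 →L[ℝ] ℝ) q' := by
      refine ContinuousLinearMap.ext fun v => ?_
      have hx := mem_extChartAt_target (I := 𝓡 3) (f q').2
      have h4 := fderiv_chartFun_lapse hW (f q').2
      have h5 : chartFun (lapseGradSq g N) (f q').2 =ᶠ[𝓝 (extChartAt (𝓡 3) (f q').2 (f q').2)]
          fun y => fderiv ℝ (chartFun N (f q').2) y
            (covGrad (chartMetric g (f q').2) (chartFun N (f q').2) y) := by
        filter_upwards [eventually_mem_target hx] with y hy using chartFun_lapseGradSq hN hy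
      have h6 := (isMetricOn_chartMetric g (f q').2).fderiv_apply_covGrad hx
        (contDiffOn_chartFun hN (f q').2) (mfderiv (𝓡 3) I4 f q' v : ℝ × E3).2
      rw [← h5.fderiv_eq, h4, hP.covHess_covGrad_eq_zero h hN₀ (diffForm_ne_zero hq')
        (hP.diffForm_apply h hN₀ v), mul_zero] at h6
      exact h6
    rw [← h3]
    exact h2
  have h2 : IsPotentialAt (M := P) 0 (fun _ => (0 : ℝ)) q :=
    Eventually.of_forall fun q' => hasMFDerivAt_const (0 : ℝ) q'
  obtain ⟨c, hc⟩ := h1.eventually_eq_add_const h2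
  filter_upwards [hc] with q' hq'
  rw [hq', hc.self_of_nhds]

end Sphere

end LapseGradient

/-! ### The photon sphere is the boundary of the exterior region -/

section Boundary

variable {M : Type*} [TopologicalSpace M] [ChartedSpace E3 M] [IsManifold (𝓡 3) ∞ M]
  {P : Type*} [TopologicalSpace P] [ChartedSpace E3 P]
  {g : RiemMetric3 M} {N : M → ℝ} {F : BilinField I4 (ℝ × M)} {K : Set M}
  {φ : PartialDiffeomorph (𝓡 3) (𝓡 3) M E3 ∞} {m Q : ℝ} {f : P → ℝ × M} {U : Set M}
  {N₀ : ℝ} {x : M} {q : P}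

theorem lapseGradSq_pos (hd : diffForm N x ≠ 0) : 0 < lapseGradSq g N x := formInner_self_pos g hd

theorem IsRegularExterior.eventually_mem_frontier (hU : IsRegularExterior g N φ f U)
    (hN : ContMDiff (𝓡 3) 𝓘(ℝ, ℝ) ∞ N) (hN₀ : ∀ q, N (f q).2 = N₀) (hlow : ∀ y ∈ U, N₀ < N y)
    (hx : x ∈ frontier U) (hd : diffForm N x ≠ 0) : ∀ᶠ y in 𝓝 x, N y = N₀ → y ∈ frontier U := by
  have hNx := hU.lapse_frontier hN₀ hx
  have h1 := hU.eventually_mem_of_lt hx (hN x) hd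
    (fun y hy => by rw [hU.lapse_frontier hN₀ hy, hNx]) (fun y hy => by rw [hNx]; exact hlow y hy)
  have h2 := (contMDiff_lapseGradSq (g := g) hN).continuous.continuousAt.eventually_ne
    (lapseGradSq_pos hd).ne'
  filter_upwards [h1.eventually_nhds, h2] with y hy1 hy2 hy
  have h3 := (frequently_lt_of_mfderiv_ne_zero (hN.mdifferentiable (by simp) y)
    (diffForm_ne_zero hy2)).and_eventually hy1
  have h4 : y ∈ closure U := mem_closure_iff_frequently.2 (h3.mono fun z hz =>
    hz.2 (by rw [hNx, ← hy]; exact hz.1))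
  refine (hU.closure_cases h4).resolve_left fun hyU => ?_
  exact (hlow y hyU).ne' hy

/-- The photon sphere projects to the boundary of the exterior region, on which the gradient of the
lapse function has constant length and the electric field is a constant multiple of it. -/
theorem IsPhotonSphere.exists_lapse_data [T2Space M] [SecondCountableTopology M] [ConnectedSpace P]
    [IsManifold (𝓡 3) ∞ P] (hP : IsPhotonSphere g N F f) (h : IsStaticElectrovac g N F)
    (hflat : IsAsymptoticallyFlat g N F K φ m Q) (hm : 0 < m) (hQ : Q ≠ 0)
    (hU : IsRegularExterior g N φ f U) (hN₀ : ∀ q, N (f q).2 = N₀) :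
    ∃ w k : ℝ, 0 < w ∧ ∀ q, lapseGradSq g N (f q).2 = w * w ∧
      elecForm F (f q).2 = k • diffForm N (f q).2 := by
  obtain ⟨ψ, ψ₀, hψ1, hψ2, hψ3⟩ := hU.exists_potential h hP hflat hm hN₀
  have hψ : IsExteriorPotential F φ U ψ ψ₀ := ⟨hψ1, hψ2, hψ3⟩
  obtain ⟨c, hc⟩ := hψ.exists_lapse_sq_eq h hflat hm hQ hU hN₀
  obtain ⟨x₀, hx₀, hd₀⟩ := hψ.exists_mfderiv_ne_zero h hflat hm hQ hU hN₀ hc hP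
  have hN := h.lapse_smooth
  obtain ⟨-, -, hlow, -⟩ := hU.lapse_bounds hN₀ hN hflat hm
  have hpos₀ : 0 < lapseGradSq g N x₀ := lapseGradSq_pos hd₀
  have hcont : Continuous fun q => (f q).2 :=
    continuous_snd.comp hP.photonSurface.embedding.isEmbedding.continuous
  have hWc : Continuous fun q => lapseGradSq g N (f q).2 :=
    (contMDiff_lapseGradSq (g := g) hN).continuous.comp hcont
  set A := {q : P | (f q).2 ∈ frontier U ∧ lapseGradSq g N (f q).2 = lapseGradSq g N x₀}
  have hclosed : IsClosed A :=
    (isClosed_frontier.preimage hcont).inter (isClosed_eq hWc continuous_const)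
  have hopen : IsOpen A := by
    rw [isOpen_iff_mem_nhds]
    rintro q ⟨hq, hq'⟩
    have hne : lapseGradSq g N (f q).2 ≠ 0 := by rw [hq']; exact hpos₀.ne'
    have h1 := hU.eventually_mem_frontier hN hN₀ hlow hq (diffForm_ne_zero hne)
    filter_upwards [hcont.continuousAt.eventually h1, hP.eventually_lapseGradSq_eq h hN₀ hne]
      with q' h2 h3 using ⟨h2 (hN₀ q'), h3.trans hq'⟩
  have huniv : A = univ := by
    refine IsClopen.eq_univ ⟨hclosed, hopen⟩ ?_
    have hx₀' := hx₀
    rw [hU.frontier_eq] at hx₀'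
    obtain ⟨q, hq⟩ := hx₀'
    refine ⟨q, ?_, ?_⟩
    · rw [hq]
      exact hx₀
    · rw [hq]
  refine ⟨Real.sqrt (lapseGradSq g N x₀), N₀ / (ψ₀ - c), Real.sqrt_pos.2 hpos₀, fun q => ?_⟩
  obtain ⟨hq, hq'⟩ : q ∈ A := huniv ▸ mem_univ q
  refine ⟨by rw [Real.mul_self_sqrt hpos₀.le, hq'], ?_⟩
  have h1 : N (f q).2 • diffForm N (f q).2 = (ψ (f q).2 - c) • elecForm F (f q).2 :=
    hψ.lapse_mul_mfderiv h hU.isOpen hc hq.1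
  rw [hN₀, hψ2 _ hq] at h1
  have hne : diffForm N (f q).2 ≠ 0 := diffForm_ne_zero (g := g) (by rw [hq']; exact hpos₀.ne')
  have hNpos : N₀ ≠ 0 := by rw [← hN₀ q]; exact (h.lapse_pos _).ne'
  have hψc : ψ₀ - c ≠ 0 := fun h0 => by
    rw [h0, zero_smul] at h1
    exact smul_ne_zero hNpos hne h1
  rw [div_eq_inv_mul, mul_smul, h1, inv_smul_smul₀ hψc]

end Boundary

/-! ### Unit normal fields of a photon sphere -/

section UnitNormal

variable {M : Type*} [TopologicalSpace M] [ChartedSpace E3 M] [IsManifold (𝓡 3) ∞ M]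
  {P : Type*} [TopologicalSpace P] [ChartedSpace E3 P]
  {g : RiemMetric3 M} {N : M → ℝ} {F : BilinField I4 (ℝ × M)} {f : P → ℝ × M} {N₀ w k κ : ℝ}
  {x : M} {q : P}

/-- The gradient of a function. -/
noncomputable def gradVec (g : RiemMetric3 M) (N : M → ℝ) (x : M) : E3 :=
  ContinuousLinearMap.inverse (g.inner x : E3 →L[ℝ] E3 →L[ℝ] ℝ) (diffForm N x)

theorem inner_gradVec (v : E3) :
    (g.inner x : E3 →L[ℝ] E3 →L[ℝ] ℝ) (gradVec g N x) v = diffForm N x v :=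
  congrArg (fun A : E3 →L[ℝ] ℝ => A v) (apply_inverse_of_nondeg (inner_nondeg g x) (diffForm N x))

theorem inner_smul_gradVec (κ : ℝ) (v : E3) :
    (g.inner x : E3 →L[ℝ] E3 →L[ℝ] ℝ) (κ • gradVec g N x) v = κ * diffForm N x v := by
  have h1 : ∀ B : E3 →L[ℝ] E3 →L[ℝ] ℝ, B (κ • gradVec g N x) v = κ * B (gradVec g N x) v :=
    fun B => by rw [map_smul, smul_apply, smul_eq_mul]
  exact (h1 _).trans (congrArg (κ * ·) (inner_gradVec v))

theorem chartInv_covGrad (hN : ContMDiff (𝓡 3) 𝓘(ℝ, ℝ) ∞ N) {y : E3}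
    (hy : y ∈ (extChartAt (𝓡 3) x).target) :
    chartInv (𝓡 3) x y (covGrad (chartMetric g x) (chartFun N x) y)
      = gradVec g N ((extChartAt (𝓡 3) x).symm y) := by
  have : IsManifold (𝓡 3) 1 M := isManifold_one
  rw [covGrad, ← chartForm_diffForm hN hy]
  exact apply_inverse_of_comp ((isMetricOn_chartMetric g x).nondeg y hy)
    (inner_nondeg g ((extChartAt (𝓡 3) x).symm y)) (chartInv_bijective hy).2 (fun v w => rfl) _

theorem covGrad_chart_self (hN : ContMDiff (𝓡 3) 𝓘(ℝ, ℝ) ∞ N) :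
    covGrad (chartMetric g x) (chartFun N x) (extChartAt (𝓡 3) x x) = gradVec g N x := by
  have : IsManifold (𝓡 3) 1 M := isManifold_one
  have h1 := chartInv_covGrad (g := g) hN (mem_extChartAt_target (I := 𝓡 3) x)
  rwa [chartInv_self, extChartAt_to_inv] at h1

/-- The vector field `κ ∇N` on the spacetime. -/
noncomputable def normalField (g : RiemMetric3 M) (N : M → ℝ) (κ : ℝ) (z : ℝ × M) :
    TangentSpace I4 z := ((0, κ • gradVec g N z.2) : ℝ × E3)

theorem mfderiv_extChartAt_normalField (hN : ContMDiff (𝓡 3) 𝓘(ℝ, ℝ) ∞ N) (κ : ℝ) {z₀ z : ℝ × M}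
    (hz : z.2 ∈ (extChartAt (𝓡 3) z₀.2).source) :
    (mfderiv I4 𝓘(ℝ, ℝ × E3) (extChartAt I4 z₀) z (normalField g N κ z) : ℝ × E3)
      = (0, κ • covGrad (chartMetric g z₀.2) (chartFun N z₀.2) (extChartAt (𝓡 3) z₀.2 z.2)) := by
  have : IsManifold (𝓡 3) 1 M := isManifold_one
  have hz4 : z ∈ (extChartAt I4 z₀).source := by
    rw [extChartAt_I4_source]
    exact ⟨mem_univ _, hz⟩
  have hy := (extChartAt (𝓡 3) z₀.2).map_source hz
  have h1 := mfderiv_extChartAt_comp_mfderivWithin_extChartAt_symm' (I := I4) hz4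
  rw [I4.range_eq_univ, mfderivWithin_univ] at h1
  have h2 := chartInv_I4 (z := z₀) (y := extChartAt I4 z₀ z) (by
    rw [extChartAt_I4_apply]
    exact hy) (0, κ • covGrad (chartMetric g z₀.2) (chartFun N z₀.2) (extChartAt (𝓡 3) z₀.2 z.2))
  simp only [extChartAt_I4_apply, map_smul, chartInv_covGrad hN hy,
    (extChartAt (𝓡 3) z₀.2).left_inv hz] at h2
  have h3 := congrArg (fun A : (ℝ × E3) →L[ℝ] ℝ × E3 =>
    A (0, κ • covGrad (chartMetric g z₀.2) (chartFun N z₀.2) (extChartAt (𝓡 3) z₀.2 z.2))) h1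
  refine Eq.trans ?_ h3
  rw [← extChartAt_I4_apply] at h2
  exact congrArg (mfderiv I4 𝓘(ℝ, ℝ × E3) (extChartAt I4 z₀) z : (ℝ × E3) →L[ℝ] ℝ × E3) h2.symm

theorem contMDiff_normalField (hN : ContMDiff (𝓡 3) 𝓘(ℝ, ℝ) ∞ N) (κ : ℝ) :
    ContMDiff I4 I4.tangent ∞ (fun z => (⟨z, normalField g N κ z⟩ : TangentBundle I4 (ℝ × M))) := by
  have : IsManifold (𝓡 3) 1 M := isManifold_one
  intro z₀
  rw [Bundle.contMDiffAt_totalSpace]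
  refine ⟨contMDiffAt_id, ?_⟩
  have h1 : ContMDiffAt I4 𝓘(ℝ, ℝ × E3) ∞ (fun z : ℝ × M =>
      ((0, κ • covGrad (chartMetric g z₀.2) (chartFun N z₀.2)
        (extChartAt (𝓡 3) z₀.2 z.2)) : ℝ × E3)) z₀ := by
    have hx := mem_extChartAt_target (I := 𝓡 3) z₀.2
    have hG := isMetricOn_chartMetric g z₀.2
    have h2 : ContDiffAt ℝ ∞ (fun y => κ • covGrad (chartMetric g z₀.2) (chartFun N z₀.2) y)
        (extChartAt (𝓡 3) z₀.2 z₀.2) := ContDiffAt.const_smul κ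
      ((hG.contDiffOn_covGrad (contDiffOn_chartFun hN z₀.2)).contDiffAt (hG.mem_nhds hx))
    have h3 : ContDiffAt ℝ ∞ (fun y => ((0, κ • covGrad (chartMetric g z₀.2) (chartFun N z₀.2) y)
        : ℝ × E3)) (extChartAt (𝓡 3) z₀.2 z₀.2) := contDiffAt_const.prodMk h2
    have h4 : ContMDiffAt I4 (𝓡 3) ∞ (fun z : ℝ × M => extChartAt (𝓡 3) z₀.2 z.2) z₀ :=
      (contMDiffAt_extChartAt (I := 𝓡 3) (n := ∞) (x := z₀.2)).comp z₀ contMDiffAt_snd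
    exact ContMDiffAt.comp z₀ (g := fun y => ((0, κ • covGrad (chartMetric g z₀.2)
      (chartFun N z₀.2) y) : ℝ × E3)) h3.contMDiffAt h4
  refine h1.congr_of_eventuallyEq ?_
  filter_upwards [continuousAt_snd.eventually (extChartAt_source_mem_nhds (I := 𝓡 3) z₀.2)] with z hz
  rw [← mfderiv_extChartAt_normalField hN κ hz]
  have hz4 : z ∈ (chartAt (ModelProd ℝ E3) z₀).source := by
    rw [← extChartAt_source I4, extChartAt_I4_source]
    exact ⟨mem_univ _, hz⟩
  rw [← TangentBundle.continuousLinearMapAt_trivializationAt hz4]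
  exact (Bundle.Trivialization.continuousLinearMapAt_apply_of_mem (R := ℝ)
    (trivializationAt (ℝ × E3) (TangentSpace I4) z₀) hz4 _).symm

section Sphere

variable [IsManifold (𝓡 3) ∞ P] (hP : IsPhotonSphere g N F f) (h : IsStaticElectrovac g N F)
  (hN₀ : ∀ q, N (f q).2 = N₀) (hw : ∀ q, lapseGradSq g N (f q).2 = w * w) (hw0 : 0 < w)

include hP h hN₀ hw

theorem isUnitNormal_normalField (hκ : κ * κ * (w * w) = 1) :
    IsUnitNormal I4 (𝓡 3) (staticMetric g N) f (fun q => normalField g N κ (f q)) where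
  smooth := (contMDiff_normalField h.lapse_smooth κ).comp
    hP.photonSurface.embedding.isImmersion.contMDiff
  unit q := by
    refine (staticMetric_apply g N (f q) (0, κ • gradVec g N (f q).2)
      (0, κ • gradVec g N (f q).2)).trans ?_
    change -(N (f q).2) ^ 2 * (0 * 0) + (g.inner (f q).2 : E3 →L[ℝ] E3 →L[ℝ] ℝ)
      (κ • gradVec g N (f q).2) (κ • gradVec g N (f q).2) = 1
    rw [inner_smul_gradVec, map_smul, smul_eq_mul, ← hκ, ← hw q]
    change _ + κ * (κ * lapseGradSq g N (f q).2) = _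
    ring
  normal q v := by
    refine (staticMetric_apply g N (f q) (0, κ • gradVec g N (f q).2)
      (mfderiv (𝓡 3) I4 f q v : ℝ × E3)).trans ?_
    change -(N (f q).2) ^ 2 * (0 * _) + (g.inner (f q).2 : E3 →L[ℝ] E3 →L[ℝ] ℝ)
      (κ • gradVec g N (f q).2) (mfderiv (𝓡 3) I4 f q v : ℝ × E3).2 = 0
    rw [inner_smul_gradVec, hP.diffForm_apply h hN₀]
    ring

include hw0

theorem IsUnitNormal.eq_normalField_at {ν : ∀ q : P, TangentSpace I4 (f q)}
    (hν : IsUnitNormal I4 (𝓡 3) (staticMetric g N) f ν) (q : P) :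
    ν q = normalField g N (diffForm N (f q).2 (ν q : ℝ × E3).2 / (w * w)) (f q) ∧
      diffForm N (f q).2 (ν q : ℝ × E3).2 * diffForm N (f q).2 (ν q : ℝ × E3).2 = w * w := by
  have hww : w * w ≠ 0 := (mul_pos hw0 hw0).ne'
  have hd : diffForm N (f q).2 ≠ 0 := diffForm_ne_zero (g := g) (by rw [hw]; exact hww)
  set B : E3 →L[ℝ] E3 →L[ℝ] ℝ := g.inner (f q).2
  set a := (ν q : ℝ × E3)
  have hG : ∀ b : ℝ × E3, diffForm N (f q).2 b.2 = 0 →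
      -(N (f q).2) ^ 2 * (a.1 * b.1) + B a.2 b.2 = 0 := fun b hb => by
    obtain ⟨v, hv⟩ := hP.exists_mfderiv_eq h hN₀ hd hb
    have h1 := hν.normal q v
    rw [show mfderiv (𝓡 3) I4 f q v = (b : TangentSpace I4 (f q)) from hv] at h1
    exact h1
  have ha1 : a.1 = 0 := by
    have h1 := hG (1, 0) (map_zero _)
    simp only [map_zero, mul_one, add_zero] at h1
    exact (mul_eq_zero.1 h1).resolve_left (neg_ne_zero.2 (pow_ne_zero 2 (h.lapse_pos _).ne'))
  have hV : ∀ v, B (gradVec g N (f q).2) v = diffForm N (f q).2 v := inner_gradVec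
  have hVV : diffForm N (f q).2 (gradVec g N (f q).2) = w * w := hw q
  set l := diffForm N (f q).2 a.2
  have h2 : a.2 - (l / (w * w)) • gradVec g N (f q).2 = 0 := by
    by_contra h0
    have hdz : diffForm N (f q).2 (a.2 - (l / (w * w)) • gradVec g N (f q).2) = 0 := by
      rw [map_sub, map_smul, hVV, smul_eq_mul, div_mul_cancel₀ _ hww, sub_self]
    have h3 := hG (0, a.2 - (l / (w * w)) • gradVec g N (f q).2) hdz
    simp only [mul_zero, zero_add] at h3
    have h4 : 0 < B (a.2 - (l / (w * w)) • gradVec g N (f q).2)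
      (a.2 - (l / (w * w)) • gradVec g N (f q).2) := g.pos (f q).2 _ h0
    have h5 := hV (a.2 - (l / (w * w)) • gradVec g N (f q).2)
    rw [map_sub B, sub_apply, h3, map_smul, smul_apply, h5, hdz, smul_zero, sub_zero] at h4
    exact lt_irrefl _ h4
  have ha2 := sub_eq_zero.1 h2
  refine ⟨Prod.ext ha1 ha2, ?_⟩
  have h3 : -(N (f q).2) ^ 2 * (a.1 * a.1) + B a.2 a.2 = 1 := hν.unit q
  have h4 : B a.2 a.2 = l / (w * w) * l := by
    nth_rw 1 [ha2]
    rw [map_smul, smul_apply, hV, smul_eq_mul]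
  rw [ha1, h4] at h3
  field_simp at h3
  linarith

/-- The unit normal fields of a photon sphere. -/
theorem IsUnitNormal.eq_normalField [ConnectedSpace P] {ν : ∀ q : P, TangentSpace I4 (f q)}
    (hν : IsUnitNormal I4 (𝓡 3) (staticMetric g N) f ν) :
    ∃ κ : ℝ, κ * κ * (w * w) = 1 ∧ ν = fun q => normalField g N κ (f q) := by
  have hcont : Continuous fun q => diffForm N (f q).2 (ν q : ℝ × E3).2 := by
    have h1 := (h.lapse_smooth.contMDiff_tangentMap (m := 0) (by simp)).comp
      ((contMDiff_snd (I := 𝓘(ℝ, ℝ)) (J := 𝓡 3) (M := ℝ) (N := M)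
        (n := ∞)).contMDiff_tangentMap (m := 0) (by simp))
    have h2 := h1.continuous.comp hν.smooth.continuous
    have h3 := (contMDiff_snd_tangentBundle_modelSpace ℝ 𝓘(ℝ, ℝ) (n := 0)).continuous.comp h2
    refine h3.congr fun q => ?_
    have h4 : (mfderiv I4 (𝓡 3) Prod.snd (f q) : ℝ × E3 →L[ℝ] E3)
      = ContinuousLinearMap.snd ℝ ℝ E3 := mfderiv_snd
    exact congrArg (fun A : ℝ × E3 →L[ℝ] E3 => diffForm N (f q).2 (A (ν q))) h4
  have hev := hν.eq_normalField_at hP h hN₀ hw hw0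
  have h1 : ∃ r : ℝ, r * r = w * w ∧ ∀ q, diffForm N (f q).2 (ν q : ℝ × E3).2 = r := by
    rcases isPreconnected_univ.eq_or_eq_neg_of_sq_eq hcont.continuousOn
      (continuous_const (y := w)).continuousOn
      (fun q _ => by simp only [Pi.pow_apply, sq, (hev q).2]) (fun _ => hw0.ne') with h1 | h1
    · exact ⟨w, rfl, fun q => h1 (mem_univ q)⟩
    · exact ⟨-w, by ring, fun q => h1 (mem_univ q)⟩
  obtain ⟨r, hr, hr'⟩ := h1
  refine ⟨r / (w * w), ?_, funext fun q => ?_⟩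
  · field_simp
    linarith
  · rw [(hev q).1, hr' q]

end Sphere

end UnitNormal

/-! ### The scalar curvature of an umbilic static hypersurface -/

section StaticHypersurface

variable {G : E3 → E3 →L[ℝ] E3 →L[ℝ] ℝ} {n ψ : E3 → ℝ} {Ω : Set E3} {y : E3} {t k N₀ : ℝ}

section Sectional

variable {E : Type*} [NormedAddCommGroup E] [NormedSpace ℝ E] [FiniteDimensional ℝ E]
  {G : E → E →L[ℝ] E →L[ℝ] ℝ} {Ω : Set E} {y : E} (hG : IsMetricOn G Ω) (hy : y ∈ Ω)

include hG hy

theorem IsMetricOn.apply_riemann_comm (v w : E) :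
    G y (riemann G y v w w) v = G y (riemann G y w v v) w := by
  have h1 : riemann G y v w w = -riemann G y w v w := by
    rw [riemann, riemann]
    abel
  rw [h1, map_neg, ContinuousLinearMap.neg_apply, hG.riemann_skew hy, neg_neg]

theorem IsMetricOn.apply_riemann_self (v : E) : G y (riemann G y v v v) v = 0 := by
  have h1 := hG.riemann_skew hy v v v v
  linarith

end Sectional

/-- The sum of the sectional curvatures of the spacetime over the orthogonal complement of the
gradient of the lapse function. -/
theorem ElectrovacOn.sum_curvature_tangential (h : ElectrovacOn G n ψ Ω y)
    {b : Module.Basis (Fin 3) ℝ E3} (hb : ∀ i j, G y (b i) (b j) = if i = j then 1 else 0)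
    (h1 : fderiv ℝ ψ y (b 1) = 0) (h2 : fderiv ℝ ψ y (b 2) = 0)
    {S : ℝ × E3 → ℝ × E3 → ℝ} (hS : ∀ v w, S v w = staticCoord G n (t, y)
      (riemann (staticCoord G n) (t, y) v w w) v) :
    S (0, b 1) (0, b 2) - (S (1, 0) (0, b 1) + S (1, 0) (0, b 2)) / n y ^ 2
      = fderiv ℝ ψ y (covGrad G ψ y) / n y ^ 2 := by
  have hz : ((t, y) : ℝ × E3) ∈ (univ : Set ℝ) ×ˢ Ω := ⟨mem_univ _, h.mem⟩
  have hG := h.static.metric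
  have hcomm : ∀ v w, S v w = S w v := fun v w => by
    rw [hS, hS, h.static.metric4.apply_riemann_comm hz]
  have hself : ∀ v, S v v = 0 := fun v => (hS v v).trans (h.static.metric4.apply_riemann_self hz v)
  have hfr : ∀ v, ricci (staticCoord G n) (t, y) v v = -(S (1, 0) v / n y ^ 2)
      + (S (0, b 0) v + S (0, b 1) v + S (0, b 2) v) := fun v => by
    rw [h.static.ricci_staticCoord_frame h.mem hb, Fin.sum_univ_three, hS, hS, hS, hS]
  have hsp : ∀ i, ricci (staticCoord G n) (t, y) (0, b i) (0, b i)
      = -2 * (fderiv ℝ ψ y (b i) * fderiv ℝ ψ y (b i)) / n y ^ 2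
        + fderiv ℝ ψ y (covGrad G ψ y) / n y ^ 2 := fun i => by
    rw [h.static.ricci_staticCoord_space h.mem hb, h.ricci_eq, hb, if_pos rfl]
    ring
  have ht := h.static.ricci_staticCoord_time (t := t) h.mem hb
  rw [h.lapse_eq y h.mem, hfr, hself] at ht
  have r0 := hsp 0
  have r1 := hsp 1
  have r2 := hsp 2
  rw [hfr, hself] at r0 r1 r2
  rw [h1] at r1
  rw [h2] at r2
  have he : fderiv ℝ ψ y (covGrad G ψ y) = fderiv ℝ ψ y (b 0) ^ 2 := by
    rw [covGrad, ← sum_sq_eq_apply_inverse (hG.nondeg y h.mem) (hG.symm y h.mem) hb,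
      Fin.sum_univ_three, h1, h2]
    ring
  rw [hcomm (0, b 0) (1, 0), hcomm (0, b 1) (1, 0), hcomm (0, b 2) (1, 0)] at ht
  rw [hcomm (0, b 1) (0, b 0), hcomm (0, b 2) (0, b 0)] at r0
  rw [hcomm (0, b 2) (0, b 1)] at r1
  rw [← sq, ← he] at r0
  linear_combination (1 / 2) * r1 + (1 / 2) * r2 - (1 / 2) * r0 - (1 / (2 * n y ^ 2)) * ht

variable {p : E3 → E3 →L[ℝ] E3 →L[ℝ] ℝ} {Ω' : Set E3} {X : E3 → ℝ × E3} {s : E3}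
  (h : ElectrovacOn G n ψ Ω y) (hn : fderiv ℝ n y ≠ 0)
  (humb : ∀ a b, fderiv ℝ n y a = 0 → fderiv ℝ n y b = 0 →
    covHess G n y a b = fderiv ℝ n y (covGrad G n y) / n y * G y a b)
  (hp : IsMetricOn p Ω') (hX : ContDiffOn ℝ ∞ X Ω') (hmaps : MapsTo X Ω' (univ ×ˢ Ω))
  (hpull : ∀ s ∈ Ω', ∀ v w, p s v w = staticCoord G n (X s) (fderiv ℝ X s v) (fderiv ℝ X s w))
  (hlev : ∀ s ∈ Ω', n (X s).2 = N₀) (hs : s ∈ Ω') (hXs : X s = (t, y))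

include h hX hmaps hlev

theorem fderiv_lapse_along {s : E3} (hs : s ∈ Ω') (ho : IsOpen Ω') (v : E3) :
    fderiv ℝ n (X s).2 (fderiv ℝ X s v).2 = 0 := by
  have hXd := (hX.contDiffAt (ho.mem_nhds hs)).differentiableAt infty_ne_zero
  have hnd := (h.static.metric.contDiffAt_of_mem h.static.lapse_smooth (hmaps hs).2).differentiableAt
    infty_ne_zero
  have h1 : HasFDerivAt (fun s => n (X s).2)
      ((fderiv ℝ n (X s).2).comp ((ContinuousLinearMap.snd ℝ ℝ E3).comp (fderiv ℝ X s))) s :=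
    HasFDerivAt.comp s (g := n) (f := fun s => (X s).2) hnd.hasFDerivAt
      (hasFDerivAt_snd.comp s hXd.hasFDerivAt)
  have h2 : HasFDerivAt (fun s => n (X s).2) (0 : E3 →L[ℝ] ℝ) s := by
    refine (hasFDerivAt_const N₀ s).congr_of_eventuallyEq ?_
    filter_upwards [ho.mem_nhds hs] with s' hs' using hlev s' hs'
  exact congrArg (fun A : E3 →L[ℝ] ℝ => A v) (h1.unique h2)

include humb hp hpull hs hXs

/-- The normal component of the second derivative. -/
theorem fderiv_lapse_covAlong (v w : E3) :
    fderiv ℝ n y (covAlong (staticCoord G n) X s v w).2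
      = -(fderiv ℝ n y (covGrad G n y) / n y * p s v w) := by
  have hn0 := (h.static.lapse_pos y h.mem).ne'
  have ho := hp.isOpen
  have hXc := hX.contDiffAt (ho.mem_nhds hs)
  have hXd := hXc.differentiableAt infty_ne_zero
  have hXd2 := (hXc.fderiv_right (m := 1) (by norm_cast)).differentiableAt
    one_ne_zero
  have hXs2 : (X s).2 = y := by rw [hXs]
  have hnd := h.static.metric.differentiableAt_fderiv h.mem h.static.lapse_smooth
  rw [← hXs2] at hnd
  have h1 : HasFDerivAt (fun s => fderiv ℝ n (X s).2)
      ((fderiv ℝ (fderiv ℝ n) (X s).2).comp ((ContinuousLinearMap.snd ℝ ℝ E3).comp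
        (fderiv ℝ X s))) s :=
    HasFDerivAt.comp s (g := fderiv ℝ n) (f := fun s => (X s).2) hnd.hasFDerivAt
      (hasFDerivAt_snd.comp s hXd.hasFDerivAt)
  have h2 : HasFDerivAt (fun s => (fderiv ℝ X s w).2) ((ContinuousLinearMap.snd ℝ ℝ E3).comp
      ((fderiv ℝ (fderiv ℝ X) s).flip w)) s := by
    have h3 := hXd2.hasFDerivAt.clm_apply (hasFDerivAt_const w s)
    refine hasFDerivAt_snd.comp s (h3.congr_fderiv ?_)
    ext u <;> simp
  have h3 := h1.clm_apply h2
  have h4 : HasFDerivAt (fun s => fderiv ℝ n (X s).2 (fderiv ℝ X s w).2) (0 : E3 →L[ℝ] ℝ) s := by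
    refine (hasFDerivAt_const (0 : ℝ) s).congr_of_eventuallyEq ?_
    filter_upwards [ho.mem_nhds hs] with s' hs'
      using fderiv_lapse_along h hX hmaps hlev hs' ho w
  have h5 := congrArg (fun A : E3 →L[ℝ] ℝ => A v) (h3.unique h4)
  simp at h5
  have hv := fderiv_lapse_along h hX hmaps hlev hs ho v
  have hw := fderiv_lapse_along h hX hmaps hlev hs ho w
  rw [covAlong, h.static.christoffel_staticCoord (by rw [hXs2]; exact h.mem), hpull s hs,
    staticCoord_apply]
  rw [hXs2] at h5 hv hw ⊢
  have h6 := humb _ _ hv hw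
  rw [covHess_apply] at h6
  simp only [Prod.snd_add, map_add, map_smul, smul_eq_mul]
  field_simp at h6 ⊢
  linear_combination n y * h5 - h6

include hn

theorem gauss_of_umbilic (hsurj : ∀ w : ℝ × E3, fderiv ℝ n y w.2 = 0 → ∃ v, fderiv ℝ X s v = w)
    (u v : E3) :
    p s (riemann p s u v v) u
      = staticCoord G n (t, y) (riemann (staticCoord G n) (t, y) (fderiv ℝ X s u) (fderiv ℝ X s v)
          (fderiv ℝ X s v)) (fderiv ℝ X s u)
        + fderiv ℝ n y (covGrad G n y) / n y ^ 2 * (p s v v * p s u u - p s u v * p s u v) := by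
  have ho := hp.isOpen
  have hXs2 : (X s).2 = y := by rw [hXs]
  set W := fderiv ℝ n y (covGrad G n y) with hWdef
  have hmet := h.static.metric4
  have hz := hmaps hs
  have key : ∀ v w, covAlong (staticCoord G n) X s v w = fderiv ℝ X s (christoffel p s v w)
      + (-(p s v w / n y)) • (0, covGrad G n y) := by
    intro v w
    obtain ⟨a, ha⟩ := hsurj (covAlong (staticCoord G n) X s v w
      - (-(p s v w / n y)) • (0, covGrad G n y)) (by
        rw [Prod.snd_sub, Prod.smul_snd, map_sub, map_smul,
          fderiv_lapse_covAlong h humb hp hX hmaps hpull hlev hs hXs, smul_eq_mul, ← hWdef]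
        ring)
    have h1 : a = christoffel p s v w := by
      refine hp.eq_of_forall hs fun z => ?_
      rw [hp.christoffel_spec hs, christoffelLower_along hmet hp hX hmaps hpull hs, hpull s hs, ha,
        map_sub, sub_apply, map_smul, smul_apply, staticCoord_apply _ _ _ (0, covGrad G n y), hXs2,
        h.static.metric.apply_covGrad h.mem]
      have h2 := fderiv_lapse_along h hX hmaps hlev hs ho z
      rw [hXs2] at h2
      rw [h2]
      simp
    rw [← h1, ha, sub_add_cancel]
  have hcov : ∀ a b c d, staticCoord G n (X s) (covAlong (staticCoord G n) X s a b)
      (covAlong (staticCoord G n) X s c d)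
      = p s (christoffel p s a b) (christoffel p s c d) + W / n y ^ 2 * (p s a b * p s c d) := by
    intro a b c d
    have h2 : ∀ z, fderiv ℝ n y (fderiv ℝ X s z).2 = 0 := fun z => by
      have h3 := fderiv_lapse_along h hX hmaps hlev hs ho z
      rwa [hXs2] at h3
    rw [key, key]
    simp only [map_add, map_smul, add_apply, smul_apply, ← hpull s hs, smul_eq_mul]
    rw [hmet.symm _ hz (fderiv ℝ X s _) (0, covGrad G n y)]
    simp only [staticCoord_apply _ _ _ (0, covGrad G n y), hXs2,
      h.static.metric.apply_covGrad h.mem, h2, ← hWdef]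
    field_simp
    ring
  rw [gauss_along hmet hp hX hmaps hpull hs, hcov, hcov, hXs, hp.symm s hs v u]
  ring

/-- The scalar curvature of an umbilic static hypersurface to which the electric field is normal. -/
theorem scalarCurv_of_umbilic (hk : fderiv ℝ ψ y = k • fderiv ℝ n y)
    (hsurj : ∀ w : ℝ × E3, fderiv ℝ n y w.2 = 0 → ∃ v, fderiv ℝ X s v = w) :
    scalarCurv p s = 6 * (fderiv ℝ n y (covGrad G n y) / n y ^ 2)
      + 2 * (fderiv ℝ ψ y (covGrad G ψ y) / n y ^ 2) := by
  obtain ⟨b, hb, c, -, hV⟩ := h.exists_basis (covGrad G n y)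
  have hn0 := (h.static.lapse_pos y h.mem).ne'
  have hdn : ∀ i, i ≠ 0 → fderiv ℝ n y (b i) = 0 := by
    intro i hi
    rw [← h.static.metric.apply_covGrad h.mem, hV, map_smul, smul_apply, hb, if_neg (Ne.symm hi),
      smul_zero]
  obtain ⟨e0, he0⟩ := hsurj (1, 0) (map_zero _)
  obtain ⟨e1, he1⟩ := hsurj (0, b 1) (hdn 1 (by decide))
  obtain ⟨e2, he2⟩ := hsurj (0, b 2) (hdn 2 (by decide))
  have p00 : p s e0 e0 = -n y ^ 2 := by
    rw [hpull s hs, he0, staticCoord_apply, hXs]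
    simp
  have p11 : p s e1 e1 = 1 := by
    rw [hpull s hs, he1, staticCoord_apply, hXs]
    simp [hb]
  have p22 : p s e2 e2 = 1 := by
    rw [hpull s hs, he2, staticCoord_apply, hXs]
    simp [hb]
  have p01 : p s e0 e1 = 0 := by
    rw [hpull s hs, he0, he1, staticCoord_apply]
    simp
  have p02 : p s e0 e2 = 0 := by
    rw [hpull s hs, he0, he2, staticCoord_apply]
    simp
  have p12 : p s e1 e2 = 0 := by
    rw [hpull s hs, he1, he2, staticCoord_apply, hXs]
    simp [hb]
  have hsym := hp.symm s hs
  have hv : ∀ i j : Fin 3, i ≠ j → p s ((![e0, e1, e2] : Fin 3 → E3) i)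
      ((![e0, e1, e2] : Fin 3 → E3) j) = 0 := by
    intro i j hij
    fin_cases i <;> fin_cases j <;>
      simp [p01, p02, p12, hsym e1 e0, hsym e2 e0, hsym e2 e1] at hij ⊢
  obtain ⟨e, he⟩ := exists_basis_of_orthogonal (B := p s) (by simp) hv (fun i => by
    fin_cases i
    · simpa [p00] using hn0
    · simp [p11]
    · simp [p22])
  have heo : ∀ i j, i ≠ j → p s (e i) (e j) = 0 := fun i j hij => by
    rw [he, he]
    exact hv i j hij
  have hR : ∀ v, ricci p s v v = ∑ i, p s (riemann p s (e i) v v) (e i) / p s (e i) (e i) :=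
    fun v => ricci_of_orthogonal hp hs heo v v
  have gau := gauss_of_umbilic h hn humb hp hX hmaps hpull hlev hs hXs hsurj
  set S := fun v w => staticCoord G n (t, y) (riemann (staticCoord G n) (t, y) v w w) v
  have gau' : ∀ u v, p s (riemann p s u v v) u = S (fderiv ℝ X s u) (fderiv ℝ X s v)
      + fderiv ℝ n y (covGrad G n y) / n y ^ 2 * (p s v v * p s u u - p s u v * p s u v) := gau
  have hsumS := h.sum_curvature_tangential (t := t) (S := S) hb
    (by rw [hk, smul_apply, hdn 1 (by decide), smul_zero])
    (by rw [hk, smul_apply, hdn 2 (by decide), smul_zero]) (fun _ _ => rfl)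
  have hz : ((t, y) : ℝ × E3) ∈ (univ : Set ℝ) ×ˢ Ω := ⟨mem_univ _, h.mem⟩
  have hcomm : ∀ v w, S v w = S w v := h.static.metric4.apply_riemann_comm hz
  have hself : ∀ v, S v v = 0 := h.static.metric4.apply_riemann_self hz
  rw [scalarCurv, metricTrace_of_orthogonal (T := ricci p s) (hp.nondeg s hs) hsym heo (ricciLin p s)
    (fun _ _ => rfl)]
  simp only [hR, gau', Fin.sum_univ_three, he, Matrix.cons_val_zero, Matrix.cons_val_one,
    Matrix.cons_val_two, Matrix.head_cons, Matrix.tail_cons, Matrix.cons_val, p00, p11, p22, p01,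
    p02, p12, hsym e1 e0, hsym e2 e0, hsym e2 e1, he0, he1, he2, hself, hcomm (0, b 1) (1, 0),
    hcomm (0, b 2) (1, 0), hcomm (0, b 2) (0, b 1)]
  have h9 : S (0, b 1) (0, b 2) = fderiv ℝ ψ y (covGrad G ψ y) / n y ^ 2
      + (S (1, 0) (0, b 1) + S (1, 0) (0, b 2)) / n y ^ 2 := by linarith
  rw [h9]
  field_simp
  ring

end StaticHypersurface

/-! ### The geometry of a photon sphere in coordinates -/

section SphereCharts

variable {M : Type*} [TopologicalSpace M] [ChartedSpace E3 M] [IsManifold (𝓡 3) ∞ M]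
  {P : Type*} [TopologicalSpace P] [ChartedSpace E3 P] [IsManifold (𝓡 3) ∞ P]
  {g : RiemMetric3 M} {N : M → ℝ} {F : BilinField I4 (ℝ × M)} {f : P → ℝ × M} {N₀ w k κ : ℝ}
  {q : P} {s : E3}

theorem metricTrace_smul_self {E : Type*} [NormedAddCommGroup E] [NormedSpace ℝ E]
    [FiniteDimensional ℝ E] {B : E →L[ℝ] E →L[ℝ] ℝ} (hnd : ∀ v, (∀ w, B v w = 0) → v = 0)
    (hs : ∀ v w, B v w = B w v) (c : ℝ) :
    metricTrace B (fun v w => c * B v w) = c * Module.finrank ℝ E := by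
  have h1 : ∀ i, B (Module.finBasis ℝ E i)
      (B.inverse (coordCovector (Module.finBasis ℝ E) i)) = 1 := fun i => by
    rw [hs, apply_inverse_of_nondeg hnd]
    simp [coordCovector]
  simp only [metricTrace, h1]
  simp [mul_comm]

/-- The coordinate expression of `f` in the preferred charts at `q` and at `f q`. -/
noncomputable def coordMap (f : P → ℝ × M) (q : P) (s : E3) : ℝ × E3 :=
  extChartAt I4 (f q) (f ((extChartAt (𝓡 3) q).symm s))

/-- The domain of `coordMap`. -/
def coordDomain (f : P → ℝ × M) (q : P) : Set E3 :=
  (extChartAt (𝓡 3) q).target ∩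
    (extChartAt (𝓡 3) q).symm ⁻¹' ((fun p => (f p).2) ⁻¹' (extChartAt (𝓡 3) (f q).2).source)

theorem mem_coordDomain_self (f : P → ℝ × M) (q : P) :
    extChartAt (𝓡 3) q q ∈ coordDomain f q := by
  refine ⟨mem_extChartAt_target q, ?_⟩
  rw [mem_preimage, extChartAt_to_inv]
  exact mem_extChartAt_source (I := 𝓡 3) (f q).2

theorem coordMap_self (f : P → ℝ × M) (q : P) : coordMap f q (extChartAt (𝓡 3) q q)
    = ((f q).1, extChartAt (𝓡 3) (f q).2 (f q).2) := by
  rw [coordMap, extChartAt_to_inv, extChartAt_I4_apply]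

theorem coordMap_snd (f : P → ℝ × M) (q : P) (s : E3) : (coordMap f q s).2
    = extChartAt (𝓡 3) (f q).2 (f ((extChartAt (𝓡 3) q).symm s)).2 := by
  rw [coordMap, extChartAt_I4_apply]

theorem coordMap_mem (hs : s ∈ coordDomain f q) :
    (coordMap f q s).2 ∈ (extChartAt (𝓡 3) (f q).2).target := by
  rw [coordMap_snd]
  exact (extChartAt (𝓡 3) (f q).2).map_source hs.2

theorem mem_source_of_mem_coordDomain (hs : s ∈ coordDomain f q) :
    f ((extChartAt (𝓡 3) q).symm s) ∈ (extChartAt I4 (f q)).source := by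
  rw [extChartAt_I4_source]
  exact ⟨mem_univ _, hs.2⟩

section Surface

variable (hP : IsPhotonSurface I4 (𝓡 3) (staticMetric g N) f)

include hP

theorem IsPhotonSurface.isOpen_coordDomain : IsOpen (coordDomain f q) :=
  (continuousOn_extChartAt_symm q).isOpen_inter_preimage (isOpen_extChartAt_target q)
    ((isOpen_extChartAt_source (I := 𝓡 3) (f q).2).preimage
      (continuous_snd.comp hP.embedding.isEmbedding.continuous))

theorem IsPhotonSurface.contDiffOn_coordMap : ContDiffOn ℝ ∞ (coordMap f q) (coordDomain f q) := by
  rw [← contMDiffOn_iff_contDiffOn]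
  refine (contMDiffOn_extChartAt (I := I4) (x := f q)).comp
    (hP.embedding.isImmersion.contMDiff.comp_contMDiffOn
      ((contMDiffOn_extChartAt_symm q).mono inter_subset_left)) fun s hs => ?_
  rw [← extChartAt_source I4]
  exact mem_source_of_mem_coordDomain hs

theorem IsPhotonSurface.chartInv_fderiv_coordMap (hs : s ∈ coordDomain f q) (v : E3) :
    chartInv I4 (f q) (coordMap f q s) (fderiv ℝ (coordMap f q) s v)
      = (mfderiv (𝓡 3) I4 f ((extChartAt (𝓡 3) q).symm s) : E3 →L[ℝ] ℝ × E3)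
        (chartInv (𝓡 3) q s v) := by
  have : IsManifold (𝓡 3) 1 P := isManifold_one
  have hz := mem_source_of_mem_coordDomain hs
  have h1 : HasMFDerivAt 𝓘(ℝ, E3) 𝓘(ℝ, ℝ × E3) (coordMap f q) s
      ((mfderiv I4 𝓘(ℝ, ℝ × E3) (extChartAt I4 (f q)) (f ((extChartAt (𝓡 3) q).symm s))).comp
        ((mfderiv (𝓡 3) I4 f ((extChartAt (𝓡 3) q).symm s)).comp
          (mfderiv 𝓘(ℝ, E3) (𝓡 3) (extChartAt (𝓡 3) q).symm s))) :=
    ((mdifferentiableAt_extChartAt (by rwa [← extChartAt_source I4])).hasMFDerivAt).comp s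
      (hP.hasMFDerivAt.comp s (mdifferentiableAt_extChartAt_symm hs.1).hasMFDerivAt)
  have h2 := mfderivWithin_extChartAt_symm_comp_mfderiv_extChartAt' (I := I4) hz
  rw [I4.range_eq_univ, mfderivWithin_univ] at h2
  rw [← mfderiv_eq_fderiv, h1.mfderiv]
  exact congrArg (fun A : (ℝ × E3) →L[ℝ] ℝ × E3 => A
    ((mfderiv (𝓡 3) I4 f ((extChartAt (𝓡 3) q).symm s) : E3 →L[ℝ] ℝ × E3)
        (chartInv (𝓡 3) q s v))) h2

theorem IsPhotonSurface.fderiv_coordMap_self : fderiv ℝ (coordMap f q) (extChartAt (𝓡 3) q q)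
    = (mfderiv (𝓡 3) I4 f q : E3 →L[ℝ] ℝ × E3) := by
  have h1 : MDifferentiableAt (𝓡 3) I4 f q := hP.hasMFDerivAt.mdifferentiableAt
  have h2 : fderivWithin ℝ (coordMap f q) (range (𝓡 3)) (extChartAt (𝓡 3) q q)
      = fderiv ℝ (coordMap f q) (extChartAt (𝓡 3) q q) := by
    rw [(𝓡 3).range_eq_univ, fderivWithin_univ]
  exact h2.symm.trans (if_pos h1).symm

theorem IsPhotonSurface.inChart_inducedMetric (hs : s ∈ coordDomain f q) (v w : E3) :
    inChart (𝓡 3) (inducedMetric I4 (𝓡 3) (staticMetric g N) f) q s v w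
      = staticCoord (chartMetric g (f q).2) (chartFun N (f q).2) (coordMap f q s)
        (fderiv ℝ (coordMap f q) s v) (fderiv ℝ (coordMap f q) s w) := by
  rw [← inChart_staticMetric g N (coordMap_mem hs), inChart_apply, inChart_apply,
    hP.chartInv_fderiv_coordMap hs, hP.chartInv_fderiv_coordMap hs]
  exact bilinField_congr (I := I4) (staticMetric g N) ((extChartAt I4 (f q)).left_inv
    (mem_source_of_mem_coordDomain hs)).symm _ _

end Surface

section Sphere

variable (hP : IsPhotonSphere g N F f) (h : IsStaticElectrovac g N F)
  (hN₀ : ∀ q, N (f q).2 = N₀) (hw : ∀ q, lapseGradSq g N (f q).2 = w * w) (hw0 : 0 < w)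

include h in
theorem inducedMetric_symm (v v' : E3) :
    (inducedMetric I4 (𝓡 3) (staticMetric g N) f q : E3 →L[ℝ] E3 →L[ℝ] ℝ) v v'
      = (inducedMetric I4 (𝓡 3) (staticMetric g N) f q : E3 →L[ℝ] E3 →L[ℝ] ℝ) v' v :=
  staticMetric_symm g h.lapse_smooth h.lapse_pos (f q) _ _

include hP h hN₀ hw hw0

theorem IsPhotonSphere.inducedMetric_nondeg (v : E3) (hv : ∀ v',
    (inducedMetric I4 (𝓡 3) (staticMetric g N) f q : E3 →L[ℝ] E3 →L[ℝ] ℝ) v v' = 0) : v = 0 := by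
  have hd : diffForm N (f q).2 ≠ 0 :=
    diffForm_ne_zero (g := g) (by rw [hw]; exact (mul_pos hw0 hw0).ne')
  set D : E3 →L[ℝ] ℝ × E3 := mfderiv (𝓡 3) I4 f q
  set B : E3 →L[ℝ] E3 →L[ℝ] ℝ := g.inner (f q).2
  have hG : ∀ b : ℝ × E3, diffForm N (f q).2 b.2 = 0 →
      -(N (f q).2) ^ 2 * ((D v).1 * b.1) + B (D v).2 b.2 = 0 := fun b hb => by
    obtain ⟨v', hv'⟩ := hP.exists_mfderiv_eq h hN₀ hd hb
    have h1 := hv v'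
    rw [← hv']
    exact h1
  have h1 : (D v).1 = 0 := by
    have h2 := hG (1, 0) (map_zero _)
    simp only [map_zero, mul_one, add_zero] at h2
    exact (mul_eq_zero.1 h2).resolve_left (neg_ne_zero.2 (pow_ne_zero 2 (h.lapse_pos _).ne'))
  have h2 : (D v).2 = 0 := by
    by_contra h0
    have h3 := hG (0, (D v).2) (hP.diffForm_apply h hN₀ v)
    simp only [mul_zero, zero_add] at h3
    exact (g.pos (f q).2 _ h0).ne' h3
  exact hP.photonSurface.mfderiv_injective ((Prod.ext h1 h2 : D v = 0).trans (map_zero D).symm)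

theorem IsPhotonSphere.isMetricOn_inducedMetric :
    IsMetricOn (inChart (𝓡 3) (inducedMetric I4 (𝓡 3) (staticMetric g N) f) q)
      (coordDomain f q) where
  isOpen := hP.photonSurface.isOpen_coordDomain
  smooth := by
    rw [contDiffOn_clm_apply]
    intro v
    rw [contDiffOn_clm_apply]
    intro v'
    have hX := hP.photonSurface.contDiffOn_coordMap (q := q)
    have hdX : ∀ u, ContDiffOn ℝ ∞ (fun s => fderiv ℝ (coordMap f q) s u) (coordDomain f q) :=
      fun u => (hX.fderiv_of_isOpen hP.photonSurface.isOpen_coordDomain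
        (by norm_cast)).clm_apply contDiffOn_const
    have hG := ((h.isStaticOn (f q).2).metric4.smooth).comp hX
      fun s hs => ⟨mem_univ _, coordMap_mem hs⟩
    refine ContDiffOn.congr ((hG.clm_apply (hdX v)).clm_apply (hdX v')) fun s hs => ?_
    exact hP.photonSurface.inChart_inducedMetric hs v v'
  symm s hs v v' := by
    rw [inChart_apply, inChart_apply]
    exact inducedMetric_symm h _ _
  nondeg s hs v hv := by
    have : IsManifold (𝓡 3) 1 P := isManifold_one
    obtain ⟨hi, hsur⟩ := chartInv_bijective (I := 𝓡 3) hs.1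
    refine hi (Eq.trans ?_ (map_zero (chartInv (𝓡 3) q s)).symm)
    refine hP.inducedMetric_nondeg h hN₀ hw hw0 (q := (extChartAt (𝓡 3) q).symm s) _ fun u => ?_
    obtain ⟨u', hu'⟩ := hsur u
    have h1 := hv u'
    rw [inChart_apply, hu'] at h1
    exact h1

theorem IsPhotonSphere.covHess_eq {a b : E3} (ha : diffForm N (f q).2 a = 0)
    (hb : diffForm N (f q).2 b = 0) :
    covHess (chartMetric g (f q).2) (chartFun N (f q).2) (extChartAt (𝓡 3) (f q).2 (f q).2) a b
      = w * w / N₀ * (g.inner (f q).2 : E3 →L[ℝ] E3 →L[ℝ] ℝ) a b := by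
  have hy := mem_extChartAt_target (I := 𝓡 3) (f q).2
  have hd := fderiv_chartFun_lapse h.lapse_smooth (f q).2
  have hW := lapseGradSq_eq (g := g) h.lapse_smooth (f q).2
  rw [hw] at hW
  have h1 := (isMetricOn_chartMetric g (f q).2).umbilicDefect_of_tangent hy
    (by rw [← hW]; exact (mul_pos hw0 hw0).ne')
    (hP.photonSurface.umbilicDefect_levelProj_chart h.lapse_smooth h.lapse_pos hN₀ hy
      (extChartAt_to_inv _)) a (by rw [hd]; exact hb)
  rw [hd, ha, zero_div, zero_mul, umbilicDefect_apply, ← hW, chartFun_self, hN₀,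
    chartMetric_self] at h1
  exact sub_eq_zero.1 h1

/-- The scalar curvature of a photon sphere. -/
theorem IsPhotonSphere.scalarCurvAt_eq (hk : elecForm F (f q).2 = k • diffForm N (f q).2) :
    scalarCurvAt (𝓡 3) (inducedMetric I4 (𝓡 3) (staticMetric g N) f) q
      = 6 * (w * w / N₀ ^ 2) + 2 * (k * k * (w * w) / N₀ ^ 2) := by
  obtain ⟨ψ, hψ⟩ := h.isClosedForm_elecForm.exists_potential (f q).2
  obtain ⟨Ω, hΩ, hE, -⟩ := h.exists_electrovacOn hψ
  have hΩo := hE.static.metric.isOpen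
  set p₀ := extChartAt (𝓡 3) (f q).2 (f q).2
  have hN := h.lapse_smooth
  have hd := fderiv_chartFun_lapse hN (f q).2
  have hW := lapseGradSq_eq (g := g) hN (f q).2
  rw [hw] at hW
  have hd0 : diffForm N (f q).2 ≠ 0 :=
    diffForm_ne_zero (g := g) (by rw [hw]; exact (mul_pos hw0 hw0).ne')
  have hX := hP.photonSurface.contDiffOn_coordMap (q := q)
  have hk' : fderiv ℝ (chartFun ψ (f q).2) p₀ = k • fderiv ℝ (chartFun N (f q).2) p₀ := by
    rw [hψ.fderiv_chartFun, hk, hd]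
  have hΩ' : IsOpen (coordDomain f q ∩ (fun s => (coordMap f q s).2) ⁻¹' Ω) :=
    (continuous_snd.comp_continuousOn hX.continuousOn).isOpen_inter_preimage
      hP.photonSurface.isOpen_coordDomain hΩo
  have hmet := hP.isMetricOn_inducedMetric h hN₀ hw hw0 (q := q)
  have h1 := scalarCurv_of_umbilic (X := coordMap f q) (N₀ := N₀) (t := (f q).1) (k := k)
    (s := extChartAt (𝓡 3) q q) hE (by rw [hd]; exact hd0)
    (fun a b ha hb => by
      rw [← hW, chartFun_self, hN₀, chartMetric_self]
      rw [hd] at ha hb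
      exact hP.covHess_eq h hN₀ hw hw0 ha hb)
    (p := inChart (𝓡 3) (inducedMetric I4 (𝓡 3) (staticMetric g N) f) q)
    ⟨hΩ', hmet.smooth.mono inter_subset_left, fun y hy => hmet.symm y hy.1,
      fun y hy => hmet.nondeg y hy.1⟩ (hX.mono inter_subset_left)
    (fun s hs => ⟨mem_univ _, hs.2⟩)
    (fun s hs => hP.photonSurface.inChart_inducedMetric hs.1)
    (fun s hs => by
      rw [coordMap_snd]
      exact (congrArg N ((extChartAt (𝓡 3) (f q).2).left_inv hs.1.2)).trans (hN₀ _))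
    ⟨mem_coordDomain_self f q, by rw [mem_preimage, coordMap_self]; exact hE.mem⟩
    (coordMap_self f q) hk'
    (fun w hw' => by
      rw [hd] at hw'
      rw [hP.photonSurface.fderiv_coordMap_self]
      exact hP.exists_mfderiv_eq h hN₀ hd0 hw')
  have h2 : fderiv ℝ (chartFun ψ (f q).2) p₀ (covGrad (chartMetric g (f q).2) (chartFun ψ (f q).2) p₀)
      = k * k * (w * w) := by
    rw [covGrad, hk', map_smul, map_smul, smul_apply, hW, ← covGrad, smul_eq_mul, smul_eq_mul,
      mul_assoc]
  rw [h2, ← hW, chartFun_self, hN₀] at h1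
  exact h1

theorem IsPhotonSphere.secondFundForm_normalField (v v' : E3) :
    secondFundForm I4 (𝓡 3) (staticMetric g N) f (fun q => normalField g N κ (f q)) q v v'
      = κ * (w * w / N₀)
        * (inducedMetric I4 (𝓡 3) (staticMetric g N) f q : E3 →L[ℝ] E3 →L[ℝ] ℝ) v v' := by
  have hN := h.lapse_smooth
  have hX := hP.photonSurface.contDiffOn_coordMap (q := q)
  have hs := mem_coordDomain_self f q
  have ho := hP.photonSurface.isOpen_coordDomain (q := q)
  have hst := h.isStaticOn (f q).2
  have hG := isMetricOn_chartMetric g (f q).2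
  have hy := mem_extChartAt_target (I := 𝓡 3) (f q).2
  have hXs := coordMap_self f q
  set p₀ := extChartAt (𝓡 3) (f q).2 (f q).2 with hp₀
  set D : E3 →L[ℝ] ℝ × E3 := mfderiv (𝓡 3) I4 f q with hD
  have hD0 : ∀ u, diffForm N (f q).2 (D u).2 = 0 := fun u => hP.diffForm_apply h hN₀ u
  have h1 : HasFDerivAt (alongInChart I4 (𝓡 3) f (fun q => normalField g N κ (f q)) q)
      ((ContinuousLinearMap.inr ℝ ℝ E3).comp (κ • (fderiv ℝ (covGrad (chartMetric g (f q).2)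
        (chartFun N (f q).2)) p₀).comp ((ContinuousLinearMap.snd ℝ ℝ E3).comp D)))
      (extChartAt (𝓡 3) q q) := by
    have h2 : HasFDerivAt (coordMap f q) D (extChartAt (𝓡 3) q q) := by
      rw [hD, ← hP.photonSurface.fderiv_coordMap_self]
      exact ((hX.contDiffAt (ho.mem_nhds hs)).differentiableAt (by simp)).hasFDerivAt
    have h3 : HasFDerivAt (covGrad (chartMetric g (f q).2) (chartFun N (f q).2))
        (fderiv ℝ (covGrad (chartMetric g (f q).2) (chartFun N (f q).2)) p₀)
        (coordMap f q (extChartAt (𝓡 3) q q)).2 := by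
      rw [hXs]
      exact (((hG.contDiffOn_covGrad (contDiffOn_chartFun hN (f q).2)).contDiffAt
        (hG.mem_nhds hy)).differentiableAt (by simp)).hasFDerivAt
    have h4 := (h3.comp (extChartAt (𝓡 3) q q) (hasFDerivAt_snd.comp _ h2)).const_smul κ
    refine ((ContinuousLinearMap.inr ℝ ℝ E3).hasFDerivAt.comp _ h4).congr_of_eventuallyEq ?_
    filter_upwards [ho.mem_nhds hs] with s hs'
    refine (mfderiv_extChartAt_normalField hN κ hs'.2).trans ?_
    rw [← coordMap_snd]
    rfl
  have h5 : inChart I4 (staticMetric g N) (f q)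
      =ᶠ[𝓝 ((f q).1, p₀)] staticCoord (chartMetric g (f q).2) (chartFun N (f q).2) := by
    have h6 : ∀ᶠ z in 𝓝 ((f q).1, p₀), z.2 ∈ (extChartAt (𝓡 3) (f q).2).target :=
      continuousAt_snd.eventually (eventually_mem_target hy)
    filter_upwards [h6] with z hz using inChart_staticMetric g N hz
  have h7 : christoffel (inChart I4 (staticMetric g N) (f q)) (extChartAt I4 (f q) (f q)) (D v)
      (0, κ • gradVec g N (f q).2) = (κ * (w * w) * (D v).1 / N₀, κ • christoffel
        (chartMetric g (f q).2) p₀ (D v).2 (covGrad (chartMetric g (f q).2)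
          (chartFun N (f q).2) p₀)) := by
    have h8 : diffForm N (f q).2 (gradVec g N (f q).2) = w * w := hw q
    rw [extChartAt_I4_apply, ← hp₀, (christoffel_congr h5).eq_of_nhds,
      hst.christoffel_staticCoord hy, fderiv_chartFun_lapse hN, map_smul, h8, chartFun_self, hN₀,
      ← covGrad_chart_self hN]
    simp
    rfl
  have h9 : secondFundForm I4 (𝓡 3) (staticMetric g N) f (fun q => normalField g N κ (f q)) q v v'
      = (staticMetric g N (f q) : (ℝ × E3) →L[ℝ] (ℝ × E3) →L[ℝ] ℝ)
        (fderiv ℝ (alongInChart I4 (𝓡 3) f (fun q => normalField g N κ (f q)) q)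
          (extChartAt (𝓡 3) q q) v + christoffel (inChart I4 (staticMetric g N) (f q))
            (extChartAt I4 (f q) (f q)) (D v) (0, κ • gradVec g N (f q).2)) (D v') := rfl
  have h10 : (inducedMetric I4 (𝓡 3) (staticMetric g N) f q : E3 →L[ℝ] E3 →L[ℝ] ℝ) v v'
      = (staticMetric g N (f q) : (ℝ × E3) →L[ℝ] (ℝ × E3) →L[ℝ] ℝ) (D v) (D v') := rfl
  have h11 := hG.apply_fderiv_covGrad hy (contDiffOn_chartFun hN (f q).2) (D v).2 (D v').2
  rw [hP.covHess_eq h hN₀ hw hw0 (hD0 v) (hD0 v'), chartMetric_self] at h11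
  rw [h9, h10, h1.fderiv, h7, staticMetric_apply, staticMetric_apply, hN₀]
  have h12 : (((ContinuousLinearMap.inr ℝ ℝ E3).comp (κ • (fderiv ℝ (covGrad (chartMetric g (f q).2)
        (chartFun N (f q).2)) p₀).comp ((ContinuousLinearMap.snd ℝ ℝ E3).comp D))) v
      + (κ * (w * w) * (D v).1 / N₀, κ • christoffel (chartMetric g (f q).2) p₀ (D v).2
        (covGrad (chartMetric g (f q).2) (chartFun N (f q).2) p₀)))
      = (κ * (w * w) * (D v).1 / N₀, κ • (fderiv ℝ (covGrad (chartMetric g (f q).2)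
        (chartFun N (f q).2)) p₀ (D v).2 + christoffel (chartMetric g (f q).2) p₀ (D v).2
        (covGrad (chartMetric g (f q).2) (chartFun N (f q).2) p₀))) := by
    simp [smul_add]
  rw [h12]
  have h13 : ∀ (A : E3 →L[ℝ] E3 →L[ℝ] ℝ) (u u' : E3), A (κ • u) u' = κ * A u u' := fun A u u' => by
    rw [map_smul, smul_apply, smul_eq_mul]
  refine (congrArg (-N₀ ^ 2 * (κ * (w * w) * (D v).1 / N₀ * (D v').1) + ·)
    ((h13 _ _ _).trans (congrArg (κ * ·) h11))).trans ?_
  field_simp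

/-- The mean curvature of a photon sphere. -/
theorem IsPhotonSphere.meanCurvature_normalField :
    meanCurvature I4 (𝓡 3) (staticMetric g N) f (fun q => normalField g N κ (f q)) q
      = 3 * κ * (w * w) / N₀ := by
  have h1 := metricTrace_smul_self (hP.inducedMetric_nondeg h hN₀ hw hw0 (q := q))
    (inducedMetric_symm h) (κ * (w * w / N₀))
  have h2 : secondFundForm I4 (𝓡 3) (staticMetric g N) f (fun q => normalField g N κ (f q)) q
      = fun v v' : E3 => κ * (w * w / N₀)
        * (inducedMetric I4 (𝓡 3) (staticMetric g N) f q : E3 →L[ℝ] E3 →L[ℝ] ℝ) v v' :=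
    funext fun v => funext fun v' => hP.secondFundForm_normalField h hN₀ hw hw0 v v'
  rw [meanCurvature, h2]
  refine h1.trans ?_
  rw [finrank_euclideanSpace_fin]
  push_cast
  ring

omit hw0 hP hN₀ in
/-- The normal component of the electric field on a photon sphere. -/
theorem IsStaticElectrovac.electricField_normalField
    (hk : elecForm F (f q).2 = k • diffForm N (f q).2) :
    electricField F (f q) (normalField g N κ (f q)) = k * κ * (w * w) := by
  have h1 : electricField F (f q) (normalField g N κ (f q))
      = -(F ((f q).1, (f q).2) : (ℝ × E3) →L[ℝ] (ℝ × E3) →L[ℝ] ℝ) (1, 0)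
        (0, κ • gradVec g N (f q).2) := rfl
  have h8 : diffForm N (f q).2 (gradVec g N (f q).2) = w * w := hw q
  have h9 : (k • diffForm N (f q).2) (κ • gradVec g N (f q).2) = k * κ * (w * w) := by
    rw [smul_apply, map_smul, h8, smul_eq_mul, smul_eq_mul, mul_assoc]
  rw [h1, h.field_eq, hk, h9]
  simp

end Sphere

end SphereCharts

/-! ### The scalar curvature of photon spheres -/

theorem theorem3p2
    {M : Type*} [TopologicalSpace M] [T2Space M] [SecondCountableTopology M]
    [ChartedSpace E3 M] [IsManifold (𝓡 3) ∞ M]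
    {P : Type*} [TopologicalSpace P] [ConnectedSpace P]
    [ChartedSpace E3 P] [IsManifold (𝓡 3) ∞ P]
    (g : RiemMetric3 M) (N : M → ℝ) (F : BilinField I4 (ℝ × M))
    (hEM : IsStaticElectrovac g N F)
    (K : Set M) (φ : PartialDiffeomorph (𝓡 3) (𝓡 3) M E3 ∞) (m Q : ℝ) (hm : 0 < m) (hQ : Q ≠ 0)
    (hflat : IsAsymptoticallyFlat g N F K φ m Q)
    (f : P → ℝ × M) (hP : IsPhotonSphere g N F f)
    (U : Set M) (hU : IsRegularExterior g N φ f U) :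
    (∃ R₀ : ℝ, ∀ q : P,
      scalarCurvAt (𝓡 3) (inducedMetric I4 (𝓡 3) (staticMetric g N) f) q = R₀) ∧
    (∃ ν : ∀ q : P, TangentSpace I4 (f q), IsUnitNormal I4 (𝓡 3) (staticMetric g N) f ν) ∧
    ∀ ν : ∀ q : P, TangentSpace I4 (f q), IsUnitNormal I4 (𝓡 3) (staticMetric g N) f ν →
      (∃ H₀ : ℝ, ∀ q : P, meanCurvature I4 (𝓡 3) (staticMetric g N) f ν q = H₀) ∧
      (∃ E₀ : ℝ, ∀ q : P, electricField F (f q) (ν q) = E₀) ∧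
      ∀ q : P,
        scalarCurvAt (𝓡 3) (inducedMetric I4 (𝓡 3) (staticMetric g N) f) q
          = 2 / 3 * meanCurvature I4 (𝓡 3) (staticMetric g N) f ν q ^ 2
            + 2 * electricField F (f q) (ν q) ^ 2 / N (f q).2 ^ 2 := by
  obtain ⟨N₀, hN₀⟩ := hP.lapse_const
  obtain ⟨w, k, hw0, hwk⟩ := hP.exists_lapse_data hEM hflat hm hQ hU hN₀
  have hw := fun q => (hwk q).1
  have hk := fun q => (hwk q).2
  have hscal := fun q => hP.scalarCurvAt_eq hEM hN₀ hw hw0 (hk q)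
  refine ⟨⟨_, hscal⟩, ⟨_, isUnitNormal_normalField hP hEM hN₀ hw (κ := 1 / w) (by field_simp)⟩,
    fun ν hν => ?_⟩
  obtain ⟨κ, hκ, rfl⟩ := hν.eq_normalField hP hEM hN₀ hw hw0
  have hmean := fun q => hP.meanCurvature_normalField hEM hN₀ hw hw0 (κ := κ) (q := q)
  have helec := fun q => hEM.electricField_normalField hw (κ := κ) (hk q)
  refine ⟨⟨_, hmean⟩, ⟨_, helec⟩, fun q => ?_⟩
  rw [hscal, hmean, helec, hN₀, div_pow]
  linear_combination (-(6 * (w * w) / N₀ ^ 2) - 2 * (k * k * (w * w)) / N₀ ^ 2) * hκ
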